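/- **Conventions.** All categories are small (in one fixed universe), and triangulated categories have an additive translation functor $\Sigma$. A *Picard groupoid* is a symmetric monoidal groupoid $(P,+)$ in which every functor $x+(-)$ is an equivalence. Lists $(X_1,\dots,X_n)$, $n\ge 0$, are finite indexed families. *Determinant functors.* A determinant functor $d\colon T\to P$ is a functor from the isomorphisms of $T$ to $P$ with morphisms $d(z)+d(x)\to d(y)$ for the distinguished triangles $x\to y\to z\to\Sigma x$, natural in isomorphisms of triangles, compatible with the symmetry on the two split triangles of a direct sum, and with associativity on octahedra. It is *universal* if for every determinant functor $D\colon T\to P$ there are a symmetric monoidal $f$ and a natural $\alpha\colon f\circ d\Rightarrow D$ compatible with the additivity morphisms, such that for any other such pair $(f',\alpha')$ there is exactly one monoidal $\gamma\colon f\Rightarrow f'$ with $\alpha'\circ(\gamma * d)=\alpha$. We then write $\det\colon T\to V(T)$ for $d$. *Multideterminant functors.* $\mathrm{Det}(T_1,\dots,T_n;P)$ is the category of functors $D\colon \mathrm{iso}(T_1\times\dots\times T_n)\to P$ which are determinant functors in each variable, with the additivity morphisms natural also in the other variables, and such that for distinguished triangles in two different variables the two ways of expanding $D$ on the resulting $3\times3$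 array by additivity agree up to the canonical symmetry (interchange) of $P$. Morphisms are natural transformations compatible with all additivity morphisms. $\mathrm{Pic}^\times(A_1,\dots,A_n;P)$ is the category of multiexact functors $A_1\times\dots\times A_n\to P$: symmetric monoidal in each variable, naturally in the others, with the analogous interchange condition for any two different variables; morphisms are natural transformations monoidal in each variable. *Multiexact functors.* A multiexact functor $F\colon S_1\times\dots\times S_m\to T$ of triangulated categories is additive in each variable, carries natural isomorphisms $F(\dots,\Sigma x_i,\dots)\cong\Sigma F(\dots,x_i,\dots)$, preserves distinguished triangles in each variable, and for $i\ne k$ the two isomorphisms $F(\dots,\Sigma x_i,\dots,\Sigma x_k,\dots)\cong\Sigma^2F(x)$ are opposite. A $3\times 3$ diagram with rows $x'\xrightarrow{f'} y'\xrightarrow{g'} z'\xrightarrow{h'}\Sigma x'$, $x\xrightarrow{f} y\xrightarrow{g} z\xrightarrow{h}\Sigma x$, $x''\xrightarrow{f''} y''\xrightarrow{g''} z''\xrightarrow{h''}\Sigma x''$ and columns $x'\xrightarrow{p'}x\xrightarrow{p}x''\xrightarrow{p''}\Sigma x'$, $y'\xrightarrow{q'}y\xrightarrow{q}y''\xrightarrow{q''}\Sigma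 y'$, $z'\xrightarrow{r'}z\xrightarrow{r}z''\xrightarrow{r''}\Sigma z'$ *admits a Verdier structure* if there are an object $A$, one distinguished triangle $x'\to y\to A\to\Sigma x'$ on $fp'$, and morphisms $\varepsilon\colon x''\to A$, $\eta\colon A\to z$, $b\colon z'\to A$, $c\colon A\to y''$ such that * $x'\xrightarrow{p'}x\xrightarrow{f}y$ with cones $x'',z,A$ is an octahedron whose triangle of cones is $x''\xrightarrow{\varepsilon}A\xrightarrow{\eta}z\xrightarrow{\Sigma p\circ h}\Sigma x''$; * $x'\xrightarrow{f'}y'\xrightarrow{q'}y$ with cones $z',y'',A$ is an octahedron whose triangle of cones is $z'\xrightarrow{b}A\xrightarrow{c}y''\xrightarrow{\Sigma g'\circ q''}\Sigma z'$; * $x''\xrightarrow{\varepsilon}A\xrightarrow{c}y''$, with composite $f''$ and triangles $(\varepsilon,\eta,\Sigma p\circ h)$, $(c,\Sigma g'\circ q'',-\Sigma b)$, $(f'',g'',h'')$, is an octahedron whose triangle of cones is $z\xrightarrow{r}z''\xrightarrow{r''}\Sigma z'\to\Sigma z$; * $\eta b=r'$. $F$ *admits a Verdier structure* if this holds for every $3\times3$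 diagram which $F$ produces from two distinguished triangles in two different variables. Let $\mathrm{TrCat}_{\mathcal V}^\times$ have finite families of triangulated categories as objects; a morphism $F\colon (S_i)_{i\in I}\to(T_j)_{j\in J}$ is a map $\varphi\colon I\to J$ with multiexact functors $F_j\colon\prod_{\varphi(i)=j}S_i\to T_j$ admitting Verdier structures; a 2-cell $F\Rightarrow F'$ is a family of natural isomorphisms $F_j\cong F'_j$ compatible with the translation isomorphisms. Let $\mathrm{Pic}^\times$ be the analogous 2-category of finite families of Picard groupoids and multiexact functors. **Theorem.** Universal determinant functors exist for all triangulated categories. For a morphism $F\colon(S_i)\to(T_j)$ of $\mathrm{TrCat}_{\mathcal V}^\times$ and $D\in\mathrm{Det}((T_j);P)$ the composite $D\circ F$ is again a multideterminant functor. Moreover, for any choice of a universal determinant functor $\det\colon T\to V(T)$ for each $T$: 1. For every Picard groupoid $P$ and every finite family $T_1,\dots,T_n$, composition with $\det\times\dots\times\det$ is an equivalence $$\det{}^*\colon \mathrm{Pic}^\times(V(T_1),\dots,V(T_n);P)\xrightarrow{\ \simeq\ }\mathrm{Det}(T_1,\dots,T_n;P).$$ 2. One can choose, for every $F\colon(S_i)\to(T_j)$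 in $\mathrm{TrCat}^\times_{\mathcal V}$, a morphism $V(F)\colon (V(S_i))\to(V(T_j))$ of $\mathrm{Pic}^\times$ over the same map $\varphi$, with isomorphisms of multideterminant functors $\alpha_{F,j}\colon V(F)_j\circ\det\cong\det\circ F_j$. 3. Any choice as in 2 extends in exactly one way to a pseudofunctor $V\colon \mathrm{TrCat}^\times_{\mathcal V}\to\mathrm{Pic}^\times$ (action on 2-cells and composition and identity constraints, satisfying all coherence laws) whose structure is compatible with the $\alpha_{F,j}$. 4. Let a choice as in 2 be given, let $P$ be a Picard groupoid, and for every finite family let $D\mapsto\overline D$ be a functor $\mathrm{Det}(T_1,\dots,T_n;P)\to\mathrm{Pic}^\times(V(T_1),\dots,V(T_n);P)$ with a natural isomorphism $\tau_D\colon\overline D\circ\det\cong D$. There is exactly one family of isomorphisms $$\kappa_{F,D}\colon\ \overline{D\circ F}\ \cong\ \overline D\circ V(F),$$ natural in $D$, indexed by the morphisms $F\colon(S_i)\to(T_j)$ of $\mathrm{TrCat}_{\mathcal V}^\times$, such that the composite $$\overline{D\circ F}\circ\det\xrightarrow{\kappa_{F,D}*\det}\overline D\circ V(F)\circ\det\xrightarrow{\overline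 D * \alpha_F}\overline D\circ\det\circ F\xrightarrow{\tau_D * F}D\circ F$$ is $\tau_{D\circ F}$, and $\kappa$ is compatible with 2-cells, with composition and with identities of $\mathrm{TrCat}_{\mathcal V}^\times$. That is, the equivalences $\mathrm{Det}(T_1,\dots,T_n;P)\simeq\mathrm{Pic}^\times(V(T_1),\dots,V(T_n);P)$ form a pseudonatural equivalence over $\mathrm{TrCat}_{\mathcal V}^\times$. -/

import Mathlib

open CategoryTheory Category Limits MonoidalCategory Pretriangulated Functor.LaxMonoidal

universe u

set_option linter.unusedVariables false

namespace DetFun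

/-- Small triangulated categories (with additive translation functor `Σ = ⟦1⟧`). -/
structure TrCat : Type (u + 1) where
  carrier : Type u
  [cat : SmallCategory carrier]
  [zero : HasZeroObject carrier]
  [shift : HasShift carrier ℤ]
  [pre : Preadditive carrier]
  [shiftAdditive : ∀ n : ℤ, (shiftFunctor carrier n).Additive]
  [pretri : Pretriangulated carrier]
  [tri : IsTriangulated carrier]

instance : CoeSort TrCat.{u} (Type u) := ⟨TrCat.carrier⟩

attribute [instance] TrCat.cat TrCat.zero TrCat.shift TrCat.pre TrCat.shiftAdditive
  TrCat.pretri TrCat.tri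

/-- Picard groupoids: symmetric monoidal groupoids in which every functor `x + -` is an
equivalence.  The operation `+` is written `⊗`. -/
structure PicCat : Type (u + 1) where
  carrier : Type u
  [cat : SmallCategory carrier]
  [groupoid : IsGroupoid carrier]
  [monoidal : MonoidalCategory carrier]
  [symmetric : SymmetricCategory carrier]
  groupLike : ∀ x : carrier, (tensorLeft x).IsEquivalence

instance : CoeSort PicCat.{u} (Type u) := ⟨PicCat.carrier⟩

attribute [instance] PicCat.cat PicCat.groupoid PicCat.monoidal PicCat.symmetric

/-! ### Determinant functors in one variable -/

/-- A determinant functor `T → P`. -/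
structure DetFunctor (T : TrCat.{u}) (P : PicCat.{u}) where
  functor : Core T ⥤ P
  additivity (Δ : Triangle T) (hΔ : Δ ∈ distTriang T) :
    functor.obj ⟨Δ.obj₃⟩ ⊗ functor.obj ⟨Δ.obj₁⟩ ⟶ functor.obj ⟨Δ.obj₂⟩
  naturality {Δ Δ' : Triangle T} (hΔ : Δ ∈ distTriang T) (hΔ' : Δ' ∈ distTriang T)
    (p : Δ.obj₁ ≅ Δ'.obj₁) (q : Δ.obj₂ ≅ Δ'.obj₂) (r : Δ.obj₃ ≅ Δ'.obj₃)
    (comm₁ : Δ.mor₁ ≫ q.hom = p.hom ≫ Δ'.mor₁) (comm₂ : Δ.mor₂ ≫ r.hom = q.hom ≫ Δ'.mor₂)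
    (comm₃ : Δ.mor₃ ≫ p.hom⟦(1 : ℤ)⟧' = r.hom ≫ Δ'.mor₃) :
    additivity Δ hΔ ≫ functor.map ⟨q⟩ =
      (functor.map ⟨r⟩ ⊗ₘ functor.map ⟨p⟩) ≫ additivity Δ' hΔ'
  commutativity {x y : T} (b : BinaryBicone x y) (_ : b.IsBilimit)
    (h₁ : Triangle.mk b.inl b.snd (0 : y ⟶ x⟦(1 : ℤ)⟧) ∈ distTriang T)
    (h₂ : Triangle.mk b.inr b.fst (0 : x ⟶ y⟦(1 : ℤ)⟧) ∈ distTriang T) :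
    (β_ (functor.obj ⟨x⟩) (functor.obj ⟨y⟩)).hom ≫ additivity _ h₁ = additivity _ h₂
  octahedron {x y z z' x' y' : T} {f : x ⟶ y} {g : y ⟶ z} {k : x ⟶ z} (comm : f ≫ g = k)
    {f' : y ⟶ z'} {f'' : z' ⟶ x⟦(1 : ℤ)⟧} (h₁ : Triangle.mk f f' f'' ∈ distTriang T)
    {g' : z ⟶ x'} {g'' : x' ⟶ y⟦(1 : ℤ)⟧} (h₃ : Triangle.mk g g' g'' ∈ distTriang T)
    {k' : z ⟶ y'} {k'' : y' ⟶ x⟦(1 : ℤ)⟧} (h₂ : Triangle.mk k k' k'' ∈ distTriang T)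
    (o : Triangulated.Octahedron comm h₁ h₃ h₂) :
    (additivity _ o.mem ▷ functor.obj ⟨x⟩) ≫ additivity _ h₂ =
      (α_ (functor.obj ⟨x'⟩) (functor.obj ⟨z'⟩) (functor.obj ⟨x⟩)).hom ≫
        (functor.obj ⟨x'⟩ ◁ additivity _ h₁) ≫ additivity _ h₃

/-- Compatibility of `α : f ∘ d ⇒ D` with the additivity data. -/
def DetFunctor.IsCompatible {T : TrCat.{u}} {Q P : PicCat.{u}} (d : DetFunctor T Q)
    (D : DetFunctor T P) (f : Q ⥤ P) [f.Monoidal] (α : d.functor ⋙ f ⟶ D.functor) : Prop :=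
  ∀ (Δ : Triangle T) (hΔ : Δ ∈ distTriang T),
    μ f (d.functor.obj ⟨Δ.obj₃⟩) (d.functor.obj ⟨Δ.obj₁⟩) ≫ f.map (d.additivity Δ hΔ) ≫
        α.app ⟨Δ.obj₂⟩ =
      (α.app ⟨Δ.obj₃⟩ ⊗ₘ α.app ⟨Δ.obj₁⟩) ≫ D.additivity Δ hΔ

/-- `d : T → Q` is a universal determinant functor; `Q` is then the Picard groupoid `V(T)` of
virtual objects.  Morphisms of Picard groupoids are symmetric monoidal functors, and
transformations between them are monoidal. -/
def DetFunctor.IsUniversal {T : TrCat.{u}} {Q : PicCat.{u}} (d : DetFunctor T Q) : Prop :=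
  ∀ (P : PicCat.{u}) (D : DetFunctor T P),
    ∃ (f : Q ⥤ P) (_ : f.Braided) (α : d.functor ⋙ f ⟶ D.functor), d.IsCompatible D f α ∧
      ∀ (f' : Q ⥤ P) (_ : f'.Braided) (α' : d.functor ⋙ f' ⟶ D.functor),
        d.IsCompatible D f' α' →
          ∃! γ : f ⟶ f', NatTrans.IsMonoidal γ ∧ Functor.whiskerLeft d.functor γ ≫ α' = α

/-! ### Diagrams in a product of triangulated categories, in the direction of one variable -/

section Tr

variable {ι : Type} (T : ι → TrCat.{u})

/-- A morphism from `z` to "`x` with its `i`-th entry replaced by its translate", given entry by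
entry. -/
@[ext]
structure DegHom (i : ι) (z x : ∀ j, T j) where
  main : z i ⟶ (x i)⟦(1 : ℤ)⟧
  off : ∀ j, j ≠ i → (z j ⟶ x j)

variable {T}

/-- Precomposition with a morphism of families. -/
@[simps]
def DegHom.precomp {i : ι} {z' z x : ∀ j, T j} (p : z' ⟶ z) (d : DegHom T i z x) :
    DegHom T i z' x where
  main := p i ≫ d.main
  off j h := p j ≫ d.off j h

/-- Postcomposition with a morphism of families. -/
@[simps]
def DegHom.postcomp {i : ι} {z x x' : ∀ j, T j} (d : DegHom T i z x) (q : x ⟶ x') :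
    DegHom T i z x' where
  main := d.main ≫ (q i)⟦(1 : ℤ)⟧'
  off j h := d.off j h ≫ q j

variable (T) in
/-- A distinguished triangle `x → y → z → Σx` in the `i`-th variable, the other variables being
fixed (up to specified isomorphism): the other entries of `x → y → z` are isomorphisms, and the
connecting morphism inverts their composite. -/
structure TriangleIn (i : ι) (x y z : ∀ j, T j) where
  u : x ⟶ y
  v : y ⟶ z
  w : DegHom T i z x
  dist : Triangle.mk (u i) (v i) w.main ∈ distTriang (T i)
  isIso_u : ∀ j, j ≠ i → IsIso (u j)
  isIso_v : ∀ j, j ≠ i → IsIso (v j)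
  off_comp : ∀ j (h : j ≠ i), u j ≫ v j ≫ w.off j h = 𝟙 (x j)

/-- `(p, q, r)` is a morphism of triangles in the `i`-th variable. -/
structure TriangleIn.IsMap {i : ι} {x y z x' y' z' : ∀ j, T j} (Δ : TriangleIn T i x y z)
    (Δ' : TriangleIn T i x' y' z') (p : x ⟶ x') (q : y ⟶ y') (r : z ⟶ z') : Prop where
  comm₁ : Δ.u ≫ q = p ≫ Δ'.u
  comm₂ : Δ.v ≫ r = q ≫ Δ'.v
  comm₃ : Δ.w.main ≫ (p i)⟦(1 : ℤ)⟧' = r i ≫ Δ'.w.main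

variable (T) in
/-- The `3 × 3` array of families obtained from a distinguished triangle `X 0 b → X 1 b → X 2 b` in
the `i`-th variable and a distinguished triangle `X a 0 → X a 1 → X a 2` in the `j`-th variable. -/
structure TriangleGrid (i j : ι) where
  X : Fin 3 → Fin 3 → ∀ k, T k
  row : ∀ b, TriangleIn T i (X 0 b) (X 1 b) (X 2 b)
  col : ∀ a, TriangleIn T j (X a 0) (X a 1) (X a 2)
  row_u : (row 0).IsMap (row 1) (col 0).u (col 1).u (col 2).u
  row_v : (row 1).IsMap (row 2) (col 0).v (col 1).v (col 2).v
  col_u : (col 0).IsMap (col 1) (row 0).u (row 1).u (row 2).u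
  col_v : (col 1).IsMap (col 2) (row 0).v (row 1).v (row 2).v

end Tr

/-! ### Verdier structures -/

section Verdier

variable {T : TrCat.{u}}

/-- The displayed morphisms form an octahedron on `u₂₃ ∘ u₁₂ = u₁₃`, with `(m₁, m₃)` the triangle
on the three cones. -/
def IsOctahedron {X₁ X₂ X₃ Z₁₂ Z₂₃ Z₁₃ : T}
    (u₁₂ : X₁ ⟶ X₂) (v₁₂ : X₂ ⟶ Z₁₂) (w₁₂ : Z₁₂ ⟶ X₁⟦(1 : ℤ)⟧)
    (u₂₃ : X₂ ⟶ X₃) (v₂₃ : X₃ ⟶ Z₂₃) (w₂₃ : Z₂₃ ⟶ X₂⟦(1 : ℤ)⟧)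
    (u₁₃ : X₁ ⟶ X₃) (v₁₃ : X₃ ⟶ Z₁₃) (w₁₃ : Z₁₃ ⟶ X₁⟦(1 : ℤ)⟧)
    (m₁ : Z₁₂ ⟶ Z₁₃) (m₃ : Z₁₃ ⟶ Z₂₃) : Prop :=
  ∃ (comm : u₁₂ ≫ u₂₃ = u₁₃) (h₁₂ : Triangle.mk u₁₂ v₁₂ w₁₂ ∈ distTriang T)
    (h₂₃ : Triangle.mk u₂₃ v₂₃ w₂₃ ∈ distTriang T) (h₁₃ : Triangle.mk u₁₃ v₁₃ w₁₃ ∈ distTriang T)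
    (o : Triangulated.Octahedron comm h₁₂ h₂₃ h₁₃), o.m₁ = m₁ ∧ o.m₃ = m₃

variable (T) in
/-- The objects and morphisms of a `3 × 3` diagram: rows `x' → y' → z' → Σx'`, `x → y → z → Σx`,
`x'' → y'' → z'' → Σx''`, and columns `x' → x → x'' → Σx'`, `y' → y → y'' → Σy'`,
`z' → z → z'' → Σz'`. -/
structure NineDiagram where
  (x' y' z' x y z x'' y'' z'' : T)
  (f' : x' ⟶ y') (g' : y' ⟶ z') (h' : z' ⟶ x'⟦(1 : ℤ)⟧)
  (f : x ⟶ y) (g : y ⟶ z) (h : z ⟶ x⟦(1 : ℤ)⟧)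
  (f'' : x'' ⟶ y'') (g'' : y'' ⟶ z'') (h'' : z'' ⟶ x''⟦(1 : ℤ)⟧)
  (p' : x' ⟶ x) (p : x ⟶ x'') (p'' : x'' ⟶ x'⟦(1 : ℤ)⟧)
  (q' : y' ⟶ y) (q : y ⟶ y'') (q'' : y'' ⟶ y'⟦(1 : ℤ)⟧)
  (r' : z' ⟶ z) (r : z ⟶ z'') (r'' : z'' ⟶ z'⟦(1 : ℤ)⟧)

/-- A Verdier structure: an object `A` with a distinguished triangle `x' → y → A → Σx'` on the
diagonal, and three octahedra, on `x' → x → y`, on `x' → y' → y` and on `x'' → A → y''`. -/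
def NineDiagram.HasVerdierStructure (N : NineDiagram T) : Prop :=
  ∃ (A : T) (a : N.y ⟶ A) (v : A ⟶ N.x'⟦(1 : ℤ)⟧) (ε : N.x'' ⟶ A) (η : A ⟶ N.z)
    (b : N.z' ⟶ A) (c : A ⟶ N.y''),
    IsOctahedron N.p' N.p N.p'' N.f N.g N.h (N.p' ≫ N.f) a v ε η ∧
    IsOctahedron N.f' N.g' N.h' N.q' N.q N.q'' (N.p' ≫ N.f) a v b c ∧
    IsOctahedron ε η (N.h ≫ N.p⟦(1 : ℤ)⟧') c (N.q'' ≫ N.g'⟦(1 : ℤ)⟧') (-b⟦(1 : ℤ)⟧')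
      N.f'' N.g'' N.h'' N.r N.r'' ∧
    b ≫ η = N.r'

end Verdier

/-! ### Multiexact functors of triangulated categories -/

/-- The data of a multiexact functor of triangulated categories: a functor of several variables,
and, for every variable, its compatibility with the translation, recorded as the operation which
takes a morphism from `z` to "`x` translated in the `i`-th variable" to a morphism `F z ⟶ Σ F x`. -/
@[ext]
structure TrFunctor {ι : Type} (S : ι → TrCat.{u}) (T : TrCat.{u}) where
  functor : (∀ i, S i) ⥤ T
  conn : ∀ (i : ι) {z x : ∀ j, S j}, DegHom S i z x → (functor.obj z ⟶ (functor.obj x)⟦(1 : ℤ)⟧)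

namespace TrFunctor

variable {ι : Type} {S : ι → TrCat.{u}} {T : TrCat.{u}}

/-- `F` is multiexact. -/
structure IsMultiexact (F : TrFunctor S T) : Prop where
  /-- `F` is additive in each variable -/
  map_add : ∀ (i : ι) {x y : ∀ j, S j} (f g h : x ⟶ y), h i = f i + g i →
    (∀ j, j ≠ i → f j = h j ∧ g j = h j) → F.functor.map h = F.functor.map f + F.functor.map g
  /-- the compatibility with the translations is natural -/
  conn_precomp : ∀ (i : ι) {z' z x : ∀ j, S j} (p : z' ⟶ z) (d : DegHom S i z x),
    F.conn i (d.precomp p) = F.functor.map p ≫ F.conn i d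
  conn_postcomp : ∀ (i : ι) {z x x' : ∀ j, S j} (d : DegHom S i z x) (q : x ⟶ x'),
    F.conn i (d.postcomp q) = F.conn i d ≫ (F.functor.map q)⟦(1 : ℤ)⟧'
  /-- the comparison of `F (Σ_i x)` with `Σ F x` is an isomorphism -/
  conn_isIso : ∀ (i : ι) {z x : ∀ j, S j} (d : DegHom S i z x), IsIso d.main →
    (∀ j h, IsIso (d.off j h)) → IsIso (F.conn i d)
  /-- `F` preserves distinguished triangles in each variable -/
  dist : ∀ (i : ι) {x y z : ∀ j, S j} (Δ : TriangleIn S i x y z),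
    Triangle.mk (F.functor.map Δ.u) (F.functor.map Δ.v) (F.conn i Δ.w) ∈ distTriang T
  /-- the two comparisons of `F (Σ_i Σ_k x)` with `Σ Σ F x` are opposite -/
  anticomm : ∀ (i k : ι) (hik : i ≠ k) {t y y' x : ∀ j, S j}
    (d₁ : DegHom S k t y) (d₂ : DegHom S i y x) (e₁ : DegHom S i t y') (e₂ : DegHom S k y' x),
    d₁.off i hik ≫ d₂.main = e₁.main ≫ (e₂.off i hik)⟦(1 : ℤ)⟧' →
    d₁.main ≫ (d₂.off k hik.symm)⟦(1 : ℤ)⟧' = e₁.off k hik.symm ≫ e₂.main →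
    (∀ j (hi : j ≠ i) (hk : j ≠ k), d₁.off j hk ≫ d₂.off j hi = e₁.off j hi ≫ e₂.off j hk) →
    F.conn k d₁ ≫ (F.conn i d₂)⟦(1 : ℤ)⟧' = -(F.conn i e₁ ≫ (F.conn k e₂)⟦(1 : ℤ)⟧')

/-- The `3 × 3` diagram which is the image of two distinguished triangles in two variables. -/
@[simps]
def nineDiagram (F : TrFunctor S T) {i j : ι} (G : TriangleGrid S i j) : NineDiagram T where
  x' := F.functor.obj (G.X 0 0)
  y' := F.functor.obj (G.X 1 0)
  z' := F.functor.obj (G.X 2 0)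
  x := F.functor.obj (G.X 0 1)
  y := F.functor.obj (G.X 1 1)
  z := F.functor.obj (G.X 2 1)
  x'' := F.functor.obj (G.X 0 2)
  y'' := F.functor.obj (G.X 1 2)
  z'' := F.functor.obj (G.X 2 2)
  f' := F.functor.map (G.row 0).u
  g' := F.functor.map (G.row 0).v
  h' := F.conn i (G.row 0).w
  f := F.functor.map (G.row 1).u
  g := F.functor.map (G.row 1).v
  h := F.conn i (G.row 1).w
  f'' := F.functor.map (G.row 2).u
  g'' := F.functor.map (G.row 2).v
  h'' := F.conn i (G.row 2).w
  p' := F.functor.map (G.col 0).u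
  p := F.functor.map (G.col 0).v
  p'' := F.conn j (G.col 0).w
  q' := F.functor.map (G.col 1).u
  q := F.functor.map (G.col 1).v
  q'' := F.conn j (G.col 1).w
  r' := F.functor.map (G.col 2).u
  r := F.functor.map (G.col 2).v
  r'' := F.conn j (G.col 2).w

/-- `F` admits a Verdier structure. -/
def AdmitsVerdierStructure (F : TrFunctor S T) : Prop :=
  ∀ (i j : ι), i ≠ j → ∀ G : TriangleGrid S i j, (F.nineDiagram G).HasVerdierStructure

end TrFunctor

/-! ### Pulling back along index maps -/

section Pull

variable {κ ι : Type} {T : ι → TrCat.{u}} (r : κ → ι)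

/-- Restriction of families along `r`. -/
abbrev pull : (∀ i, T i) ⥤ (∀ k, T (r k)) where
  obj x k := x (r k)
  map p k := p (r k)

variable {r} (k : κ) (hr : ∀ k', r k' = r k → k' = k)

/-- Restriction of `DegHom` along `r`. -/
@[simps]
def DegHom.pull {z x : ∀ j, T j} (d : DegHom T (r k) z x) :
    DegHom (fun k => T (r k)) k (fun k => z (r k)) (fun k => x (r k)) where
  main := d.main
  off k' h := d.off (r k') (fun h' => h (hr k' h'))

/-- Restriction of `TriangleIn` along `r`. -/
@[simps]
def TriangleIn.pull {x y z : ∀ j, T j} (Δ : TriangleIn T (r k) x y z) :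
    TriangleIn (fun k => T (r k)) k (fun k => x (r k)) (fun k => y (r k)) (fun k => z (r k)) where
  u k := Δ.u (r k)
  v k := Δ.v (r k)
  w := Δ.w.pull k hr
  dist := Δ.dist
  isIso_u k' h := Δ.isIso_u _ (fun h' => h (hr k' h'))
  isIso_v k' h := Δ.isIso_v _ (fun h' => h (hr k' h'))
  off_comp k' h := Δ.off_comp _ (fun h' => h (hr k' h'))

lemma TriangleIn.IsMap.pull {x y z x' y' z' : ∀ j, T j} {Δ : TriangleIn T (r k) x y z}
    {Δ' : TriangleIn T (r k) x' y' z'} {p : x ⟶ x'} {q : y ⟶ y'} {s : z ⟶ z'}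
    (h : Δ.IsMap Δ' p q s) :
    (Δ.pull k hr).IsMap (Δ'.pull k hr) (fun k => p (r k)) (fun k => q (r k)) (fun k => s (r k)) where
  comm₁ := funext fun k => congrFun h.comm₁ (r k)
  comm₂ := funext fun k => congrFun h.comm₂ (r k)
  comm₃ := h.comm₃

/-- Restriction of `TriangleGrid` along `r`. -/
@[simps]
def TriangleGrid.pull {l : κ} (hl : ∀ k', r k' = r l → k' = l) (G : TriangleGrid T (r k) (r l)) :
    TriangleGrid (fun k => T (r k)) k l where
  X a b k := G.X a b (r k)
  row b := (G.row b).pull k hr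
  col a := (G.col a).pull l hl
  row_u := G.row_u.pull k hr
  row_v := G.row_v.pull k hr
  col_u := G.col_u.pull l hl
  col_v := G.col_v.pull l hl

end Pull

/-! ### Strings of multiexact functors and their composition -/

/-- The fibre of `φ` over `j`. -/
abbrev Fib {I J : Type} (φ : I → J) (j : J) : Type := {i : I // φ i = j}

/-- The restriction of an indexed family to a fibre. -/
abbrev onFib {I J : Type} {α : Type*} (S : I → α) (φ : I → J) (j : J) : Fib φ j → α :=
  fun i => S i.1

section Star

variable {I J : Type} {φ : I → J} {S : I → TrCat.{u}} {T : J → TrCat.{u}}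

/-- Strings of functors `F j : (S i)_{φ i = j} → T j`. -/
abbrev TrString (φ : I → J) (S : I → TrCat.{u}) (T : J → TrCat.{u}) :=
  ∀ j, TrFunctor (onFib S φ j) (T j)

namespace TrString

variable (F : TrString φ S T)

/-- The functor `∏ S i ⥤ ∏ T j` given by a string. -/
@[simps]
def star : (∀ i, S i) ⥤ (∀ j, T j) where
  obj x j := (F j).functor.obj (fun i => x i.1)
  map p j := (F j).functor.map (fun i => p i.1)
  map_id x := by ext j; exact (F j).functor.map_id _
  map_comp p q := by ext j; exact (F j).functor.map_comp (fun i => p i.1) (fun i => q i.1)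

lemma fib_inj {j : J} (i : Fib φ j) (i' : Fib φ j) (h : i'.1 = i.1) : i' = i := Subtype.ext h

/-- The action of a string on `DegHom`. -/
@[simps]
def starDeg {k : J} (i : Fib φ k) {z x : ∀ i, S i} (d : DegHom S i.1 z x) :
    DegHom T k (F.star.obj z) (F.star.obj x) where
  main := (F k).conn i (d.pull i (fib_inj i))
  off j h := (F j).functor.map (fun i' => d.off i'.1 (fun e => h (by rw [← i'.2, e, i.2])))


lemma starDeg_precomp (hF : ∀ j, (F j).IsMultiexact) {k : J} (i : Fib φ k) {z' z x : ∀ i, S i}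
    (p : z' ⟶ z) (d : DegHom S i.1 z x) :
    F.starDeg i (d.precomp p) = (F.starDeg i d).precomp (F.star.map p) := by
  refine DegHom.ext ?_ ?_
  · exact (hF k).conn_precomp i (fun i' => p i'.1) (d.pull i (fib_inj i))
  · funext j h
    exact (F j).functor.map_comp (fun i' => p i'.1)
      (fun i' => d.off i'.1 (fun e => h (by rw [← i'.2, e, i.2])))

lemma starDeg_postcomp (hF : ∀ j, (F j).IsMultiexact) {k : J} (i : Fib φ k) {z x x' : ∀ i, S i}
    (d : DegHom S i.1 z x) (q : x ⟶ x') :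
    F.starDeg i (d.postcomp q) = (F.starDeg i d).postcomp (F.star.map q) := by
  refine DegHom.ext ?_ ?_
  · exact (hF k).conn_postcomp i (d.pull i (fib_inj i)) (fun i' => q i'.1)
  · funext j h
    exact (F j).functor.map_comp
      (fun i' => d.off i'.1 (fun e => h (by rw [← i'.2, e, i.2]))) (fun i' => q i'.1)

/-- The action of a string on distinguished triangles in one variable. -/
@[simps u v w]
def starTri (hF : ∀ j, (F j).IsMultiexact) {k : J} (i : Fib φ k) {x y z : ∀ i, S i}
    (Δ : TriangleIn S i.1 x y z) :
    TriangleIn T k (F.star.obj x) (F.star.obj y) (F.star.obj z) where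
  u := F.star.map Δ.u
  v := F.star.map Δ.v
  w := F.starDeg i Δ.w
  dist := (hF k).dist i (Δ.pull i (fib_inj i))
  isIso_u j h := by
    have : IsIso (C := ∀ i : Fib φ j, S i.1) (X := fun i => x i.1) (Y := fun i => y i.1)
      (fun i' : Fib φ j => Δ.u i'.1) := by
        rw [isIso_pi_iff]
        exact fun i' => Δ.isIso_u i'.1 (fun e => h (by rw [← i'.2, e, i.2]))
    exact Functor.map_isIso (F j).functor _
  isIso_v j h := by
    have : IsIso (C := ∀ i : Fib φ j, S i.1) (X := fun i => y i.1) (Y := fun i => z i.1)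
      (fun i' : Fib φ j => Δ.v i'.1) := by
        rw [isIso_pi_iff]
        exact fun i' => Δ.isIso_v i'.1 (fun e => h (by rw [← i'.2, e, i.2]))
    exact Functor.map_isIso (F j).functor _
  off_comp j h := by
    change (F j).functor.map _ ≫ (F j).functor.map _ ≫ (F j).functor.map _ = 𝟙 _
    rw [← Functor.map_comp, ← Functor.map_comp]
    exact (congrArg (F j).functor.map (funext fun i' =>
      Δ.off_comp i'.1 (fun e => h (by rw [← i'.2, e, i.2])))).trans ((F j).functor.map_id _)

lemma isMap_off {ι : Type} {T : ι → TrCat.{u}} {i : ι} {x y z x' y' z' : ∀ j, T j}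
    {Δ : TriangleIn T i x y z} {Δ' : TriangleIn T i x' y' z'} {p : x ⟶ x'} {q : y ⟶ y'}
    {r : z ⟶ z'} (h : Δ.IsMap Δ' p q r) (j : ι) (hj : j ≠ i) :
    Δ.w.off j hj ≫ p j = r j ≫ Δ'.w.off j hj := by
  have := Δ.isIso_u j hj
  have := Δ.isIso_v j hj
  have h₁ := congrFun h.comm₁ j
  have h₂ := congrFun h.comm₂ j
  simp only [Pi.comp_apply] at h₁ h₂
  rw [← cancel_epi (Δ.u j ≫ Δ.v j)]
  have e := Δ.off_comp j hj
  have e' := Δ'.off_comp j hj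
  simp only [assoc] at *
  rw [reassoc_of% e, reassoc_of% h₂, reassoc_of% h₁, e', comp_id]

lemma isMap_w {ι : Type} {T : ι → TrCat.{u}} {i : ι} {x y z x' y' z' : ∀ j, T j}
    {Δ : TriangleIn T i x y z} {Δ' : TriangleIn T i x' y' z'} {p : x ⟶ x'} {q : y ⟶ y'}
    {r : z ⟶ z'} (h : Δ.IsMap Δ' p q r) : Δ.w.postcomp p = Δ'.w.precomp r := by
  refine DegHom.ext h.comm₃ ?_
  funext j hj
  exact isMap_off h j hj

lemma starTri_isMap (hF : ∀ j, (F j).IsMultiexact) {k : J} (i : Fib φ k)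
    {x y z x' y' z' : ∀ j, S j} {Δ : TriangleIn S i.1 x y z}
    {Δ' : TriangleIn S i.1 x' y' z'} {p : x ⟶ x'} {q : y ⟶ y'} {r : z ⟶ z'}
    (h : Δ.IsMap Δ' p q r) :
    (F.starTri hF i Δ).IsMap (F.starTri hF i Δ') (F.star.map p) (F.star.map q) (F.star.map r) where
  comm₁ := (F.star.map_comp _ _).symm.trans ((congrArg F.star.map h.comm₁).trans
    (F.star.map_comp _ _))
  comm₂ := (F.star.map_comp _ _).symm.trans ((congrArg F.star.map h.comm₂).trans
    (F.star.map_comp _ _))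
  comm₃ := by
    have e := congrArg (F.starDeg i) (isMap_w h)
    rw [starDeg_precomp F hF, starDeg_postcomp F hF] at e
    exact congrArg DegHom.main e

/-- The action of a string on grids, for variables in different fibres. -/
@[simps]
def starGrid (hF : ∀ j, (F j).IsMultiexact) {k l : J} (i : Fib φ k) (j : Fib φ l)
    (G : TriangleGrid S i.1 j.1) : TriangleGrid T k l where
  X a b := F.star.obj (G.X a b)
  row b := F.starTri hF i (G.row b)
  col a := F.starTri hF j (G.col a)
  row_u := F.starTri_isMap hF i G.row_u
  row_v := F.starTri_isMap hF i G.row_v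
  col_u := F.starTri_isMap hF j G.col_u
  col_v := F.starTri_isMap hF j G.col_v

end TrString

/-- The composite `G ∘ (F_j)_j`. -/
@[simps]
def TrFunctor.comp {U : TrCat.{u}} (F : TrString φ S T) (G : TrFunctor T U) : TrFunctor S U where
  functor := F.star ⋙ G.functor
  conn i _ _ d := G.conn (φ i) (F.starDeg ⟨i, rfl⟩ d)

end Star

namespace TrFunctor

section Put

variable {ι : Type} {T : ι → TrCat.{u}} {U : TrCat.{u}} {G : TrFunctor T U}

open Classical in
/-- replace the `k`-th entry -/
noncomputable def put (x : ∀ j, T j) (k : ι) (a : T k) : ∀ j, T j := Function.update x k a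

lemma put_self (x : ∀ j, T j) (k : ι) (a : T k) : put x k a k = a := by simp [put]
lemma put_off (x : ∀ j, T j) (k : ι) (a : T k) (j : ι) (h : j ≠ k) : put x k a j = x j := by
  simp [put, h]

open Classical in
/-- a morphism into `put x k a`  -/
noncomputable def toPut {y x : ∀ j, T j} {k : ι} {a : T k} (f : y k ⟶ a)
    (g : ∀ j, j ≠ k → (y j ⟶ x j)) : y ⟶ put x k a := fun j =>
  if h : j = k then by subst h; exact f ≫ eqToHom (put_self x j a).symm
  else g j h ≫ eqToHom (put_off x k a j h).symm

lemma toPut_self {y x : ∀ j, T j} {k : ι} {a : T k} (f : y k ⟶ a)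
    (g : ∀ j, j ≠ k → (y j ⟶ x j)) : toPut f g k = f ≫ eqToHom (put_self x k a).symm := by
  simp [toPut]

lemma toPut_off {y x : ∀ j, T j} {k : ι} {a : T k} (f : y k ⟶ a)
    (g : ∀ j, j ≠ k → (y j ⟶ x j)) (j : ι) (h : j ≠ k) :
    toPut f g j = g j h ≫ eqToHom (put_off x k a j h).symm := by
  simp [toPut, h]

/-- the universal element -/
@[simps]
noncomputable def univ (k : ι) (x : ∀ j, T j) : DegHom T k (put x k ((x k)⟦(1 : ℤ)⟧)) x where
  main := eqToHom (put_self x k _)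
  off j h := eqToHom (put_off x k _ j h)

/-- factorisation through the universal element -/
noncomputable def lift {k : ι} {z x : ∀ j, T j} (d : DegHom T k z x) :
    z ⟶ put x k ((x k)⟦(1 : ℤ)⟧) := toPut d.main d.off

lemma lift_univ {k : ι} {z x : ∀ j, T j} (d : DegHom T k z x) :
    (univ k x).precomp (lift d) = d := by
  refine DegHom.ext ?_ ?_
  · simp [lift, toPut_self]
  · funext j h
    simp [lift, toPut_off _ _ j h]

lemma conn_eq_lift (hG : G.IsMultiexact) {k : ι} {z x : ∀ j, T j} (d : DegHom T k z x) :
    G.conn k d = G.functor.map (lift d) ≫ G.conn k (univ k x) := by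
  rw [← hG.conn_precomp, lift_univ]

lemma map_zero_of (hG : G.IsMultiexact) {k : ι} {x y : ∀ j, T j} (f : x ⟶ y) (h : f k = 0) :
    G.functor.map f = 0 := by
  have := hG.map_add k f f f (by simp [h]) (fun _ _ => ⟨rfl, rfl⟩)
  simpa using this

lemma map_neg_of (hG : G.IsMultiexact) {k : ι} {x y : ∀ j, T j} (f g : x ⟶ y) (h : f k = -g k)
    (h' : ∀ j, j ≠ k → f j = g j) : G.functor.map f = -G.functor.map g := by
  classical
  let z : x ⟶ y := fun j => if h : j = k then 0 else f j
  have hz : z k = 0 := by simp [z]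
  have := hG.map_add k f g z (by simp [hz, h]) (fun j hj => by simp [z, hj, h' j hj])
  rw [map_zero_of hG z hz] at this
  exact eq_neg_of_add_eq_zero_left this.symm

lemma conn_neg_of (hG : G.IsMultiexact) {k : ι} {z x : ∀ j, T j} (d e : DegHom T k z x)
    (h : d.main = -e.main) (h' : ∀ j hj, d.off j hj = e.off j hj) :
    G.conn k d = -G.conn k e := by
  rw [conn_eq_lift hG d, conn_eq_lift hG e,
    map_neg_of hG (k := k) (lift d) (lift e), Preadditive.neg_comp]
  · simp [lift, toPut_self, h]
  · intro j hj
    simp [lift, toPut_off _ _ j hj, h']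

lemma conn_conn_neg_of (hG : G.IsMultiexact) {k : ι} {t y y' x : ∀ j, T j}
    (d₁ : DegHom T k t y) (d₂ : DegHom T k y x) (e₁ : DegHom T k t y') (e₂ : DegHom T k y' x)
    (h : d₁.main ≫ d₂.main⟦(1 : ℤ)⟧' = -(e₁.main ≫ e₂.main⟦(1 : ℤ)⟧'))
    (h' : ∀ j hj, d₁.off j hj ≫ d₂.off j hj = e₁.off j hj ≫ e₂.off j hj) :
    G.conn k d₁ ≫ (G.conn k d₂)⟦(1 : ℤ)⟧' = -(G.conn k e₁ ≫ (G.conn k e₂)⟦(1 : ℤ)⟧') := by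
  rw [conn_eq_lift hG d₂, conn_eq_lift hG e₂, Functor.map_comp, Functor.map_comp,
    ← assoc, ← assoc, ← hG.conn_postcomp, ← hG.conn_postcomp,
    conn_neg_of hG (d₁.postcomp (lift d₂)) (e₁.postcomp (lift e₂)), Preadditive.neg_comp]
  · simp only [DegHom.postcomp_main, lift, toPut_self, Functor.map_comp]
    rw [reassoc_of% h]
    simp
  · intro j hj
    simp [lift, toPut_off _ _ j hj, reassoc_of% (h' j hj)]

end Put

section

variable {I J : Type} {φ : I → J} {S : I → TrCat.{u}} {T : J → TrCat.{u}} {U : TrCat.{u}}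
  {F : TrString φ S T} {G : TrFunctor T U}

lemma map_square {K : Type} {R : K → TrCat.{u}} {V : TrCat.{u}} (H : (∀ k, R k) ⥤ V)
    {a b c d : ∀ k, R k} {p : a ⟶ b} {q : b ⟶ d} {r : a ⟶ c} {s : c ⟶ d}
    (h : ∀ k, p k ≫ q k = r k ≫ s k) : H.map p ≫ H.map q = H.map r ≫ H.map s := by
  rw [← H.map_comp, ← H.map_comp]
  exact congrArg H.map (funext h)

lemma conn_starDeg {i : I} {k : J} (h : φ i = k) {z x : ∀ i, S i} (d : DegHom S i z x) :
    (comp F G).conn i d = G.conn k (F.starDeg ⟨i, h⟩ d) := by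
  subst h; rfl

theorem IsMultiexact.comp (hF : ∀ j, (F j).IsMultiexact) (hG : G.IsMultiexact) :
    (comp F G).IsMultiexact where
  map_add i x y f g h e e' := by
    refine hG.map_add (φ i) _ _ _ ?_ ?_
    · exact (hF _).map_add ⟨i, rfl⟩ _ _ _ e (fun j hj => e' _ (fun h => hj (Subtype.ext h)))
    · intro j hj
      have : ∀ i' : Fib φ j, i'.1 ≠ i := fun i' e => hj (by rw [← i'.2, e])
      constructor <;> refine congrArg (F j).functor.map (funext fun i' => ?_)
      exacts [(e' _ (this i')).1, (e' _ (this i')).2]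
  conn_precomp i z' z x p d := by
    simp only [comp_conn, F.starDeg_precomp hF, hG.conn_precomp]; rfl
  conn_postcomp i z x x' d q := by
    simp only [comp_conn, F.starDeg_postcomp hF, hG.conn_postcomp]; rfl
  conn_isIso i z x d h h' := by
    refine hG.conn_isIso _ _ ?_ ?_
    · exact (hF _).conn_isIso ⟨i, rfl⟩ _ h (fun _ _ => h' _ _)
    · intro j hj
      have : IsIso (C := ∀ i : Fib φ j, S i.1) (X := fun i => z i.1) (Y := fun i => x i.1)
        (fun i' : Fib φ j => d.off i'.1 (fun e => hj (by rw [← i'.2, e]))) := by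
          rw [isIso_pi_iff]
          exact fun i' => h' _ _
      exact Functor.map_isIso (F j).functor _
  dist i x y z Δ := hG.dist _ (F.starTri hF ⟨i, rfl⟩ Δ)
  anticomm i k hik t y y' x d₁ d₂ e₁ e₂ h₁ h₂ h₃ := by
    have key : ∀ (l m : J) (hl : φ i = l) (hm : φ k = m),
        G.conn m (F.starDeg ⟨k, hm⟩ d₁) ≫ (G.conn l (F.starDeg ⟨i, hl⟩ d₂))⟦(1 : ℤ)⟧' =
        -(G.conn l (F.starDeg ⟨i, hl⟩ e₁) ≫ (G.conn m (F.starDeg ⟨k, hm⟩ e₂))⟦(1 : ℤ)⟧') := by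
      intro l m hl hm
      by_cases hlm : l = m
      · subst hlm
        refine conn_conn_neg_of hG _ _ _ _ ?_ ?_
        · exact (hF l).anticomm ⟨i, hl⟩ ⟨k, hm⟩ (fun e => hik (congrArg Subtype.val e)) _ _ _ _
            h₁ h₂ (fun j hi hk => h₃ j.1 _ _)
        · intro j hj
          exact map_square _ (fun i' : Fib φ j =>
            h₃ i'.1 (fun e => hj (by rw [← i'.2, e, hl])) (fun e => hj (by rw [← i'.2, e, hm])))
      · refine hG.anticomm l m hlm _ _ _ _ ?_ ?_ ?_
        · refine ((hF l).conn_precomp ⟨i, hl⟩ _ _).symm.trans (Eq.trans ?_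
            ((hF l).conn_postcomp ⟨i, hl⟩ _ _))
          refine congrArg _ (DegHom.ext ?_ ?_)
          · exact h₁
          · funext j hj
            refine h₃ j.1 (fun h => hj (Subtype.ext h)) (fun e => hlm ?_)
            rw [← j.2, e, hm]
        · refine ((hF m).conn_postcomp ⟨k, hm⟩ _ _).symm.trans (Eq.trans ?_
            ((hF m).conn_precomp ⟨k, hm⟩ _ _))
          refine congrArg _ (DegHom.ext ?_ ?_)
          · exact h₂
          · funext j hj
            refine h₃ j.1 (fun e => hlm ?_) (fun h => hj (Subtype.ext h))
            rw [← j.2, e, hl]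
        · intro j hi hk
          exact map_square _ (fun i' : Fib φ j =>
            h₃ i'.1 (fun e => hi (by rw [← i'.2, e, hl])) (fun e => hk (by rw [← i'.2, e, hm])))
    exact key _ _ rfl rfl
end

end TrFunctor

/-! ### Multideterminant functors -/

section Det

variable {ι : Type}

/-- The data of a determinant functor in several variables: a functor on the isomorphisms, and, for
every distinguished triangle `x → y → z` in one of the variables, a morphism
`D z + D x ⟶ D y`. -/
structure DetData (T : ι → TrCat.{u}) (P : PicCat.{u}) where
  functor : Core (∀ i, T i) ⥤ P
  additivity (i : ι) {x y z : ∀ j, T j} (Δ : TriangleIn T i x y z) :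
    functor.obj ⟨z⟩ ⊗ functor.obj ⟨x⟩ ⟶ functor.obj ⟨y⟩

namespace DetData

variable {T : ι → TrCat.{u}} {P : PicCat.{u}}

/-- Transformations compatible with the additivity data. -/
@[ext]
structure Hom (D E : DetData T P) where
  natTrans : D.functor ⟶ E.functor
  comm (i : ι) {x y z : ∀ j, T j} (Δ : TriangleIn T i x y z) :
    D.additivity i Δ ≫ natTrans.app ⟨y⟩ =
      (natTrans.app ⟨z⟩ ⊗ₘ natTrans.app ⟨x⟩) ≫ E.additivity i Δ

instance : Category (DetData T P) where
  Hom := Hom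
  id D := { natTrans := 𝟙 _, comm := by simp }
  comp f g :=
    { natTrans := f.natTrans ≫ g.natTrans
      comm := fun i x y z Δ => by
        rw [NatTrans.comp_app, NatTrans.comp_app, NatTrans.comp_app, ← assoc, f.comm, assoc,
          g.comm, ← assoc, tensorHom_comp_tensorHom] }

/-- `D` is a multideterminant functor. -/
structure IsMultiDet (D : DetData T P) : Prop where
  naturality : ∀ (i : ι) {x y z x' y' z' : ∀ j, T j} (Δ : TriangleIn T i x y z)
    (Δ' : TriangleIn T i x' y' z') (p : x ≅ x') (q : y ≅ y') (r : z ≅ z'),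
    Δ.IsMap Δ' p.hom q.hom r.hom →
    D.additivity i Δ ≫ D.functor.map ⟨q⟩ =
      (D.functor.map ⟨r⟩ ⊗ₘ D.functor.map ⟨p⟩) ≫ D.additivity i Δ'
  /-- `s` is a direct sum of `a` and `b` in the `i`-th variable -/
  commutativity : ∀ (i : ι) {a b s : ∀ j, T j} (Δ₁ : TriangleIn T i a s b)
    (Δ₂ : TriangleIn T i b s a), Δ₁.w.main = 0 → Δ₂.w.main = 0 →
    Δ₁.u ≫ Δ₂.v = 𝟙 a → Δ₂.u ≫ Δ₁.v = 𝟙 b →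
    (β_ (D.functor.obj ⟨a⟩) (D.functor.obj ⟨b⟩)).hom ≫ D.additivity i Δ₁ = D.additivity i Δ₂
  /-- an octahedron in the `i`-th variable on `x → y → z` -/
  octahedron : ∀ (i : ι) {x y z z' y' x' : ∀ j, T j} (Δ₁ : TriangleIn T i x y z')
    (Δ₂ : TriangleIn T i x z y') (Δ₃ : TriangleIn T i y z x') (Δ₄ : TriangleIn T i z' y' x'),
    Δ₁.u ≫ Δ₃.u = Δ₂.u → Δ₁.v ≫ Δ₄.u = Δ₃.u ≫ Δ₂.v → Δ₄.u i ≫ Δ₂.w.main = Δ₁.w.main →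
    Δ₂.v ≫ Δ₄.v = Δ₃.v → Δ₂.w.main ≫ (Δ₁.u i)⟦(1 : ℤ)⟧' = Δ₄.v i ≫ Δ₃.w.main →
    Δ₄.w.main = Δ₃.w.main ≫ (Δ₁.v i)⟦(1 : ℤ)⟧' →
    (D.additivity i Δ₄ ▷ D.functor.obj ⟨x⟩) ≫ D.additivity i Δ₂ =
      (α_ (D.functor.obj ⟨x'⟩) (D.functor.obj ⟨z'⟩) (D.functor.obj ⟨x⟩)).hom ≫
        (D.functor.obj ⟨x'⟩ ◁ D.additivity i Δ₁) ≫ D.additivity i Δ₃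
  /-- compatibility of the additivity data in two variables -/
  two_triangles : ∀ (i j : ι), i ≠ j → ∀ (G : TriangleGrid T i j),
    (D.additivity i (G.row 2) ⊗ₘ D.additivity i (G.row 0)) ≫ D.additivity j (G.col 1) =
      tensorμ (D.functor.obj ⟨G.X 2 2⟩) (D.functor.obj ⟨G.X 0 2⟩) (D.functor.obj ⟨G.X 2 0⟩)
        (D.functor.obj ⟨G.X 0 0⟩) ≫
      (D.additivity j (G.col 2) ⊗ₘ D.additivity j (G.col 0)) ≫ D.additivity i (G.row 1)

end DetData

/-- The category of multideterminant functors `T₁ × ⋯ × Tₙ → P`. -/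
abbrev Det (T : ι → TrCat.{u}) (P : PicCat.{u}) :=
  ObjectProperty.FullSubcategory (fun D : DetData T P => D.IsMultiDet)

end Det

/-! ### Multiexact functors of Picard groupoids -/

section Pic

variable {ι : Type}

/-- An identification of `s` with the sum of `x` and `y` in the `i`-th variable, the other
variables being fixed (up to specified isomorphism). -/
@[ext]
structure SumIn (A : ι → PicCat.{u}) (i : ι) (x y s : ∀ j, A j) where
  main : x i ⊗ y i ⟶ s i
  fst : ∀ j, j ≠ i → (x j ⟶ s j)
  snd : ∀ j, j ≠ i → (y j ⟶ s j)

/-- The data of a multiexact functor of Picard groupoids: a functor of several variables, and, for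
every variable, its compatibility with sums in this variable. -/
structure PicFunctor (A : ι → PicCat.{u}) (B : PicCat.{u}) where
  functor : (∀ i, A i) ⥤ B
  sum (i : ι) {x y s : ∀ j, A j} (σ : SumIn A i x y s) :
    functor.obj x ⊗ functor.obj y ⟶ functor.obj s

namespace PicFunctor

variable {A : ι → PicCat.{u}} {B : PicCat.{u}}

/-- Transformations compatible with sums in each variable. -/
@[ext]
structure Hom (f g : PicFunctor A B) where
  natTrans : f.functor ⟶ g.functor
  comm (i : ι) {x y s : ∀ j, A j} (σ : SumIn A i x y s) :
    f.sum i σ ≫ natTrans.app s = (natTrans.app x ⊗ₘ natTrans.app y) ≫ g.sum i σ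

instance : Category (PicFunctor A B) where
  Hom := Hom
  id D := { natTrans := 𝟙 _, comm := by simp }
  comp f g :=
    { natTrans := f.natTrans ≫ g.natTrans
      comm := fun i x y z Δ => by
        rw [NatTrans.comp_app, NatTrans.comp_app, NatTrans.comp_app, ← assoc, f.comm, assoc,
          g.comm, ← assoc, tensorHom_comp_tensorHom] }

/-- `f` is multiexact: symmetric monoidal in each variable, with interchange of the sums in two
variables. -/
structure IsMultiexact (f : PicFunctor A B) : Prop where
  naturality : ∀ (i : ι) {x y s x' y' s' : ∀ j, A j} (σ : SumIn A i x y s)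
    (σ' : SumIn A i x' y' s') (p : x ⟶ x') (q : y ⟶ y') (r : s ⟶ s'),
    σ.main ≫ r i = (p i ⊗ₘ q i) ≫ σ'.main →
    (∀ j h, σ.fst j h ≫ r j = p j ≫ σ'.fst j h) → (∀ j h, σ.snd j h ≫ r j = q j ≫ σ'.snd j h) →
    f.sum i σ ≫ f.functor.map r = (f.functor.map p ⊗ₘ f.functor.map q) ≫ f.sum i σ'
  associativity : ∀ (i : ι) {x y z s t w : ∀ j, A j} (σ₁ : SumIn A i x y s)
    (σ₂ : SumIn A i s z w) (σ₃ : SumIn A i y z t) (σ₄ : SumIn A i x t w),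
    (σ₁.main ▷ z i) ≫ σ₂.main = (α_ (x i) (y i) (z i)).hom ≫ (x i ◁ σ₃.main) ≫ σ₄.main →
    (∀ j h, σ₁.fst j h ≫ σ₂.fst j h = σ₄.fst j h) →
    (∀ j h, σ₁.snd j h ≫ σ₂.fst j h = σ₃.fst j h ≫ σ₄.snd j h) →
    (∀ j h, σ₂.snd j h = σ₃.snd j h ≫ σ₄.snd j h) →
    (f.sum i σ₁ ▷ f.functor.obj z) ≫ f.sum i σ₂ =
      (α_ (f.functor.obj x) (f.functor.obj y) (f.functor.obj z)).hom ≫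
        (f.functor.obj x ◁ f.sum i σ₃) ≫ f.sum i σ₄
  commutativity : ∀ (i : ι) {x y s : ∀ j, A j} (σ : SumIn A i x y s) (σ' : SumIn A i y x s),
    (β_ (x i) (y i)).hom ≫ σ'.main = σ.main → (∀ j h, σ.fst j h = σ'.snd j h) →
    (∀ j h, σ.snd j h = σ'.fst j h) →
    (β_ (f.functor.obj x) (f.functor.obj y)).hom ≫ f.sum i σ' = f.sum i σ
  interchange : ∀ (i k : ι) (hik : i ≠ k) {x₀₀ x₁₀ x₀₁ x₁₁ s₀ s₁ t₀ t₁ w : ∀ j, A j}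
    (σ₀ : SumIn A i x₀₀ x₁₀ s₀) (σ₁ : SumIn A i x₀₁ x₁₁ s₁) (σ : SumIn A k s₀ s₁ w)
    (τ₀ : SumIn A k x₀₀ x₀₁ t₀) (τ₁ : SumIn A k x₁₀ x₁₁ t₁) (τ : SumIn A i t₀ t₁ w),
    σ₀.main ≫ σ.fst i hik = (τ₀.fst i hik ⊗ₘ τ₁.fst i hik) ≫ τ.main →
    σ₁.main ≫ σ.snd i hik = (τ₀.snd i hik ⊗ₘ τ₁.snd i hik) ≫ τ.main →
    τ₀.main ≫ τ.fst k hik.symm = (σ₀.fst k hik.symm ⊗ₘ σ₁.fst k hik.symm) ≫ σ.main →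
    τ₁.main ≫ τ.snd k hik.symm = (σ₀.snd k hik.symm ⊗ₘ σ₁.snd k hik.symm) ≫ σ.main →
    (∀ j (hi : j ≠ i) (hk : j ≠ k), σ₀.fst j hi ≫ σ.fst j hk = τ₀.fst j hk ≫ τ.fst j hi ∧
      σ₀.snd j hi ≫ σ.fst j hk = τ₁.fst j hk ≫ τ.snd j hi ∧
      σ₁.fst j hi ≫ σ.snd j hk = τ₀.snd j hk ≫ τ.fst j hi ∧
      σ₁.snd j hi ≫ σ.snd j hk = τ₁.snd j hk ≫ τ.snd j hi) →
    (f.sum i σ₀ ⊗ₘ f.sum i σ₁) ≫ f.sum k σ =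
      tensorμ (f.functor.obj x₀₀) (f.functor.obj x₁₀) (f.functor.obj x₀₁) (f.functor.obj x₁₁) ≫
        (f.sum k τ₀ ⊗ₘ f.sum k τ₁) ≫ f.sum i τ

end PicFunctor

/-- The category `Pic^×(A₁, …, Aₙ; B)`. -/
abbrev Pic (A : ι → PicCat.{u}) (B : PicCat.{u}) :=
  ObjectProperty.FullSubcategory (fun f : PicFunctor A B => f.IsMultiexact)

end Pic

section PicStar

variable {I J : Type} {φ : I → J} {A : I → PicCat.{u}} {B : J → PicCat.{u}}

/-- Restriction of `SumIn` along `r`. -/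
@[simps]
def SumIn.pull {κ ι : Type} {A : ι → PicCat.{u}} {r : κ → ι} (k : κ)
    (hr : ∀ k', r k' = r k → k' = k) {x y s : ∀ j, A j} (σ : SumIn A (r k) x y s) :
    SumIn (fun k => A (r k)) k (fun k => x (r k)) (fun k => y (r k)) (fun k => s (r k)) where
  main := σ.main
  fst k' h := σ.fst (r k') (fun h' => h (hr k' h'))
  snd k' h := σ.snd (r k') (fun h' => h (hr k' h'))

/-- Strings of functors `f j : (A i)_{φ i = j} → B j`. -/
abbrev PicString (φ : I → J) (A : I → PicCat.{u}) (B : J → PicCat.{u}) :=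
  ∀ j, PicFunctor (onFib A φ j) (B j)

namespace PicString

variable (f : PicString φ A B)

/-- The functor `∏ A i ⥤ ∏ B j` given by a string. -/
@[simps]
def star : (∀ i, A i) ⥤ (∀ j, B j) where
  obj x j := (f j).functor.obj (fun i => x i.1)
  map p j := (f j).functor.map (fun i => p i.1)
  map_id x := by ext j; exact (f j).functor.map_id _
  map_comp p q := by ext j; exact (f j).functor.map_comp (fun i => p i.1) (fun i => q i.1)

/-- The action of a string on sums in one variable. -/
@[simps]
def starSum {k : J} (i : Fib φ k) {x y s : ∀ i, A i} (σ : SumIn A i.1 x y s) :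
    SumIn B k (f.star.obj x) (f.star.obj y) (f.star.obj s) where
  main := (f k).sum i (σ.pull i (TrString.fib_inj i))
  fst j h := (f j).functor.map (fun i' => σ.fst i'.1 (fun e => h (by rw [← i'.2, e, i.2])))
  snd j h := (f j).functor.map (fun i' => σ.snd i'.1 (fun e => h (by rw [← i'.2, e, i.2])))

end PicString

namespace PicFunctor

/-- The composite `g ∘ (f_j)_j`. -/
@[simps]
def comp (f : PicString φ A B) {C : PicCat.{u}} (g : PicFunctor B C) : PicFunctor A C where
  functor := f.star ⋙ g.functor
  sum i _ _ _ σ := g.sum (φ i) (f.starSum ⟨i, rfl⟩ σ)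

/-- Transformations `g ⟶ g'` induce transformations `g ∘ (f_j)_j ⟶ g' ∘ (f_j)_j`. -/
@[simps]
def whisker (f : PicString φ A B) {C : PicCat.{u}} {g g' : PicFunctor B C} (γ : g ⟶ g') :
    comp f g ⟶ comp f g' where
  natTrans := Functor.whiskerLeft f.star γ.natTrans
  comm i _ _ _ σ := γ.comm (φ i) (f.starSum ⟨i, rfl⟩ σ)

end PicFunctor
end PicStar

/-! ### Composition with determinant functors -/

section DetPull

variable {V : TrCat.{u} → PicCat.{u}} (det : ∀ T, DetFunctor T (V T))
variable {ι : Type} (T : ι → TrCat.{u})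

/-- The functor `(x_i) ↦ (det x_i)`. -/
@[simps]
def detPi : Core (∀ i, T i) ⥤ (∀ i, V (T i)) where
  obj x i := (det (T i)).functor.obj ⟨x.of i⟩
  map p i := (det (T i)).functor.map ⟨Pi.isoApp p.iso i⟩
  map_id x := by ext i; exact (det (T i)).functor.map_id _
  map_comp p q := by
    ext i
    exact (det (T i)).functor.map_comp (X := ⟨_⟩) (Y := ⟨_⟩) (Z := ⟨_⟩) ⟨Pi.isoApp p.iso i⟩
      ⟨Pi.isoApp q.iso i⟩

variable {T}

/-- The additivity of `det` in one variable: `det z + det x ⟶ det y`. -/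
@[simps]
noncomputable def detSum (i : ι) {x y z : ∀ j, T j} (Δ : TriangleIn T i x y z) :
    SumIn (fun i => V (T i)) i ((detPi det T).obj ⟨z⟩) ((detPi det T).obj ⟨x⟩)
      ((detPi det T).obj ⟨y⟩) where
  main := (det (T i)).additivity _ Δ.dist
  fst j h := have := Δ.isIso_v j h; (det (T j)).functor.map ⟨(asIso (Δ.v j)).symm⟩
  snd j h := have := Δ.isIso_u j h; (det (T j)).functor.map ⟨asIso (Δ.u j)⟩

/-- The composite `g ∘ (det, …, det)`. -/
@[simps]
noncomputable def detPullObj {P : PicCat.{u}} (g : PicFunctor (fun i => V (T i)) P) :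
    DetData T P where
  functor := detPi det T ⋙ g.functor
  additivity i _ _ _ Δ := g.sum i (detSum det i Δ)

/-- Functoriality of `g ∘ (det, …, det)` in `g`. -/
@[simps]
noncomputable def detPullMap {P : PicCat.{u}} {g g' : PicFunctor (fun i => V (T i)) P} (γ : g ⟶ g') :
    detPullObj det g ⟶ detPullObj det g' where
  natTrans := Functor.whiskerLeft (detPi det T) γ.natTrans
  comm i _ _ _ Δ := γ.comm i (detSum det i Δ)

lemma DetFunctor.map_square {T : TrCat.{u}} {P : PicCat.{u}} (D : DetFunctor T P) {a b c d : T}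
    {f : a ≅ b} {g : b ≅ d} {h : a ≅ c} {k : c ≅ d} (e : f.hom ≫ g.hom = h.hom ≫ k.hom) :
    D.functor.map (⟨f⟩ : (⟨a⟩ : Core T) ⟶ ⟨b⟩) ≫ D.functor.map (⟨g⟩ : (⟨b⟩ : Core T) ⟶ ⟨d⟩) =
      D.functor.map (⟨h⟩ : (⟨a⟩ : Core T) ⟶ ⟨c⟩) ≫
        D.functor.map (⟨k⟩ : (⟨c⟩ : Core T) ⟶ ⟨d⟩) := by
  rw [← Functor.map_comp, ← Functor.map_comp]
  congr 1
  ext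
  exact e

lemma DetFunctor.map_triangle {T : TrCat.{u}} {P : PicCat.{u}} (D : DetFunctor T P) {a b c : T}
    {f : a ≅ b} {g : b ≅ c} {h : a ≅ c} (e : f.hom ≫ g.hom = h.hom) :
    D.functor.map (⟨f⟩ : (⟨a⟩ : Core T) ⟶ ⟨b⟩) ≫ D.functor.map (⟨g⟩ : (⟨b⟩ : Core T) ⟶ ⟨c⟩) =
      D.functor.map (⟨h⟩ : (⟨a⟩ : Core T) ⟶ ⟨c⟩) := by
  rw [← Functor.map_comp]
  congr 1
  ext
  exact e

lemma DetFunctor.map_congr {T : TrCat.{u}} {P : PicCat.{u}} (D : DetFunctor T P) {a b : T}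
    {f g : a ≅ b} (e : f.hom = g.hom) :
    D.functor.map (⟨f⟩ : (⟨a⟩ : Core T) ⟶ ⟨b⟩) = D.functor.map (⟨g⟩ : (⟨a⟩ : Core T) ⟶ ⟨b⟩) := by
  rw [Iso.ext e]

lemma inv_square {C : Type*} [Category C] {a b c d : C} {f : a ⟶ b} {g : b ⟶ d} {h : a ⟶ c}
    {k : c ⟶ d} (_ : IsIso g) (_ : IsIso h) (e : f ≫ g = h ≫ k) : k ≫ inv g = inv h ≫ f := by
  rw [IsIso.comp_inv_eq, assoc, e, IsIso.inv_hom_id_assoc]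

theorem detPullObj_isMultiDet {P : PicCat.{u}} {g : PicFunctor (fun i => V (T i)) P}
    (hg : g.IsMultiexact) : (detPullObj det g).IsMultiDet where
  naturality i x y z x' y' z' Δ Δ' p q r h := by
    have h₁ := fun j => congrFun h.comm₁ j
    have h₂ := fun j => congrFun h.comm₂ j
    refine hg.naturality i (detSum det i Δ) (detSum det i Δ') _ _ _ ?_ ?_ ?_
    · exact (det (T i)).naturality Δ.dist Δ'.dist (Pi.isoApp p i) (Pi.isoApp q i)
        (Pi.isoApp r i) (h₁ i) (h₂ i) h.comm₃
    · intro j hj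
      have := Δ.isIso_v j hj
      have := Δ'.isIso_v j hj
      refine (det (T j)).map_square ?_
      change inv (Δ.v j) ≫ q.hom j = r.hom j ≫ inv (Δ'.v j)
      rw [IsIso.inv_comp_eq, ← assoc, IsIso.eq_comp_inv]
      exact (h₂ j).symm
    · intro j hj
      have := Δ.isIso_u j hj
      have := Δ'.isIso_u j hj
      exact (det (T j)).map_square (h₁ j)
  commutativity i a b s Δ₁ Δ₂ h₁ h₂ e₁ e₂ := by
    have e₁' := fun j => congrFun e₁ j
    have e₂' := fun j => congrFun e₂ j
    simp only [Pi.comp_apply, Pi.id_apply] at e₁' e₂'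
    refine hg.commutativity i (detSum det i Δ₂) (detSum det i Δ₁) ?_ ?_ ?_
    · have z₁ : Δ₁.u i ≫ Δ₁.v i = 0 := comp_distTriang_mor_zero₁₂ _ Δ₁.dist
      have z₂ : Δ₂.u i ≫ Δ₂.v i = 0 := comp_distTriang_mor_zero₁₂ _ Δ₂.dist
      let B : BinaryBicone (a i) (b i) :=
        { pt := s i, fst := Δ₂.v i, snd := Δ₁.v i, inl := Δ₁.u i, inr := Δ₂.u i
          inl_fst := e₁' i, inl_snd := z₁, inr_fst := z₂, inr_snd := e₂' i }
      have hB : B.IsBilimit := by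
        refine isBinaryBilimitOfTotal B ?_
        change Δ₂.v i ≫ Δ₁.u i + Δ₁.v i ≫ Δ₂.u i = 𝟙 _
        have h0 : Δ₁.u i ≫ (𝟙 (s i) - (Δ₂.v i ≫ Δ₁.u i + Δ₁.v i ≫ Δ₂.u i)) = 0 := by
          rw [Preadditive.comp_sub, Preadditive.comp_add, ← assoc, ← assoc, z₁, e₁' i]
          simp
        have ht' : ∃ t : b i ⟶ s i,
            𝟙 (s i) - (Δ₂.v i ≫ Δ₁.u i + Δ₁.v i ≫ Δ₂.u i) = Δ₁.v i ≫ t :=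
          Triangle.yoneda_exact₂ _ Δ₁.dist _ h0
        obtain ⟨t, ht⟩ := ht'
        have h3 : t = 0 := by
          rw [← id_comp t, ← e₂' i, assoc, ← ht]
          rw [Preadditive.comp_sub, Preadditive.comp_add, ← assoc, ← assoc, z₂, e₂' i]
          simp
        rw [h3, comp_zero, sub_eq_zero] at ht
        exact ht.symm
      have c : ∀ {x y z : T i} {u : x ⟶ y} {v : y ⟶ z} {w w' : z ⟶ x⟦(1 : ℤ)⟧} (e : w = w')
          (h : Triangle.mk u v w ∈ distTriang (T i)) (h' : Triangle.mk u v w' ∈ distTriang (T i)),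
          (det (T i)).additivity _ h = (det (T i)).additivity _ h' := by
        intro x y z u v w w' e h h'
        subst e
        rfl
      have d₁ : Triangle.mk (Δ₁.u i) (Δ₁.v i) (0 : b i ⟶ (a i)⟦(1 : ℤ)⟧) ∈ distTriang (T i) := by
        rw [← h₁]; exact Δ₁.dist
      have d₂ : Triangle.mk (Δ₂.u i) (Δ₂.v i) (0 : a i ⟶ (b i)⟦(1 : ℤ)⟧) ∈ distTriang (T i) := by
        rw [← h₂]; exact Δ₂.dist
      have key := (det (T i)).commutativity B hB d₁ d₂
      refine (congrArg (fun t => (β_ _ _).hom ≫ t) (c h₁ Δ₁.dist d₁)).trans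
        (key.trans (c h₂ Δ₂.dist d₂).symm)
    · intro j hj
      have := Δ₂.isIso_v j hj
      have := Δ₁.isIso_u j hj
      refine (det (T j)).map_congr ?_
      change inv (Δ₂.v j) = Δ₁.u j
      exact IsIso.inv_eq_of_inv_hom_id (e₁' j)
    · intro j hj
      have := Δ₂.isIso_u j hj
      have := Δ₁.isIso_v j hj
      refine (det (T j)).map_congr ?_
      change Δ₂.u j = inv (Δ₁.v j)
      exact (IsIso.inv_eq_of_inv_hom_id (e₂' j)).symm
  octahedron i x y z z' y' x' Δ₁ Δ₂ Δ₃ Δ₄ h₁ h₂ h₃ h₄ h₅ h₆ := by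
    have h₁' := fun j => congrFun h₁ j
    have h₂' := fun j => congrFun h₂ j
    have h₄' := fun j => congrFun h₄ j
    simp only [Pi.comp_apply] at h₁' h₂' h₄'
    refine hg.associativity i (detSum det i Δ₄) (detSum det i Δ₂) (detSum det i Δ₁)
      (detSum det i Δ₃) ?_ ?_ ?_ ?_
    · have hm : Triangle.mk (Δ₄.u i) (Δ₄.v i) (Δ₃.w.main ≫ (Δ₁.v i)⟦(1 : ℤ)⟧') ∈
          distTriang (T i) := by
        rw [← h₆]; exact Δ₄.dist
      have c : ∀ {x y z : T i} {u : x ⟶ y} {v : y ⟶ z} {w w' : z ⟶ x⟦(1 : ℤ)⟧} (e : w = w')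
          (h : Triangle.mk u v w ∈ distTriang (T i)) (h' : Triangle.mk u v w' ∈ distTriang (T i)),
          (det (T i)).additivity _ h = (det (T i)).additivity _ h' := by
        intro x y z u v w w' e h h'
        subst e
        rfl
      have key := (det (T i)).octahedron (h₁' i) Δ₁.dist Δ₃.dist Δ₂.dist
        { m₁ := Δ₄.u i, m₃ := Δ₄.v i, comm₁ := h₂' i, comm₂ := h₃, comm₃ := h₄' i
          comm₄ := h₅, mem := hm }
      refine Eq.trans ?_ key
      exact congrArg (fun t => (t ▷ _) ≫ _) (c h₆ Δ₄.dist hm)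
    · intro j hj
      have := Δ₂.isIso_v j hj
      have := Δ₃.isIso_v j hj
      have := Δ₄.isIso_v j hj
      refine (det (T j)).map_triangle ?_
      change inv (Δ₄.v j) ≫ inv (Δ₂.v j) = inv (Δ₃.v j)
      rw [← IsIso.inv_comp]
      exact IsIso.inv_eq_inv.2 (h₄' j)
    · intro j hj
      have := Δ₄.isIso_u j hj
      have := Δ₁.isIso_v j hj
      have := Δ₃.isIso_u j hj
      have := Δ₂.isIso_v j hj
      refine (det (T j)).map_square ?_
      change Δ₄.u j ≫ inv (Δ₂.v j) = inv (Δ₁.v j) ≫ Δ₃.u j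
      rw [IsIso.comp_inv_eq, assoc, IsIso.eq_inv_comp]
      exact h₂' j
    · intro j hj
      have := Δ₂.isIso_u j hj
      have := Δ₁.isIso_u j hj
      have := Δ₃.isIso_u j hj
      refine ((det (T j)).map_triangle ?_).symm
      exact h₁' j
  two_triangles i j hij G := by
    refine hg.interchange i j hij (detSum det i (G.row 2)) (detSum det i (G.row 0))
      (detSum det j (G.col 1)) (detSum det j (G.col 2)) (detSum det j (G.col 0))
      (detSum det i (G.row 1)) ?_ ?_ ?_ ?_ ?_
    · have := (G.col 0).isIso_v i hij
      have := (G.col 1).isIso_v i hij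
      have := (G.col 2).isIso_v i hij
      refine (det (T i)).naturality (G.row 2).dist (G.row 1).dist (@asIso _ _ _ _ ((G.col 0).v i) ((G.col 0).isIso_v i hij)).symm
        (@asIso _ _ _ _ ((G.col 1).v i) ((G.col 1).isIso_v i hij)).symm (@asIso _ _ _ _ ((G.col 2).v i) ((G.col 2).isIso_v i hij)).symm ?_ ?_ ?_
      · exact inv_square ((G.col 1).isIso_v i hij) ((G.col 0).isIso_v i hij)
          (congrFun G.row_v.comm₁ i)
      · exact inv_square ((G.col 2).isIso_v i hij) ((G.col 1).isIso_v i hij)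
          (congrFun G.row_v.comm₂ i)
      · have e := G.row_v.comm₃
        change (G.row 2).w.main ≫ (inv ((G.col 0).v i))⟦(1 : ℤ)⟧' =
          inv ((G.col 2).v i) ≫ (G.row 1).w.main
        rw [Functor.map_inv, IsIso.comp_inv_eq, assoc, e, IsIso.inv_hom_id_assoc]
    · have := (G.col 0).isIso_u i hij
      have := (G.col 1).isIso_u i hij
      have := (G.col 2).isIso_u i hij
      exact (det (T i)).naturality (G.row 0).dist (G.row 1).dist (@asIso _ _ _ _ ((G.col 0).u i) ((G.col 0).isIso_u i hij))
        (@asIso _ _ _ _ ((G.col 1).u i) ((G.col 1).isIso_u i hij)) (@asIso _ _ _ _ ((G.col 2).u i) ((G.col 2).isIso_u i hij)) (congrFun G.row_u.comm₁ i)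
        (congrFun G.row_u.comm₂ i) G.row_u.comm₃
    · have := (G.row 0).isIso_v j hij.symm
      have := (G.row 1).isIso_v j hij.symm
      have := (G.row 2).isIso_v j hij.symm
      refine (det (T j)).naturality (G.col 2).dist (G.col 1).dist (@asIso _ _ _ _ ((G.row 0).v j) ((G.row 0).isIso_v j hij.symm)).symm
        (@asIso _ _ _ _ ((G.row 1).v j) ((G.row 1).isIso_v j hij.symm)).symm (@asIso _ _ _ _ ((G.row 2).v j) ((G.row 2).isIso_v j hij.symm)).symm ?_ ?_ ?_
      · exact inv_square ((G.row 1).isIso_v j hij.symm) ((G.row 0).isIso_v j hij.symm)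
          (congrFun G.col_v.comm₁ j)
      · exact inv_square ((G.row 2).isIso_v j hij.symm) ((G.row 1).isIso_v j hij.symm)
          (congrFun G.col_v.comm₂ j)
      · have e := G.col_v.comm₃
        change (G.col 2).w.main ≫ (inv ((G.row 0).v j))⟦(1 : ℤ)⟧' =
          inv ((G.row 2).v j) ≫ (G.col 1).w.main
        rw [Functor.map_inv, IsIso.comp_inv_eq, assoc, e, IsIso.inv_hom_id_assoc]
    · have := (G.row 0).isIso_u j hij.symm
      have := (G.row 1).isIso_u j hij.symm
      have := (G.row 2).isIso_u j hij.symm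
      exact (det (T j)).naturality (G.col 0).dist (G.col 1).dist (@asIso _ _ _ _ ((G.row 0).u j) ((G.row 0).isIso_u j hij.symm))
        (@asIso _ _ _ _ ((G.row 1).u j) ((G.row 1).isIso_u j hij.symm)) (@asIso _ _ _ _ ((G.row 2).u j) ((G.row 2).isIso_u j hij.symm)) (congrFun G.col_u.comm₁ j)
        (congrFun G.col_u.comm₂ j) G.col_u.comm₃
    · intro k hi hj
      have := fun b => (G.row b).isIso_u k hi
      have := fun b => (G.row b).isIso_v k hi
      have := fun b => (G.col b).isIso_u k hj
      have := fun b => (G.col b).isIso_v k hj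
      have ru := congrFun G.row_u.comm₁ k
      have ru' := congrFun G.row_u.comm₂ k
      have rv := congrFun G.row_v.comm₁ k
      have rv' := congrFun G.row_v.comm₂ k
      simp only [Pi.comp_apply] at ru ru' rv rv'
      refine ⟨(det (T k)).map_square ?_, (det (T k)).map_square ?_, (det (T k)).map_square ?_,
        (det (T k)).map_square ?_⟩
      · change inv ((G.row 2).v k) ≫ inv ((G.col 1).v k) =
          inv ((G.col 2).v k) ≫ inv ((G.row 1).v k)
        rw [← IsIso.inv_comp, ← IsIso.inv_comp, IsIso.inv_eq_inv]
        exact rv'.symm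
      · change (G.row 2).u k ≫ inv ((G.col 1).v k) = inv ((G.col 0).v k) ≫ (G.row 1).u k
        exact inv_square inferInstance inferInstance rv
      · change inv ((G.row 0).v k) ≫ (G.col 1).u k = (G.col 2).u k ≫ inv ((G.row 1).v k)
        exact (inv_square inferInstance inferInstance ru'.symm).symm
      · exact ru

end DetPull

/-! ### Composition of multiexact functors of Picard groupoids -/

namespace PicFunctor

lemma exists_family {ι : Type} {A : ι → PicCat.{u}} (w : ∀ j, A j) (l : ι) (a : A l) :
    ∃ (m : ∀ j, A j) (_ : m l ≅ a), Nonempty (∀ j, j ≠ l → (m j ≅ w j)) := by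
  classical
  exact ⟨Function.update w l a, eqToIso (by simp), ⟨fun j h => eqToIso (by simp [h])⟩⟩

section

variable {C : Type*} [Category C] [MonoidalCategory C]

lemma four_aux₁ {x y z v s s' t w : C} (σ₀ : x ⊗ y ⟶ s) (σ₁ : z ⊗ v ⟶ s') [IsIso σ₁]
    (σ : s ⊗ s' ⟶ w) (T : y ⊗ (z ⊗ v) ⟶ t) (Q : x ⊗ t ⟶ w)
    (h : (σ₀ ⊗ₘ σ₁) ≫ σ = (α_ _ _ _).hom ≫ (x ◁ T) ≫ Q) :
    (σ₀ ▷ s') ≫ σ = (α_ _ _ _).hom ≫ (x ◁ ((y ◁ inv σ₁) ≫ T)) ≫ Q := by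
  rw [← cancel_epi ((x ⊗ y) ◁ σ₁), ← assoc, ← tensorHom_def', h,
    associator_naturality_right_assoc, ← MonoidalCategory.whiskerLeft_comp_assoc,
    ← assoc (y ◁ σ₁), ← MonoidalCategory.whiskerLeft_comp, IsIso.hom_inv_id,
    MonoidalCategory.whiskerLeft_id, id_comp]

lemma four_aux₂ {x y z v s s' t w : C} (σ₀ : x ⊗ y ⟶ s) (σ₁ : z ⊗ v ⟶ s')
    (σ : s ⊗ s' ⟶ w) (T : y ⊗ (z ⊗ v) ⟶ t) (Q : x ⊗ t ⟶ w) (R : y ⊗ s' ⟶ t)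
    (h : (σ₀ ▷ s') ≫ σ = (α_ _ _ _).hom ≫ (x ◁ R) ≫ Q) (h' : T = (y ◁ σ₁) ≫ R) :
    (σ₀ ⊗ₘ σ₁) ≫ σ = (α_ _ _ _).hom ≫ (x ◁ T) ≫ Q := by
  rw [tensorHom_def', assoc, h, h']
  simp

lemma four_aux₃ {x y z v t w m : C} (e : m ≅ y ⊗ z) (e' : t ≅ (y ⊗ z) ⊗ v)
    (q : (x ⊗ y) ⊗ (z ⊗ v) ⟶ w) :
    q = (α_ _ _ _).hom ≫ (x ◁ ((α_ _ _ _).inv ≫ (e.inv ▷ v) ≫ (e.hom ▷ v) ≫ e'.inv)) ≫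
      (x ◁ (e'.hom ≫ (α_ _ _ _).hom)) ≫ (α_ _ _ _).inv ≫ q := by
  simp only [← MonoidalCategory.whiskerLeft_comp_assoc]
  simp

lemma four_aux₄ [SymmetricCategory C] {x y z v t w m : C} (e : m ≅ y ⊗ z) (e' : t ≅ (y ⊗ z) ⊗ v)
    (r : (x ⊗ z) ⊗ (y ⊗ v) ⟶ w) (q : (x ⊗ y) ⊗ (z ⊗ v) ⟶ w) (h : q = tensorμ _ _ _ _ ≫ r) :
    r = (α_ _ _ _).hom ≫
      (x ◁ ((α_ _ _ _).inv ≫ (((β_ z y).hom ≫ e.inv) ▷ v) ≫ (e.hom ▷ v) ≫ e'.inv)) ≫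
      (x ◁ (e'.hom ≫ (α_ _ _ _).hom)) ≫ (α_ _ _ _).inv ≫ q := by
  have : (β_ z y).hom ▷ v ≫ (β_ y z).hom ▷ v = 𝟙 _ := by
    rw [← comp_whiskerRight, SymmetricCategory.symmetry, id_whiskerRight]
  rw [h, tensorμ]
  simp only [assoc, Iso.inv_hom_id_assoc, Iso.hom_inv_id_assoc, Iso.inv_hom_id,
    ← MonoidalCategory.whiskerLeft_comp_assoc, comp_whiskerRight, inv_hom_whiskerRight_assoc,
    reassoc_of% this, MonoidalCategory.whiskerLeft_id, id_comp]

lemma four_aux₅ [SymmetricCategory C] {x y z v t w m : C} (M : y ⊗ z ⟶ m) (N : m ⊗ v ⟶ t)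
    (Q : x ⊗ t ⟶ w) :
    (α_ _ _ _).hom ≫ (x ◁ ((α_ _ _ _).inv ≫ (M ▷ v) ≫ N)) ≫ Q =
      tensorμ _ _ _ _ ≫ (α_ _ _ _).hom ≫
        (x ◁ ((α_ _ _ _).inv ≫ (((β_ z y).hom ≫ M) ▷ v) ≫ N)) ≫ Q := by
  have : (β_ y z).hom ▷ v ≫ (β_ z y).hom ▷ v = 𝟙 _ := by
    rw [← comp_whiskerRight, SymmetricCategory.symmetry, id_whiskerRight]
  rw [tensorμ]
  simp only [assoc, Iso.inv_hom_id_assoc, ← MonoidalCategory.whiskerLeft_comp_assoc,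
    comp_whiskerRight, Iso.hom_inv_id_assoc, reassoc_of% this]

end

section

variable {ι : Type} {A : ι → PicCat.{u}} {B : PicCat.{u}} {g : PicFunctor A B}

lemma sum_four (hg : g.IsMultiexact) {l : ι} {x₀₀ x₁₀ x₀₁ x₁₁ s₀ s₁ w m t : ∀ j, A j}
    (σ₀ : SumIn A l x₀₀ x₁₀ s₀) (σ₁ : SumIn A l x₀₁ x₁₁ s₁) (σ : SumIn A l s₀ s₁ w)
    (M : SumIn A l x₁₀ x₀₁ m) (N : SumIn A l m x₁₁ t) (Q : SumIn A l x₀₀ t w)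
    (h : (σ₀.main ⊗ₘ σ₁.main) ≫ σ.main = (α_ _ _ _).hom ≫
      (x₀₀ l ◁ ((α_ _ _ _).inv ≫ (M.main ▷ x₁₁ l) ≫ N.main)) ≫ Q.main)
    (h₀₀ : ∀ j h, σ₀.fst j h ≫ σ.fst j h = Q.fst j h)
    (h₁₀ : ∀ j h, σ₀.snd j h ≫ σ.fst j h = M.fst j h ≫ N.fst j h ≫ Q.snd j h)
    (h₀₁ : ∀ j h, σ₁.fst j h ≫ σ.snd j h = M.snd j h ≫ N.fst j h ≫ Q.snd j h)
    (h₁₁ : ∀ j h, σ₁.snd j h ≫ σ.snd j h = N.snd j h ≫ Q.snd j h) :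
    (g.sum l σ₀ ⊗ₘ g.sum l σ₁) ≫ g.sum l σ = (α_ _ _ _).hom ≫
      (g.functor.obj x₀₀ ◁ ((α_ _ _ _).inv ≫ (g.sum l M ▷ g.functor.obj x₁₁) ≫ g.sum l N)) ≫
        g.sum l Q := by
  let R : SumIn A l x₁₀ s₁ t :=
    { main := (x₁₀ l ◁ inv σ₁.main) ≫ (α_ _ _ _).inv ≫ (M.main ▷ x₁₁ l) ≫ N.main
      fst := fun j h => M.fst j h ≫ N.fst j h
      snd := fun j h => σ.snd j h ≫ inv (Q.snd j h) }
  have e₁ := hg.associativity l σ₀ σ R Q (four_aux₁ _ _ _ _ _ h) (fun j h => h₀₀ j h)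
      (fun j h => by simp [R, h₁₀]) (fun j h => by simp [R])
  have e₂ := hg.associativity l M N σ₁ R (by
      simp only [R]
      rw [← MonoidalCategory.whiskerLeft_comp_assoc, IsIso.hom_inv_id,
        MonoidalCategory.whiskerLeft_id, id_comp, Iso.hom_inv_id_assoc]) (fun j h => rfl)
      (fun j h => by simp [R, reassoc_of% h₀₁]) (fun j h => by simp [R, reassoc_of% h₁₁])
  refine four_aux₂ _ _ _ _ _ _ e₁ ?_
  rw [e₂, Iso.inv_hom_id_assoc]

lemma interchange_self (hg : g.IsMultiexact) {l : ι}
    {x₀₀ x₁₀ x₀₁ x₁₁ s₀ s₁ t₀ t₁ w : ∀ j, A j}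
    (σ₀ : SumIn A l x₀₀ x₁₀ s₀) (σ₁ : SumIn A l x₀₁ x₁₁ s₁) (σ : SumIn A l s₀ s₁ w)
    (τ₀ : SumIn A l x₀₀ x₀₁ t₀) (τ₁ : SumIn A l x₁₀ x₁₁ t₁) (τ : SumIn A l t₀ t₁ w)
    (h : (σ₀.main ⊗ₘ σ₁.main) ≫ σ.main =
      tensorμ _ _ _ _ ≫ (τ₀.main ⊗ₘ τ₁.main) ≫ τ.main)
    (h₀₀ : ∀ j h, σ₀.fst j h ≫ σ.fst j h = τ₀.fst j h ≫ τ.fst j h)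
    (h₁₀ : ∀ j h, σ₀.snd j h ≫ σ.fst j h = τ₁.fst j h ≫ τ.snd j h)
    (h₀₁ : ∀ j h, σ₁.fst j h ≫ σ.snd j h = τ₀.snd j h ≫ τ.fst j h)
    (h₁₁ : ∀ j h, σ₁.snd j h ≫ σ.snd j h = τ₁.snd j h ≫ τ.snd j h) :
    (g.sum l σ₀ ⊗ₘ g.sum l σ₁) ≫ g.sum l σ =
      tensorμ _ _ _ _ ≫ (g.sum l τ₀ ⊗ₘ g.sum l τ₁) ≫ g.sum l τ := by
  obtain ⟨m, em, ⟨om⟩⟩ := exists_family w l (x₁₀ l ⊗ x₀₁ l)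
  obtain ⟨t, et, ⟨ot⟩⟩ := exists_family w l ((x₁₀ l ⊗ x₀₁ l) ⊗ x₁₁ l)
  let M : SumIn A l x₁₀ x₀₁ m :=
    { main := em.inv
      fst := fun j h => (σ₀.snd j h ≫ σ.fst j h) ≫ (om j h).inv
      snd := fun j h => (σ₁.fst j h ≫ σ.snd j h) ≫ (om j h).inv }
  let M' : SumIn A l x₀₁ x₁₀ m :=
    { main := (β_ _ _).hom ≫ em.inv, fst := M.snd, snd := M.fst }
  let N : SumIn A l m x₁₁ t :=
    { main := (em.hom ▷ _) ≫ et.inv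
      fst := fun j h => (om j h).hom ≫ (ot j h).inv
      snd := fun j h => (σ₁.snd j h ≫ σ.snd j h) ≫ (ot j h).inv }
  let Q : SumIn A l x₀₀ t w :=
    { main := (_ ◁ (et.hom ≫ (α_ _ _ _).hom)) ≫ (α_ _ _ _).inv ≫ (σ₀.main ⊗ₘ σ₁.main) ≫ σ.main
      fst := fun j h => σ₀.fst j h ≫ σ.fst j h
      snd := fun j h => (ot j h).hom }
  have e₁ := sum_four hg σ₀ σ₁ σ M N Q (four_aux₃ em et _)
    (by simp [Q]) (by simp [M, N, Q]) (by simp [M, N, Q]) (by simp [N, Q])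
  have e₂ := sum_four hg τ₀ τ₁ τ M' N Q (four_aux₄ em et _ _ h)
    (by simp [Q, h₀₀]) (by simp [M', M, N, Q, h₀₁]) (by simp [M', M, N, Q, h₁₀])
    (by simp [N, Q, h₁₁])
  have e₃ := hg.commutativity l M' M rfl (fun _ _ => rfl) (fun _ _ => rfl)
  rw [e₁, e₂, ← e₃]
  exact four_aux₅ _ _ _

end

section

variable {I J : Type} {φ : I → J} {A : I → PicCat.{u}} {B : J → PicCat.{u}} {C : PicCat.{u}}
  {f : PicString φ A B} {g : PicFunctor B C}

lemma map_square {K : Type} {R : K → PicCat.{u}} {E : PicCat.{u}} (H : (∀ k, R k) ⥤ E)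
    {a b c d : ∀ k, R k} {p : a ⟶ b} {q : b ⟶ d} {r : a ⟶ c} {s : c ⟶ d}
    (h : ∀ k, p k ≫ q k = r k ≫ s k) : H.map p ≫ H.map q = H.map r ≫ H.map s := by
  rw [← H.map_comp, ← H.map_comp]
  exact congrArg H.map (funext h)

lemma map_triangle {K : Type} {R : K → PicCat.{u}} {E : PicCat.{u}} (H : (∀ k, R k) ⥤ E)
    {a b c : ∀ k, R k} {p : a ⟶ b} {q : b ⟶ c} {r : a ⟶ c}
    (h : ∀ k, p k ≫ q k = r k) : H.map p ≫ H.map q = H.map r := by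
  rw [← H.map_comp]
  exact congrArg H.map (funext h)

lemma sum_starSum {i : I} {k : J} (h : φ i = k) {x y s : ∀ i, A i} (σ : SumIn A i x y s) :
    (comp f g).sum i σ = g.sum k (f.starSum ⟨i, h⟩ σ) := by
  subst h; rfl

theorem IsMultiexact.comp (hf : ∀ j, (f j).IsMultiexact) (hg : g.IsMultiexact) :
    (comp f g).IsMultiexact where
  naturality i x y s x' y' s' σ σ' p q r h₁ h₂ h₃ := by
    refine hg.naturality (φ i) (f.starSum ⟨i, rfl⟩ σ) (f.starSum ⟨i, rfl⟩ σ') (f.star.map p)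
      (f.star.map q) (f.star.map r) ?_ ?_ ?_
    · exact (hf _).naturality ⟨i, rfl⟩ _ _ _ _ _ h₁ (fun _ _ => h₂ _ _) (fun _ _ => h₃ _ _)
    · intro j h
      exact map_square _ (fun i' : Fib φ j => h₂ _ _)
    · intro j h
      exact map_square _ (fun i' : Fib φ j => h₃ _ _)
  associativity i x y z s t w σ₁ σ₂ σ₃ σ₄ h₁ h₂ h₃ h₄ := by
    refine hg.associativity (φ i) (f.starSum ⟨i, rfl⟩ σ₁) (f.starSum ⟨i, rfl⟩ σ₂)
      (f.starSum ⟨i, rfl⟩ σ₃) (f.starSum ⟨i, rfl⟩ σ₄) ?_ ?_ ?_ ?_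
    · exact (hf _).associativity ⟨i, rfl⟩ _ _ _ _ h₁ (fun _ _ => h₂ _ _) (fun _ _ => h₃ _ _)
        (fun _ _ => h₄ _ _)
    · intro j h
      exact map_triangle _ (fun i' : Fib φ j => h₂ _ _)
    · intro j h
      exact map_square _ (fun i' : Fib φ j => h₃ _ _)
    · intro j h
      exact (map_triangle _ (fun i' : Fib φ j => (h₄ _ _).symm)).symm
  commutativity i x y s σ σ' h₁ h₂ h₃ := by
    refine hg.commutativity (φ i) (f.starSum ⟨i, rfl⟩ σ) (f.starSum ⟨i, rfl⟩ σ') ?_ ?_ ?_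
    · exact (hf _).commutativity ⟨i, rfl⟩ _ _ h₁ (fun _ _ => h₂ _ _) (fun _ _ => h₃ _ _)
    · intro j h
      exact congrArg (f j).functor.map (funext fun i' => h₂ _ _)
    · intro j h
      exact congrArg (f j).functor.map (funext fun i' => h₃ _ _)
  interchange i k hik x₀₀ x₁₀ x₀₁ x₁₁ s₀ s₁ t₀ t₁ w σ₀ σ₁ σ τ₀ τ₁ τ h₁ h₂ h₃ h₄ h₅ := by
    have key : ∀ (l m : J) (hl : φ i = l) (hm : φ k = m),
        (g.sum l (f.starSum ⟨i, hl⟩ σ₀) ⊗ₘ g.sum l (f.starSum ⟨i, hl⟩ σ₁)) ≫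
          g.sum m (f.starSum ⟨k, hm⟩ σ) =
        tensorμ _ _ _ _ ≫ (g.sum m (f.starSum ⟨k, hm⟩ τ₀) ⊗ₘ g.sum m (f.starSum ⟨k, hm⟩ τ₁)) ≫
          g.sum l (f.starSum ⟨i, hl⟩ τ) := by
      intro l m hl hm
      by_cases hlm : l = m
      · subst hlm
        refine interchange_self hg _ _ _ _ _ _ ?_ ?_ ?_ ?_ ?_
        · exact (hf l).interchange ⟨i, hl⟩ ⟨k, hm⟩ (fun e => hik (congrArg Subtype.val e))
            _ _ _ _ _ _ h₁ h₂ h₃ h₄ (fun j _ _ => h₅ j.1 _ _)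
        all_goals
          intro j hj
          have hi : ∀ i' : Fib φ j, i'.1 ≠ i := fun i' e => hj (by rw [← i'.2, e, hl])
          have hk : ∀ i' : Fib φ j, i'.1 ≠ k := fun i' e => hj (by rw [← i'.2, e, hm])
        · exact map_square _ (fun i' : Fib φ j => (h₅ i'.1 (hi i') (hk i')).1)
        · exact map_square _ (fun i' : Fib φ j => (h₅ i'.1 (hi i') (hk i')).2.1)
        · exact map_square _ (fun i' : Fib φ j => (h₅ i'.1 (hi i') (hk i')).2.2.1)
        · exact map_square _ (fun i' : Fib φ j => (h₅ i'.1 (hi i') (hk i')).2.2.2)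
      · have hi : ∀ i' : Fib φ m, i'.1 ≠ i := fun i' e => hlm (by rw [← i'.2, e, hl])
        have hk : ∀ i' : Fib φ l, i'.1 ≠ k := fun i' e => hlm (by rw [← i'.2, e, hm])
        have hi' : ∀ i' : Fib φ l, i' ≠ ⟨i, hl⟩ → i'.1 ≠ i := fun i' h e => h (Subtype.ext e)
        have hk' : ∀ i' : Fib φ m, i' ≠ ⟨k, hm⟩ → i'.1 ≠ k := fun i' h e => h (Subtype.ext e)
        refine hg.interchange l m hlm _ _ _ _ _ _ ?_ ?_ ?_ ?_ ?_
        · exact (hf l).naturality ⟨i, hl⟩ _ _ _ _ _ h₁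
            (fun j h => (h₅ j.1 (hi' j h) (hk j)).1) (fun j h => (h₅ j.1 (hi' j h) (hk j)).2.1)
        · exact (hf l).naturality ⟨i, hl⟩ _ _ _ _ _ h₂
            (fun j h => (h₅ j.1 (hi' j h) (hk j)).2.2.1)
            (fun j h => (h₅ j.1 (hi' j h) (hk j)).2.2.2)
        · exact (hf m).naturality ⟨k, hm⟩ _ _ _ _ _ h₃
            (fun j h => (h₅ j.1 (hi j) (hk' j h)).1.symm)
            (fun j h => (h₅ j.1 (hi j) (hk' j h)).2.2.1.symm)
        · exact (hf m).naturality ⟨k, hm⟩ _ _ _ _ _ h₄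
            (fun j h => (h₅ j.1 (hi j) (hk' j h)).2.1.symm)
            (fun j h => (h₅ j.1 (hi j) (hk' j h)).2.2.2.symm)
        · intro j hi hk
          have hi : ∀ i' : Fib φ j, i'.1 ≠ i := fun i' e => hi (by rw [← i'.2, e, hl])
          have hk : ∀ i' : Fib φ j, i'.1 ≠ k := fun i' e => hk (by rw [← i'.2, e, hm])
          exact ⟨map_square _ (fun i' : Fib φ j => (h₅ i'.1 (hi i') (hk i')).1),
            map_square _ (fun i' : Fib φ j => (h₅ i'.1 (hi i') (hk i')).2.1),
            map_square _ (fun i' : Fib φ j => (h₅ i'.1 (hi i') (hk i')).2.2.1),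
            map_square _ (fun i' : Fib φ j => (h₅ i'.1 (hi i') (hk i')).2.2.2)⟩
    exact key _ _ rfl rfl

end

end PicFunctor

namespace TrFunctor

section MapOctahedron

variable {ι : Type} {T : ι → TrCat.{u}} {U : TrCat.{u}} {G : TrFunctor T U}

lemma dist_iso₃ {T : TrCat.{u}} {x y z z' : T} {f : x ⟶ y} {g : y ⟶ z} {h : z ⟶ x⟦(1 : ℤ)⟧}
    (H : Triangle.mk f g h ∈ distTriang T) (e : z' ≅ z) :
    Triangle.mk f (g ≫ e.inv) (e.hom ≫ h) ∈ distTriang T :=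
  isomorphic_distinguished _ H _ (Triangle.isoMk _ _ (Iso.refl _) (Iso.refl _) e
    (show f ≫ 𝟙 y = 𝟙 x ≫ f by simp) (show (g ≫ e.inv) ≫ e.hom = 𝟙 y ≫ g by simp)
    (show (e.hom ≫ h) ≫ (𝟙 x)⟦(1 : ℤ)⟧' = e.hom ≫ h by simp))

lemma dist_iso₂ {T : TrCat.{u}} {x y z y' : T} {f : x ⟶ y} {g : y ⟶ z} {h : z ⟶ x⟦(1 : ℤ)⟧}
    (H : Triangle.mk f g h ∈ distTriang T) (e : y' ≅ y) :
    Triangle.mk (f ≫ e.inv) (e.hom ≫ g) h ∈ distTriang T :=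
  isomorphic_distinguished _ H _ (Triangle.isoMk _ _ (Iso.refl _) e (Iso.refl _)
    (show (f ≫ e.inv) ≫ e.hom = 𝟙 x ≫ f by simp) (show (e.hom ≫ g) ≫ 𝟙 z = e.hom ≫ g by simp)
    (show h ≫ (𝟙 x)⟦(1 : ℤ)⟧' = 𝟙 z ≫ h by simp))

lemma conn_precomp_eq (hG : G.IsMultiexact) {l : ι} {z' z x : ∀ j, T j} (p : z' ⟶ z)
    (d : DegHom T l z x) (e : DegHom T l z' x) (h : p l ≫ d.main = e.main)
    (h' : ∀ j hj, p j ≫ d.off j hj = e.off j hj) :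
    G.functor.map p ≫ G.conn l d = G.conn l e := by
  rw [← hG.conn_precomp]
  exact congrArg _ (DegHom.ext h (funext fun j => funext fun hj => h' j hj))

lemma conn_postcomp_eq (hG : G.IsMultiexact) {l : ι} {z x x' : ∀ j, T j} (q : x ⟶ x')
    (d : DegHom T l z x) (e : DegHom T l z x') (h : d.main ≫ (q l)⟦(1 : ℤ)⟧' = e.main)
    (h' : ∀ j hj, d.off j hj ≫ q j = e.off j hj) :
    G.conn l d ≫ (G.functor.map q)⟦(1 : ℤ)⟧' = G.conn l e := by
  rw [← hG.conn_postcomp]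
  exact congrArg _ (DegHom.ext h (funext fun j => funext fun hj => h' j hj))

lemma map_comp_eq {x y z : ∀ j, T j} {p : x ⟶ y} {q : y ⟶ z} {r : x ⟶ z}
    (h : ∀ j, p j ≫ q j = r j) : G.functor.map p ≫ G.functor.map q = G.functor.map r := by
  rw [← G.functor.map_comp]
  exact congrArg G.functor.map (funext h)

/-- A multiexact functor preserves octahedra in each variable. -/
lemma map_octahedron (hG : G.IsMultiexact) {l : ι} {x y z z' y' x' : ∀ j, T j}
    (Δ₁ : TriangleIn T l x y z') (Δ₂ : TriangleIn T l x z y') (Δ₃ : TriangleIn T l y z x')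
    (Δ₄ : TriangleIn T l z' y' x')
    (h₁ : ∀ j, Δ₁.u j ≫ Δ₃.u j = Δ₂.u j) (h₂ : ∀ j, Δ₁.v j ≫ Δ₄.u j = Δ₃.u j ≫ Δ₂.v j)
    (h₃ : Δ₄.u l ≫ Δ₂.w.main = Δ₁.w.main) (h₄ : ∀ j, Δ₂.v j ≫ Δ₄.v j = Δ₃.v j)
    (h₅ : Δ₂.w.main ≫ (Δ₁.u l)⟦(1 : ℤ)⟧' = Δ₄.v l ≫ Δ₃.w.main)
    (h₆ : Δ₄.w.main = Δ₃.w.main ≫ (Δ₁.v l)⟦(1 : ℤ)⟧') :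
    IsOctahedron (G.functor.map Δ₁.u) (G.functor.map Δ₁.v) (G.conn l Δ₁.w)
      (G.functor.map Δ₃.u) (G.functor.map Δ₃.v) (G.conn l Δ₃.w)
      (G.functor.map Δ₂.u) (G.functor.map Δ₂.v) (G.conn l Δ₂.w)
      (G.functor.map Δ₄.u) (G.functor.map Δ₄.v) := by
  have o₁ : ∀ j hj, Δ₄.u j ≫ Δ₂.w.off j hj = Δ₁.w.off j hj := by
    intro j hj
    have := Δ₁.isIso_u j hj
    have := Δ₁.isIso_v j hj
    rw [← cancel_epi (Δ₁.v j), ← cancel_epi (Δ₁.u j), reassoc_of% (h₂ j), reassoc_of% (h₁ j),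
      Δ₂.off_comp, Δ₁.off_comp]
  have o₂ : ∀ j hj, Δ₂.w.off j hj ≫ Δ₁.u j = Δ₄.v j ≫ Δ₃.w.off j hj := by
    intro j hj
    have := Δ₂.isIso_u j hj
    have := Δ₂.isIso_v j hj
    rw [← cancel_epi (Δ₂.v j), ← cancel_epi (Δ₂.u j), reassoc_of% (Δ₂.off_comp j hj),
      reassoc_of% (h₄ j), ← h₁ j, assoc, Δ₃.off_comp, comp_id]
  have o₃ : ∀ j hj, Δ₃.w.off j hj ≫ Δ₁.v j = Δ₄.w.off j hj := by
    intro j hj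
    have := Δ₃.isIso_u j hj
    have := Δ₃.isIso_v j hj
    have := Δ₁.isIso_v j hj
    rw [← cancel_epi (Δ₃.v j), ← cancel_epi (Δ₃.u j), reassoc_of% (Δ₃.off_comp j hj), ← h₄ j,
      ← assoc, ← assoc, ← h₂ j, assoc, assoc, Δ₄.off_comp, comp_id]
  refine ⟨map_comp_eq h₁, hG.dist l Δ₁, hG.dist l Δ₃, hG.dist l Δ₂,
    { m₁ := G.functor.map Δ₄.u
      m₃ := G.functor.map Δ₄.v
      comm₁ := (map_comp_eq h₂).trans (G.functor.map_comp _ _)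
      comm₂ := conn_precomp_eq hG _ _ _ h₃ o₁
      comm₃ := map_comp_eq h₄
      comm₄ := ((conn_postcomp_eq hG _ _ (Δ₃.w.precomp Δ₄.v) h₅ o₂)).trans (hG.conn_precomp _ _ _)
      mem := ?_ }, rfl, rfl⟩
  rw [conn_postcomp_eq hG _ _ _ h₆.symm o₃]
  exact hG.dist l Δ₄

lemma exists_family {ι : Type} {A : ι → TrCat.{u}} (w : ∀ j, A j) (l : ι) (a : A l) :
    ∃ (m : ∀ j, A j) (_ : m l ≅ a), Nonempty (∀ j, j ≠ l → (m j ≅ w j)) := by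
  classical
  exact ⟨Function.update w l a, eqToIso (by simp), ⟨fun j h => eqToIso (by simp [h])⟩⟩

end MapOctahedron
end TrFunctor

namespace TrFunctor

section VerdierComp

variable {I J : Type} {φ : I → J} {S : I → TrCat.{u}} {T : J → TrCat.{u}} {U : TrCat.{u}}
  {F : TrString φ S T} {G : TrFunctor T U}

/-- The octahedra of a Verdier structure in one variable are preserved by a multiexact functor. -/
lemma verdier_aux {ι : Type} {T : ι → TrCat.{u}} {G : TrFunctor T U} (hG : G.IsMultiexact) {l : ι}
    {X : Fin 3 → Fin 3 → ∀ k, T k} (row : ∀ b, TriangleIn T l (X 0 b) (X 1 b) (X 2 b))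
    (col : ∀ a, TriangleIn T l (X a 0) (X a 1) (X a 2))
    (row_u : ∀ k, (row 0).u k ≫ (col 1).u k = (col 0).u k ≫ (row 1).u k)
    (row_v : ∀ k, (row 0).v k ≫ (col 2).u k = (col 1).u k ≫ (row 1).v k)
    (row_u' : ∀ k, (row 1).u k ≫ (col 1).v k = (col 0).v k ≫ (row 2).u k)
    (row_v' : ∀ k, (row 1).v k ≫ (col 2).v k = (col 1).v k ≫ (row 2).v k)
    (hN : NineDiagram.HasVerdierStructure (T := T l)
      ⟨X 0 0 l, X 1 0 l, X 2 0 l, X 0 1 l, X 1 1 l, X 2 1 l, X 0 2 l, X 1 2 l, X 2 2 l,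
      (row 0).u l, (row 0).v l, (row 0).w.main, (row 1).u l, (row 1).v l, (row 1).w.main,
      (row 2).u l, (row 2).v l, (row 2).w.main,
      (col 0).u l, (col 0).v l, (col 0).w.main, (col 1).u l, (col 1).v l, (col 1).w.main,
      (col 2).u l, (col 2).v l, (col 2).w.main⟩) :
    NineDiagram.HasVerdierStructure (T := U)
      ⟨_, _, _, _, _, _, _, _, _,
      G.functor.map (row 0).u, G.functor.map (row 0).v, G.conn l (row 0).w,
      G.functor.map (row 1).u, G.functor.map (row 1).v, G.conn l (row 1).w,
      G.functor.map (row 2).u, G.functor.map (row 2).v, G.conn l (row 2).w,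
      G.functor.map (col 0).u, G.functor.map (col 0).v, G.conn l (col 0).w,
      G.functor.map (col 1).u, G.functor.map (col 1).v, G.conn l (col 1).w,
      G.functor.map (col 2).u, G.functor.map (col 2).v, G.conn l (col 2).w⟩ := by
  classical
  have iru := fun b k hk => (row b).isIso_u k hk
  have irv := fun b k hk => (row b).isIso_v k hk
  have icu := fun b k hk => (col b).isIso_u k hk
  have icv := fun b k hk => (col b).isIso_v k hk
  obtain ⟨A, a, v, ε, η, b, c, p₀, p₁, p₂, p₃, p₄, p₅, s₁, s₂, s₃, s₄, s₅, t₀, t₁, t₂, t₃, t₄, hr⟩ :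
      ∃ (A : T l) (a : X 1 1 l ⟶ A) (v : A ⟶ (X 0 0 l)⟦(1 : ℤ)⟧) (ε : X 0 2 l ⟶ A)
        (η : A ⟶ X 2 1 l) (b : X 2 0 l ⟶ A) (c : A ⟶ X 1 2 l),
        Triangle.mk ((col 0).u l ≫ (row 1).u l) a v ∈ distTriang (T l) ∧
        (col 0).v l ≫ ε = (row 1).u l ≫ a ∧ ε ≫ v = (col 0).w.main ∧ a ≫ η = (row 1).v l ∧
        v ≫ ((col 0).u l)⟦(1 : ℤ)⟧' = η ≫ (row 1).w.main ∧
        Triangle.mk ε η ((row 1).w.main ≫ ((col 0).v l)⟦(1 : ℤ)⟧') ∈ distTriang (T l) ∧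
        (row 0).v l ≫ b = (col 1).u l ≫ a ∧ b ≫ v = (row 0).w.main ∧ a ≫ c = (col 1).v l ∧
        v ≫ ((row 0).u l)⟦(1 : ℤ)⟧' = c ≫ (col 1).w.main ∧
        Triangle.mk b c ((col 1).w.main ≫ ((row 0).v l)⟦(1 : ℤ)⟧') ∈ distTriang (T l) ∧
        ε ≫ c = (row 2).u l ∧
        η ≫ (col 2).v l = c ≫ (row 2).v l ∧
        (col 2).v l ≫ (row 2).w.main = (row 1).w.main ≫ ((col 0).v l)⟦(1 : ℤ)⟧' ∧
        (row 2).v l ≫ (col 2).w.main = (col 1).w.main ≫ ((row 0).v l)⟦(1 : ℤ)⟧' ∧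
        (row 2).w.main ≫ ε⟦(1 : ℤ)⟧' = (col 2).w.main ≫ (-b⟦(1 : ℤ)⟧') ∧
        b ≫ η = (col 2).u l := by
    obtain ⟨A, a, v, ε, η, b, c, ⟨k₁, h₁₂, h₂₃, h₁₃, o₁, rfl, rfl⟩,
      ⟨k₂, m₁₂, m₂₃, m₁₃, o₂, rfl, rfl⟩, ⟨k₃, n₁₂, n₂₃, n₁₃, o₃, e₁, e₃⟩, hr⟩ := hN
    have c₁ := o₃.comm₁
    have c₂ := o₃.comm₂
    have c₃ := o₃.comm₃
    have c₄ := o₃.comm₄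
    rw [e₁] at c₁ c₂
    rw [e₃] at c₃ c₄
    exact ⟨A, a, v, o₁.m₁, o₁.m₃, o₂.m₁, o₂.m₃, h₁₃, o₁.comm₁, o₁.comm₂, o₁.comm₃, o₁.comm₄,
      o₁.mem, o₂.comm₁, o₂.comm₂, o₂.comm₃, o₂.comm₄, o₂.mem, k₃, c₁, c₂, c₃, c₄, hr⟩
  clear hN
  obtain ⟨W, e, ⟨oW⟩⟩ := exists_family (X 1 1) l A
  have mk : ∀ {x : ∀ k, T k} (f : x l ⟶ W l) (g : ∀ k, k ≠ l → (x k ⟶ W k)),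
      ∃ p : x ⟶ W, p l = f ∧ ∀ k hk, p k = g k hk := fun {x} f g =>
    ⟨fun k => if h : k = l then by subst h; exact f else g k h, by simp, fun k hk => by simp [hk]⟩
  have mk' : ∀ {x : ∀ k, T k} (f : W l ⟶ x l) (g : ∀ k, k ≠ l → (W k ⟶ x k)),
      ∃ p : W ⟶ x, p l = f ∧ ∀ k hk, p k = g k hk := fun {x} f g =>
    ⟨fun k => if h : k = l then by subst h; exact f else g k h, by simp, fun k hk => by simp [hk]⟩
  obtain ⟨a', al, ao⟩ := mk (x := X 1 1) (a ≫ e.inv) (fun k hk => (oW k hk).inv)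
  obtain ⟨ε', εl, εo⟩ := mk (x := X 0 2) (ε ≫ e.inv)
    (fun k hk => have := icv 0 k hk; inv ((col 0).v k) ≫ (row 1).u k ≫ (oW k hk).inv)
  obtain ⟨b', bl, bo⟩ := mk (x := X 2 0) (b ≫ e.inv)
    (fun k hk => have := irv 0 k hk; inv ((row 0).v k) ≫ (col 1).u k ≫ (oW k hk).inv)
  obtain ⟨η', ηl, ηo⟩ := mk' (x := X 2 1) (e.hom ≫ η)
    (fun k hk => (oW k hk).hom ≫ (row 1).v k)
  obtain ⟨c', cl, co⟩ := mk' (x := X 1 2) (e.hom ≫ c)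
    (fun k hk => (oW k hk).hom ≫ (col 1).v k)
  let D : TriangleIn T l (X 0 0) (X 1 1) W :=
    { u := (col 0).u ≫ (row 1).u
      v := a'
      w :=
        { main := e.hom ≫ v
          off := fun k hk => have := icu 0 k hk; have := iru 1 k hk
            (oW k hk).hom ≫ inv ((row 1).u k) ≫ inv ((col 0).u k) }
      dist := by rw [al]; exact dist_iso₃ p₀ e
      isIso_u := fun k hk => by
        have := icu 0 k hk; have := iru 1 k hk
        simp only [Pi.comp_apply]; infer_instance
      isIso_v := fun k hk => by rw [ao k hk]; infer_instance
      off_comp := fun k hk => by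
        have := icu 0 k hk; have := iru 1 k hk
        simp [ao k hk] }
  let E : TriangleIn T l (X 0 2) W (X 2 1) :=
    { u := ε'
      v := η'
      w := (row 1).w.postcomp (col 0).v
      dist := by rw [εl, ηl]; exact dist_iso₂ p₅ e
      isIso_u := fun k hk => by
        have := icv 0 k hk; have := iru 1 k hk
        rw [εo k hk]; infer_instance
      isIso_v := fun k hk => by
        have := irv 1 k hk
        rw [ηo k hk]; infer_instance
      off_comp := fun k hk => by
        have := icv 0 k hk
        simp [εo k hk, ηo k hk, reassoc_of% ((row 1).off_comp k hk)] }
  let B : TriangleIn T l (X 2 0) W (X 1 2) :=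
    { u := b'
      v := c'
      w := (col 1).w.postcomp (row 0).v
      dist := by rw [bl, cl]; exact dist_iso₂ s₅ e
      isIso_u := fun k hk => by
        have := irv 0 k hk; have := icu 1 k hk
        rw [bo k hk]; infer_instance
      isIso_v := fun k hk => by
        have := icv 1 k hk
        rw [co k hk]; infer_instance
      off_comp := fun k hk => by
        have := irv 0 k hk
        simp [bo k hk, co k hk, reassoc_of% ((col 1).off_comp k hk)] }
  have hE : ∀ k, ε' k ≫ c' k = (row 2).u k := fun k => by
    by_cases hk : k = l
    · subst hk
      rw [εl, cl]
      simpa using t₀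
    · have := icv 0 k hk
      simp [εo k hk, co k hk, row_u' k]
  have hB : ∀ k, b' k ≫ η' k = (col 2).u k := fun k => by
    by_cases hk : k = l
    · subst hk
      rw [bl, ηl]
      simpa using hr
    · have := irv 0 k hk
      simp [bo k hk, ηo k hk, ← row_v k]
  have hM : ∀ k, η' k ≫ (col 2).v k = c' k ≫ (row 2).v k := fun k => by
    by_cases hk : k = l
    · subst hk
      rw [ηl, cl]
      simpa using t₁
    · simp [ηo k hk, co k hk, row_v' k]
  refine ⟨G.functor.obj W, G.functor.map a', G.conn l D.w, G.functor.map ε', G.functor.map η',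
    G.functor.map b', G.functor.map c', ?_, ?_, ?_, ?_⟩
  · have key := map_octahedron hG (col 0) D (row 1) E (fun _ => rfl) ?_ ?_ ?_ ?_ rfl
    · rw [show G.functor.map D.u = G.functor.map (col 0).u ≫ G.functor.map (row 1).u from
        G.functor.map_comp _ _] at key
      exact key
    · intro k
      by_cases hk : k = l
      · subst hk
        change (col 0).v k ≫ ε' k = (row 1).u k ≫ a' k
        rw [εl, al]
        simpa using congrArg (· ≫ e.inv) p₁
      · have := icv 0 k hk
        simp [D, E, εo k hk, ao k hk]
    · change ε' l ≫ e.hom ≫ v = _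
      rw [εl]
      simpa using p₂
    · intro k
      by_cases hk : k = l
      · subst hk
        change a' k ≫ η' k = _
        rw [ηl, al]
        simpa using p₃
      · simp [D, E, ηo k hk, ao k hk]
    · change (e.hom ≫ v) ≫ _ = η' l ≫ _
      rw [ηl]
      simpa using congrArg (e.hom ≫ ·) p₄
  · have key := map_octahedron hG (row 0) D (col 1) B row_u ?_ ?_ ?_ ?_ rfl
    · rw [show G.functor.map D.u = G.functor.map (col 0).u ≫ G.functor.map (row 1).u from
        G.functor.map_comp _ _] at key
      exact key
    · intro k
      by_cases hk : k = l
      · subst hk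
        change (row 0).v k ≫ b' k = (col 1).u k ≫ a' k
        rw [bl, al]
        simpa using congrArg (· ≫ e.inv) s₁
      · have := irv 0 k hk
        simp [D, B, bo k hk, ao k hk]
    · change b' l ≫ e.hom ≫ v = _
      rw [bl]
      simpa using s₂
    · intro k
      by_cases hk : k = l
      · subst hk
        change a' k ≫ c' k = _
        rw [cl, al]
        simpa using s₃
      · simp [D, B, co k hk, ao k hk]
    · change (e.hom ≫ v) ≫ _ = c' l ≫ _
      rw [cl]
      simpa using congrArg (e.hom ≫ ·) s₄
  · have q₁ : G.functor.map (col 2).v ≫ G.conn l (row 2).w =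
        G.conn l (row 1).w ≫ (G.functor.map (col 0).v)⟦(1 : ℤ)⟧' := by
      refine (conn_precomp_eq hG _ _ ((row 1).w.postcomp (col 0).v) ?_ ?_).trans
        (hG.conn_postcomp _ _ _)
      · exact t₂
      · intro k hk
        have := iru 1 k hk; have := irv 1 k hk
        rw [← cancel_epi ((row 1).v k), ← cancel_epi ((row 1).u k)]
        rw [reassoc_of% (row_v' k), reassoc_of% (row_u' k), (row 2).off_comp]
        simp [reassoc_of% ((row 1).off_comp k hk)]
    have q₂ : G.functor.map (row 2).v ≫ G.conn l (col 2).w =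
        G.conn l (col 1).w ≫ (G.functor.map (row 0).v)⟦(1 : ℤ)⟧' := by
      refine (conn_precomp_eq hG _ _ ((col 1).w.postcomp (row 0).v) ?_ ?_).trans
        (hG.conn_postcomp _ _ _)
      · exact t₃
      · intro k hk
        have := icu 1 k hk; have := icv 1 k hk
        rw [← cancel_epi ((col 1).v k), ← cancel_epi ((col 1).u k)]
        rw [← reassoc_of% (row_v' k), ← reassoc_of% (row_v k), (col 2).off_comp]
        simp [reassoc_of% ((col 1).off_comp k hk)]
    have q₃ : G.conn l (row 2).w ≫ (G.functor.map ε')⟦(1 : ℤ)⟧' =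
        -(G.conn l (col 2).w ≫ (G.functor.map b')⟦(1 : ℤ)⟧') := by
      rw [← hG.conn_postcomp, ← hG.conn_postcomp]
      refine conn_neg_of hG _ _ ?_ ?_
      · have := congrArg (· ≫ e.inv⟦(1 : ℤ)⟧') t₄
        simp only [DegHom.postcomp_main]
        rw [εl, bl]
        simpa using this
      · intro k hk
        have := iru 1 k hk; have := irv 1 k hk; have := iru 2 k hk; have := irv 2 k hk
        have := icv 0 k hk; have := icu 1 k hk; have := irv 0 k hk; have := icu 2 k hk
        simp only [DegHom.postcomp_off]
        have hb : b' k = inv ((row 0).v k) ≫ (col 1).u k ≫ (oW k hk).inv := bo k hk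
        have hc : (row 1).v k ≫ (col 2).v k ≫ (col 2).w.off k hk ≫ inv ((row 0).v k) ≫
            (col 1).u k = 𝟙 _ := by
          rw [← cancel_epi ((col 1).u k), ← reassoc_of% (row_v k),
            reassoc_of% ((col 2).off_comp k hk), IsIso.hom_inv_id_assoc, comp_id]
        rw [← cancel_epi ((row 2).v k), ← cancel_epi ((row 2).u k),
          reassoc_of% ((row 2).off_comp k hk), εo k hk, hb, IsIso.inv_comp_eq,
          ← reassoc_of% (row_u' k), ← reassoc_of% (row_v' k), reassoc_of% hc]
    refine ⟨map_comp_eq hE, ?_, rot_of_distTriang _ (by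
      have := hG.dist l B
      rw [show G.conn l B.w = _ from hG.conn_postcomp _ _ _] at this
      exact this), hG.dist l (row 2),
      { m₁ := G.functor.map (col 2).v
        m₃ := G.conn l (col 2).w
        comm₁ := (map_comp_eq hM).trans (G.functor.map_comp _ _)
        comm₂ := q₁
        comm₃ := q₂
        comm₄ := q₃.trans (Preadditive.comp_neg _ _).symm
        mem := ?_ }, rfl, rfl⟩
    · have := hG.dist l E
      rw [show G.conn l E.w = _ from hG.conn_postcomp _ _ _] at this
      exact this
    · rw [Preadditive.neg_comp, ← Functor.map_comp, map_comp_eq hB]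
      exact rot_of_distTriang _ (hG.dist l (col 2))
  · exact map_comp_eq hB

lemma AdmitsVerdierStructure.comp (hF : ∀ j, (F j).IsMultiexact)
    (hF' : ∀ j, (F j).AdmitsVerdierStructure) (hG : G.IsMultiexact)
    (hG' : G.AdmitsVerdierStructure) : (comp F G).AdmitsVerdierStructure := by
  intro i j hij Gr
  by_cases h : φ j = φ i
  · have hc : ∀ {z x : ∀ k, S k} (d : DegHom S j z x),
        (TrFunctor.comp F G).conn j d = G.conn (φ i) (F.starDeg ⟨j, h⟩ d) :=
      fun d => conn_starDeg h d
    have key := verdier_aux hG (l := φ i) (X := fun a b => F.star.obj (Gr.X a b))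
      (fun b => F.starTri hF ⟨i, rfl⟩ (Gr.row b)) (fun a => F.starTri hF ⟨j, h⟩ (Gr.col a))
      (congrFun (F.starTri_isMap hF ⟨i, rfl⟩ Gr.row_u).comm₁)
      (congrFun (F.starTri_isMap hF ⟨i, rfl⟩ Gr.row_u).comm₂)
      (congrFun (F.starTri_isMap hF ⟨i, rfl⟩ Gr.row_v).comm₁)
      (congrFun (F.starTri_isMap hF ⟨i, rfl⟩ Gr.row_v).comm₂)
      (hF' (φ i) ⟨i, rfl⟩ ⟨j, h⟩ (fun e => hij (congrArg Subtype.val e))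
        (Gr.pull (r := Subtype.val) (k := (⟨i, rfl⟩ : Fib φ (φ i))) (TrString.fib_inj _)
          (l := (⟨j, h⟩ : Fib φ (φ i))) (TrString.fib_inj _)))
    simp only [nineDiagram]
    rw [hc, hc, hc]
    exact key
  · exact hG' _ _ (Ne.symm h) (F.starGrid hF ⟨i, rfl⟩ ⟨j, rfl⟩ Gr)

end VerdierComp
end TrFunctor

/-! ### The multicategories of triangulated categories and of Picard groupoids -/

section Fibres

variable {I J K : Type} (φ : I → J) (ψ : J → K)

/-- The map induced by `φ` on the fibres over `k`. -/
abbrev fibMap (k : K) : Fib (ψ ∘ φ) k → Fib ψ k := fun i => ⟨φ i.1, i.2⟩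

/-- The fibres of `fibMap` are the fibres of `φ`. -/
abbrev inFib {k : K} (j : Fib ψ k) : Fib φ j.1 → Fib (fibMap φ ψ k) j :=
  fun i => ⟨⟨i.1, (congrArg ψ i.2).trans j.2⟩, Subtype.ext i.2⟩

lemma inFib_inj {k : K} (j : Fib ψ k) (i i' : Fib φ j.1)
    (h : inFib φ ψ j i' = inFib φ ψ j i) : i' = i :=
  Subtype.ext (congrArg (fun a => a.1.1) h)

end Fibres

/-- Natural transformations of multiexact functors, compatible with the translations. -/
@[ext]
structure TrFunctor.Hom {ι : Type} {S : ι → TrCat.{u}} {T : TrCat.{u}} (F G : TrFunctor S T) where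
  natTrans : F.functor ⟶ G.functor
  comm (i : ι) {z x : ∀ j, S j} (d : DegHom S i z x) :
    F.conn i d ≫ (natTrans.app x)⟦(1 : ℤ)⟧' = natTrans.app z ≫ G.conn i d

instance {ι : Type} {S : ι → TrCat.{u}} {T : TrCat.{u}} : Category (TrFunctor S T) where
  Hom := TrFunctor.Hom
  id F := { natTrans := 𝟙 _, comm := by simp }
  comp f g :=
    { natTrans := f.natTrans ≫ g.natTrans
      comm := fun i z x d => by
        rw [NatTrans.comp_app, NatTrans.comp_app, Functor.map_comp, ← assoc, f.comm, assoc,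
          g.comm, assoc] }

/-- Multiexact functors of triangulated categories that admit a Verdier structure. -/
abbrev TrV {ι : Type} (S : ι → TrCat.{u}) (T : TrCat.{u}) :=
  ObjectProperty.FullSubcategory (fun F : TrFunctor S T =>
    F.IsMultiexact ∧ F.AdmitsVerdierStructure)

/-- Morphisms of families in the multicategory of triangulated categories and multiexact functors
that admit a Verdier structure. -/
abbrev TrHom {I J : Type} (φ : I → J) (S : I → TrCat.{u}) (T : J → TrCat.{u}) :=
  ∀ j, TrV (onFib S φ j) (T j)

/-- Morphisms of families in the multicategory of Picard groupoids. -/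
abbrev PicHom {I J : Type} (φ : I → J) (A : I → PicCat.{u}) (B : J → PicCat.{u}) :=
  ∀ j, Pic (onFib A φ j) (B j)

section Restrict

variable {I J K : Type} {φ : I → J} {ψ : J → K} {k : K} (j : Fib ψ k)

/-- A functor on a fibre of `φ`, regarded as a functor on a fibre of `fibMap φ ψ k`. -/
def TrFunctor.restrict {S : I → TrCat.{u}} {T : TrCat.{u}} (F : TrFunctor (onFib S φ j.1) T) :
    TrFunctor (onFib (onFib S (ψ ∘ φ) k) (fibMap φ ψ k) j) T where
  functor := pull (T := onFib (onFib S (ψ ∘ φ) k) (fibMap φ ψ k) j) (inFib φ ψ j) ⋙ F.functor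
  conn i _ _ d := F.conn ⟨i.1.1, congrArg Subtype.val i.2⟩
    (d.pull (r := inFib φ ψ j) ⟨i.1.1, congrArg Subtype.val i.2⟩ (inFib_inj φ ψ j _))

lemma TrFunctor.IsMultiexact.restrict {S : I → TrCat.{u}} {T : TrCat.{u}}
    {F : TrFunctor (onFib S φ j.1) T} (hF : F.IsMultiexact) : (F.restrict j).IsMultiexact where
  map_add i x y f g h e e' := hF.map_add ⟨i.1.1, congrArg Subtype.val i.2⟩ _ _ _ e
    (fun i' h => e' (inFib φ ψ j i') (fun a => h (inFib_inj φ ψ j ⟨i.1.1, _⟩ i' a)))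
  conn_precomp i z' z x p d := hF.conn_precomp ⟨i.1.1, congrArg Subtype.val i.2⟩
    (fun i' => p (inFib φ ψ j i'))
    (d.pull (r := inFib φ ψ j) ⟨i.1.1, congrArg Subtype.val i.2⟩ (inFib_inj φ ψ j _))
  conn_postcomp i z x x' d q := hF.conn_postcomp ⟨i.1.1, congrArg Subtype.val i.2⟩
    (d.pull (r := inFib φ ψ j) ⟨i.1.1, congrArg Subtype.val i.2⟩ (inFib_inj φ ψ j _))
    (fun i' => q (inFib φ ψ j i'))
  conn_isIso i z x d h h' :=
    hF.conn_isIso ⟨i.1.1, congrArg Subtype.val i.2⟩ _ h (fun _ _ => h' _ _)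
  dist i x y z Δ := hF.dist ⟨i.1.1, congrArg Subtype.val i.2⟩
    (Δ.pull (r := inFib φ ψ j) ⟨i.1.1, congrArg Subtype.val i.2⟩ (inFib_inj φ ψ j _))
  anticomm i k hik t y y' x d₁ d₂ e₁ e₂ h₁ h₂ h₃ :=
    hF.anticomm ⟨i.1.1, congrArg Subtype.val i.2⟩ ⟨k.1.1, congrArg Subtype.val k.2⟩
      (fun h => hik (Subtype.ext (Subtype.ext (congrArg (fun a : Fib φ j.1 => a.1) h)))) _ _ _ _ h₁ h₂
      (fun _ _ _ => h₃ _ _ _)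

lemma TrFunctor.AdmitsVerdierStructure.restrict {S : I → TrCat.{u}} {T : TrCat.{u}}
    {F : TrFunctor (onFib S φ j.1) T} (hF : F.AdmitsVerdierStructure) :
    (F.restrict j).AdmitsVerdierStructure := fun i i' h G =>
  hF ⟨i.1.1, congrArg Subtype.val i.2⟩ ⟨i'.1.1, congrArg Subtype.val i'.2⟩
    (fun e => h (Subtype.ext (Subtype.ext (congrArg (fun a : Fib φ j.1 => a.1) e))))
    (G.pull (r := inFib φ ψ j) (k := ⟨i.1.1, congrArg Subtype.val i.2⟩) (inFib_inj φ ψ j _)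
      (l := ⟨i'.1.1, congrArg Subtype.val i'.2⟩) (inFib_inj φ ψ j _))

/-- A functor on a fibre of `φ`, regarded as a functor on a fibre of `fibMap φ ψ k`. -/
def PicFunctor.restrict {A : I → PicCat.{u}} {B : PicCat.{u}} (f : PicFunctor (onFib A φ j.1) B) :
    PicFunctor (onFib (onFib A (ψ ∘ φ) k) (fibMap φ ψ k) j) B where
  functor :=
    { obj := fun x => f.functor.obj (fun i => x (inFib φ ψ j i))
      map := fun p => f.functor.map (fun i => p (inFib φ ψ j i))
      map_id := fun x => f.functor.map_id _
      map_comp := fun p q => f.functor.map_comp (fun i => p (inFib φ ψ j i))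
        (fun i => q (inFib φ ψ j i)) }
  sum i _ _ _ σ := f.sum ⟨i.1.1, congrArg Subtype.val i.2⟩
    (σ.pull (r := inFib φ ψ j) ⟨i.1.1, congrArg Subtype.val i.2⟩ (inFib_inj φ ψ j _))

lemma PicFunctor.IsMultiexact.restrict {A : I → PicCat.{u}} {B : PicCat.{u}}
    {f : PicFunctor (onFib A φ j.1) B} (hf : f.IsMultiexact) : (f.restrict j).IsMultiexact where
  naturality i x y s x' y' s' σ σ' p q r h₁ h₂ h₃ :=
    hf.naturality ⟨i.1.1, congrArg Subtype.val i.2⟩ _ _ _ _ _ h₁ (fun _ _ => h₂ _ _)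
      (fun _ _ => h₃ _ _)
  associativity i x y z s t w σ₁ σ₂ σ₃ σ₄ h₁ h₂ h₃ h₄ :=
    hf.associativity ⟨i.1.1, congrArg Subtype.val i.2⟩ _ _ _ _ h₁ (fun _ _ => h₂ _ _)
      (fun _ _ => h₃ _ _) (fun _ _ => h₄ _ _)
  commutativity i x y s σ σ' h₁ h₂ h₃ :=
    hf.commutativity ⟨i.1.1, congrArg Subtype.val i.2⟩ _ _ h₁ (fun _ _ => h₂ _ _)
      (fun _ _ => h₃ _ _)
  interchange i k hik x₀₀ x₁₀ x₀₁ x₁₁ s₀ s₁ t₀ t₁ w σ₀ σ₁ σ τ₀ τ₁ τ h₁ h₂ h₃ h₄ h₅ :=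
    hf.interchange ⟨i.1.1, congrArg Subtype.val i.2⟩ ⟨k.1.1, congrArg Subtype.val k.2⟩
      (fun h => hik (Subtype.ext (Subtype.ext (congrArg (fun a : Fib φ j.1 => a.1) h)))) _ _ _ _ _ _ h₁ h₂ h₃ h₄
      (fun _ _ _ => h₅ _ _ _)

end Restrict

namespace TrHom

variable {I J K : Type} {φ : I → J} {ψ : J → K} {S : I → TrCat.{u}} {T : J → TrCat.{u}}
  {U : K → TrCat.{u}}

/-- The underlying string of functors. -/
abbrev string (F : TrHom φ S T) : TrString φ S T := fun j => (F j).obj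

lemma multiexact (F : TrHom φ S T) : ∀ j, (string F j).IsMultiexact := fun j => (F j).property.1

/-- Composition. -/
def comp (F : TrHom φ S T) (G : TrHom ψ T U) : TrHom (ψ ∘ φ) S U := fun k =>
  ⟨TrFunctor.comp (φ := fibMap φ ψ k) (fun j => (F j.1).obj.restrict j) (G k).obj,
    TrFunctor.IsMultiexact.comp (fun j => (F j.1).property.1.restrict j) (G k).property.1,
    TrFunctor.AdmitsVerdierStructure.comp (fun j => (F j.1).property.1.restrict j)
      (fun j => (F j.1).property.2.restrict j) (G k).property.1 (G k).property.2⟩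

/-- The identity functor of `T j`, as a functor on the fibre of `id` over `j`. -/
def idFunctor (T : J → TrCat.{u}) (j : J) : TrFunctor (onFib T id j) (T j) where
  functor := { obj := fun x => x ⟨j, rfl⟩, map := fun p => p ⟨j, rfl⟩ }
  conn i _ _ d := by
    obtain ⟨i, rfl⟩ := i
    exact d.main

/-- The identity morphism. -/
def id (T : J → TrCat.{u}) : TrHom (_root_.id : J → J) T T := fun j =>
  ⟨idFunctor T j,
    { map_add := by rintro ⟨i, rfl⟩ x y f g h e e'; exact e
      conn_precomp := by rintro ⟨i, rfl⟩ z' z x p d; rfl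
      conn_postcomp := by rintro ⟨i, rfl⟩ z x x' d q; rfl
      conn_isIso := by rintro ⟨i, rfl⟩ z x d h h'; exact h
      dist := by rintro ⟨i, rfl⟩ x y z Δ; exact Δ.dist
      anticomm := fun i k h => (h (Subtype.ext (i.2.trans k.2.symm))).elim },
    fun i k h => (h (Subtype.ext (i.2.trans k.2.symm))).elim⟩

/-- The components of a 2-cell. -/
def appIso {F F' : TrHom φ S T} (σ : F ≅ F') (j : J) (x : ∀ i : Fib φ j, S i.1) :
    (F j).obj.functor.obj x ≅ (F' j).obj.functor.obj x where
  hom := (σ.hom j).hom.natTrans.app x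
  inv := (σ.inv j).hom.natTrans.app x
  hom_inv_id := congrArg (fun f => (f j).hom.natTrans.app x) σ.hom_inv_id
  inv_hom_id := congrArg (fun f => (f j).hom.natTrans.app x) σ.inv_hom_id

end TrHom

namespace PicHom

variable {I J K : Type} {φ : I → J} {ψ : J → K} {A : I → PicCat.{u}} {B : J → PicCat.{u}}
  {C : K → PicCat.{u}}

/-- The underlying string of functors. -/
abbrev string (f : PicHom φ A B) : PicString φ A B := fun j => (f j).obj

/-- Composition. -/
def comp (f : PicHom φ A B) (g : PicHom ψ B C) : PicHom (ψ ∘ φ) A C := fun k =>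
  ⟨PicFunctor.comp (φ := fibMap φ ψ k) (fun j => (f j.1).obj.restrict j) (g k).obj,
    PicFunctor.IsMultiexact.comp (fun j => (f j.1).property.restrict j) (g k).property⟩

/-- The identity functor of `B j`, as a functor on the fibre of `id` over `j`. -/
def idFunctor (B : J → PicCat.{u}) (j : J) : PicFunctor (onFib B id j) (B j) where
  functor := { obj := fun x => x ⟨j, rfl⟩, map := fun p => p ⟨j, rfl⟩ }
  sum i _ _ _ σ := by
    obtain ⟨i, rfl⟩ := i
    exact σ.main

/-- The identity morphism. -/
def id (B : J → PicCat.{u}) : PicHom (_root_.id : J → J) B B := fun j =>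
  ⟨idFunctor B j,
    { naturality := by rintro ⟨i, rfl⟩ x y s x' y' s' σ σ' p q r h₁ h₂ h₃; exact h₁
      associativity := by rintro ⟨i, rfl⟩ x y z s t w σ₁ σ₂ σ₃ σ₄ h₁ h₂ h₃ h₄; exact h₁
      commutativity := by rintro ⟨i, rfl⟩ x y s σ σ' h₁ h₂ h₃; exact h₁
      interchange := fun i k h => (h (Subtype.ext (i.2.trans k.2.symm))).elim }⟩

end PicHom

theorem TrHom.comp_assoc {I J K L : Type} {φ : I → J} {ψ : J → K} {χ : K → L} {S : I → TrCat.{u}}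
    {T : J → TrCat.{u}} {U : K → TrCat.{u}} {W : L → TrCat.{u}} (F : TrHom φ S T)
    (G : TrHom ψ T U) (H : TrHom χ U W) : (F.comp G).comp H = F.comp (G.comp H) := rfl

theorem TrHom.id_comp {I J : Type} {φ : I → J} {S : I → TrCat.{u}} {T : J → TrCat.{u}}
    (F : TrHom φ S T) : (TrHom.id S).comp F = F := rfl

theorem TrHom.comp_id {I J : Type} {φ : I → J} {S : I → TrCat.{u}} {T : J → TrCat.{u}}
    (F : TrHom φ S T) : F.comp (TrHom.id T) = F := by
  funext j
  refine ObjectProperty.FullSubcategory.ext ?_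
  refine TrFunctor.ext rfl (heq_of_eq ?_)
  funext i z x d
  obtain ⟨i, rfl⟩ := i
  rfl

namespace TrHom

variable {I J K : Type} {φ : I → J} {ψ : J → K} {S : I → TrCat.{u}} {T : J → TrCat.{u}}
  {U : K → TrCat.{u}}

/-- The components of a 2-cell, for the functors `∏ S i ⥤ ∏ T j`. -/
@[simps]
def starIso {F F' : TrHom φ S T} (σ : F ≅ F') (x : ∀ i, S i) :
    F.string.star.obj x ≅ F'.string.star.obj x where
  hom j := (appIso σ j (fun i => x i.1)).hom
  inv j := (appIso σ j (fun i => x i.1)).inv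
  hom_inv_id := funext fun j => (appIso σ j (fun i => x i.1)).hom_inv_id
  inv_hom_id := funext fun j => (appIso σ j (fun i => x i.1)).inv_hom_id

end TrHom

section HComp

variable {I J : Type} {φ : I → J} {S : I → TrCat.{u}} {T : J → TrCat.{u}} {U : TrCat.{u}}

/-- Transformations of strings induce transformations of the functors `∏ S i ⥤ ∏ T j`. -/
@[simps]
def TrString.starMap {F F' : TrString φ S T} (σ : F ⟶ F') : F.star ⟶ F'.star where
  app x j := (σ j).natTrans.app (fun i => x i.1)
  naturality _ _ p := funext fun j => (σ j).natTrans.naturality (fun i : Fib φ j => p i.1)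

lemma TrString.starMap_starDeg {F F' : TrString φ S T} (σ : F ⟶ F') {k : J} (i : Fib φ k)
    {z x : ∀ i, S i} (d : DegHom S i.1 z x) :
    (F.starDeg i d).postcomp ((starMap σ).app x) =
      (F'.starDeg i d).precomp ((starMap σ).app z) :=
  DegHom.ext ((σ k).comm i (d.pull i (TrString.fib_inj i)))
    (funext fun j => funext fun _ => (σ j).natTrans.naturality (X := fun i => z i.1)
      (Y := fun i => x i.1) _)

/-- Horizontal composition of transformations. -/
def TrFunctor.hcomp {F F' : TrString φ S T} {G G' : TrFunctor T U} (hG : G.IsMultiexact)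
    (σ : F ⟶ F') (τ : G ⟶ G') : comp F G ⟶ comp F' G' where
  natTrans := Functor.whiskerRight (TrString.starMap σ) G.functor ≫
    Functor.whiskerLeft F'.star τ.natTrans
  comm i z x d := by
    have e₁ := hG.conn_postcomp (φ i) (F.starDeg ⟨i, rfl⟩ d) ((TrString.starMap σ).app x)
    have e₂ := hG.conn_precomp (φ i) ((TrString.starMap σ).app z) (F'.starDeg ⟨i, rfl⟩ d)
    have e₃ := τ.comm (φ i) (F'.starDeg ⟨i, rfl⟩ d)
    rw [TrString.starMap_starDeg, e₂] at e₁
    change G.conn (φ i) (F.starDeg ⟨i, rfl⟩ d) ≫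
      (G.functor.map ((TrString.starMap σ).app x) ≫ τ.natTrans.app (F'.star.obj x))⟦(1 : ℤ)⟧' =
      (G.functor.map ((TrString.starMap σ).app z) ≫ τ.natTrans.app (F'.star.obj z)) ≫
        G'.conn (φ i) (F'.starDeg ⟨i, rfl⟩ d)
    rw [Functor.map_comp, ← assoc, ← e₁, assoc, assoc, e₃]

/-- Transformations of functors on a fibre of `φ`, regarded as functors on a fibre of `fibMap`. -/
def TrFunctor.restrictMap {K : Type} {ψ : J → K} {k : K} (j : Fib ψ k)
    {F F' : TrFunctor (onFib S φ j.1) U} (σ : F ⟶ F') : F.restrict j ⟶ F'.restrict j where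
  natTrans := Functor.whiskerLeft (pull (T := onFib (onFib S (ψ ∘ φ) k) (fibMap φ ψ k) j)
    (inFib φ ψ j)) σ.natTrans
  comm i _ _ d := σ.comm ⟨i.1.1, congrArg Subtype.val i.2⟩
    (d.pull (r := inFib φ ψ j) ⟨i.1.1, congrArg Subtype.val i.2⟩ (inFib_inj φ ψ j _))

end HComp

namespace TrHom

variable {I J K : Type} {φ : I → J} {ψ : J → K} {S : I → TrCat.{u}} {T : J → TrCat.{u}}
  {U : K → TrCat.{u}}

/-- Horizontal composition of transformations. -/
def hcompHom {F F' : TrHom φ S T} {G G' : TrHom ψ T U} (σ : F ⟶ F') (τ : G ⟶ G') :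
    F.comp G ⟶ F'.comp G' := fun k => ObjectProperty.homMk
  (TrFunctor.hcomp (φ := fibMap φ ψ k) (G k).property.1
    (fun j => TrFunctor.restrictMap (φ := φ) (ψ := ψ) (k := k) j (σ j.1).hom) (τ k).hom)

lemma hcomp_aux {C D : Type*} [Category C] [Category D] {H H' H'' : C ⥤ D} (t : H ⟶ H')
    (t' : H' ⟶ H'') {a b c : C} (p : a ⟶ b) (q : b ⟶ c) :
    (H.map p ≫ t.app b) ≫ (H'.map q ≫ t'.app c) = H.map (p ≫ q) ≫ t.app c ≫ t'.app c := by
  simp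

lemma hcompHom_comp {F F' F'' : TrHom φ S T} {G G' G'' : TrHom ψ T U} (σ : F ⟶ F') (τ : G ⟶ G')
    (σ' : F' ⟶ F'') (τ' : G' ⟶ G'') :
    hcompHom σ τ ≫ hcompHom σ' τ' = hcompHom (σ ≫ σ') (τ ≫ τ') := by
  funext k
  refine ObjectProperty.hom_ext _ (TrFunctor.Hom.ext ?_)
  ext x
  exact hcomp_aux (τ k).hom.natTrans (τ' k).hom.natTrans
    (fun j => (σ j.1).hom.natTrans.app (fun i => x (inFib φ ψ j i)))
    (fun j => (σ' j.1).hom.natTrans.app (fun i => x (inFib φ ψ j i)))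

lemma hcompHom_id (F : TrHom φ S T) (G : TrHom ψ T U) : hcompHom (𝟙 F) (𝟙 G) = 𝟙 _ := by
  funext k
  refine ObjectProperty.hom_ext _ (TrFunctor.Hom.ext ?_)
  ext x
  change (G k).obj.functor.map (𝟙 _) ≫ 𝟙 _ = 𝟙 _
  rw [Category.comp_id, CategoryTheory.Functor.map_id]

/-- Horizontal composition of 2-cells. -/
def hcomp {F F' : TrHom φ S T} {G G' : TrHom ψ T U} (σ : F ≅ F') (τ : G ≅ G') :
    F.comp G ≅ F'.comp G' where
  hom := hcompHom σ.hom τ.hom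
  inv := hcompHom σ.inv τ.inv
  hom_inv_id := by rw [hcompHom_comp, Iso.hom_inv_id, Iso.hom_inv_id, hcompHom_id]
  inv_hom_id := by rw [hcompHom_comp, Iso.inv_hom_id, Iso.inv_hom_id, hcompHom_id]

end TrHom

/-! ### Functoriality of `Det` and `Pic` -/

section Functoriality

variable {I J : Type} {φ : I → J} {S : I → TrCat.{u}} {T : J → TrCat.{u}} (P : PicCat.{u})

/-- The composite `D ∘ (F_j)_j`. -/
@[simps]
def pullDetObj {P : PicCat.{u}} (F : TrHom φ S T) (D : DetData T P) : DetData S P where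
  functor := F.string.star.core ⋙ D.functor
  additivity i _ _ _ Δ := D.additivity (φ i) (F.string.starTri F.multiexact ⟨i, rfl⟩ Δ)

/-- Multideterminant functors are stable under composition with multiexact functors that admit a
Verdier structure. -/
def PullbackIsMultiDet : Prop :=
  ∀ {I J : Type} {φ : I → J} {S : I → TrCat.{u}} {T : J → TrCat.{u}} {P : PicCat.{u}}
    (F : TrHom φ S T) (D : DetData T P), D.IsMultiDet → (pullDetObj F D).IsMultiDet

variable (h : PullbackIsMultiDet.{u})

/-- The functor `F^* : Det(T; P) ⥤ Det(S; P)`, `D ↦ D ∘ (F_j)_j`. -/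
def pullDet (F : TrHom φ S T) : Det T P ⥤ Det S P where
  obj D := ⟨pullDetObj F D.obj, h F D.obj D.property⟩
  map γ := ObjectProperty.homMk
    { natTrans := Functor.whiskerLeft F.string.star.core γ.hom.natTrans
      comm := fun i _ _ _ Δ => γ.hom.comm (φ i) (F.string.starTri F.multiexact ⟨i, rfl⟩ Δ) }

lemma starTri_isMap_of_iso {F F' : TrHom φ S T} (σ : F ≅ F') {k : J} (i : Fib φ k)
    {x y z : ∀ i, S i} (Δ : TriangleIn S i.1 x y z) :
    (F.string.starTri F.multiexact i Δ).IsMap (F'.string.starTri F'.multiexact i Δ)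
      (TrHom.starIso σ x).hom (TrHom.starIso σ y).hom (TrHom.starIso σ z).hom where
  comm₁ := funext fun j => (σ.hom j).hom.natTrans.naturality (fun i : Fib φ j => Δ.u i.1)
  comm₂ := funext fun j => (σ.hom j).hom.natTrans.naturality (fun i : Fib φ j => Δ.v i.1)
  comm₃ := (σ.hom k).hom.comm i (Δ.w.pull i (TrString.fib_inj i))

/-- A 2-cell `σ : F ≅ F'` induces `D ∘ F ⟶ D ∘ F'`, naturally in `D`. -/
def pullDet₂ {F F' : TrHom φ S T} (σ : F ≅ F') : pullDet P h F ⟶ pullDet P h F' where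
  app D := ObjectProperty.homMk
    { natTrans :=
        { app := fun x => D.obj.functor.map ⟨TrHom.starIso σ x.of⟩
          naturality := fun x y p => by
            change D.obj.functor.map _ ≫ D.obj.functor.map _ =
              D.obj.functor.map _ ≫ D.obj.functor.map _
            rw [← Functor.map_comp, ← Functor.map_comp]
            congr 1
            ext j
            exact (σ.hom j).hom.natTrans.naturality (fun i : Fib φ j => p.iso.hom i.1) }
      comm := fun i _ _ _ Δ => D.property.naturality (φ i) _ _ _ _ _
        (starTri_isMap_of_iso σ ⟨i, rfl⟩ Δ) }
  naturality D E γ := by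
    refine ObjectProperty.hom_ext _ (DetData.Hom.ext ?_)
    ext x
    exact (γ.hom.natTrans.naturality _).symm

/-- The functor `f^* : Pic^×(B; P) ⥤ Pic^×(A; P)`, `g ↦ g ∘ (f_j)_j`. -/
def pullPic {A : I → PicCat.{u}} {B : J → PicCat.{u}} (f : PicHom φ A B) :
    Pic B P ⥤ Pic A P where
  obj g := ⟨PicFunctor.comp f.string g.obj,
    PicFunctor.IsMultiexact.comp (fun j => (f j).property) g.property⟩
  map γ := ObjectProperty.homMk (PicFunctor.whisker f.string γ.hom)
  map_id _ := rfl
  map_comp _ _ := rfl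

variable {V : TrCat.{u} → PicCat.{u}} (det : ∀ T, DetFunctor T (V T))

/-- The functor `det^* : Pic^×(V(T₁), …, V(Tₙ); P) ⥤ Det(T₁, …, Tₙ; P)`, `g ↦ g ∘ (det, …, det)`. -/
noncomputable def detStar {ι : Type} (T : ι → TrCat.{u}) :
    Pic (fun i => V (T i)) P ⥤ Det T P where
  obj g := ⟨detPullObj det g.obj, detPullObj_isMultiDet det g.property⟩
  map γ := ObjectProperty.homMk (detPullMap det γ.hom)
  map_id _ := rfl
  map_comp _ _ := rfl

theorem pullDet_comp {K : Type} {ψ : J → K} {U : K → TrCat.{u}} (F : TrHom φ S T)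
    (G : TrHom ψ T U) : pullDet P h (F.comp G) = pullDet P h G ⋙ pullDet P h F := rfl

theorem pullDet_id : pullDet P h (TrHom.id S) = 𝟭 _ := rfl

theorem pullPic_comp {K : Type} {ψ : J → K} {A : I → PicCat.{u}} {B : J → PicCat.{u}}
    {C : K → PicCat.{u}} (f : PicHom φ A B) (g : PicHom ψ B C) :
    pullPic P (f.comp g) = pullPic P g ⋙ pullPic P f := rfl

theorem pullPic_id {A : I → PicCat.{u}} : pullPic P (PicHom.id A) = 𝟭 _ := rfl

end Functoriality

/-! ### Functoriality of the virtual objects, and naturality of the equivalence -/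

section Virtual

variable {V : TrCat.{u} → PicCat.{u}} (det : ∀ T, DetFunctor T (V T))

/-- The composite `d ∘ F` of a determinant functor with a multiexact functor. -/
@[simps]
def detAfter {ι : Type} {S : ι → TrCat.{u}} {T : TrCat.{u}} {P : PicCat.{u}} (d : DetFunctor T P)
    (F : TrFunctor S T) (hF : F.IsMultiexact) : DetData S P where
  functor := F.functor.core ⋙ d.functor
  additivity i _ _ _ Δ := d.additivity _ (hF.dist i Δ)

/-- The value of `(det, …, det)` on a family of objects. -/
abbrev detObj {ι : Type} {S : ι → TrCat.{u}} (x : ∀ i, S i) : ∀ i, V (S i) :=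
  fun i => (det (S i)).functor.obj ⟨x i⟩

/-- A choice, for every string of multiexact functors `F j` that admit Verdier structures, of
multiexact functors `V(F)_j` of Picard groupoids together with isomorphisms of multideterminant
functors `V(F)_j ∘ (det, …, det) ≅ det ∘ F j`. -/
structure VirtualFunctors where
  map {I J : Type} [Finite I] [Finite J] {φ : I → J} {S : I → TrCat.{u}} {T : J → TrCat.{u}}
    (F : TrHom φ S T) : PicHom φ (fun i => V (S i)) (fun j => V (T j))
  iso {I J : Type} [Finite I] [Finite J] {φ : I → J} {S : I → TrCat.{u}} {T : J → TrCat.{u}}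
    (F : TrHom φ S T) (j : J) :
    detPullObj det (T := onFib S φ j) (map F j).obj ≅
      detAfter (det (T j)) (F j).obj (F j).property.1

variable {det}

namespace VirtualFunctors

variable (L : VirtualFunctors det)

/-- The components of `V(F)_j ∘ (det, …, det) ≅ det ∘ F j`. -/
abbrev isoApp {I J : Type} [Finite I] [Finite J] {φ : I → J} {S : I → TrCat.{u}}
    {T : J → TrCat.{u}} (F : TrHom φ S T) (j : J) (x : ∀ i : Fib φ j, S i.1) :
    (L.map F j).obj.functor.obj (detObj det (S := onFib S φ j) x) ⟶
      (det (T j)).functor.obj ⟨(F j).obj.functor.obj x⟩ :=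
  (L.iso F j).hom.natTrans.app ⟨x⟩

/-- The components of a transformation of strings of functors of Picard groupoids. -/
abbrev app {I J : Type} {φ : I → J} {A : I → PicCat.{u}} {B : J → PicCat.{u}} {f g : PicHom φ A B}
    (γ : f ≅ g) (j : J) (y : ∀ i : Fib φ j, A i.1) :
    (f j).obj.functor.obj y ⟶ (g j).obj.functor.obj y :=
  (γ.hom j).hom.natTrans.app y

/-- The structure of a pseudofunctor on `F ↦ V(F)`, compatible with the isomorphisms
`V(F)_j ∘ (det, …, det) ≅ det ∘ F j`. -/
structure Coherence where
  /-- 2-cells `F ≅ F'` induce isomorphisms `V(F) ≅ V(F')` -/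
  map₂ {I J : Type} [Finite I] [Finite J] {φ : I → J} {S : I → TrCat.{u}} {T : J → TrCat.{u}}
    {F F' : TrHom φ S T} (σ : F ≅ F') : L.map F ≅ L.map F'
  mapComp {I J K : Type} [Finite I] [Finite J] [Finite K] {φ : I → J} {ψ : J → K}
    {S : I → TrCat.{u}} {T : J → TrCat.{u}} {U : K → TrCat.{u}} (F : TrHom φ S T)
    (G : TrHom ψ T U) : L.map (F.comp G) ≅ (L.map F).comp (L.map G)
  mapId {J : Type} [Finite J] (T : J → TrCat.{u}) :
    L.map (TrHom.id T) ≅ PicHom.id (fun j => V (T j))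
  map₂_iso {I J : Type} [Finite I] [Finite J] {φ : I → J} {S : I → TrCat.{u}}
    {T : J → TrCat.{u}} {F F' : TrHom φ S T} (σ : F ≅ F') (j : J) (x : ∀ i : Fib φ j, S i.1) :
    app (map₂ σ) j (detObj det (S := onFib S φ j) x) ≫ L.isoApp F' j x =
      L.isoApp F j x ≫ (det (T j)).functor.map ⟨TrHom.appIso σ j x⟩
  mapComp_iso {I J K : Type} [Finite I] [Finite J] [Finite K] {φ : I → J} {ψ : J → K}
    {S : I → TrCat.{u}} {T : J → TrCat.{u}} {U : K → TrCat.{u}} (F : TrHom φ S T)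
    (G : TrHom ψ T U) (k : K) (x : ∀ i : Fib (ψ ∘ φ) k, S i.1) :
    app (mapComp F G) k (detObj det (S := onFib S (ψ ∘ φ) k) x) ≫
        (L.map G k).obj.functor.map
          (fun j : Fib ψ k => L.isoApp F j.1 (fun i => x (inFib φ ψ j i).1)) ≫
        L.isoApp G k
          (fun j : Fib ψ k => (F j.1).obj.functor.obj (fun i => x (inFib φ ψ j i).1)) =
      L.isoApp (F.comp G) k x
  mapId_iso {J : Type} [Finite J] (T : J → TrCat.{u}) (j : J) (x : ∀ i : Fib (id : J → J) j, T i.1) :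
    app (mapId T) j (detObj det (S := onFib T id j) x) = L.isoApp (TrHom.id T) j x
  map₂_id {I J : Type} [Finite I] [Finite J] {φ : I → J} {S : I → TrCat.{u}} {T : J → TrCat.{u}}
    (F : TrHom φ S T) : map₂ (Iso.refl F) = Iso.refl _
  map₂_comp {I J : Type} [Finite I] [Finite J] {φ : I → J} {S : I → TrCat.{u}} {T : J → TrCat.{u}}
    {F F' F'' : TrHom φ S T} (σ : F ≅ F') (σ' : F' ≅ F'') : map₂ (σ ≪≫ σ') = map₂ σ ≪≫ map₂ σ'
  mapComp_naturality {I J K : Type} [Finite I] [Finite J] [Finite K] {φ : I → J} {ψ : J → K}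
    {S : I → TrCat.{u}} {T : J → TrCat.{u}} {U : K → TrCat.{u}} {F F' : TrHom φ S T}
    {G G' : TrHom ψ T U} (σ : F ≅ F') (τ : G ≅ G') (k : K)
    (y : ∀ i : Fib (ψ ∘ φ) k, V (S i.1)) :
    app (map₂ (TrHom.hcomp σ τ)) k y ≫ app (mapComp F' G') k y =
      app (mapComp F G) k y ≫
        (L.map G k).obj.functor.map
          (fun j : Fib ψ k => app (map₂ σ) j.1 (fun i => y (inFib φ ψ j i).1)) ≫
        app (map₂ τ) k
          (fun j : Fib ψ k => (L.map F' j.1).obj.functor.obj (fun i => y (inFib φ ψ j i).1))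
  associativity {I J K M : Type} [Finite I] [Finite J] [Finite K] [Finite M] {φ : I → J}
    {ψ : J → K} {χ : K → M} {S : I → TrCat.{u}} {T : J → TrCat.{u}} {U : K → TrCat.{u}}
    {W : M → TrCat.{u}} (F : TrHom φ S T) (G : TrHom ψ T U) (H : TrHom χ U W) (m : M)
    (y : ∀ i : Fib (χ ∘ ψ ∘ φ) m, V (S i.1)) :
    app (mapComp (F.comp G) H) m y ≫
        (L.map H m).obj.functor.map
          (fun k : Fib χ m => app (mapComp F G) k.1 (fun i => y (inFib (ψ ∘ φ) χ k i).1)) =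
      app (mapComp F (G.comp H)) m y ≫
        app (mapComp G H) m (fun j : Fib (χ ∘ ψ) m =>
          (L.map F j.1).obj.functor.obj (fun i => y (inFib φ (χ ∘ ψ) j i).1))
  left_unit {I J : Type} [Finite I] [Finite J] {φ : I → J} {S : I → TrCat.{u}} {T : J → TrCat.{u}}
    (F : TrHom φ S T) (j : J) (y : ∀ i : Fib φ j, V (S i.1)) :
    app (mapComp (TrHom.id S) F) j y ≫
        (L.map F j).obj.functor.map
          (fun i : Fib φ j => app (mapId S) i.1 (fun i' => y (inFib id φ i i').1)) =
      𝟙 ((L.map F j).obj.functor.obj y)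
  right_unit {I J : Type} [Finite I] [Finite J] {φ : I → J} {S : I → TrCat.{u}} {T : J → TrCat.{u}}
    (F : TrHom φ S T) (j : J) (y : ∀ i : Fib φ j, V (S i.1)) :
    app (mapComp F (TrHom.id T)) j y ≫
        app (mapId T) j (fun j' : Fib (id : J → J) j =>
          (L.map F j'.1).obj.functor.obj (fun i => y (inFib φ id j' i).1)) =
      app (map₂ (eqToIso F.comp_id)) j y

/-- The equivalences `bar T : Det(T; P) ≌ Pic^×(V(T); P)`, `D ↦ D'`, with
`τ : D' ∘ (det, …, det) ≅ D`, are natural in `T`: the structure of a pseudonatural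
transformation. -/
structure Naturality {L : VirtualFunctors det} (c : L.Coherence) (h : PullbackIsMultiDet.{u})
    (P : PicCat.{u})
    (bar : ∀ {ι : Type} [Finite ι] (T : ι → TrCat.{u}), Det T P ⥤ Pic (fun i => V (T i)) P)
    (τ : ∀ {ι : Type} [Finite ι] (T : ι → TrCat.{u}), bar T ⋙ detStar P det T ≅ 𝟭 (Det T P)) where
  /-- the natural isomorphism which fills the naturality square of `F` -/
  square {I J : Type} [Finite I] [Finite J] {φ : I → J} {S : I → TrCat.{u}} {T : J → TrCat.{u}}
    (F : TrHom φ S T) : pullDet P h F ⋙ bar S ≅ bar T ⋙ pullPic P (L.map F)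
  /-- it is induced by `V(F)_j ∘ (det, …, det) ≅ det ∘ F j` and `D' ∘ (det, …, det) ≅ D` -/
  square_iso {I J : Type} [Finite I] [Finite J] {φ : I → J} {S : I → TrCat.{u}} {T : J → TrCat.{u}}
    (F : TrHom φ S T) (D : Det T P) (x : ∀ i, S i) :
    ((square F).hom.app D).hom.natTrans.app (detObj det x) ≫
        ((bar T).obj D).obj.functor.map (fun j => L.isoApp F j (fun i => x i.1)) ≫
        ((τ T).hom.app D).hom.natTrans.app ⟨F.string.star.obj x⟩ =
      ((τ S).hom.app ((pullDet P h F).obj D)).hom.natTrans.app ⟨x⟩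
  /-- compatibility with 2-cells -/
  square_map₂ {I J : Type} [Finite I] [Finite J] {φ : I → J} {S : I → TrCat.{u}}
    {T : J → TrCat.{u}} {F F' : TrHom φ S T} (σ : F ≅ F') (D : Det T P) (y : ∀ i, V (S i)) :
    ((bar S).map ((pullDet₂ P h σ).app D)).hom.natTrans.app y ≫
        ((square F').hom.app D).hom.natTrans.app y =
      ((square F).hom.app D).hom.natTrans.app y ≫
        ((bar T).obj D).obj.functor.map (fun j => app (c.map₂ σ) j (fun i => y i.1))
  /-- compatibility with composition; note that `(G ∘ F)^* = F^* G^*` -/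
  square_comp {I J K : Type} [Finite I] [Finite J] [Finite K] {φ : I → J} {ψ : J → K}
    {S : I → TrCat.{u}} {T : J → TrCat.{u}} {U : K → TrCat.{u}} (F : TrHom φ S T)
    (G : TrHom ψ T U) (D : Det U P) (y : ∀ i, V (S i)) :
    ((square (F.comp G)).hom.app D).hom.natTrans.app y ≫
        ((bar U).obj D).obj.functor.map (fun k => app (c.mapComp F G) k (fun i => y i.1)) =
      ((square F).hom.app ((pullDet P h G).obj D)).hom.natTrans.app y ≫
        ((square G).hom.app D).hom.natTrans.app ((L.map F).string.star.obj y)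
  /-- compatibility with identities; note that `id^* = id` -/
  square_id {J : Type} [Finite J] (T : J → TrCat.{u}) (D : Det T P) (y : ∀ j, V (T j)) :
    ((square (TrHom.id T)).hom.app D).hom.natTrans.app y ≫
        ((bar T).obj D).obj.functor.map (fun j => app (c.mapId T) j (fun i => y i.1)) =
      𝟙 (((bar T).obj D).obj.functor.obj y)

end VirtualFunctors

end Virtual

end DetFun

open DetFun

/-! Determinant functors and symmetric monoidal functors of Picard groupoids are two cases of one
notion. Call a category with sums (`SumCat`) a category in which some triples (x, y, s) carry
"sums", together with notions of morphism, associativity and commutativity of sums. In a Picard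
groupoid the sums are the morphisms x ⊗ y ⟶ s; on the core of a triangulated category they are the
distinguished triangles, with octahedra for associativity and the two split triangles of a direct
sum for commutativity. Additive functors on such a category are then braided functors in the first
case and determinant functors in the second, and `MultiAdd` is the version in several variables,
with interchange.

Equivalence `det^*`. Additive functors from a category with sums to `P` again form a Picard
groupoid, `AddFunctor.pic`: they are added pointwise, and one can divide by them because tensoring
with an object of `P` is an equivalence. Hence a multiadditive functor can be curried: singling out
one variable, it becomes a multiadditive functor of the remaining variables with values in additive
functors of that variable. A universal determinant functor is one along which restriction of
additive functors is an equivalence for every target (`isUniversal_toAdd`), so it can be substituted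
in one variable at a time. Induction on the number of variables gives
`MultiAdd.precomp_isEquivalence`, and from it `detStar_isEquivalence`.

Composition with `F`. The one law that is not formal is interchange for two variables of `F` that
lie over the same variable k of `D`: it becomes a statement about a 3×3 diagram in a single
triangulated category. A Verdier structure provides three octahedra. Two of them compare the two
expansions through the diagonal cone; the third relates the outer triangles, but contains rotated
ones. By `exists_rotation`, additivity on a rotated triangle is determined by additivity on the
original one and a contraction of F(Σx) ⊗ F(x) that depends on x only. Together these yield
`NineDiagram.HasVerdierStructure.interchange`, and then `detAfter_isMultiDet` and
`pullbackIsMultiDet`.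

Existence. The universal determinant functor takes values in formal sums of objects and their
inverses. Its morphisms are formal composites, two of which are identified when every determinant
functor gives them the same value; so every axiom holds because it holds after evaluation
(`DetFunctor.virtual_isUniversal`).

Functoriality. Essential surjectivity of `det^*` produces V(F) from det ∘ F. As `det^*` is fully
faithful, a transformation between multiexact functors on virtual objects may be prescribed at
determinants and is determined there. Thus each constraint of the pseudofunctor, and each square of
the pseudonatural equivalence, exists and is unique, and each coherence law is a diagram chase at
determinants. -/

namespace DetFun

/-! ### Coherence identities for the pointwise sum. -/

section Coherence

variable {C : Type*} [Category C] [MonoidalCategory C] [SymmetricCategory C]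

/-- In a symmetric category the middle braiding is inverse to the opposite one, so the second factor
is `tensorδ` of the first. -/
lemma tensorμ_tensorμ (X₁ X₂ Y₁ Y₂ : C) :
    tensorμ X₁ X₂ Y₁ Y₂ ≫ tensorμ X₁ Y₁ X₂ Y₂ = 𝟙 _ := by
  have : tensorμ X₁ Y₁ X₂ Y₂ = tensorδ X₁ X₂ Y₁ Y₂ := by
    simp only [tensorμ, tensorδ, ← SymmetricCategory.braiding_swap_eq_inv_braiding X₂ Y₁]
  rw [this, tensorμ_tensorδ]

lemma braiding_tensorμ (X₁ X₂ Y₁ Y₂ : C) :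
    (β_ (X₁ ⊗ X₂) (Y₁ ⊗ Y₂)).hom ≫ tensorμ Y₁ Y₂ X₁ X₂ =
      tensorμ X₁ X₂ Y₁ Y₂ ≫ ((β_ X₁ Y₁).hom ⊗ₘ (β_ X₂ Y₂).hom) := by
  simp [tensorμ, SymmetricCategory.braiding_swap_eq_inv_braiding Y₂ X₁,
    MonoidalCategory.tensorHom_def]

/-- Follows from `braiding_tensorμ` by composing with `tensorμ` on both sides. It is what makes the
braiding of a functor category compatible with pointwise sums. -/
lemma tensorμ_braiding (X₁ X₂ Y₁ Y₂ : C) :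
    tensorμ X₁ X₂ Y₁ Y₂ ≫ (β_ (X₁ ⊗ Y₁) (X₂ ⊗ Y₂)).hom =
      ((β_ X₁ X₂).hom ⊗ₘ (β_ Y₁ Y₂).hom) ≫ tensorμ X₂ X₁ Y₂ Y₁ := by
  have h := braiding_tensorμ X₁ Y₁ X₂ Y₂
  have h' := congrArg (fun t => tensorμ X₁ X₂ Y₁ Y₂ ≫ t ≫ tensorμ X₂ X₁ Y₂ Y₁) h
  simpa [tensorμ_tensorμ, reassoc_of% tensorμ_tensorμ Y₁ Y₂ X₁ X₂, reassoc_of% tensorμ_tensorμ X₁ X₂ Y₁ Y₂, reassoc_of% tensorμ_tensorμ X₁ Y₁ X₂ Y₂] using h'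

/-- The sum of two sums. -/
abbrev addSum {x x' y y' s s' : C} (a : x ⊗ y ⟶ s) (b : x' ⊗ y' ⟶ s') :
    (x ⊗ x') ⊗ (y ⊗ y') ⟶ s ⊗ s' := tensorμ x x' y y' ≫ (a ⊗ₘ b)

lemma addSum_map {x x' y y' s s' z z' w w' t t' : C} {a : x ⊗ y ⟶ s} {b : x' ⊗ y' ⟶ s'}
    {c : z ⊗ w ⟶ t} {d : z' ⊗ w' ⟶ t'} {p : x ⟶ z} {q : y ⟶ w} {r : s ⟶ t} {p' : x' ⟶ z'}
    {q' : y' ⟶ w'} {r' : s' ⟶ t'} (h : a ≫ r = (p ⊗ₘ q) ≫ c) (h' : b ≫ r' = (p' ⊗ₘ q') ≫ d) :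
    addSum a b ≫ (r ⊗ₘ r') = ((p ⊗ₘ p') ⊗ₘ (q ⊗ₘ q')) ≫ addSum c d := by
  simp only [addSum, assoc, tensorHom_comp_tensorHom]
  rw [h, h', ← tensorHom_comp_tensorHom, ← tensorμ_natural_assoc]

/-- The tensor product C × C ⥤ C is itself a monoidal functor with constraint `tensorμ`; its
associativity axiom `tensor_associativity` reduces the claim to the two factors. -/
lemma addSum_assoc {x y z s t w x' y' z' s' t' w' : C} {a : x ⊗ y ⟶ s} {b : s ⊗ z ⟶ w}
    {c : y ⊗ z ⟶ t} {d : x ⊗ t ⟶ w} {a' : x' ⊗ y' ⟶ s'} {b' : s' ⊗ z' ⟶ w'} {c' : y' ⊗ z' ⟶ t'}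
    {d' : x' ⊗ t' ⟶ w'} (h : (a ▷ z) ≫ b = (α_ x y z).hom ≫ (x ◁ c) ≫ d)
    (h' : (a' ▷ z') ≫ b' = (α_ x' y' z').hom ≫ (x' ◁ c') ≫ d') :
    (addSum a a' ▷ (z ⊗ z')) ≫ addSum b b' =
      (α_ _ _ _).hom ≫ ((x ⊗ x') ◁ addSum c c') ≫ addSum d d' := by
  simp only [addSum, comp_whiskerRight, assoc, MonoidalCategory.whiskerLeft_comp]
  rw [tensorμ_natural_left_assoc, tensorHom_comp_tensorHom, h, h',
    ← tensorHom_comp_tensorHom, ← tensorHom_comp_tensorHom, tensor_associativity_assoc,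
    tensorμ_natural_right_assoc]

lemma addSum_comm {x y s x' y' s' : C} {a : x ⊗ y ⟶ s} {b : y ⊗ x ⟶ s} {a' : x' ⊗ y' ⟶ s'}
    {b' : y' ⊗ x' ⟶ s'} (h : (β_ x y).hom ≫ b = a) (h' : (β_ x' y').hom ≫ b' = a') :
    (β_ (x ⊗ x') (y ⊗ y')).hom ≫ addSum b b' = addSum a a' := by
  rw [addSum, reassoc_of% braiding_tensorμ x x' y y', tensorHom_comp_tensorHom, h, h']

/-- This lemma and those for the unitors and the braiding say that the structural isomorphisms of a
functor category respect pointwise sums, hence are morphisms of additive functors. -/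
lemma addSum_associator {x y s x' y' s' x'' y'' s'' : C} (a : x ⊗ y ⟶ s) (b : x' ⊗ y' ⟶ s')
    (c : x'' ⊗ y'' ⟶ s'') :
    addSum (addSum a b) c ≫ (α_ s s' s'').hom =
      ((α_ x x' x'').hom ⊗ₘ (α_ y y' y'').hom) ≫ addSum a (addSum b c) := by
  have := associator_monoidal x x' x'' y y' y''
  have e : (addSum a b ⊗ₘ c) = (tensorμ x x' y y' ▷ (x'' ⊗ y'')) ≫ ((a ⊗ₘ b) ⊗ₘ c) := by
    rw [← tensorHom_id, tensorHom_comp_tensorHom, id_comp]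
  have e' : (a ⊗ₘ addSum b c) = ((x ⊗ y) ◁ tensorμ x' x'' y' y'') ≫ (a ⊗ₘ (b ⊗ₘ c)) := by
    rw [← id_tensorHom, tensorHom_comp_tensorHom, id_comp]
  rw [addSum, e, addSum, e', assoc, assoc, associator_naturality, reassoc_of% this]

lemma addSum_leftUnitor {x y s : C} (a : x ⊗ y ⟶ s) :
    addSum (λ_ (𝟙_ C)).hom a ≫ (λ_ s).hom = ((λ_ x).hom ⊗ₘ (λ_ y).hom) ≫ a := by
  rw [leftUnitor_monoidal, addSum, assoc, assoc, MonoidalCategory.tensorHom_def, assoc,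
    leftUnitor_naturality, assoc]

lemma addSum_rightUnitor {x y s : C} (a : x ⊗ y ⟶ s) :
    addSum a (λ_ (𝟙_ C)).hom ≫ (ρ_ s).hom = ((ρ_ x).hom ⊗ₘ (ρ_ y).hom) ≫ a := by
  rw [rightUnitor_monoidal, addSum, assoc, assoc, MonoidalCategory.tensorHom_def', assoc,
    rightUnitor_naturality, assoc]

lemma addSum_braiding {x y s x' y' s' : C} (a : x ⊗ y ⟶ s) (b : x' ⊗ y' ⟶ s') :
    addSum a b ≫ (β_ s s').hom = ((β_ x x').hom ⊗ₘ (β_ y y').hom) ≫ addSum b a := by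
  rw [addSum, assoc, BraidedCategory.braiding_naturality, reassoc_of% tensorμ_braiding x x' y y']

lemma addSum_unit_comm : (β_ (𝟙_ C) (𝟙_ C)).hom ≫ (λ_ (𝟙_ C)).hom = (λ_ (𝟙_ C)).hom := by
  rw [braiding_leftUnitor, unitors_equal]

end Coherence

/-! ### Categories with sums, and the symmetric monoidal groupoid of additive functors. -/

/-- A small category with a notion of sums. -/
structure SumCat : Type (u + 1) where
  carrier : Type u
  [cat : SmallCategory carrier]
  Sum : carrier → carrier → carrier → Type u
  IsMap {x y s x' y' s' : carrier} :
    Sum x y s → Sum x' y' s' → (x ⟶ x') → (y ⟶ y') → (s ⟶ s') → Prop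
  IsAssoc {x y z s t w : carrier} : Sum x y s → Sum s z w → Sum y z t → Sum x t w → Prop
  IsComm {x y s : carrier} : Sum x y s → Sum y x s → Prop
  isMap_id {x y s : carrier} (σ : Sum x y s) : IsMap σ σ (𝟙 x) (𝟙 y) (𝟙 s)

instance : CoeSort SumCat.{u} (Type u) := ⟨SumCat.carrier⟩

attribute [instance] SumCat.cat

/-- The sums `x ⊗ y ⟶ s` in a Picard groupoid. -/
abbrev SumCat.ofPic (A : PicCat.{u}) : SumCat.{u} where
  carrier := A
  Sum x y s := x ⊗ y ⟶ s
  IsMap σ σ' p q r := σ ≫ r = (p ⊗ₘ q) ≫ σ'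
  IsAssoc {x y z s t w} σ₁ σ₂ σ₃ σ₄ := (σ₁ ▷ z) ≫ σ₂ = (α_ x y z).hom ≫ (x ◁ σ₃) ≫ σ₄
  IsComm {x y s} σ σ' := (β_ x y).hom ≫ σ' = σ
  isMap_id := by simp

/-- A functor from a category with sums to a Picard groupoid, compatible with sums. -/
structure AddFunctor (Z : SumCat.{u}) (P : PicCat.{u}) where
  functor : Z ⥤ P
  sum {x y s : Z} (σ : Z.Sum x y s) : functor.obj x ⊗ functor.obj y ⟶ functor.obj s
  sum_map {x y s x' y' s' : Z} (σ : Z.Sum x y s) (σ' : Z.Sum x' y' s') (p : x ⟶ x') (q : y ⟶ y')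
    (r : s ⟶ s') : Z.IsMap σ σ' p q r →
    sum σ ≫ functor.map r = (functor.map p ⊗ₘ functor.map q) ≫ sum σ'
  sum_assoc {x y z s t w : Z} (σ₁ : Z.Sum x y s) (σ₂ : Z.Sum s z w) (σ₃ : Z.Sum y z t)
    (σ₄ : Z.Sum x t w) : Z.IsAssoc σ₁ σ₂ σ₃ σ₄ →
    (sum σ₁ ▷ functor.obj z) ≫ sum σ₂ =
      (α_ (functor.obj x) (functor.obj y) (functor.obj z)).hom ≫
        (functor.obj x ◁ sum σ₃) ≫ sum σ₄
  sum_comm {x y s : Z} (σ : Z.Sum x y s) (σ' : Z.Sum y x s) : Z.IsComm σ σ' →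
    (β_ (functor.obj x) (functor.obj y)).hom ≫ sum σ' = sum σ

namespace AddFunctor

variable {Z : SumCat.{u}} {P : PicCat.{u}}

/-- Natural transformations compatible with sums. -/
@[ext]
structure Hom (F G : AddFunctor Z P) where
  natTrans : F.functor ⟶ G.functor
  comm {x y s : Z} (σ : Z.Sum x y s) :
    F.sum σ ≫ natTrans.app s = (natTrans.app x ⊗ₘ natTrans.app y) ≫ G.sum σ

instance : Category (AddFunctor Z P) where
  Hom := Hom
  id F := { natTrans := 𝟙 _, comm := by simp }
  comp f g :=
    { natTrans := f.natTrans ≫ g.natTrans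
      comm := fun σ => by
        rw [NatTrans.comp_app, NatTrans.comp_app, NatTrans.comp_app, ← assoc, f.comm, assoc,
          g.comm, ← assoc, tensorHom_comp_tensorHom] }

@[simp] lemma id_natTrans (F : AddFunctor Z P) : Hom.natTrans (𝟙 F) = 𝟙 F.functor := rfl

@[simp] lemma comp_natTrans {F G H : AddFunctor Z P} (f : F ⟶ G) (g : G ⟶ H) :
    Hom.natTrans (f ≫ g) = f.natTrans ≫ g.natTrans := rfl

@[ext]
lemma hom_ext {F G : AddFunctor Z P} {f g : F ⟶ G}
    (h : ∀ x, f.natTrans.app x = g.natTrans.app x) : f = g :=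
  Hom.ext (NatTrans.ext (funext h))

/-- An isomorphism of functors compatible with sums. -/
def mkIso {F G : AddFunctor Z P} (e : F.functor ≅ G.functor)
    (h : ∀ {x y s : Z} (σ : Z.Sum x y s),
      F.sum σ ≫ e.hom.app s = (e.hom.app x ⊗ₘ e.hom.app y) ≫ G.sum σ) : F ≅ G where
  hom := { natTrans := e.hom, comm := h }
  inv :=
    { natTrans := e.inv
      comm := fun {x y s} σ => by
        rw [← cancel_mono (e.hom.app s), assoc, assoc, h]
        simp }
  hom_inv_id := Hom.ext e.hom_inv_id
  inv_hom_id := Hom.ext e.inv_hom_id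

instance : IsGroupoid (AddFunctor Z P) where
  all_isIso {F G} f := by
    have : ∀ x, IsIso (f.natTrans.app x) := fun x => inferInstance
    have : IsIso f.natTrans := NatIso.isIso_of_isIso_app _
    exact (mkIso (asIso f.natTrans) f.comm).isIso_hom

/-- The pointwise sum. -/
def tensorObj (F G : AddFunctor Z P) : AddFunctor Z P where
  functor := F.functor ⊗ G.functor
  sum {x y s} σ := addSum (F.sum σ) (G.sum σ)
  sum_map σ σ' p q r h := addSum_map (F.sum_map σ σ' p q r h) (G.sum_map σ σ' p q r h)
  sum_assoc σ₁ σ₂ σ₃ σ₄ h := addSum_assoc (F.sum_assoc σ₁ σ₂ σ₃ σ₄ h) (G.sum_assoc σ₁ σ₂ σ₃ σ₄ h)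
  sum_comm σ σ' h := addSum_comm (F.sum_comm σ σ' h) (G.sum_comm σ σ' h)

variable (Z P) in
/-- The zero functor. -/
def tensorUnit : AddFunctor Z P where
  functor := 𝟙_ (Z ⥤ P)
  sum σ := (λ_ (𝟙_ P)).hom
  sum_map σ σ' p q r h := by simp
  sum_assoc {x y z s t w} σ₁ σ₂ σ₃ σ₄ h := by
    simp only [Monoidal.tensorUnit_obj]
    monoidal
  sum_comm {x y s} σ σ' h := addSum_unit_comm

instance : MonoidalCategoryStruct (AddFunctor Z P) where
  tensorObj := tensorObj
  tensorHom f g :=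
    { natTrans := f.natTrans ⊗ₘ g.natTrans
      comm := fun σ => addSum_map (f.comm σ) (g.comm σ) }
  whiskerLeft F {G H} f :=
    { natTrans := F.functor ◁ f.natTrans
      comm := fun {x y s} σ => by
        have := addSum_map (C := P) (a := F.sum σ) (c := F.sum σ) (p := 𝟙 _) (q := 𝟙 _) (r := 𝟙 _)
          (by simp) (f.comm σ)
        rw [id_tensorHom, id_tensorHom, id_tensorHom] at this
        exact this }
  whiskerRight {F G} f H :=
    { natTrans := f.natTrans ▷ H.functor
      comm := fun {x y s} σ => by
        have := addSum_map (C := P) (b := H.sum σ) (d := H.sum σ) (p' := 𝟙 _) (q' := 𝟙 _)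
          (r' := 𝟙 _) (f.comm σ) (by simp)
        rw [tensorHom_id, tensorHom_id, tensorHom_id] at this
        exact this }
  tensorUnit := tensorUnit Z P
  associator F G H := mkIso (α_ F.functor G.functor H.functor)
    (fun σ => addSum_associator (F.sum σ) (G.sum σ) (H.sum σ))
  leftUnitor F := mkIso (λ_ F.functor) (fun σ => addSum_leftUnitor (F.sum σ))
  rightUnitor F := mkIso (ρ_ F.functor) (fun σ => addSum_rightUnitor (F.sum σ))

/-- A morphism of additive functors is determined by its natural transformation, so every axiom is
inherited from the functor category `Z ⥤ P`. The same applies to the symmetry. -/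
instance : MonoidalCategory (AddFunctor Z P) where
  tensorHom_def f g := Hom.ext (MonoidalCategory.tensorHom_def f.natTrans g.natTrans)
  id_tensorHom_id F G := Hom.ext (id_tensorHom_id F.functor G.functor)
  tensorHom_comp_tensorHom f g h k := Hom.ext
    (tensorHom_comp_tensorHom f.natTrans g.natTrans h.natTrans k.natTrans)
  whiskerLeft_id F G := Hom.ext (MonoidalCategory.whiskerLeft_id F.functor G.functor)
  id_whiskerRight F G := Hom.ext (MonoidalCategory.id_whiskerRight F.functor G.functor)
  associator_naturality f g h := Hom.ext
    (associator_naturality f.natTrans g.natTrans h.natTrans)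
  leftUnitor_naturality f := Hom.ext (leftUnitor_naturality f.natTrans)
  rightUnitor_naturality f := Hom.ext (rightUnitor_naturality f.natTrans)
  pentagon F G H K := Hom.ext (pentagon F.functor G.functor H.functor K.functor)
  triangle F G := Hom.ext (triangle F.functor G.functor)

instance : SymmetricCategory (AddFunctor Z P) where
  braiding F G := mkIso (β_ F.functor G.functor) (fun σ => addSum_braiding (F.sum σ) (G.sum σ))
  braiding_naturality_right F _ _ f := Hom.ext
    (BraidedCategory.braiding_naturality_right F.functor f.natTrans)
  braiding_naturality_left f F := Hom.ext
    (BraidedCategory.braiding_naturality_left f.natTrans F.functor)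
  hexagon_forward F G H := Hom.ext (BraidedCategory.hexagon_forward F.functor G.functor H.functor)
  hexagon_reverse F G H := Hom.ext (BraidedCategory.hexagon_reverse F.functor G.functor H.functor)
  symmetry F G := Hom.ext (SymmetricCategory.symmetry F.functor G.functor)

instance (x : P) : (tensorLeft x).IsEquivalence := P.groupLike x

lemma whiskerLeft_injective' (x : P) {y z : P} {f g : y ⟶ z} (h : x ◁ f = x ◁ g) : f = g :=
  (tensorLeft x).map_injective h

lemma whiskerLeft_surjective (x : P) {y z : P} (f : x ⊗ y ⟶ x ⊗ z) : ∃ g : y ⟶ z, x ◁ g = f :=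
  (tensorLeft x).map_surjective f

lemma tensorHom_right_injective {x y z w : P} {f : x ⟶ y} {g g' : z ⟶ w}
    (h : f ⊗ₘ g = f ⊗ₘ g') : g = g' := by
  refine whiskerLeft_injective' y ?_
  rwa [MonoidalCategory.tensorHom_def, MonoidalCategory.tensorHom_def, cancel_epi] at h

/-- Tensoring with `s` is full and all morphisms of `P` are invertible, so the second summand can be
solved for. This yields the sums of a quotient of two additive functors. -/
lemma addSum_surjective {x x' y y' s s' : P} (a : x ⊗ y ⟶ s)
    (c : (x ⊗ x') ⊗ (y ⊗ y') ⟶ s ⊗ s') : ∃ b : x' ⊗ y' ⟶ s', addSum a b = c := by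
  obtain ⟨b, hb⟩ := whiskerLeft_surjective s (inv (a ▷ (x' ⊗ y')) ≫ inv (tensorμ x x' y y') ≫ c)
  exact ⟨b, by simp [addSum, MonoidalCategory.tensorHom_def, hb]⟩

end AddFunctor

/-- Associativity survives the replacement of all six objects by isomorphic ones. It serves for
functors whose values are only chosen up to isomorphism. -/
lemma assoc_conj {C : Type*} [Category C] [MonoidalCategory C] {x y z s t w x' y' z' s' t' w' : C}
    (ex : x' ≅ x) (ey : y' ≅ y) (ez : z' ≅ z) (es : s' ≅ s) (et : t' ≅ t) (ew : w' ≅ w)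
    {a : x ⊗ y ⟶ s} {b : s ⊗ z ⟶ w} {c : y ⊗ z ⟶ t} {d : x ⊗ t ⟶ w}
    (h : (a ▷ z) ≫ b = (α_ x y z).hom ≫ (x ◁ c) ≫ d) :
    (((ex.hom ⊗ₘ ey.hom) ≫ a ≫ es.inv) ▷ z') ≫ (es.hom ⊗ₘ ez.hom) ≫ b ≫ ew.inv =
      (α_ x' y' z').hom ≫ (x' ◁ ((ey.hom ⊗ₘ ez.hom) ≫ c ≫ et.inv)) ≫
        (ex.hom ⊗ₘ et.hom) ≫ d ≫ ew.inv := by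
  have e₁ : (((ex.hom ⊗ₘ ey.hom) ≫ a ≫ es.inv) ▷ z') ≫ (es.hom ⊗ₘ ez.hom) =
      ((ex.hom ⊗ₘ ey.hom) ⊗ₘ ez.hom) ≫ (a ▷ z) := by
    rw [← tensorHom_id, ← tensorHom_id, tensorHom_comp_tensorHom, tensorHom_comp_tensorHom]
    simp
  have e₂ : (x' ◁ ((ey.hom ⊗ₘ ez.hom) ≫ c ≫ et.inv)) ≫ (ex.hom ⊗ₘ et.hom) =
      (ex.hom ⊗ₘ (ey.hom ⊗ₘ ez.hom)) ≫ (x ◁ c) := by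
    rw [← id_tensorHom, ← id_tensorHom, tensorHom_comp_tensorHom, tensorHom_comp_tensorHom]
    simp
  rw [reassoc_of% e₁, reassoc_of% e₂, reassoc_of% h, associator_naturality_assoc]

/-! ### Division by an additive functor, composition, and universality. -/

namespace AddFunctor

variable {Z : SumCat.{u}} {P : PicCat.{u}}

/-- A law that holds for a pointwise sum and for its first summand holds for the second, because
tensoring with a morphism of `P` reflects equalities. The next two lemmas do the same for
commutativity and for morphisms. -/
lemma addSum_assoc_cancel {x y z s t w x' y' z' s' t' w' : P} {a : x ⊗ y ⟶ s} {b : s ⊗ z ⟶ w}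
    {c : y ⊗ z ⟶ t} {d : x ⊗ t ⟶ w} {a' : x' ⊗ y' ⟶ s'} {b' : s' ⊗ z' ⟶ w'} {c' : y' ⊗ z' ⟶ t'}
    {d' : x' ⊗ t' ⟶ w'} (h : (a ▷ z) ≫ b = (α_ x y z).hom ≫ (x ◁ c) ≫ d)
    (h' : (addSum a a' ▷ (z ⊗ z')) ≫ addSum b b' =
      (α_ _ _ _).hom ≫ ((x ⊗ x') ◁ addSum c c') ≫ addSum d d') :
    (a' ▷ z') ≫ b' = (α_ x' y' z').hom ≫ (x' ◁ c') ≫ d' := by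
  simp only [addSum, comp_whiskerRight, assoc, MonoidalCategory.whiskerLeft_comp] at h'
  rw [tensorμ_natural_left_assoc, tensorHom_comp_tensorHom, tensorμ_natural_right_assoc,
    ← tensor_associativity_assoc, tensorHom_comp_tensorHom, tensorHom_comp_tensorHom,
    cancel_epi, cancel_epi, h] at h'
  exact tensorHom_right_injective h'

lemma addSum_comm_cancel {x y s x' y' s' : P} {a : x ⊗ y ⟶ s} {b : y ⊗ x ⟶ s} {a' : x' ⊗ y' ⟶ s'}
    {b' : y' ⊗ x' ⟶ s'} (h : (β_ x y).hom ≫ b = a)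
    (h' : (β_ (x ⊗ x') (y ⊗ y')).hom ≫ addSum b b' = addSum a a') :
    (β_ x' y').hom ≫ b' = a' := by
  rw [addSum, reassoc_of% braiding_tensorμ, tensorHom_comp_tensorHom, cancel_epi, h] at h'
  exact tensorHom_right_injective h'

lemma addSum_map_cancel {x x' y y' s s' z z' w w' t t' : P} {a : x ⊗ y ⟶ s} {b : x' ⊗ y' ⟶ s'}
    {c : z ⊗ w ⟶ t} {d : z' ⊗ w' ⟶ t'} {p : x ⟶ z} {q : y ⟶ w} {r : s ⟶ t} {p' : x' ⟶ z'}
    {q' : y' ⟶ w'} {r' : s' ⟶ t'} (h : a ≫ r = (p ⊗ₘ q) ≫ c)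
    (h' : addSum a b ≫ (r ⊗ₘ r') = ((p ⊗ₘ p') ⊗ₘ (q ⊗ₘ q')) ≫ addSum c d) :
    b ≫ r' = (p' ⊗ₘ q') ≫ d := by
  simp only [addSum, assoc, tensorHom_comp_tensorHom] at h'
  rw [h, tensorμ_natural_assoc, cancel_epi, tensorHom_comp_tensorHom] at h'
  exact tensorHom_right_injective h'

lemma tensorHom_right_surjective {x y z w : P} (f : x ⟶ y) (c : x ⊗ z ⟶ y ⊗ w) :
    ∃ g : z ⟶ w, f ⊗ₘ g = c := by
  obtain ⟨g, hg⟩ := whiskerLeft_surjective y (inv (f ▷ z) ≫ c)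
  exact ⟨g, by simp [MonoidalCategory.tensorHom_def, hg]⟩

instance (F : AddFunctor Z P) : (tensorLeft F).Faithful where
  map_injective {G H f g} h := hom_ext fun x =>
    whiskerLeft_injective' (F.functor.obj x) (congrArg (fun t => t.natTrans.app x) h)

/-- A transformation F ⊗ G ⟶ F ⊗ H is divided by `F` object by object; cancelling `F` then gives the
naturality and the additivity of the quotient. -/
instance (F : AddFunctor Z P) : (tensorLeft F).Full where
  map_surjective {G H} g := by
    have hb := fun x => whiskerLeft_surjective (F.functor.obj x) (g.natTrans.app x)
    choose b hb using hb
    refine ⟨{ natTrans := { app := b, naturality := fun x y p => ?_ }, comm := fun {x y s} σ => ?_ },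
      hom_ext hb⟩
    · refine tensorHom_right_injective (f := F.functor.map p) ?_
      have := g.natTrans.naturality p
      rw [← hb, ← hb] at this
      change (F.functor.map p ⊗ₘ G.functor.map p) ≫ _ = _ ≫ (F.functor.map p ⊗ₘ H.functor.map p)
        at this
      rwa [← id_tensorHom, ← id_tensorHom, tensorHom_comp_tensorHom, tensorHom_comp_tensorHom,
        id_comp, comp_id] at this
    · have := g.comm σ
      rw [← hb, ← hb, ← hb] at this
      change addSum (F.sum σ) (G.sum σ) ≫ _ = _ ≫ addSum (F.sum σ) (H.sum σ) at this
      rw [← id_tensorHom, ← id_tensorHom, ← id_tensorHom] at this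
      exact addSum_map_cancel (by simp) this

/-- The quotient of `H` by `F`. Once objects with F x ⊗ G x ≅ H x are chosen, the morphisms and sums
of `G` are forced, and its laws follow from those of `F` and `H` by cancellation. -/
instance (F : AddFunctor Z P) : (tensorLeft F).EssSurj where
  mem_essImage H := by
    have hG : ∀ x, ∃ y, Nonempty (F.functor.obj x ⊗ y ≅ H.functor.obj x) := fun x =>
      ⟨_, ⟨(tensorLeft (F.functor.obj x)).objObjPreimageIso (H.functor.obj x)⟩⟩
    choose G e using hG
    replace e := fun x => (e x).some
    have hm : ∀ {x y} (p : x ⟶ y), ∃ m : G x ⟶ G y,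
        F.functor.map p ⊗ₘ m = (e x).hom ≫ H.functor.map p ≫ (e y).inv :=
      fun p => tensorHom_right_surjective _ _
    choose m hm using @hm
    have hs : ∀ {x y s} (σ : Z.Sum x y s), ∃ t : G x ⊗ G y ⟶ G s,
        addSum (F.sum σ) t = ((e x).hom ⊗ₘ (e y).hom) ≫ H.sum σ ≫ (e s).inv :=
      fun σ => addSum_surjective _ _
    choose t ht using @hs
    let G' : AddFunctor Z P :=
      { functor :=
          { obj := G
            map := m
            map_id := fun x => tensorHom_right_injective (f := F.functor.map (𝟙 x)) (by
              rw [hm]; simp)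
            map_comp := fun {x y z} p q =>
              tensorHom_right_injective (f := F.functor.map (p ≫ q)) (by
                rw [hm, F.functor.map_comp, ← tensorHom_comp_tensorHom, hm, hm]; simp) }
        sum := t
        sum_map := fun {x y s x' y' s'} σ σ' p q r h =>
          addSum_map_cancel (F.sum_map σ σ' p q r h) (by
            change addSum (F.sum σ) (t σ) ≫ (F.functor.map r ⊗ₘ m r) =
              ((F.functor.map p ⊗ₘ m p) ⊗ₘ (F.functor.map q ⊗ₘ m q)) ≫ addSum (F.sum σ') (t σ')
            rw [ht, ht, hm, hm, hm, assoc, assoc, Iso.inv_hom_id_assoc, reassoc_of%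
              H.sum_map σ σ' p q r h, tensorHom_comp_tensorHom_assoc,
              tensorHom_comp_tensorHom_assoc]
            simp)
        sum_assoc := fun {x y z s t' w} σ₁ σ₂ σ₃ σ₄ h =>
          addSum_assoc_cancel (F.sum_assoc σ₁ σ₂ σ₃ σ₄ h) (by
            change (addSum (F.sum σ₁) (t σ₁) ▷ _) ≫ addSum (F.sum σ₂) (t σ₂) =
              (α_ _ _ _).hom ≫ (_ ◁ addSum (F.sum σ₃) (t σ₃)) ≫ addSum (F.sum σ₄) (t σ₄)
            rw [ht, ht, ht, ht]
            exact assoc_conj (e x) (e y) (e z) (e s) (e t') (e w) (H.sum_assoc σ₁ σ₂ σ₃ σ₄ h))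
        sum_comm := fun {x y s} σ σ' h =>
          addSum_comm_cancel (F.sum_comm σ σ' h) (by
            change _ ≫ addSum (F.sum σ') (t σ') = addSum (F.sum σ) (t σ)
            rw [ht, ht, ← H.sum_comm σ σ' h, assoc,
              ← BraidedCategory.braiding_naturality_assoc]) }
    refine ⟨G', ⟨mkIso (F := F ⊗ G') (NatIso.ofComponents e fun {x y} p => ?_) fun {x y s} σ => ?_⟩⟩
    · change (F.functor.map p ⊗ₘ m p) ≫ (e y).hom = (e x).hom ≫ H.functor.map p
      simp [hm]
    · change addSum (F.sum σ) (t σ) ≫ (e s).hom = ((e x).hom ⊗ₘ (e y).hom) ≫ H.sum σ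
      simp [ht]

variable (Z P) in
/-- The Picard groupoid of additive functors. -/
abbrev pic : PicCat.{u} where
  carrier := AddFunctor Z P
  groupLike F := { }

/-- Composition of additive functors. -/
def comp {Q : PicCat.{u}} (Φ : AddFunctor Z Q) (G : AddFunctor (SumCat.ofPic Q) P) :
    AddFunctor Z P where
  functor := Φ.functor ⋙ G.functor
  sum σ := G.sum (Φ.sum σ)
  sum_map σ σ' p q r h := G.sum_map (Φ.sum σ) (Φ.sum σ') _ _ _ (Φ.sum_map σ σ' p q r h)
  sum_assoc σ₁ σ₂ σ₃ σ₄ h := G.sum_assoc (Φ.sum σ₁) (Φ.sum σ₂) (Φ.sum σ₃) (Φ.sum σ₄)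
    (Φ.sum_assoc σ₁ σ₂ σ₃ σ₄ h)
  sum_comm σ σ' h := G.sum_comm (Φ.sum σ) (Φ.sum σ') (Φ.sum_comm σ σ' h)

/-- Precomposition with an additive functor. -/
def precomp {Q : PicCat.{u}} (Φ : AddFunctor Z Q) (P : PicCat.{u}) :
    AddFunctor (SumCat.ofPic Q) P ⥤ AddFunctor Z P where
  obj G := Φ.comp G
  map γ :=
    { natTrans := Functor.whiskerLeft Φ.functor γ.natTrans
      comm := fun σ => γ.comm (Φ.sum σ) }

/-- Precomposition with an additive functor, as an additive functor. -/
def precompAdd {Q : PicCat.{u}} (Φ : AddFunctor Z Q) (P : PicCat.{u}) :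
    AddFunctor (SumCat.ofPic (pic (SumCat.ofPic Q) P)) (pic Z P) where
  functor := Φ.precomp P
  sum σ := (Φ.precomp P).map σ
  sum_map σ σ' p q r h := by
    have h : σ ≫ r = (p ⊗ₘ q) ≫ σ' := h
    exact hom_ext fun x => congrArg (fun t => t.natTrans.app (Φ.functor.obj x)) h
  sum_assoc {x y z s t w} σ₁ σ₂ σ₃ σ₄ h := by
    have h : (σ₁ ▷ z) ≫ σ₂ = (α_ x y z).hom ≫ (x ◁ σ₃) ≫ σ₄ := h
    exact hom_ext fun x => congrArg (fun t => t.natTrans.app (Φ.functor.obj x)) h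
  sum_comm {x y s} σ σ' h := by
    have h : (β_ x y).hom ≫ σ' = σ := h
    exact hom_ext fun x => congrArg (fun t => t.natTrans.app (Φ.functor.obj x)) h

/-- Every additive functor from the target of `Φ` is determined by its restriction along `Φ`. -/
def IsUniversal {Q : PicCat.{u}} (Φ : AddFunctor Z Q) : Prop :=
  ∀ P : PicCat.{u}, (Φ.precomp P).IsEquivalence

/-- An additive functor of Picard groupoids as a multiexact functor of one variable. -/
def toPicFunctor {Q : PicCat.{u}} (L : AddFunctor (SumCat.ofPic Q) P) :
    PicFunctor (fun _ : Unit => Q) P where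
  functor := Pi.eval _ () ⋙ L.functor
  sum i _ _ _ σ := L.sum σ.main

lemma toPicFunctor_isMultiexact {Q : PicCat.{u}} (L : AddFunctor (SumCat.ofPic Q) P) :
    L.toPicFunctor.IsMultiexact where
  naturality i _ _ _ _ _ _ σ σ' p q r h _ _ := L.sum_map σ.main σ'.main _ _ _ h
  associativity i _ _ _ _ _ _ σ₁ σ₂ σ₃ σ₄ h _ _ _ :=
    L.sum_assoc σ₁.main σ₂.main σ₃.main σ₄.main h
  commutativity i _ _ _ σ σ' h _ _ := L.sum_comm σ.main σ'.main h
  interchange i k hik := (hik rfl).elim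

/-- In a single variable interchange is no extra condition: it follows from associativity and
commutativity. The earlier lemma `PicFunctor.interchange_self` is applied to `L` regarded as a
multiexact functor over a one-point index set. -/
lemma sum_interchange {Q : PicCat.{u}} (L : AddFunctor (SumCat.ofPic Q) P)
    {x₀₀ x₁₀ x₀₁ x₁₁ s₀ s₁ t₀ t₁ w : Q} (σ₀ : x₀₀ ⊗ x₁₀ ⟶ s₀) (σ₁ : x₀₁ ⊗ x₁₁ ⟶ s₁)
    (σ : s₀ ⊗ s₁ ⟶ w) (τ₀ : x₀₀ ⊗ x₀₁ ⟶ t₀) (τ₁ : x₁₀ ⊗ x₁₁ ⟶ t₁) (τ : t₀ ⊗ t₁ ⟶ w)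
    (h : (σ₀ ⊗ₘ σ₁) ≫ σ = tensorμ _ _ _ _ ≫ (τ₀ ⊗ₘ τ₁) ≫ τ) :
    (L.sum σ₀ ⊗ₘ L.sum σ₁) ≫ L.sum σ =
      tensorμ _ _ _ _ ≫ (L.sum τ₀ ⊗ₘ L.sum τ₁) ≫ L.sum τ := by
  let f : ∀ {x y s : Q} (a : x ⊗ y ⟶ s), SumIn (fun _ : Unit => Q) () (fun _ => x) (fun _ => y)
    (fun _ => s) := fun a =>
      { main := a, fst := fun _ h => (h rfl).elim, snd := fun _ h => (h rfl).elim }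
  exact PicFunctor.interchange_self L.toPicFunctor_isMultiexact (l := ()) (f σ₀) (f σ₁) (f σ)
    (f τ₀) (f τ₁) (f τ) h (fun _ h => (h rfl).elim) (fun _ h => (h rfl).elim)
    (fun _ h => (h rfl).elim) (fun _ h => (h rfl).elim)

end AddFunctor

/-! ### Reflecting laws along a faithful additive functor. -/

namespace AddFunctor

variable {A B : PicCat.{u}} (L : AddFunctor (SumCat.ofPic A) B)

/-- All sums are determined by those at identities, that is, by the usual tensorators. -/
lemma sum_eq {x y s : A} (σ : x ⊗ y ⟶ s) :
    L.sum σ = L.sum (𝟙 (x ⊗ y)) ≫ L.functor.map σ := by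
  have := L.sum_map (𝟙 (x ⊗ y)) σ (𝟙 x) (𝟙 y) σ
    (show 𝟙 (x ⊗ y) ≫ σ = (𝟙 x ⊗ₘ 𝟙 y) ≫ σ by simp)
  rw [this]
  simp

lemma sum_injective [L.functor.Faithful] {x y s : A} {σ τ : x ⊗ y ⟶ s}
    (h : L.sum σ = L.sum τ) : σ = τ := by
  rw [sum_eq, sum_eq L τ, cancel_epi] at h
  exact L.functor.map_injective h

lemma sum_surjective [L.functor.Full] {x y s : A}
    (τ : L.functor.obj x ⊗ L.functor.obj y ⟶ L.functor.obj s) : ∃ σ : x ⊗ y ⟶ s, L.sum σ = τ := by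
  obtain ⟨σ, hσ⟩ := L.functor.map_surjective (inv (L.sum (𝟙 (x ⊗ y))) ≫ τ)
  exact ⟨σ, by rw [sum_eq, hσ, IsIso.hom_inv_id_assoc]⟩

lemma map_of_sum [L.functor.Faithful] {x y s x' y' s' : A} {σ : x ⊗ y ⟶ s} {σ' : x' ⊗ y' ⟶ s'}
    {p : x ⟶ x'} {q : y ⟶ y'} {r : s ⟶ s'}
    (h : L.sum σ ≫ L.functor.map r = (L.functor.map p ⊗ₘ L.functor.map q) ≫ L.sum σ') :
    σ ≫ r = (p ⊗ₘ q) ≫ σ' := by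
  refine L.sum_injective ?_
  have h₁ := L.sum_map σ (σ ≫ r) (𝟙 x) (𝟙 y) r (show σ ≫ r = (𝟙 x ⊗ₘ 𝟙 y) ≫ σ ≫ r by simp)
  have h₂ := L.sum_map ((p ⊗ₘ q) ≫ σ') σ' p q (𝟙 s')
    (show ((p ⊗ₘ q) ≫ σ') ≫ 𝟙 s' = (p ⊗ₘ q) ≫ σ' by simp)
  have k₁ : (L.functor.map (𝟙 x) ⊗ₘ L.functor.map (𝟙 y)) = 𝟙 _ :=
    (congrArg₂ (· ⊗ₘ ·) (L.functor.map_id x) (L.functor.map_id y)).trans (id_tensorHom_id _ _)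
  have k₂ : L.functor.map (𝟙 s') = 𝟙 _ := L.functor.map_id s'
  rw [k₁, id_comp] at h₁
  rw [k₂, comp_id] at h₂
  exact (h₁.symm.trans h).trans h₂.symm

lemma assoc_of_sum [L.functor.Faithful] {x y z s t w : A} {a : x ⊗ y ⟶ s} {b : s ⊗ z ⟶ w}
    {c : y ⊗ z ⟶ t} {d : x ⊗ t ⟶ w}
    (h : (L.sum a ▷ L.functor.obj z) ≫ L.sum b = (α_ _ _ _).hom ≫
      (L.functor.obj x ◁ L.sum c) ≫ L.sum d) :
    (a ▷ z) ≫ b = (α_ x y z).hom ≫ (x ◁ c) ≫ d := by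
  let d' : x ⊗ t ⟶ w := inv (x ◁ c) ≫ (α_ x y z).inv ≫ (a ▷ z) ≫ b
  have hd : (a ▷ z) ≫ b = (α_ x y z).hom ≫ (x ◁ c) ≫ d' := by simp [d']
  have h' := L.sum_assoc a b c d' hd
  rw [h, cancel_epi, cancel_epi] at h'
  rw [hd, L.sum_injective h']

lemma comm_of_sum [L.functor.Faithful] {x y s : A} {a : x ⊗ y ⟶ s} {b : y ⊗ x ⟶ s}
    (h : (β_ _ _).hom ≫ L.sum b = L.sum a) : (β_ x y).hom ≫ b = a :=
  L.sum_injective ((L.sum_comm ((β_ x y).hom ≫ b) b rfl).symm.trans h)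

lemma interchange_of_sum [L.functor.Faithful] {x₀₀ x₁₀ x₀₁ x₁₁ s₀ s₁ t₀ t₁ w : A}
    {σ₀ : x₀₀ ⊗ x₁₀ ⟶ s₀} {σ₁ : x₀₁ ⊗ x₁₁ ⟶ s₁} {σ : s₀ ⊗ s₁ ⟶ w} {τ₀ : x₀₀ ⊗ x₀₁ ⟶ t₀}
    {τ₁ : x₁₀ ⊗ x₁₁ ⟶ t₁} {τ : t₀ ⊗ t₁ ⟶ w}
    (h : (L.sum σ₀ ⊗ₘ L.sum σ₁) ≫ L.sum σ =
      tensorμ _ _ _ _ ≫ (L.sum τ₀ ⊗ₘ L.sum τ₁) ≫ L.sum τ) :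
    (σ₀ ⊗ₘ σ₁) ≫ σ = tensorμ _ _ _ _ ≫ (τ₀ ⊗ₘ τ₁) ≫ τ := by
  have : IsIso (tensorμ x₀₀ x₁₀ x₀₁ x₁₁) := inferInstance
  let τ' : t₀ ⊗ t₁ ⟶ w :=
    inv (τ₀ ⊗ₘ τ₁) ≫ inv (tensorμ x₀₀ x₁₀ x₀₁ x₁₁) ≫ (σ₀ ⊗ₘ σ₁) ≫ σ
  have hd : (σ₀ ⊗ₘ σ₁) ≫ σ = tensorμ _ _ _ _ ≫ (τ₀ ⊗ₘ τ₁) ≫ τ' := by simp [τ']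
  have h' := L.sum_interchange σ₀ σ₁ σ τ₀ τ₁ τ' hd
  rw [h, cancel_epi, cancel_epi] at h'
  rw [hd, L.sum_injective h']

end AddFunctor

/-! ### Functors additive in several variables. -/

section MultiAdd

variable {ι : Type}

/-- A sum of `x` and `y` in the `i`-th variable. -/
@[ext]
structure ElemSum (X : ι → SumCat.{u}) (i : ι) (x y s : ∀ j, X j) where
  main : (X i).Sum (x i) (y i) (s i)
  fst : ∀ j, j ≠ i → (x j ⟶ s j)
  snd : ∀ j, j ≠ i → (y j ⟶ s j)

/-- Functors of several variables which are additive in each variable, with interchange of the sums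
in two variables. -/
structure MultiAdd (X : ι → SumCat.{u}) (P : PicCat.{u}) where
  functor : (∀ i, X i) ⥤ P
  sum (i : ι) {x y s : ∀ j, X j} (σ : ElemSum X i x y s) :
    functor.obj x ⊗ functor.obj y ⟶ functor.obj s
  sum_map (i : ι) {x y s x' y' s' : ∀ j, X j} (σ : ElemSum X i x y s) (σ' : ElemSum X i x' y' s')
    (p : x ⟶ x') (q : y ⟶ y') (r : s ⟶ s') : (X i).IsMap σ.main σ'.main (p i) (q i) (r i) →
    (∀ j h, σ.fst j h ≫ r j = p j ≫ σ'.fst j h) → (∀ j h, σ.snd j h ≫ r j = q j ≫ σ'.snd j h) →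
    sum i σ ≫ functor.map r = (functor.map p ⊗ₘ functor.map q) ≫ sum i σ'
  sum_assoc (i : ι) {x y z s t w : ∀ j, X j} (σ₁ : ElemSum X i x y s)
    (σ₂ : ElemSum X i s z w) (σ₃ : ElemSum X i y z t) (σ₄ : ElemSum X i x t w) :
    (X i).IsAssoc σ₁.main σ₂.main σ₃.main σ₄.main →
    (∀ j h, σ₁.fst j h ≫ σ₂.fst j h = σ₄.fst j h) →
    (∀ j h, σ₁.snd j h ≫ σ₂.fst j h = σ₃.fst j h ≫ σ₄.snd j h) →
    (∀ j h, σ₂.snd j h = σ₃.snd j h ≫ σ₄.snd j h) →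
    (sum i σ₁ ▷ functor.obj z) ≫ sum i σ₂ =
      (α_ (functor.obj x) (functor.obj y) (functor.obj z)).hom ≫
        (functor.obj x ◁ sum i σ₃) ≫ sum i σ₄
  sum_comm (i : ι) {x y s : ∀ j, X j} (σ : ElemSum X i x y s) (σ' : ElemSum X i y x s) :
    (X i).IsComm σ.main σ'.main → (∀ j h, σ.fst j h = σ'.snd j h) →
    (∀ j h, σ.snd j h = σ'.fst j h) →
    (β_ (functor.obj x) (functor.obj y)).hom ≫ sum i σ' = sum i σ
  interchange (i k : ι) (hik : i ≠ k) {x₀₀ x₁₀ x₀₁ x₁₁ s₀ s₁ t₀ t₁ w : ∀ j, X j}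
    (σ₀ : ElemSum X i x₀₀ x₁₀ s₀) (σ₁ : ElemSum X i x₀₁ x₁₁ s₁) (σ : ElemSum X k s₀ s₁ w)
    (τ₀ : ElemSum X k x₀₀ x₀₁ t₀) (τ₁ : ElemSum X k x₁₀ x₁₁ t₁) (τ : ElemSum X i t₀ t₁ w) :
    (X i).IsMap σ₀.main τ.main (τ₀.fst i hik) (τ₁.fst i hik) (σ.fst i hik) →
    (X i).IsMap σ₁.main τ.main (τ₀.snd i hik) (τ₁.snd i hik) (σ.snd i hik) →
    (X k).IsMap τ₀.main σ.main (σ₀.fst k hik.symm) (σ₁.fst k hik.symm) (τ.fst k hik.symm) →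
    (X k).IsMap τ₁.main σ.main (σ₀.snd k hik.symm) (σ₁.snd k hik.symm) (τ.snd k hik.symm) →
    (∀ j (hi : j ≠ i) (hk : j ≠ k), σ₀.fst j hi ≫ σ.fst j hk = τ₀.fst j hk ≫ τ.fst j hi ∧
      σ₀.snd j hi ≫ σ.fst j hk = τ₁.fst j hk ≫ τ.snd j hi ∧
      σ₁.fst j hi ≫ σ.snd j hk = τ₀.snd j hk ≫ τ.fst j hi ∧
      σ₁.snd j hi ≫ σ.snd j hk = τ₁.snd j hk ≫ τ.snd j hi) →
    (sum i σ₀ ⊗ₘ sum i σ₁) ≫ sum k σ =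
      tensorμ (functor.obj x₀₀) (functor.obj x₁₀) (functor.obj x₀₁) (functor.obj x₁₁) ≫
        (sum k τ₀ ⊗ₘ sum k τ₁) ≫ sum i τ

namespace MultiAdd

variable {X : ι → SumCat.{u}} {P : PicCat.{u}}

/-- Natural transformations compatible with sums. -/
@[ext]
structure Hom (F G : MultiAdd X P) where
  natTrans : F.functor ⟶ G.functor
  comm (i : ι) {x y s : ∀ j, X j} (σ : ElemSum X i x y s) :
    F.sum i σ ≫ natTrans.app s = (natTrans.app x ⊗ₘ natTrans.app y) ≫ G.sum i σ

instance : Category (MultiAdd X P) where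
  Hom := Hom
  id F := { natTrans := 𝟙 _, comm := by simp }
  comp f g :=
    { natTrans := f.natTrans ≫ g.natTrans
      comm := fun i _ _ _ σ => by
        rw [NatTrans.comp_app, NatTrans.comp_app, NatTrans.comp_app, ← assoc, f.comm, assoc,
          g.comm, ← assoc, tensorHom_comp_tensorHom] }

@[simp] lemma id_natTrans (F : MultiAdd X P) : Hom.natTrans (𝟙 F) = 𝟙 F.functor := rfl

@[simp] lemma comp_natTrans {F G H : MultiAdd X P} (f : F ⟶ G) (g : G ⟶ H) :
    Hom.natTrans (f ≫ g) = f.natTrans ≫ g.natTrans := rfl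

@[ext]
lemma hom_ext {F G : MultiAdd X P} {f g : F ⟶ G}
    (h : ∀ x, f.natTrans.app x = g.natTrans.app x) : f = g :=
  Hom.ext (NatTrans.ext (funext h))

/-- An isomorphism of functors compatible with sums. -/
def mkIso {F G : MultiAdd X P} (e : F.functor ≅ G.functor)
    (h : ∀ (i : ι) {x y s : ∀ j, X j} (σ : ElemSum X i x y s),
      F.sum i σ ≫ e.hom.app s = (e.hom.app x ⊗ₘ e.hom.app y) ≫ G.sum i σ) : F ≅ G where
  hom := { natTrans := e.hom, comm := h }
  inv :=
    { natTrans := e.inv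
      comm := fun i {x y s} σ => by
        rw [← cancel_mono (e.hom.app s), assoc, assoc, h]
        simp }
  hom_inv_id := Hom.ext e.hom_inv_id
  inv_hom_id := Hom.ext e.inv_hom_id

lemma interchange_conj {C : Type*} [Category C] [MonoidalCategory C] [BraidedCategory C]
    {a b c d s s' t t' w a' b' c' d' r r' q q' w' : C}
    (ea : a' ≅ a) (eb : b' ≅ b) (ec : c' ≅ c) (ed : d' ≅ d) (es : r ≅ s) (es' : r' ≅ s')
    (et : q ≅ t) (et' : q' ≅ t') (ew : w' ≅ w)
    {σ₀ : a ⊗ b ⟶ s} {σ₁ : c ⊗ d ⟶ s'} {σ : s ⊗ s' ⟶ w} {τ₀ : a ⊗ c ⟶ t} {τ₁ : b ⊗ d ⟶ t'}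
    {τ : t ⊗ t' ⟶ w} (h : (σ₀ ⊗ₘ σ₁) ≫ σ = tensorμ a b c d ≫ (τ₀ ⊗ₘ τ₁) ≫ τ) :
    ((((ea.hom ⊗ₘ eb.hom) ≫ σ₀ ≫ es.inv) ⊗ₘ ((ec.hom ⊗ₘ ed.hom) ≫ σ₁ ≫ es'.inv)) ≫
      (es.hom ⊗ₘ es'.hom) ≫ σ ≫ ew.inv) = tensorμ a' b' c' d' ≫
      (((ea.hom ⊗ₘ ec.hom) ≫ τ₀ ≫ et.inv) ⊗ₘ ((eb.hom ⊗ₘ ed.hom) ≫ τ₁ ≫ et'.inv)) ≫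
        (et.hom ⊗ₘ et'.hom) ≫ τ ≫ ew.inv := by
  have e₁ : (((ea.hom ⊗ₘ eb.hom) ≫ σ₀ ≫ es.inv) ⊗ₘ ((ec.hom ⊗ₘ ed.hom) ≫ σ₁ ≫ es'.inv)) ≫
      (es.hom ⊗ₘ es'.hom) =
      ((ea.hom ⊗ₘ eb.hom) ⊗ₘ (ec.hom ⊗ₘ ed.hom)) ≫ (σ₀ ⊗ₘ σ₁) := by
    rw [tensorHom_comp_tensorHom, tensorHom_comp_tensorHom]
    simp
  have e₂ : (((ea.hom ⊗ₘ ec.hom) ≫ τ₀ ≫ et.inv) ⊗ₘ ((eb.hom ⊗ₘ ed.hom) ≫ τ₁ ≫ et'.inv)) ≫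
      (et.hom ⊗ₘ et'.hom) =
      ((ea.hom ⊗ₘ ec.hom) ⊗ₘ (eb.hom ⊗ₘ ed.hom)) ≫ (τ₀ ⊗ₘ τ₁) := by
    rw [tensorHom_comp_tensorHom, tensorHom_comp_tensorHom]
    simp
  rw [reassoc_of% e₁, reassoc_of% e₂, reassoc_of% h, tensorμ_natural_assoc]

/-! #### Postcomposition -/

section Postcomp

variable {A B : PicCat.{u}} (L : AddFunctor (SumCat.ofPic A) B)

/-- Postcomposition with an additive functor of Picard groupoids. -/
def postcompObj (F : MultiAdd X A) : MultiAdd X B where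
  functor := F.functor ⋙ L.functor
  sum i _ _ _ σ := L.sum (F.sum i σ)
  sum_map i x y s x' y' s' σ σ' p q r h h₁ h₂ :=
    L.sum_map (F.sum i σ) (F.sum i σ') (F.functor.map p) (F.functor.map q) (F.functor.map r)
      (F.sum_map i σ σ' p q r h h₁ h₂)
  sum_assoc i x y z s t w σ₁ σ₂ σ₃ σ₄ h h₁ h₂ h₃ :=
    L.sum_assoc (F.sum i σ₁) (F.sum i σ₂) (F.sum i σ₃) (F.sum i σ₄)
      (F.sum_assoc i σ₁ σ₂ σ₃ σ₄ h h₁ h₂ h₃)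
  sum_comm i x y s σ σ' h h₁ h₂ :=
    L.sum_comm (F.sum i σ) (F.sum i σ') (F.sum_comm i σ σ' h h₁ h₂)
  interchange i k hik _ _ _ _ _ _ _ _ _ σ₀ σ₁ σ τ₀ τ₁ τ h₁ h₂ h₃ h₄ h₅ :=
    L.sum_interchange _ _ _ _ _ _ (F.interchange i k hik σ₀ σ₁ σ τ₀ τ₁ τ h₁ h₂ h₃ h₄ h₅)

variable (X) in
/-- Postcomposition with an additive functor of Picard groupoids. -/
def postcomp : MultiAdd X A ⥤ MultiAdd X B where
  obj F := postcompObj L F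
  map {F G} γ :=
    { natTrans := Functor.whiskerRight γ.natTrans L.functor
      comm := fun i {x y s} σ => L.sum_map (F.sum i σ) (G.sum i σ) (γ.natTrans.app x)
        (γ.natTrans.app y) (γ.natTrans.app s) (γ.comm i σ) }

instance [L.functor.Faithful] : (postcomp X L).Faithful where
  map_injective {F G f g} h := hom_ext fun x =>
    L.functor.map_injective (congrArg (fun t => t.natTrans.app x) h)

instance [L.functor.Full] [L.functor.Faithful] : (postcomp X L).Full where
  map_surjective {F G} g := by
    have hm := fun x => L.functor.map_surjective (g.natTrans.app x)
    choose m hm using hm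
    let m' : F.functor ⟶ G.functor :=
      { app := m
        naturality := fun x y p => L.functor.map_injective (by
          rw [L.functor.map_comp, L.functor.map_comp, hm, hm]
          exact g.natTrans.naturality p) }
    have hc : ∀ i {x y s : ∀ j, X j} (σ : ElemSum X i x y s),
        F.sum i σ ≫ m'.app s = (m'.app x ⊗ₘ m'.app y) ≫ G.sum i σ := fun i _ _ _ σ =>
      L.map_of_sum (by
        rw [hm, hm, hm]
        exact g.comm i σ)
    exact ⟨Hom.mk m' hc, hom_ext hm⟩

/-- Objects are lifted along `L` up to isomorphism; full faithfulness then lifts the morphisms and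
sums uniquely, and the laws are reflected by the lemmas ending in `_of_sum`. -/
instance [L.functor.IsEquivalence] : (postcomp X L).EssSurj where
  mem_essImage G := by
    have hF : ∀ x, ∃ a, Nonempty (L.functor.obj a ≅ G.functor.obj x) := fun x =>
      ⟨_, ⟨L.functor.objObjPreimageIso (G.functor.obj x)⟩⟩
    choose F e using hF
    replace e := fun x => (e x).some
    have hm : ∀ {x y} (p : x ⟶ y), ∃ m : F x ⟶ F y,
        L.functor.map m = (e x).hom ≫ G.functor.map p ≫ (e y).inv :=
      fun p => L.functor.map_surjective _
    choose m hm using @hm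
    have hs : ∀ i {x y s} (σ : ElemSum X i x y s), ∃ t : F x ⊗ F y ⟶ F s,
        L.sum t = ((e x).hom ⊗ₘ (e y).hom) ≫ G.sum i σ ≫ (e s).inv :=
      fun i _ _ _ σ => AddFunctor.sum_surjective L _
    choose t ht using @hs
    let F' : MultiAdd X A :=
      { functor :=
          { obj := F
            map := m
            map_id := fun x => L.functor.map_injective (by rw [hm]; simp)
            map_comp := fun p q => L.functor.map_injective (by
              rw [hm, L.functor.map_comp, hm, hm]; simp) }
        sum := fun i {x y s} σ => t i σ
        sum_map := fun i {x y s x' y' s'} σ σ' p q r h h₁ h₂ => AddFunctor.map_of_sum L (by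
          have h := G.sum_map i σ σ' p q r h h₁ h₂
          rw [ht, ht, hm, hm, hm, assoc, assoc, Iso.inv_hom_id_assoc, reassoc_of% h,
            tensorHom_comp_tensorHom_assoc, tensorHom_comp_tensorHom_assoc]
          simp)
        sum_assoc := fun i {x y z s t' w} σ₁ σ₂ σ₃ σ₄ h h₁ h₂ h₃ => AddFunctor.assoc_of_sum L (by
          rw [ht, ht, ht, ht]
          exact assoc_conj (e x) (e y) (e z) (e s) (e t') (e w)
            (G.sum_assoc i σ₁ σ₂ σ₃ σ₄ h h₁ h₂ h₃))
        sum_comm := fun i {x y s} σ σ' h h₁ h₂ => AddFunctor.comm_of_sum L (by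
          rw [ht, ht, ← G.sum_comm i σ σ' h h₁ h₂, assoc,
            ← BraidedCategory.braiding_naturality_assoc])
        interchange := fun i k hik {a b c d s s' q q' w} σ₀ σ₁ σ τ₀ τ₁ τ h₁ h₂ h₃ h₄ h₅ =>
          AddFunctor.interchange_of_sum L (by
            rw [ht, ht, ht, ht, ht, ht]
            exact interchange_conj (e a) (e b) (e c) (e d) (e s) (e s') (e q) (e q') (e w)
              (G.interchange i k hik σ₀ σ₁ σ τ₀ τ₁ τ h₁ h₂ h₃ h₄ h₅)) }
    refine ⟨F', ⟨mkIso (F := postcompObj L F') (NatIso.ofComponents e fun {x y} p => ?_)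
      fun i {x y s} σ => ?_⟩⟩
    · change L.functor.map (m p) ≫ (e y).hom = (e x).hom ≫ G.functor.map p
      simp [hm]
    · change L.sum (t i σ) ≫ (e s).hom = ((e x).hom ⊗ₘ (e y).hom) ≫ G.sum i σ
      simp [ht]

instance [L.functor.IsEquivalence] : (postcomp X L).IsEquivalence where

end Postcomp

end MultiAdd

end MultiAdd

/-! ### Currying: singling out the variable `none`. -/

section Curry

variable {κ : Type} {X : Option κ → SumCat.{u}} {P : PicCat.{u}}

/-- A family indexed by `Option κ`. -/
abbrev optFam (c : X none) (y : ∀ k, X (some k)) : ∀ o, X o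
  | none => c
  | some k => y k

/-- A morphism of families indexed by `Option κ`. -/
abbrev optHom {x y : ∀ o, X o} (f : x none ⟶ y none) (g : ∀ k, x (some k) ⟶ y (some k)) : x ⟶ y
  | none => f
  | some k => g k

/-- A family of morphisms outside `none`. -/
def offNone {x y : ∀ o, X o} (g : ∀ k, x (some k) ⟶ y (some k)) : ∀ j, j ≠ none → (x j ⟶ y j)
  | none, h => (h rfl).elim
  | some k, _ => g k

/-- A family of morphisms outside `some k`. -/
def offSome {x y : ∀ o, X o} (k : κ) (f : x none ⟶ y none)
    (g : ∀ l, l ≠ k → (x (some l) ⟶ y (some l))) : ∀ j, j ≠ some k → (x j ⟶ y j)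
  | none, _ => f
  | some l, h => g l (fun e => h (congrArg some e))

/-- A sum in the variable `none`. -/
def noneSum (y : ∀ k, X (some k)) {c c' c'' : X none} (σ : (X none).Sum c c' c'') :
    ElemSum X none (optFam c y) (optFam c' y) (optFam c'' y) where
  main := σ
  fst := offNone (fun k => 𝟙 (y k))
  snd := offNone (fun k => 𝟙 (y k))

/-- A sum in the variable `some k`. -/
def someSum (c : X none) (k : κ) {x y s : ∀ k, X (some k)}
    (σ : ElemSum (fun k => X (some k)) k x y s) :
    ElemSum X (some k) (optFam c x) (optFam c y) (optFam c s) where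
  main := σ.main
  fst := offSome (X := X) (x := optFam c x) (y := optFam c s) k (𝟙 c) σ.fst
  snd := offSome (X := X) (x := optFam c y) (y := optFam c s) k (𝟙 c) σ.snd

namespace MultiAdd

/-- Fixing the variables other than `none`. -/
def curryObjObj (F : MultiAdd X P) (y : ∀ k, X (some k)) : AddFunctor (X none) P where
  functor :=
    { obj := fun c => F.functor.obj (optFam c y)
      map := fun {c c'} f => F.functor.map (optHom (x := optFam c y) (y := optFam c' y) f
        (fun k => 𝟙 (y k)))
      map_id := fun c => (congrArg F.functor.map (by ext (_ | k) <;> rfl)).trans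
        (F.functor.map_id _)
      map_comp := fun f g => (congrArg F.functor.map (by
        ext (_ | k)
        · rfl
        · exact (id_comp _).symm)).trans (F.functor.map_comp _ _) }
  sum σ := F.sum none (noneSum y σ)
  sum_map σ σ' p q r h := F.sum_map none _ _ _ _ _ h
    (by rintro (_ | k) h; exacts [(h rfl).elim, rfl])
    (by rintro (_ | k) h; exacts [(h rfl).elim, rfl])
  sum_assoc σ₁ σ₂ σ₃ σ₄ h := F.sum_assoc none _ _ _ _ h
    (by rintro (_ | k) h; exacts [(h rfl).elim, id_comp _])
    (by rintro (_ | k) h; exacts [(h rfl).elim, rfl])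
    (by rintro (_ | k) h; exacts [(h rfl).elim, (id_comp _).symm])
  sum_comm σ σ' h := F.sum_comm none _ _ h
    (by rintro (_ | k) h; exacts [(h rfl).elim, rfl])
    (by rintro (_ | k) h; exacts [(h rfl).elim, rfl])

lemma map_square' {K : Type} {R : K → SumCat.{u}} {E : PicCat.{u}} (H : (∀ k, R k) ⥤ E)
    {a b c d : ∀ k, R k} {p : a ⟶ b} {q : b ⟶ d} {r : a ⟶ c} {s : c ⟶ d}
    (h : ∀ k, p k ≫ q k = r k ≫ s k) : H.map p ≫ H.map q = H.map r ≫ H.map s := by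
  rw [← H.map_comp, ← H.map_comp]
  exact congrArg H.map (funext h)

/-- Fixing the variables other than `none`, on morphisms. -/
def curryObjMap (F : MultiAdd X P) {y y' : ∀ k, X (some k)} (g : y ⟶ y') :
    F.curryObjObj y ⟶ F.curryObjObj y' where
  natTrans :=
    { app := fun c => F.functor.map (optHom (x := optFam c y) (y := optFam c y') (𝟙 c) g)
      naturality := fun c c' f => map_square' F.functor (by
        rintro (_ | k)
        exacts [(comp_id _).trans (id_comp _).symm, (id_comp _).trans (comp_id _).symm]) }
  -- The sum in the variable `none` does not change, which is why a category with sums is required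
  -- to satisfy `isMap_id`.
  comm σ := F.sum_map none _ _ _ _ _ ((X none).isMap_id σ)
    (by rintro (_ | k) h; exacts [(h rfl).elim, (id_comp _).trans (comp_id _).symm])
    (by rintro (_ | k) h; exacts [(h rfl).elim, (id_comp _).trans (comp_id _).symm])

/-- The sums of the curried functor. -/
def currySum (F : MultiAdd X P) (k : κ) {x y s : ∀ k, X (some k)}
    (σ : ElemSum (fun k => X (some k)) k x y s) :
    F.curryObjObj x ⊗ F.curryObjObj y ⟶ F.curryObjObj s where
  natTrans :=
    { app := fun c => F.sum (some k) (someSum c k σ)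
      naturality := fun c c' f => (F.sum_map (some k) (someSum c k σ) (someSum c' k σ)
        (optHom (x := optFam c x) (y := optFam c' x) f (fun k => 𝟙 (x k)))
        (optHom (x := optFam c y) (y := optFam c' y) f (fun k => 𝟙 (y k)))
        (optHom (x := optFam c s) (y := optFam c' s) f (fun k => 𝟙 (s k)))
        ((X (some k)).isMap_id σ.main)
        (by
          rintro (_ | l) h
          exacts [(id_comp _).trans (comp_id _).symm, (comp_id _).trans (id_comp _).symm])
        (by
          rintro (_ | l) h
          exacts [(id_comp _).trans (comp_id _).symm, (comp_id _).trans (id_comp _).symm])).symm }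
  comm {c c' c''} τ := by
    -- Compatibility with the sums of the variable `none` is interchange for `some k` and `none`. So
    -- interchange is exactly what makes the curried sums morphisms of additive functors.
    have := F.interchange (some k) none (by simp) (someSum c k σ) (someSum c' k σ) (noneSum s τ)
      (noneSum x τ) (noneSum y τ) (someSum c'' k σ) ((X (some k)).isMap_id σ.main)
      ((X (some k)).isMap_id σ.main) ((X none).isMap_id τ) ((X none).isMap_id τ)
      (by
        rintro (_ | l) h h'
        · exact (h' rfl).elim
        · refine ⟨?_, ?_, ?_, ?_⟩ <;> exact (comp_id _).trans (id_comp _).symm)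
    exact (assoc _ _ _).trans this.symm

/-- Currying. -/
def curryObj (F : MultiAdd X P) :
    MultiAdd (fun k => X (some k)) (AddFunctor.pic (X none) P) where
  functor :=
    { obj := F.curryObjObj
      map := F.curryObjMap
      map_id := fun y => AddFunctor.hom_ext fun c =>
        (congrArg F.functor.map (by ext (_ | k) <;> rfl)).trans (F.functor.map_id _)
      map_comp := fun f g => AddFunctor.hom_ext fun c => (congrArg F.functor.map (by
        ext (_ | k)
        · exact (id_comp _).symm
        · rfl)).trans (F.functor.map_comp _ _) }
  sum k _ _ _ σ := F.currySum k σ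
  sum_map k {x y s x' y' s'} σ σ' p q r h h₁ h₂ := AddFunctor.hom_ext fun c =>
    F.sum_map (some k) _ _ _ _ _ h
      (by rintro (_ | l) h'; exacts [rfl, h₁ l _])
      (by rintro (_ | l) h'; exacts [rfl, h₂ l _])
  sum_assoc k {x y z s t w} σ₁ σ₂ σ₃ σ₄ h h₁ h₂ h₃ := AddFunctor.hom_ext fun c =>
    F.sum_assoc (some k) _ _ _ _ h
      (by rintro (_ | l) h'; exacts [id_comp _, h₁ l _])
      (by rintro (_ | l) h'; exacts [rfl, h₂ l _])
      (by rintro (_ | l) h'; exacts [(id_comp _).symm, h₃ l _])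
  sum_comm k {x y s} σ σ' h h₁ h₂ := AddFunctor.hom_ext fun c =>
    F.sum_comm (some k) _ _ h
      (by rintro (_ | l) h'; exacts [rfl, h₁ l _])
      (by rintro (_ | l) h'; exacts [rfl, h₂ l _])
  interchange i k hik {_ _ _ _ _ _ _ _ _} σ₀ σ₁ σ τ₀ τ₁ τ h₁ h₂ h₃ h₄ h₅ :=
    AddFunctor.hom_ext fun c => by
      have := F.interchange (some i) (some k) (fun e => hik (Option.some.inj e)) (someSum c i σ₀)
        (someSum c i σ₁) (someSum c k σ) (someSum c k τ₀) (someSum c k τ₁) (someSum c i τ) h₁ h₂ h₃ h₄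
        (by
          rintro (_ | l) h h'
          · exact ⟨rfl, rfl, rfl, rfl⟩
          · exact h₅ l _ _)
      exact this

end MultiAdd

end Curry

/-! ### Pasting lemmas for sums preceded by morphisms. -/

section Coherence

variable {C : Type*} [Category C] [MonoidalCategory C]

/-- An uncurried sum has the form `(f ⊗ₘ g) ≫ a`, with `f`, `g` coming from the other variables.
This and the following lemmas deduce a law for such composites from the law for `a` and some
commuting squares. -/
lemma map_of_parts {x y s x' y' s' z z' : C} {f : x ⟶ z} {g : y ⟶ z'} {a : z ⊗ z' ⟶ s} {r : s ⟶ s'}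
    {p : x ⟶ x'} {q : y ⟶ y'} {w w' : C} {f' : x' ⟶ w} {g' : y' ⟶ w'} {a' : w ⊗ w' ⟶ s'}
    {m : z ⟶ w} {n : z' ⟶ w'} (h : a ≫ r = (m ⊗ₘ n) ≫ a') (h₁ : f ≫ m = p ≫ f')
    (h₂ : g ≫ n = q ≫ g') : ((f ⊗ₘ g) ≫ a) ≫ r = (p ⊗ₘ q) ≫ (f' ⊗ₘ g') ≫ a' := by
  rw [assoc, h, tensorHom_comp_tensorHom_assoc, h₁, h₂, ← tensorHom_comp_tensorHom_assoc]

lemma map_of_parts' {x y s s' z z' : C} {f : x ⟶ z} {g : y ⟶ z'} {a : z ⊗ z' ⟶ s} {r : s ⟶ s'}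
    {w w' : C} {p : x ⟶ w} {q : y ⟶ w'} {a' : w ⊗ w' ⟶ s'} {m : z ⟶ w} {n : z' ⟶ w'}
    (h : a ≫ r = (m ⊗ₘ n) ≫ a') (h₁ : f ≫ m = p) (h₂ : g ≫ n = q) :
    ((f ⊗ₘ g) ≫ a) ≫ r = (p ⊗ₘ q) ≫ a' := by
  rw [assoc, h, tensorHom_comp_tensorHom_assoc, h₁, h₂]

lemma paste_squares {C : Type*} [Category C] {a b c d e f : C} {p : a ⟶ b} {q : b ⟶ c} {r : a ⟶ d}
    {s : b ⟶ e} {t : c ⟶ f} {m : d ⟶ e} {n : e ⟶ f} (h : p ≫ s = r ≫ m) (h' : q ≫ t = s ≫ n) :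
    (p ≫ q) ≫ t = r ≫ m ≫ n := by
  rw [assoc, h', reassoc_of% h]

lemma paste_maps {x y s x' y' s' x'' y'' s'' : C} {a : x ⊗ y ⟶ s} {a' : x' ⊗ y' ⟶ s'}
    {a'' : x'' ⊗ y'' ⟶ s''} {p : x ⟶ x'} {q : y ⟶ y'} {r : s ⟶ s'} {p' : x' ⟶ x''} {q' : y' ⟶ y''}
    {r' : s' ⟶ s''} (h : a ≫ r = (p ⊗ₘ q) ≫ a') (h' : a' ≫ r' = (p' ⊗ₘ q') ≫ a'') :
    a ≫ (r ≫ r') = ((p ≫ p') ⊗ₘ (q ≫ q')) ≫ a'' := by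
  rw [reassoc_of% h, h', tensorHom_comp_tensorHom_assoc]

lemma assoc_of_parts {x y z s t w x' y' z' s' t' : C} {a : x ⊗ y ⟶ s} {c : y ⊗ z ⟶ t}
    {f₂ : s ⟶ s'} {g₂ : z ⟶ z'} {f₄ : x ⟶ x'} {g₄ : t ⟶ t'} {v : y ⟶ y'} {A : x' ⊗ y' ⟶ s'}
    {B : s' ⊗ z' ⟶ w} {C' : y' ⊗ z' ⟶ t'} {D : x' ⊗ t' ⟶ w}
    (h : (A ▷ z') ≫ B = (α_ x' y' z').hom ≫ (x' ◁ C') ≫ D)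
    (h₁ : a ≫ f₂ = (f₄ ⊗ₘ v) ≫ A) (h₂ : c ≫ g₄ = (v ⊗ₘ g₂) ≫ C') :
    (a ▷ z) ≫ (f₂ ⊗ₘ g₂) ≫ B = (α_ x y z).hom ≫ (x ◁ c) ≫ (f₄ ⊗ₘ g₄) ≫ D := by
  have e₁ : (a ▷ z) ≫ (f₂ ⊗ₘ g₂) = ((f₄ ⊗ₘ v) ⊗ₘ g₂) ≫ (A ▷ z') := by
    rw [← tensorHom_id, ← tensorHom_id, tensorHom_comp_tensorHom, tensorHom_comp_tensorHom, h₁,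
      id_comp, comp_id]
  have e₂ : (x ◁ c) ≫ (f₄ ⊗ₘ g₄) = (f₄ ⊗ₘ (v ⊗ₘ g₂)) ≫ (x' ◁ C') := by
    rw [← id_tensorHom, ← id_tensorHom, tensorHom_comp_tensorHom, tensorHom_comp_tensorHom, h₂,
      id_comp, comp_id]
  rw [reassoc_of% e₁, reassoc_of% e₂, h, associator_naturality_assoc]

variable [SymmetricCategory C]

lemma comm_of_parts {x y s x' y' : C} {f : x ⟶ x'} {g : y ⟶ y'} {f' : y ⟶ y'} {g' : x ⟶ x'}
    {a : x' ⊗ y' ⟶ s} {a' : y' ⊗ x' ⟶ s} (h : (β_ x' y').hom ≫ a' = a) (h₁ : f = g') (h₂ : g = f') :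
    (β_ x y).hom ≫ (f' ⊗ₘ g') ≫ a' = (f ⊗ₘ g) ≫ a := by
  subst h₁ h₂
  rw [← BraidedCategory.braiding_naturality_assoc, h]

lemma interchange_of_parts {a b c d s s' t t' w a' b' c' d' r r' q q' : C}
    {σ₀ : a ⊗ b ⟶ s} {σ₁ : c ⊗ d ⟶ s'} {τ₀ : a ⊗ c ⟶ t} {τ₁ : b ⊗ d ⟶ t'}
    {f : s ⟶ r} {f' : s' ⟶ r'} {g : t ⟶ q} {g' : t' ⟶ q'} {σ : r ⊗ r' ⟶ w} {τ : q ⊗ q' ⟶ w}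
    {ua : a ⟶ a'} {ub : b ⟶ b'} {uc : c ⟶ c'} {ud : d ⟶ d'}
    {A₀ : a' ⊗ b' ⟶ r} {A₁ : c' ⊗ d' ⟶ r'} {B₀ : a' ⊗ c' ⟶ q} {B₁ : b' ⊗ d' ⟶ q'}
    (h : (A₀ ⊗ₘ A₁) ≫ σ = tensorμ a' b' c' d' ≫ (B₀ ⊗ₘ B₁) ≫ τ)
    (h₁ : σ₀ ≫ f = (ua ⊗ₘ ub) ≫ A₀) (h₂ : σ₁ ≫ f' = (uc ⊗ₘ ud) ≫ A₁)
    (h₃ : τ₀ ≫ g = (ua ⊗ₘ uc) ≫ B₀) (h₄ : τ₁ ≫ g' = (ub ⊗ₘ ud) ≫ B₁) :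
    (σ₀ ⊗ₘ σ₁) ≫ (f ⊗ₘ f') ≫ σ = tensorμ a b c d ≫ (τ₀ ⊗ₘ τ₁) ≫ (g ⊗ₘ g') ≫ τ := by
  rw [tensorHom_comp_tensorHom_assoc, tensorHom_comp_tensorHom_assoc, h₁, h₂, h₃, h₄,
    ← tensorHom_comp_tensorHom, ← tensorHom_comp_tensorHom, assoc, assoc, h,
    tensorμ_natural_assoc]

/-- Interchange is symmetric in the two variables because exchanging the middle factors twice is the
identity. -/
lemma interchange_swap {a b c d s s' t t' w : C}
    {σ₀ : a ⊗ b ⟶ s} {σ₁ : c ⊗ d ⟶ s'} {σ : s ⊗ s' ⟶ w} {τ₀ : a ⊗ c ⟶ t} {τ₁ : b ⊗ d ⟶ t'}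
    {τ : t ⊗ t' ⟶ w} (h : (σ₀ ⊗ₘ σ₁) ≫ σ = tensorμ a b c d ≫ (τ₀ ⊗ₘ τ₁) ≫ τ) :
    (τ₀ ⊗ₘ τ₁) ≫ τ = tensorμ a c b d ≫ (σ₀ ⊗ₘ σ₁) ≫ σ := by
  rw [h, reassoc_of% tensorμ_tensorμ]

end Coherence

/-! ### Uncurrying. -/

namespace MultiAdd

section Uncurry

variable {κ : Type} {X : Option κ → SumCat.{u}} {P : PicCat.{u}}
  (G : MultiAdd (fun k => X (some k)) (AddFunctor.pic (X none) P))

/-- The restriction of a sum to the variables other than `none`. -/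
def restSum {k : κ} {x y s : ∀ o, X o} (σ : ElemSum X (some k) x y s) :
    ElemSum (fun k => X (some k)) k (fun l => x (some l)) (fun l => y (some l))
      (fun l => s (some l)) where
  main := σ.main
  fst l h := σ.fst (some l) (fun e => h (Option.some.inj e))
  snd l h := σ.snd (some l) (fun e => h (Option.some.inj e))

/-- The value of `G` on a morphism, at an object. -/
abbrev appMap {y y' : ∀ k, X (some k)} (g : y ⟶ y') (c : X none) :
    (G.functor.obj y).functor.obj c ⟶ (G.functor.obj y').functor.obj c :=
  (G.functor.map g).natTrans.app c

lemma appMap_square {a b c d : ∀ k, X (some k)} {p : a ⟶ b} {q : b ⟶ d} {r : a ⟶ c} {s : c ⟶ d}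
    (h : ∀ k, p k ≫ q k = r k ≫ s k) (z : X none) :
    G.appMap p z ≫ G.appMap q z = G.appMap r z ≫ G.appMap s z :=
  congrArg (fun t => t.natTrans.app z) (map_square' G.functor h)

lemma appMap_triangle {a b d : ∀ k, X (some k)} {p : a ⟶ b} {q : b ⟶ d} {r : a ⟶ d}
    (h : ∀ k, p k ≫ q k = r k) (z : X none) :
    G.appMap p z ≫ G.appMap q z = G.appMap r z := by
  obtain rfl : p ≫ q = r := funext h
  exact (congrArg (fun t => t.natTrans.app z) (G.functor.map_comp p q)).symm

lemma appMap_nat {y y' : ∀ k, X (some k)} (g : y ⟶ y') {c c' : X none} (f : c ⟶ c') :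
    G.appMap g c ≫ (G.functor.obj y').functor.map f =
      (G.functor.obj y).functor.map f ≫ G.appMap g c' :=
  ((G.functor.map g).natTrans.naturality f).symm

/-- The sums of the uncurried functor. -/
def uncurrySum : ∀ (i : Option κ) {x y s : ∀ o, X o} (σ : ElemSum X i x y s),
    (G.functor.obj (fun k => x (some k))).functor.obj (x none) ⊗
      (G.functor.obj (fun k => y (some k))).functor.obj (y none) ⟶
      (G.functor.obj (fun k => s (some k))).functor.obj (s none)
  | none, x, y, s, σ => (G.appMap (fun k => σ.fst (some k) (Option.some_ne_none k)) (x none) ⊗ₘ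
      G.appMap (fun k => σ.snd (some k) (Option.some_ne_none k)) (y none)) ≫
        (G.functor.obj (fun k => s (some k))).sum σ.main
  | some k, x, y, s, σ => ((G.functor.obj (fun k => x (some k))).functor.map
      (σ.fst none (Option.some_ne_none k).symm) ⊗ₘ
      (G.functor.obj (fun k => y (some k))).functor.map
      (σ.snd none (Option.some_ne_none k).symm)) ≫ (G.sum k (restSum σ)).natTrans.app (s none)

lemma sum_app_nat (k : κ) {x y s : ∀ k, X (some k)}
    (σ : ElemSum (fun k => X (some k)) k x y s) {c c' : X none} (f : c ⟶ c') :
    (G.sum k σ).natTrans.app c ≫ (G.functor.obj s).functor.map f =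
      ((G.functor.obj x).functor.map f ⊗ₘ (G.functor.obj y).functor.map f) ≫
        (G.sum k σ).natTrans.app c' :=
  ((G.sum k σ).natTrans.naturality f).symm

lemma sum_app_map (k : κ) {x y s x' y' s' : ∀ k, X (some k)}
    (σ : ElemSum (fun k => X (some k)) k x y s) (σ' : ElemSum (fun k => X (some k)) k x' y' s')
    (p : x ⟶ x') (q : y ⟶ y') (r : s ⟶ s')
    (h : (X (some k)).IsMap σ.main σ'.main (p k) (q k) (r k))
    (h₁ : ∀ j h, σ.fst j h ≫ r j = p j ≫ σ'.fst j h)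
    (h₂ : ∀ j h, σ.snd j h ≫ r j = q j ≫ σ'.snd j h) (c : X none) :
    (G.sum k σ).natTrans.app c ≫ G.appMap r c =
      (G.appMap p c ⊗ₘ G.appMap q c) ≫ (G.sum k σ').natTrans.app c :=
  congrArg (fun t => t.natTrans.app c) (G.sum_map k σ σ' p q r h h₁ h₂)

/-- The sum of `G` in the variable `k` is a morphism of additive functors of the variable `none`;
its compatibility with sums there is the interchange law of the two variables. The hypotheses move
the four inner sums to the place where it applies. -/
lemma uncurrySum_interchange (k : κ) {x₀₀ x₁₀ x₀₁ x₁₁ s₀ s₁ t₀ t₁ w : ∀ j, X j}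
    (σ₀ : ElemSum X none x₀₀ x₁₀ s₀) (σ₁ : ElemSum X none x₀₁ x₁₁ s₁)
    (σ : ElemSum X (some k) s₀ s₁ w) (τ₀ : ElemSum X (some k) x₀₀ x₀₁ t₀)
    (τ₁ : ElemSum X (some k) x₁₀ x₁₁ t₁) (τ : ElemSum X none t₀ t₁ w)
    (hk : none ≠ some k)
    (h₁ : (X none).IsMap σ₀.main τ.main (τ₀.fst none hk) (τ₁.fst none hk) (σ.fst none hk))
    (h₂ : (X none).IsMap σ₁.main τ.main (τ₀.snd none hk) (τ₁.snd none hk) (σ.snd none hk))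
    (h₃ : (X (some k)).IsMap τ₀.main σ.main (σ₀.fst _ hk.symm) (σ₁.fst _ hk.symm)
      (τ.fst _ hk.symm))
    (h₄ : (X (some k)).IsMap τ₁.main σ.main (σ₀.snd _ hk.symm) (σ₁.snd _ hk.symm)
      (τ.snd _ hk.symm))
    (h₅ : ∀ j (hi : j ≠ none) (hk : j ≠ some k), σ₀.fst j hi ≫ σ.fst j hk = τ₀.fst j hk ≫ τ.fst j hi ∧
      σ₀.snd j hi ≫ σ.fst j hk = τ₁.fst j hk ≫ τ.snd j hi ∧
      σ₁.fst j hi ≫ σ.snd j hk = τ₀.snd j hk ≫ τ.fst j hi ∧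
      σ₁.snd j hi ≫ σ.snd j hk = τ₁.snd j hk ≫ τ.snd j hi) :
    (G.uncurrySum none σ₀ ⊗ₘ G.uncurrySum none σ₁) ≫ G.uncurrySum (some k) σ =
      tensorμ _ _ _ _ ≫ (G.uncurrySum (some k) τ₀ ⊗ₘ G.uncurrySum (some k) τ₁) ≫
        G.uncurrySum none τ := by
  have c := (G.sum k (restSum σ)).comm τ.main
  refine interchange_of_parts (interchange_swap (c.symm.trans (assoc _ _ _)))
    (map_of_parts' ((G.functor.obj (fun k => s₀ (some k))).sum_map _ _ _ _ _ h₁) rfl rfl)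
    (map_of_parts' ((G.functor.obj (fun k => s₁ (some k))).sum_map _ _ _ _ _ h₂) rfl rfl) ?_ ?_
  · exact map_of_parts' (G.sum_app_map k (restSum τ₀) (restSum σ) (fun l => σ₀.fst (some l) (Option.some_ne_none l))
      (fun l => σ₁.fst (some l) (Option.some_ne_none l)) (fun l => τ.fst (some l) (Option.some_ne_none l)) h₃
      (fun l h => (h₅ (some l) _ _).1.symm) (fun l h => (h₅ (some l) _ _).2.2.1.symm) _)
      (G.appMap_nat _ _).symm (G.appMap_nat _ _).symm
  · exact map_of_parts' (G.sum_app_map k (restSum τ₁) (restSum σ) (fun l => σ₀.snd (some l) (Option.some_ne_none l))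
      (fun l => σ₁.snd (some l) (Option.some_ne_none l)) (fun l => τ.snd (some l) (Option.some_ne_none l)) h₄
      (fun l h => (h₅ (some l) _ _).2.1.symm) (fun l h => (h₅ (some l) _ _).2.2.2.symm) _)
      (G.appMap_nat _ _).symm (G.appMap_nat _ _).symm

/-- Uncurrying, on underlying functors. -/
def uncurryFunctor : (∀ o, X o) ⥤ P where
  obj := fun x => (G.functor.obj (fun k => x (some k))).functor.obj (x none)
  map := fun {x y} p => G.appMap (fun k => p (some k)) (x none) ≫
    (G.functor.obj (fun k => y (some k))).functor.map (p none)
  map_id := fun x => by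
    have := congrArg (fun t => t.natTrans.app (x none))
      (G.functor.map_id (fun k => x (some k)))
    refine (congrArg₂ (· ≫ ·) this ((G.functor.obj _).functor.map_id _)).trans ?_
    exact id_comp _
  map_comp := fun {x y z} p q => by
    have h₁ := G.appMap_triangle (p := fun k => p (some k)) (q := fun k => q (some k))
      (r := fun k => (p ≫ q) (some k)) (fun _ => rfl) (x none)
    have h₂ := G.appMap_nat (fun k => q (some k)) (p none)
    rw [← h₁, Pi.comp_apply, Functor.map_comp, assoc, assoc, reassoc_of% h₂]

/-- A morphism acts first in the variables `some k` and then in `none`. The square to be filled is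
pasted from one square for each of these two steps. -/
lemma uncurrySum_map (i : Option κ) {x y s x' y' s' : ∀ j, X j} (σ : ElemSum X i x y s)
    (σ' : ElemSum X i x' y' s') (p : x ⟶ x') (q : y ⟶ y') (r : s ⟶ s')
    (h : (X i).IsMap σ.main σ'.main (p i) (q i) (r i))
    (h₁ : ∀ j h, σ.fst j h ≫ r j = p j ≫ σ'.fst j h)
    (h₂ : ∀ j h, σ.snd j h ≫ r j = q j ≫ σ'.snd j h) :
    G.uncurrySum i σ ≫ G.uncurryFunctor.map r =
      (G.uncurryFunctor.map p ⊗ₘ G.uncurryFunctor.map q) ≫ G.uncurrySum i σ' := by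
  obtain _ | k := i
  · refine map_of_parts (C := P) (m := G.appMap (fun k => r (some k)) (x none) ≫
      (G.functor.obj (fun k => s' (some k))).functor.map (p none))
      (n := G.appMap (fun k => r (some k)) (y none) ≫
      (G.functor.obj (fun k => s' (some k))).functor.map (q none)) ?_ ?_ ?_
    · exact paste_maps ((G.functor.map (fun k => r (some k))).comm σ.main)
        ((G.functor.obj _).sum_map σ.main σ'.main _ _ _ h)
    · exact (paste_squares (G.appMap_square (fun k => (h₁ (some k) _).symm) (x none))
        (G.appMap_nat _ (p none)).symm).symm
    · exact (paste_squares (G.appMap_square (fun k => (h₂ (some k) _).symm) (y none))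
        (G.appMap_nat _ (q none)).symm).symm
  · have hm : ∀ {y : ∀ k, X (some k)} {a b c d : X none} {f : a ⟶ b} {g : b ⟶ d} {f' : a ⟶ c}
        {g' : c ⟶ d}, f ≫ g = f' ≫ g' → (G.functor.obj y).functor.map f ≫
          (G.functor.obj y).functor.map g =
          (G.functor.obj y).functor.map f' ≫ (G.functor.obj y).functor.map g' :=
      fun e => by rw [← Functor.map_comp, e, Functor.map_comp]
    refine map_of_parts (C := P) (m := G.appMap (fun k => p (some k)) (s none) ≫
      (G.functor.obj (fun k => x' (some k))).functor.map (r none))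
      (n := G.appMap (fun k => q (some k)) (s none) ≫
      (G.functor.obj (fun k => y' (some k))).functor.map (r none)) ?_ ?_ ?_
    · exact paste_maps (G.sum_app_map k (restSum σ) (restSum σ') (fun k => p (some k))
        (fun k => q (some k)) (fun k => r (some k)) h (fun _ _ => h₁ _ _) (fun _ _ => h₂ _ _)
        (s none)) (G.sum_app_nat k (restSum σ') (r none))
    · exact (paste_squares (G.appMap_nat _ _)
        (hm (h₁ none (Option.some_ne_none k).symm).symm)).symm
    · exact (paste_squares (G.appMap_nat _ _)
        (hm (h₂ none (Option.some_ne_none k).symm).symm)).symm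

lemma uncurrySum_assoc (i : Option κ) {x y z s t w : ∀ j, X j} (σ₁ : ElemSum X i x y s)
    (σ₂ : ElemSum X i s z w) (σ₃ : ElemSum X i y z t) (σ₄ : ElemSum X i x t w)
    (h : (X i).IsAssoc σ₁.main σ₂.main σ₃.main σ₄.main)
    (h₁ : ∀ j h, σ₁.fst j h ≫ σ₂.fst j h = σ₄.fst j h)
    (h₂ : ∀ j h, σ₁.snd j h ≫ σ₂.fst j h = σ₃.fst j h ≫ σ₄.snd j h)
    (h₃ : ∀ j h, σ₂.snd j h = σ₃.snd j h ≫ σ₄.snd j h) :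
    (G.uncurrySum i σ₁ ▷ G.uncurryFunctor.obj z) ≫ G.uncurrySum i σ₂ =
      (α_ (G.uncurryFunctor.obj x) (G.uncurryFunctor.obj y) (G.uncurryFunctor.obj z)).hom ≫
        (G.uncurryFunctor.obj x ◁ G.uncurrySum i σ₃) ≫ G.uncurrySum i σ₄ := by
  obtain _ | k := i
  -- Here, and in the case of `some k`, `v` is the common diagonal of the squares `h₂`: it carries
  -- the middle summand to `w` outside the variable of the sum.
  · refine assoc_of_parts (C := P)
      (v := G.appMap (fun k => σ₁.snd (some k) (Option.some_ne_none k)) _ ≫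
        G.appMap (fun k => σ₂.fst (some k) (Option.some_ne_none k)) _)
      ((G.functor.obj (fun k => w (some k))).sum_assoc _ _ _ _ h) ?_ ?_
    · exact map_of_parts' (C := P) (p := G.appMap (fun k => σ₄.fst (some k) (Option.some_ne_none k)) (x none))

        ((G.functor.map (fun k => σ₂.fst (some k) (Option.some_ne_none k))).comm σ₁.main)
        ((G.appMap_triangle (fun k => h₁ (some k) _) _)) rfl
    · exact map_of_parts' (C := P) (q := G.appMap (fun k => σ₂.snd (some k) (Option.some_ne_none k)) (z none))

        ((G.functor.map (fun k => σ₄.snd (some k) (Option.some_ne_none k))).comm σ₃.main)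
        (((G.appMap_square (fun k => h₂ (some k) _) _).symm))
        ((G.appMap_triangle (fun k => (h₃ (some k) _).symm) _))
  · have e := congrArg (fun t => t.natTrans.app (w none))
      (G.sum_assoc k (restSum σ₁) (restSum σ₂) (restSum σ₃) (restSum σ₄) h (fun _ _ => h₁ _ _)
        (fun _ _ => h₂ _ _) (fun _ _ => h₃ _ _))
    have hm : ∀ {y : ∀ k, X (some k)} {a b d : X none} {f : a ⟶ b} {g : b ⟶ d} {l : a ⟶ d},
        f ≫ g = l → (G.functor.obj y).functor.map f ≫ (G.functor.obj y).functor.map g =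
          (G.functor.obj y).functor.map l := fun e => by rw [← Functor.map_comp, e]
    refine assoc_of_parts (C := P)
      (v := (G.functor.obj (fun k => y (some k))).functor.map
        (σ₁.snd none (Option.some_ne_none k).symm ≫ σ₂.fst none (Option.some_ne_none k).symm))
      e ?_ ?_
    · exact map_of_parts' (C := P)
        (G.sum_app_nat k (restSum σ₁) (σ₂.fst none (Option.some_ne_none k).symm))
        ((hm (h₁ none _))) ((hm rfl))
    · exact map_of_parts' (C := P)
        (G.sum_app_nat k (restSum σ₃) (σ₄.snd none (Option.some_ne_none k).symm))
        ((hm (h₂ none _).symm))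
        ((hm (h₃ none _).symm))

/-- Uncurrying. -/
def uncurryObj : MultiAdd X P where
  functor := G.uncurryFunctor
  sum i _ _ _ σ := G.uncurrySum i σ
  sum_map i _ _ _ _ _ _ σ σ' p q r h h₁ h₂ := G.uncurrySum_map i σ σ' p q r h h₁ h₂
  sum_assoc i _ _ _ _ _ _ σ₁ σ₂ σ₃ σ₄ h h₁ h₂ h₃ := G.uncurrySum_assoc i σ₁ σ₂ σ₃ σ₄ h h₁ h₂ h₃
  sum_comm i x y s σ σ' h h₁ h₂ := by
    obtain _ | k := i
    · exact comm_of_parts ((G.functor.obj _).sum_comm _ _ h)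
        (congrArg (fun t => G.appMap t _) (funext fun k => h₁ _ _))
        (congrArg (fun t => G.appMap t _) (funext fun k => h₂ _ _))
    · exact comm_of_parts (congrArg (fun t => t.natTrans.app (s none))
        (G.sum_comm k (restSum σ) (restSum σ') h (fun _ _ => h₁ _ _) (fun _ _ => h₂ _ _)))
        (congrArg (G.functor.obj _).functor.map (h₁ _ _))
        (congrArg (G.functor.obj _).functor.map (h₂ _ _))
  interchange i k hik _ _ _ _ _ _ _ _ w σ₀ σ₁ σ τ₀ τ₁ τ h₁ h₂ h₃ h₄ h₅ := by
    obtain _ | i := i <;> obtain _ | k := k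
    · exact (hik rfl).elim
    · exact G.uncurrySum_interchange k σ₀ σ₁ σ τ₀ τ₁ τ hik h₁ h₂ h₃ h₄ h₅
    -- The same mixed case with the two variables exchanged.
    · exact interchange_swap (G.uncurrySum_interchange i τ₀ τ₁ τ σ₀ σ₁ σ hik.symm h₃ h₄ h₁ h₂
        (fun j hi hk => ⟨(h₅ j hk hi).1.symm, (h₅ j hk hi).2.2.1.symm, (h₅ j hk hi).2.1.symm,
          (h₅ j hk hi).2.2.2.symm⟩))
    · have e := congrArg (fun t => t.natTrans.app (w none)) (G.interchange i k (fun e => hik (congrArg some e)) (restSum σ₀) (restSum σ₁)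
        (restSum σ) (restSum τ₀) (restSum τ₁) (restSum τ) h₁ h₂ h₃ h₄ (fun j _ _ => h₅ _ _ _))
      obtain ⟨e₁, e₂, e₃, e₄⟩ := h₅ none (Option.some_ne_none i).symm (Option.some_ne_none k).symm
      exact interchange_of_parts e
        (map_of_parts' (G.sum_app_nat _ _ _) rfl rfl)
        (map_of_parts' (G.sum_app_nat _ _ _) rfl rfl)
        (map_of_parts' (G.sum_app_nat _ _ _)
          (((G.functor.obj _).functor.map_comp _ _).symm.trans
            ((congrArg _ e₁.symm).trans ((G.functor.obj _).functor.map_comp _ _)))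
          (((G.functor.obj _).functor.map_comp _ _).symm.trans
            ((congrArg _ e₃.symm).trans ((G.functor.obj _).functor.map_comp _ _))))
        (map_of_parts' (G.sum_app_nat _ _ _)
          (((G.functor.obj _).functor.map_comp _ _).symm.trans
            ((congrArg _ e₂.symm).trans ((G.functor.obj _).functor.map_comp _ _)))
          (((G.functor.obj _).functor.map_comp _ _).symm.trans
            ((congrArg _ e₄.symm).trans ((G.functor.obj _).functor.map_comp _ _))))

end Uncurry

end MultiAdd

/-- A sum is compared with a standard one by means of `e.inv`; this turns the comparison into
compatibility with `e.hom`. It is used with `optIso` for `e`. -/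
lemma sum_of_parts {C : Type*} [Category C] [MonoidalCategory C] {x y s x' y' s' x'' y'' : C}
    (e : s ≅ s') {a : x ⟶ x'} {b : y ⟶ y'} {t : x' ⊗ y' ⟶ s} {t' : x'' ⊗ y'' ⟶ s'} {p : x'' ⟶ x'}
    {q : y'' ⟶ y'} {m : x ⟶ x''} {n : y ⟶ y''} (h : t' ≫ e.inv = (p ⊗ₘ q) ≫ t) (h₁ : m ≫ p = a)
    (h₂ : n ≫ q = b) : ((a ⊗ₘ b) ≫ t) ≫ e.hom = (m ⊗ₘ n) ≫ t' := by
  rw [← h₁, ← h₂, ← tensorHom_comp_tensorHom, assoc, assoc, ← reassoc_of% h, Iso.inv_hom_id,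
    comp_id]

/-! ### Uncurrying is an equivalence. -/

namespace MultiAdd

section Uncurry

variable {κ : Type} {X : Option κ → SumCat.{u}} {P : PicCat.{u}}

lemma appMap_id (G : MultiAdd (fun k => X (some k)) (AddFunctor.pic (X none) P))
    (y : ∀ k, X (some k)) (c : X none) : G.appMap (𝟙 y) c = 𝟙 _ :=
  congrArg (fun t => t.natTrans.app c) (G.functor.map_id y)

lemma uncurrySum_noneSum (G : MultiAdd (fun k => X (some k)) (AddFunctor.pic (X none) P))
    (y : ∀ k, X (some k)) {c c' c'' : X none} (m : (X none).Sum c c' c'') :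
    G.uncurrySum none (noneSum y m) = (G.functor.obj y).sum m :=
  (congrArg₂ (fun a b => (a ⊗ₘ b) ≫ (G.functor.obj y).sum m) (G.appMap_id y c)
    (G.appMap_id y c')).trans (by rw [id_tensorHom_id]; exact id_comp _)

lemma uncurrySum_someSum (G : MultiAdd (fun k => X (some k)) (AddFunctor.pic (X none) P))
    (c : X none) (k : κ) {x y s : ∀ k, X (some k)} (σ : ElemSum (fun k => X (some k)) k x y s) :
    G.uncurrySum (some k) (someSum c k σ) = (G.sum k σ).natTrans.app c :=
  (congrArg₂ (fun a b => (a ⊗ₘ b) ≫ (G.sum k σ).natTrans.app c)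
    ((G.functor.obj x).functor.map_id c) ((G.functor.obj y).functor.map_id c)).trans
    (by rw [id_tensorHom_id]; exact id_comp _)

variable (X P) in
/-- Uncurrying. -/
def uncurry : MultiAdd (fun k => X (some k)) (AddFunctor.pic (X none) P) ⥤ MultiAdd X P where
  obj G := G.uncurryObj
  map {G G'} γ :=
    { natTrans :=
        { app := fun x => (γ.natTrans.app (fun k => x (some k))).natTrans.app (x none)
          naturality := fun x y p => paste_squares
            (congrArg (fun t => t.natTrans.app (x none)) (γ.natTrans.naturality
              (fun k => p (some k))))
            ((γ.natTrans.app (fun k => y (some k))).natTrans.naturality (p none)) |>.trans rfl }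
      comm := fun i x y s σ => by
        obtain _ | k := i
        · exact map_of_parts ((γ.natTrans.app (fun k => s (some k))).comm σ.main)
            (congrArg (fun t => t.natTrans.app (x none)) (γ.natTrans.naturality
              (fun k => σ.fst (some k) (Option.some_ne_none k))))
            (congrArg (fun t => t.natTrans.app (y none)) (γ.natTrans.naturality
              (fun k => σ.snd (some k) (Option.some_ne_none k))))
        · exact map_of_parts (congrArg (fun t => t.natTrans.app (s none)) (γ.comm k (restSum σ)))
            ((γ.natTrans.app (fun k => x (some k))).natTrans.naturality _)
            ((γ.natTrans.app (fun k => y (some k))).natTrans.naturality _) }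

instance : (uncurry X P).Faithful where
  map_injective {G G' f g} h := hom_ext fun y => AddFunctor.hom_ext fun c =>
    congrArg (fun t => t.natTrans.app (optFam c y)) h

/-- A family indexed by `Option κ` is determined by its values. -/
def optIso (x : ∀ o, X o) : optFam (x none) (fun k => x (some k)) ≅ x where
  hom
    | none => 𝟙 _
    | some k => 𝟙 _
  inv
    | none => 𝟙 _
    | some k => 𝟙 _
  hom_inv_id := by ext (_ | k) <;> exact id_comp _
  inv_hom_id := by ext (_ | k) <;> exact id_comp _

/-- An uncurried functor sees a family only through its entry at `none` and its restriction to `some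
k`, so it has the same value at `x` and at the reassembled family. -/
lemma uncurry_map_optIso (G : MultiAdd (fun k => X (some k)) (AddFunctor.pic (X none) P))
    (x : ∀ o, X o) : G.uncurryFunctor.map (optIso x).hom = 𝟙 (G.uncurryFunctor.obj x) :=
  (congrArg₂ (· ≫ ·) (G.appMap_id (fun k => x (some k)) (x none))
    ((G.functor.obj (fun k => x (some k))).functor.map_id (x none))).trans (comp_id _)

/-- The preimage is read off at the families `optFam c y`. Its naturality in `c` and in `y` (`n₁`,
`n₂`) comes from morphisms that are identities in the other variables; components at general
families are recovered through `optIso`. -/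
instance : (uncurry X P).Full where
  map_surjective {G G'} N := by
    have n₁ : ∀ (y : ∀ k, X (some k)) {c c' : X none} (f : c ⟶ c'),
        (G.functor.obj y).functor.map f ≫ N.natTrans.app (optFam c' y) =
          N.natTrans.app (optFam c y) ≫ (G'.functor.obj y).functor.map f := fun y c c' f => by
      have := N.natTrans.naturality (X := optFam c y) (Y := optFam c' y)
        (optHom (x := optFam c y) (y := optFam c' y) f (fun k => 𝟙 (y k)))
      have e : ∀ G : MultiAdd (fun k => X (some k)) (AddFunctor.pic (X none) P),
          G.uncurryFunctor.map (X := optFam c y) (Y := optFam c' y)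
            (optHom (x := optFam c y) (y := optFam c' y) f (fun k => 𝟙 (y k))) =
            (G.functor.obj y).functor.map f := fun G =>
        (congrArg (· ≫ (G.functor.obj y).functor.map f) (G.appMap_id y c)).trans (id_comp _)
      exact (congrArg (· ≫ _) (e G)).symm.trans (this.trans (congrArg (_ ≫ ·) (e G')))
    have n₂ : ∀ {y y' : ∀ k, X (some k)} (g : y ⟶ y') (c : X none),
        G.appMap g c ≫ N.natTrans.app (optFam c y') =
          N.natTrans.app (optFam c y) ≫ G'.appMap g c := fun {y y'} g c => by
      have := N.natTrans.naturality (X := optFam c y) (Y := optFam c y')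
        (optHom (x := optFam c y) (y := optFam c y') (𝟙 c) g)
      have e : ∀ G : MultiAdd (fun k => X (some k)) (AddFunctor.pic (X none) P),
          G.uncurryFunctor.map (X := optFam c y) (Y := optFam c y')
            (optHom (x := optFam c y) (y := optFam c y') (𝟙 c) g) = G.appMap g c := fun G =>
        (congrArg (G.appMap g c ≫ ·) ((G.functor.obj y').functor.map_id c)).trans (comp_id _)
      exact (congrArg (· ≫ _) (e G)).symm.trans (this.trans (congrArg (_ ≫ ·) (e G')))
    let n : ∀ y, G.functor.obj y ⟶ G'.functor.obj y := fun y =>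
      { natTrans :=
          { app := fun c => N.natTrans.app (optFam c y)
            naturality := fun c c' f => n₁ y f }
        comm := fun {c c' c''} m => by
          have := N.comm none (noneSum y m)
          exact (congrArg (· ≫ _) (G.uncurrySum_noneSum y m)).symm.trans
            (this.trans (congrArg (_ ≫ ·) (G'.uncurrySum_noneSum y m))) }
    let n' : G.functor ⟶ G'.functor :=
      { app := n
        naturality := fun y y' g => AddFunctor.hom_ext fun c => n₂ g c }
    have hn : ∀ k {x y s} (σ : ElemSum (fun k => X (some k)) k x y s),
        G.sum k σ ≫ n'.app s = (n'.app x ⊗ₘ n'.app y) ≫ G'.sum k σ := fun k x y s σ =>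
      AddFunctor.hom_ext fun c =>
        (congrArg (· ≫ _) (G.uncurrySum_someSum c k σ)).symm.trans
            ((N.comm (some k) (someSum c k σ)).trans
              (congrArg (_ ≫ ·) (G'.uncurrySum_someSum c k σ)))
    refine ⟨Hom.mk n' hn, hom_ext fun x => ?_⟩
    have := N.natTrans.naturality (optIso x).hom
    have h : N.natTrans.app (optFam (x none) (fun k => x (some k))) ≫ 𝟙 (G'.uncurryFunctor.obj x) =
        𝟙 (G.uncurryFunctor.obj x) ≫ N.natTrans.app x :=
      (congrArg (_ ≫ ·) (G'.uncurry_map_optIso x).symm).trans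
        (this.symm.trans (congrArg (· ≫ _) (G.uncurry_map_optIso x)))
    exact (comp_id _).symm.trans (h.trans (id_comp _))

/-- `F` is compared with the uncurrying of its currying by means of `optIso`. For the sums, one
decomposes a sum in one variable into morphisms of the other variables followed by `noneSum` or
`someSum`. -/
instance : (uncurry X P).EssSurj where
  mem_essImage F := by
    refine ⟨F.curryObj, ⟨mkIso (F := F.curryObj.uncurryObj)
      (NatIso.ofComponents (fun x => F.functor.mapIso (optIso x)) fun {x y} p => ?_)
      fun i {x y s} σ => ?_⟩⟩
    · change (F.functor.map _ ≫ F.functor.map _) ≫ F.functor.map _ = F.functor.map _ ≫ F.functor.map _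
      rw [← F.functor.map_comp, ← F.functor.map_comp, ← F.functor.map_comp]
      congr 1
      ext (_ | k)
      · exact (comp_id _)
      · exact (comp_id _).trans ((comp_id _).trans (id_comp _).symm)
    · have hm : ∀ {a b c : ∀ o, X o} {f : a ⟶ b} {g : b ⟶ c} {h : a ⟶ c},
          (∀ o, f o ≫ g o = h o) → F.functor.map f ≫ F.functor.map g = F.functor.map h :=
        fun e => by rw [← F.functor.map_comp]; exact congrArg F.functor.map (funext e)
      obtain _ | k := i
      · refine sum_of_parts (F.functor.mapIso (optIso s))
          (F.sum_map none σ (noneSum _ σ.main)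
            (optHom (x := x) (y := optFam (x none) (fun k => s (some k))) (𝟙 _)
              (fun k => σ.fst (some k) (Option.some_ne_none k)))
            (optHom (x := y) (y := optFam (y none) (fun k => s (some k))) (𝟙 _)
              (fun k => σ.snd (some k) (Option.some_ne_none k))) (optIso s).inv
            ((X none).isMap_id _) ?_ ?_) (hm ?_) (hm ?_)
        · rintro (_ | k) h; exacts [(h rfl).elim, rfl]
        · rintro (_ | k) h; exacts [(h rfl).elim, rfl]
        · rintro (_ | k); exacts [id_comp _, id_comp _]
        · rintro (_ | k); exacts [id_comp _, id_comp _]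
      · refine sum_of_parts (F.functor.mapIso (optIso s))
          (F.sum_map (some k) σ (someSum _ k (restSum σ))
            (optHom (x := x) (y := optFam (s none) (fun k => x (some k)))
              (σ.fst none (Option.some_ne_none k).symm) (fun k => 𝟙 _))
            (optHom (x := y) (y := optFam (s none) (fun k => y (some k)))
              (σ.snd none (Option.some_ne_none k).symm) (fun k => 𝟙 _)) (optIso s).inv
            ((X (some k)).isMap_id _) ?_ ?_) (hm ?_) (hm ?_)
        · rintro (_ | k) h; exacts [rfl, (comp_id _).trans (id_comp _).symm]
        · rintro (_ | k) h; exacts [rfl, (comp_id _).trans (id_comp _).symm]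
        · rintro (_ | k); exacts [id_comp _, id_comp _]
        · rintro (_ | k); exacts [id_comp _, id_comp _]

instance : (uncurry X P).IsEquivalence where

end Uncurry

end MultiAdd

/-! ### Reindexing along bijections. -/

namespace MultiAdd

section Reindex

variable {ι ι' : Type} {P : PicCat.{u}}

/-- Restriction of sums along an injective map of indices. -/
def pullSum {f : ι → ι'} (hf : Function.Injective f) {X : ι' → SumCat.{u}} (i : ι)
    {x y s : ∀ j, X j} (σ : ElemSum X (f i) x y s) :
    ElemSum (fun i => X (f i)) i (fun i => x (f i)) (fun i => y (f i)) (fun i => s (f i)) where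
  main := σ.main
  fst j h := σ.fst (f j) (fun e => h (hf e))
  snd j h := σ.snd (f j) (fun e => h (hf e))

variable {f : ι → ι'} (hf : Function.Bijective f) {X : ι' → SumCat.{u}}

/-- The sums of a reindexed functor, at a preimage of the variable. -/
def sumAt (F : MultiAdd (fun i => X (f i)) P) {i' : ι'} (i : ι) (h : f i = i')
    {x y s : ∀ j, X j} (σ : ElemSum X i' x y s) :
    F.functor.obj (fun i => x (f i)) ⊗ F.functor.obj (fun i => y (f i)) ⟶
      F.functor.obj (fun i => s (f i)) :=
  F.sum i (pullSum hf.1 i (h ▸ σ))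

/-- The sums of a reindexed functor. -/
noncomputable def reindexSum (F : MultiAdd (fun i => X (f i)) P) (i' : ι')
    {x y s : ∀ j, X j} (σ : ElemSum X i' x y s) :
    F.functor.obj (fun i => x (f i)) ⊗ F.functor.obj (fun i => y (f i)) ⟶
      F.functor.obj (fun i => s (f i)) :=
  F.sumAt hf (hf.2 i').choose (hf.2 i').choose_spec σ

/-- The definition goes through a chosen preimage of the index; by injectivity of `f` the choice
does not matter, and at `f i` no transport remains. -/
lemma reindexSum_apply (F : MultiAdd (fun i => X (f i)) P) (i : ι)
    {x y s : ∀ j, X j} (σ : ElemSum X (f i) x y s) :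
    F.reindexSum hf (f i) σ = F.sum i (pullSum hf.1 i σ) := by
  have : ∀ (i₂ : ι) (h : f i₂ = f i), F.sumAt hf i₂ h σ = F.sum i (pullSum hf.1 i σ) := by
    intro i₂ h
    obtain rfl := hf.1 h
    rfl
  exact this _ _

/-- Reindexing along a bijection. -/
@[simps sum]
noncomputable def reindexObj (F : MultiAdd (fun i => X (f i)) P) : MultiAdd X P where
  functor :=
    { obj := fun x => F.functor.obj (fun i => x (f i))
      map := fun p => F.functor.map (fun i => p (f i))
      map_id := fun x => F.functor.map_id _
      map_comp := fun p q => F.functor.map_comp (fun i => p (f i)) (fun i => q (f i)) }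
  sum i' _ _ _ σ := F.reindexSum hf i' σ
  sum_map i' x y s x' y' s' σ σ' p q r h h₁ h₂ := by
    obtain ⟨i, rfl⟩ := hf.2 i'
    rw [reindexSum_apply, reindexSum_apply]
    exact F.sum_map i _ _ _ _ _ h (fun _ _ => h₁ _ _) (fun _ _ => h₂ _ _)
  sum_assoc i' x y z s t w σ₁ σ₂ σ₃ σ₄ h h₁ h₂ h₃ := by
    obtain ⟨i, rfl⟩ := hf.2 i'
    rw [reindexSum_apply, reindexSum_apply, reindexSum_apply, reindexSum_apply]
    exact F.sum_assoc i _ _ _ _ h (fun _ _ => h₁ _ _) (fun _ _ => h₂ _ _) (fun _ _ => h₃ _ _)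
  sum_comm i' x y s σ σ' h h₁ h₂ := by
    obtain ⟨i, rfl⟩ := hf.2 i'
    rw [reindexSum_apply, reindexSum_apply]
    exact F.sum_comm i _ _ h (fun _ _ => h₁ _ _) (fun _ _ => h₂ _ _)
  interchange i' k' hik _ _ _ _ _ _ _ _ _ σ₀ σ₁ σ τ₀ τ₁ τ h₁ h₂ h₃ h₄ h₅ := by
    obtain ⟨i, rfl⟩ := hf.2 i'
    obtain ⟨k, rfl⟩ := hf.2 k'
    rw [reindexSum_apply, reindexSum_apply, reindexSum_apply, reindexSum_apply, reindexSum_apply,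
      reindexSum_apply]
    exact F.interchange i k (fun e => hik (congrArg f e)) _ _ _ _ _ _ h₁ h₂ h₃ h₄
      (fun _ _ _ => h₅ _ _ _)

/-- Reindexing along a bijection. -/
noncomputable def reindex {f : ι → ι'} (hf : Function.Bijective f) (X : ι' → SumCat.{u})
    (P : PicCat.{u}) : MultiAdd (fun i => X (f i)) P ⥤ MultiAdd X P where
  obj F := F.reindexObj hf
  map γ :=
    { natTrans :=
        { app := fun x => γ.natTrans.app (fun i => x (f i))
          naturality := fun x y p => γ.natTrans.naturality (fun i => p (f i)) }
      comm := fun i' x y s σ => by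
        obtain ⟨i, rfl⟩ := hf.2 i'
        rw [reindexObj_sum, reindexObj_sum, reindexSum_apply, reindexSum_apply]
        exact γ.comm i _ }

/-- The composite of a bijection with its inverse equals `id` only propositionally, hence the
hypothesis `h`. -/
lemma reindex_isEquivalence_of_eq {f : ι → ι} (hf : Function.Bijective f) (h : f = id)
    (X : ι → SumCat.{u}) : (reindex hf X P).IsEquivalence := by
  subst h
  refine Functor.isEquivalence_of_iso (F := 𝟭 _) (NatIso.ofComponents (fun F =>
    mkIso (F := F) (G := F.reindexObj hf) (NatIso.ofComponents (fun x => Iso.refl _)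
      (fun p => (comp_id _).trans (id_comp _).symm)) ?_) ?_)
  · intro i x y s σ
    have : (F.reindexObj hf).sum i σ = F.sum i σ := F.reindexSum_apply hf i σ
    rw [this]
    change _ ≫ 𝟙 _ = (𝟙 _ ⊗ₘ 𝟙 _) ≫ _
    rw [id_tensorHom_id]
    exact (comp_id _).trans (id_comp _).symm
  · intro F G γ
    refine hom_ext fun x => ?_
    exact (comp_id _).trans (id_comp _).symm

lemma reindex_comp_isEquivalence_iff {ι'' : Type} {g : ι' → ι''} (hg : Function.Bijective g)
    (X : ι'' → SumCat.{u}) (h : (reindex (hg.comp hf) X P).IsEquivalence) :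
    (reindex hf (fun i => X (g i)) P ⋙ reindex hg X P).IsEquivalence := by
  refine Functor.isEquivalence_of_iso (F := reindex (hg.comp hf) X P) (NatIso.ofComponents
    (fun F => mkIso (F := F.reindexObj (hg.comp hf)) (G := (F.reindexObj hf (X := fun i => X (g i))).reindexObj hg)
      (NatIso.ofComponents (fun x => Iso.refl _)
      (fun p => (comp_id _).trans (id_comp _).symm)) ?_) ?_)
  · intro k x y s σ
    obtain ⟨j, rfl⟩ := hg.2 k
    obtain ⟨i, rfl⟩ := hf.2 j
    have e₁ : (F.reindexObj (hg.comp hf)).sum (g (f i)) σ =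
      F.sum i (pullSum (hg.comp hf).1 i σ) := F.reindexSum_apply (hg.comp hf) i σ
    have e₂ : ((F.reindexObj hf (X := fun i => X (g i))).reindexObj hg).sum (g (f i)) σ =
      F.sum i (pullSum (hg.comp hf).1 i σ) :=
        ((F.reindexObj hf (X := fun i => X (g i))).reindexSum_apply hg (f i) σ).trans
        (F.reindexSum_apply hf i (X := fun i => X (g i)) _)
    rw [e₁, e₂]
    change _ ≫ 𝟙 _ = (𝟙 _ ⊗ₘ 𝟙 _) ≫ _
    rw [id_tensorHom_id]
    exact (comp_id _).trans (id_comp _).symm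
  · intro F G γ
    refine hom_ext fun x => ?_
    exact (comp_id _).trans (id_comp _).symm

/-- Part of the two-out-of-six property. It is applied to reindexing along e, its inverse and e
again, whose consecutive composites are isomorphic to reindexing along identities. This avoids an
explicit inverse functor with transports along dependent families. -/
lemma isEquivalence_of_two_of_six {A B C D : Type*} [Category A] [Category B] [Category C]
    [Category D] (F : A ⥤ B) (G : B ⥤ C) (H : C ⥤ D) [(F ⋙ G).IsEquivalence]
    [(G ⋙ H).IsEquivalence] : H.IsEquivalence := by
  have : G.Faithful := Functor.Faithful.of_comp G H
  have : F.Faithful := Functor.Faithful.of_comp F G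
  have : F.Full := Functor.Full.of_comp_faithful F G
  -- Essential surjectivity of `F ⋙ G` gives `G (F a) ≅ G b`, and full faithfulness of `G ⋙ H` lifts
  -- this to `F a ≅ b`.
  have : F.EssSurj :=
    { mem_essImage := fun b => ⟨_, ⟨(G ⋙ H).preimageIso (H.mapIso
        ((F ⋙ G).objObjPreimageIso (G.obj b)))⟩⟩ }
  have : F.IsEquivalence := { }
  have : G.IsEquivalence := Functor.isEquivalence_of_comp_left F G
  exact Functor.isEquivalence_of_comp_left G H

lemma reindex_isEquivalence (e : ι ≃ ι') (X : ι' → SumCat.{u}) :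
    (reindex e.bijective X P).IsEquivalence := by
  have := reindex_comp_isEquivalence_iff (P := P) e.bijective e.symm.bijective (fun i => X (e i))
    (reindex_isEquivalence_of_eq _ (funext e.symm_apply_apply) _)
  have := reindex_comp_isEquivalence_iff (P := P) e.symm.bijective e.bijective X
    (reindex_isEquivalence_of_eq _ (funext e.apply_symm_apply) _)
  exact isEquivalence_of_two_of_six (reindex e.bijective _ P) (reindex e.symm.bijective _ P)
    (reindex e.bijective X P)

end Reindex

/-! ### Substitution of universal additive functors in every variable. -/

section Precomp

variable {ι : Type} {X : ι → SumCat.{u}} {Q : ι → PicCat.{u}} (Φ : ∀ i, AddFunctor (X i) (Q i))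
  (P : PicCat.{u})

/-- The image of a sum under a family of additive functors. -/
def mapSum (i : ι) {x y s : ∀ j, X j} (σ : ElemSum X i x y s) :
    ElemSum (fun i => SumCat.ofPic (Q i)) i (fun j => (Φ j).functor.obj (x j))
      (fun j => (Φ j).functor.obj (y j)) (fun j => (Φ j).functor.obj (s j)) where
  main := (Φ i).sum σ.main
  fst j h := (Φ j).functor.map (σ.fst j h)
  snd j h := (Φ j).functor.map (σ.snd j h)

variable {P} in
/-- Composition with an additive functor in each variable. -/
def precompObj (F : MultiAdd (fun i => SumCat.ofPic (Q i)) P) : MultiAdd X P where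
  functor := Functor.pi (fun i => (Φ i).functor) ⋙ F.functor
  sum i _ _ _ σ := F.sum i (mapSum Φ i σ)
  sum_map i x y s x' y' s' σ σ' p q r h h₁ h₂ := by
    have hm : ∀ {j} {a b c d : X j} {p : a ⟶ b} {q : b ⟶ d} {r : a ⟶ c} {s : c ⟶ d},
        p ≫ q = r ≫ s → (Φ j).functor.map p ≫ (Φ j).functor.map q =
          (Φ j).functor.map r ≫ (Φ j).functor.map s := fun e => by
      rw [← Functor.map_comp, e, Functor.map_comp]
    exact F.sum_map i (mapSum Φ i σ) (mapSum Φ i σ') _ _ _ ((Φ i).sum_map _ _ _ _ _ h)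
      (fun j h => hm (h₁ j h)) (fun j h => hm (h₂ j h))
  sum_assoc i x y z s t w σ₁ σ₂ σ₃ σ₄ h h₁ h₂ h₃ := by
    refine F.sum_assoc i (mapSum Φ i σ₁) (mapSum Φ i σ₂) (mapSum Φ i σ₃) (mapSum Φ i σ₄)
      ((Φ i).sum_assoc _ _ _ _ h) ?_ ?_ ?_
    · exact fun j h => ((Φ j).functor.map_comp _ _).symm.trans (congrArg _ (h₁ j h))
    · exact fun j h => ((Φ j).functor.map_comp _ _).symm.trans ((congrArg _ (h₂ j h)).trans
        ((Φ j).functor.map_comp _ _))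
    · exact fun j h => (congrArg _ (h₃ j h)).trans ((Φ j).functor.map_comp _ _)
  sum_comm i x y s σ σ' h h₁ h₂ := F.sum_comm i (mapSum Φ i σ) (mapSum Φ i σ')
    ((Φ i).sum_comm _ _ h) (fun j h => congrArg _ (h₁ j h)) (fun j h => congrArg _ (h₂ j h))
  interchange i k hik _ _ _ _ _ _ _ _ _ σ₀ σ₁ σ τ₀ τ₁ τ h₁ h₂ h₃ h₄ h₅ := by
    have hm : ∀ {j} {a b c d : X j} {p : a ⟶ b} {q : b ⟶ d} {r : a ⟶ c} {s : c ⟶ d},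
        p ≫ q = r ≫ s → (Φ j).functor.map p ≫ (Φ j).functor.map q =
          (Φ j).functor.map r ≫ (Φ j).functor.map s := fun e => by
      rw [← Functor.map_comp, e, Functor.map_comp]
    exact F.interchange i k hik (mapSum Φ i σ₀) (mapSum Φ i σ₁) (mapSum Φ k σ) (mapSum Φ k τ₀)
      (mapSum Φ k τ₁) (mapSum Φ i τ) ((Φ i).sum_map _ _ _ _ _ h₁) ((Φ i).sum_map _ _ _ _ _ h₂)
      ((Φ k).sum_map _ _ _ _ _ h₃) ((Φ k).sum_map _ _ _ _ _ h₄)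
      (fun j hi hk => ⟨hm (h₅ j hi hk).1, hm (h₅ j hi hk).2.1, hm (h₅ j hi hk).2.2.1,
        hm (h₅ j hi hk).2.2.2⟩)

/-- Composition with an additive functor in each variable. -/
def precomp : MultiAdd (fun i => SumCat.ofPic (Q i)) P ⥤ MultiAdd X P where
  obj F := F.precompObj Φ
  map γ :=
    { natTrans := Functor.whiskerLeft (Functor.pi (fun i => (Φ i).functor)) γ.natTrans
      comm := fun i _ _ _ σ => γ.comm i (mapSum Φ i σ) }

/-- Substitution commutes with reindexing, up to an isomorphism with identity components. -/
lemma precomp_isEquivalence_of_equiv {ι' : Type} (e : ι ≃ ι') {X : ι' → SumCat.{u}}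
    {Q : ι' → PicCat.{u}} (Φ : ∀ i, AddFunctor (X i) (Q i))
    (h : (precomp (fun i => Φ (e i)) P).IsEquivalence) : (precomp Φ P).IsEquivalence := by
  have h₁ := reindex_isEquivalence (P := P) e X
  have h₂ := reindex_isEquivalence (P := P) e (fun i => SumCat.ofPic (Q i))
  have : (reindex e.bijective (fun i => SumCat.ofPic (Q i)) P ⋙ precomp Φ P).IsEquivalence := by
    refine Functor.isEquivalence_of_iso (F := precomp (fun i => Φ (e i)) P ⋙
      reindex e.bijective X P) (NatIso.ofComponents (fun F =>
        mkIso (F := (F.precompObj (fun i => Φ (e i))).reindexObj e.bijective)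
          (G := (F.reindexObj e.bijective (X := fun i => SumCat.ofPic (Q i))).precompObj Φ)
        (NatIso.ofComponents (fun x => Iso.refl _)
        (fun p => (comp_id _).trans (id_comp _).symm)) ?_) ?_)
    · intro i' x y s σ
      obtain ⟨i, rfl⟩ := e.surjective i'
      have e₁ : ((F.precompObj (fun i => Φ (e i))).reindexObj e.bijective).sum (e i) σ =
        F.sum i (mapSum (fun i => Φ (e i)) i (pullSum e.injective i σ)) :=
          (F.precompObj (fun i => Φ (e i))).reindexSum_apply e.bijective i σ
      have e₂ : ((F.reindexObj e.bijective (X := fun i => SumCat.ofPic (Q i))).precompObj Φ).sum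
          (e i) σ = F.sum i (mapSum (fun i => Φ (e i)) i (pullSum e.injective i σ)) :=
        F.reindexSum_apply e.bijective (X := fun i => SumCat.ofPic (Q i)) i _
      rw [e₁, e₂]
      change _ ≫ 𝟙 _ = (𝟙 _ ⊗ₘ 𝟙 _) ≫ _
      rw [id_tensorHom_id]
      exact (comp_id _).trans (id_comp _).symm
    · intro F G γ
      refine hom_ext fun x => ?_
      exact (comp_id _).trans (id_comp _).symm
  exact Functor.isEquivalence_of_comp_left (reindex e.bijective _ P) (precomp Φ P)

/-- The inductive step. Under uncurrying, substitution in all variables becomes substitution in the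
variables `some k`, for functors with values in additive functors, followed by restriction of these
values along `Φ none`. The latter is an equivalence by universality. Since the target changes, `h`
is required for all Picard groupoids. -/
lemma precomp_isEquivalence_option {κ : Type} {X : Option κ → SumCat.{u}}
    {Q : Option κ → PicCat.{u}} (Φ : ∀ i, AddFunctor (X i) (Q i)) (hΦ : (Φ none).IsUniversal)
    (h : ∀ P, (precomp (fun k => Φ (some k)) P).IsEquivalence) :
    (precomp Φ P).IsEquivalence := by
  have h₁ := hΦ P
  have h₂ := h (AddFunctor.pic (SumCat.ofPic (Q none)) P)
  have : ((Φ none).precompAdd P).functor.IsEquivalence := h₁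
  have : (uncurry (fun i => SumCat.ofPic (Q i)) P ⋙ precomp Φ P).IsEquivalence := by
    refine Functor.isEquivalence_of_iso (F := precomp (fun k => Φ (some k))
      (AddFunctor.pic (SumCat.ofPic (Q none)) P) ⋙ postcomp (fun k => X (some k))
        ((Φ none).precompAdd P) ⋙ uncurry X P) (NatIso.ofComponents (fun F =>
        mkIso (F := ((postcomp (fun k => X (some k)) ((Φ none).precompAdd P)).obj
          (F.precompObj (fun k => Φ (some k)))).uncurryObj)
          (G := (F.uncurryObj (X := fun i => SumCat.ofPic (Q i))).precompObj Φ)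
        (NatIso.ofComponents (fun x => Iso.refl _)
        (fun p => (comp_id _).trans (id_comp _).symm)) ?_) ?_)
    · intro i x y s σ
      refine Eq.trans (comp_id _) (Eq.trans ?_ ((id_comp _).symm.trans (congrArg (· ≫ _) (id_tensorHom_id _ _).symm)))
      obtain _ | k := i <;> rfl
    · intro F G γ
      refine hom_ext fun x => ?_
      exact (comp_id _).trans (id_comp _).symm
  exact Functor.isEquivalence_of_comp_left (uncurry (fun i => SumCat.ofPic (Q i)) P) (precomp Φ P)

/-- Without variables a multiadditive functor amounts to an object of `P`. Different expressions for
the empty family are compared through the image of the unique morphism between them. -/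
lemma precomp_isEquivalence_empty {X : PEmpty → SumCat.{u}}
    {Q : PEmpty → PicCat.{u}} (Φ : ∀ i, AddFunctor (X i) (Q i)) :
    (precomp Φ P).IsEquivalence where
  faithful := ⟨fun {F G f g} h => hom_ext fun x => by
    obtain rfl : (fun i => (Φ i).functor.obj (PEmpty.elim i)) = x := funext fun i => i.elim
    exact congrArg (fun t => t.natTrans.app (fun i => PEmpty.elim i)) h⟩
  full := ⟨fun {F G} N => by
    have hm : ∀ (G : MultiAdd (fun i => SumCat.ofPic (Q i)) P) {a b c : ∀ i, Q i} (p : a ⟶ b)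
        (q : b ⟶ c) (r : a ⟶ c), G.functor.map p ≫ G.functor.map q = G.functor.map r :=
      fun G a b c p q r => by
        rw [← G.functor.map_comp]
        exact congrArg G.functor.map (funext fun i => i.elim)
    obtain ⟨n, hn⟩ : ∃ n : F.functor.obj (fun i => (Φ i).functor.obj (PEmpty.elim i)) ⟶
        G.functor.obj (fun i => (Φ i).functor.obj (PEmpty.elim i)),
        ∀ x, F.functor.map (fun i => PEmpty.elim i) ≫ N.natTrans.app x =
          n ≫ G.functor.map (fun i => PEmpty.elim i) :=
      ⟨N.natTrans.app (fun i => PEmpty.elim i), fun x =>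
        (congrArg (· ≫ _) (congrArg F.functor.map (funext fun i => i.elim))).trans
          ((N.natTrans.naturality (X := fun i => PEmpty.elim i) (Y := x) (fun i => i.elim)).trans
            (congrArg (_ ≫ ·) (congrArg G.functor.map (funext fun i => i.elim))))⟩
    refine ⟨Hom.mk
      { app := fun x => F.functor.map (fun i => i.elim) ≫ n ≫ G.functor.map (fun i => i.elim)
        naturality := fun x y p => ?_ } (fun i => i.elim), hom_ext fun x => ?_⟩
    · rw [← assoc, hm F _ _ (fun i => i.elim), assoc, assoc, hm G _ _ (fun i => i.elim)]
    · refine (congrArg (_ ≫ ·) (hn x).symm).trans ((assoc _ _ _).symm.trans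
        ((congrArg (· ≫ _) ((hm F _ _ (𝟙 _)).trans (F.functor.map_id _))).trans (id_comp _)))⟩
  essSurj := ⟨fun F => by
    let G : MultiAdd (fun i => SumCat.ofPic (Q i)) P :=
      { functor :=
          { obj := fun _ => F.functor.obj (fun i => PEmpty.elim i)
            map := fun _ => 𝟙 _ }
        sum := fun i => i.elim
        sum_map := fun i => i.elim
        sum_assoc := fun i => i.elim
        sum_comm := fun i => i.elim
        interchange := fun i => i.elim }
    refine ⟨G, ⟨mkIso (F := G.precompObj Φ) (NatIso.ofComponents (fun x => F.functor.mapIso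
      { hom := fun i => i.elim
        inv := fun i => i.elim
        hom_inv_id := funext fun i => i.elim
        inv_hom_id := funext fun i => i.elim }) fun {x y} p => ?_) (fun i => i.elim)⟩⟩
    exact (id_comp _).trans ((congrArg F.functor.map (funext fun i => i.elim)).trans
      (F.functor.map_comp _ _))⟩

/-- Induction over finite types up to bijection, which is what reindexing is needed for. -/
theorem precomp_isEquivalence [Finite ι] (hΦ : ∀ i, (Φ i).IsUniversal) :
    (precomp Φ P).IsEquivalence := by
  revert X Q P
  refine Finite.induction_empty_option (P := fun ι => ∀ {X : ι → SumCat.{u}} {Q : ι → PicCat.{u}}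
    (Φ : ∀ i, AddFunctor (X i) (Q i)) (P : PicCat.{u}), (∀ i, (Φ i).IsUniversal) →
    (precomp Φ P).IsEquivalence) ?_ ?_ ?_ ι
  · intro ι ι' e h X Q Φ P hΦ
    exact precomp_isEquivalence_of_equiv P e Φ (h _ P (fun i => hΦ _))
  · intro X Q Φ P hΦ
    exact precomp_isEquivalence_empty P Φ
  · intro κ _ h X Q Φ P hΦ
    exact precomp_isEquivalence_option P Φ (hΦ none) (fun P => h _ P (fun k => hΦ _))

end Precomp

end MultiAdd

/-! ### Additive functors between Picard groupoids are braided functors. -/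

/-- Think of `m` as an associative action of `I` on `X` and of `e` as a right unit of `I`. After
precomposition with `m ▷ 𝟙_ C`, which can be cancelled, associativity reduces the unit law of the
action to `he`. -/
lemma right_unit_of_assoc {C : Type*} [Category C] [MonoidalCategory C] {X I : C} (e : 𝟙_ C ⟶ I)
    (m : X ⊗ I ⟶ X) [IsIso m] (n : I ⊗ I ⟶ I) (h : (m ▷ I) ≫ m = (α_ X I I).hom ≫ (X ◁ n) ≫ m)
    (he : (I ◁ e) ≫ n = (ρ_ I).hom) : (X ◁ e) ≫ m = (ρ_ X).hom := by
  rw [← cancel_epi (m ▷ 𝟙_ C), ← whisker_exchange_assoc, h, tensor_whiskerLeft, assoc, assoc,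
    Iso.inv_hom_id_assoc, ← MonoidalCategory.whiskerLeft_comp_assoc, he, rightUnitor_naturality,
    rightUnitor_tensor_hom, assoc]

namespace AddFunctor

variable {Q P : PicCat.{u}}

/-- A braided functor, as an additive functor. -/
@[simps sum]
def ofBraided (f : Q ⥤ P) [f.Braided] : AddFunctor (SumCat.ofPic Q) P where
  functor := f
  sum {x y s} σ := μ f x y ≫ f.map σ
  sum_map {x y s x' y' s'} σ σ' p q r h := by
    have h : σ ≫ r = (p ⊗ₘ q) ≫ σ' := h
    rw [assoc, ← f.map_comp, h, f.map_comp, μ_natural_assoc]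
  sum_assoc {x y z s t w} σ₁ σ₂ σ₃ σ₄ h := by
    have h : (σ₁ ▷ z) ≫ σ₂ = (α_ x y z).hom ≫ (x ◁ σ₃) ≫ σ₄ := h
    rw [comp_whiskerRight, assoc, μ_natural_left_assoc, ← f.map_comp, h, f.map_comp,
      associativity_assoc, MonoidalCategory.whiskerLeft_comp, assoc, μ_natural_right_assoc,
      f.map_comp]
  sum_comm {x y s} σ σ' h := by
    have h : (β_ x y).hom ≫ σ' = σ := h
    rw [← h, f.map_comp, Functor.LaxBraided.braided_assoc]

section Unit

variable (L : AddFunctor (SumCat.ofPic Q) P)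

/-- Additive functors carry no unit constraint. It is recovered by solving the right unit equation
at the unit object, which is possible because tensoring with `L.functor.obj (𝟙_ Q)` is full. -/
lemma exists_unit : ∃ e : 𝟙_ P ⟶ L.functor.obj (𝟙_ Q),
    (L.functor.obj (𝟙_ Q) ◁ e) ≫ L.sum (ρ_ (𝟙_ Q)).hom = (ρ_ (L.functor.obj (𝟙_ Q))).hom := by
  obtain ⟨e, he⟩ := whiskerLeft_surjective (L.functor.obj (𝟙_ Q))
    ((ρ_ (L.functor.obj (𝟙_ Q))).hom ≫ inv (L.sum (ρ_ (𝟙_ Q)).hom))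
  exact ⟨e, by rw [he, assoc, IsIso.inv_hom_id, comp_id]⟩

/-- The unit isomorphism of an additive functor of Picard groupoids. -/
noncomputable def unit : 𝟙_ P ⟶ L.functor.obj (𝟙_ Q) := L.exists_unit.choose

lemma unit_right (x : Q) :
    (L.functor.obj x ◁ L.unit) ≫ L.sum (ρ_ x).hom = (ρ_ (L.functor.obj x)).hom :=
  right_unit_of_assoc L.unit (L.sum (ρ_ x).hom) (L.sum (ρ_ (𝟙_ Q)).hom)
    (L.sum_assoc (x := x) (y := 𝟙_ Q) (z := 𝟙_ Q) (ρ_ x).hom (ρ_ x).hom (ρ_ (𝟙_ Q)).hom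
    (ρ_ x).hom (show ((ρ_ x).hom ▷ 𝟙_ Q) ≫ (ρ_ x).hom =
      (α_ x (𝟙_ Q) (𝟙_ Q)).hom ≫ (x ◁ (ρ_ (𝟙_ Q)).hom) ≫ (ρ_ x).hom by simp [← unitors_equal]))
    L.exists_unit.choose_spec

lemma unit_left (x : Q) :
    (L.unit ▷ L.functor.obj x) ≫ L.sum (λ_ x).hom = (λ_ (L.functor.obj x)).hom := by
  rw [← L.sum_comm (x := 𝟙_ Q) (y := x) (λ_ x).hom (ρ_ x).hom
    (show (β_ (𝟙_ Q) x).hom ≫ (ρ_ x).hom = (λ_ x).hom by simp),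
    BraidedCategory.braiding_naturality_left_assoc, L.unit_right, braiding_rightUnitor]

lemma map_comp_sum {x y s x' y' : Q} (p : x ⟶ x') (q : y ⟶ y') (σ : x' ⊗ y' ⟶ s) :
    (L.functor.map p ⊗ₘ L.functor.map q) ≫ L.sum σ = L.sum ((p ⊗ₘ q) ≫ σ) := by
  rw [← L.sum_map ((p ⊗ₘ q) ≫ σ) σ p q (𝟙 s)
    (show ((p ⊗ₘ q) ≫ σ) ≫ 𝟙 s = (p ⊗ₘ q) ≫ σ from comp_id _)]
  exact (congrArg (_ ≫ ·) (L.functor.map_id s)).trans (comp_id _)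

lemma sum_comp_map {x y s s' : Q} (σ : x ⊗ y ⟶ s) (r : s ⟶ s') :
    L.sum σ ≫ L.functor.map r = L.sum (σ ≫ r) := by
  have h := L.sum_map σ (σ ≫ r) (𝟙 x) (𝟙 y) r (show σ ≫ r = (𝟙 x ⊗ₘ 𝟙 y) ≫ σ ≫ r by simp)
  have k : (L.functor.map (𝟙 x) ⊗ₘ L.functor.map (𝟙 y)) = 𝟙 _ :=
    (congrArg₂ (· ⊗ₘ ·) (L.functor.map_id x) (L.functor.map_id y)).trans (id_tensorHom_id _ _)
  rw [h, k, id_comp]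

/-- The monoidal structure of an additive functor of Picard groupoids. -/
noncomputable def coreMonoidal : Functor.CoreMonoidal (C := Q) L.functor where
  εIso := asIso L.unit
  μIso x y := asIso (L.sum (𝟙 (x ⊗ y)))
  μIso_hom_natural_left {x y} f z := by
    have e : L.functor.map f ▷ L.functor.obj z = L.functor.map f ⊗ₘ L.functor.map (𝟙 z) :=
      (tensorHom_id _ _).symm.trans (congrArg (_ ⊗ₘ ·) (L.functor.map_id z).symm)
    rw [asIso_hom, asIso_hom, e, map_comp_sum, sum_comp_map, tensorHom_id, comp_id, id_comp]
  μIso_hom_natural_right {x y} z f := by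
    have e : L.functor.obj z ◁ L.functor.map f = L.functor.map (𝟙 z) ⊗ₘ L.functor.map f :=
      (id_tensorHom _ _).symm.trans (congrArg (· ⊗ₘ _) (L.functor.map_id z).symm)
    rw [asIso_hom, asIso_hom, e, map_comp_sum, sum_comp_map, id_tensorHom, comp_id, id_comp]
  associativity x y z := by
    simp only [asIso_hom]
    rw [sum_comp_map, id_comp]
    exact L.sum_assoc (x := x) (y := y) (z := z) (𝟙 (x ⊗ y)) (α_ x y z).hom (𝟙 (y ⊗ z))
      (𝟙 (x ⊗ y ⊗ z)) (show (𝟙 (x ⊗ y) ▷ z) ≫ (α_ x y z).hom =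
        (α_ x y z).hom ≫ (x ◁ 𝟙 (y ⊗ z)) ≫ 𝟙 (x ⊗ y ⊗ z) by simp)
  left_unitality x := by
    simp only [asIso_hom]
    rw [sum_comp_map, id_comp, unit_left]
  right_unitality x := by
    simp only [asIso_hom]
    rw [sum_comp_map, id_comp, unit_right]

/-- The monoidal structure of an additive functor of Picard groupoids. -/
@[reducible]
noncomputable def monoidal : Functor.Monoidal (C := Q) L.functor := L.coreMonoidal.toMonoidal

/-- An additive functor of Picard groupoids is braided. -/
@[reducible]
noncomputable def braided : Functor.Braided (C := Q) L.functor :=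
  { L.monoidal with
    braided := fun x y => by
      change L.sum (𝟙 (x ⊗ y)) ≫ L.functor.map (β_ x y).hom = (β_ _ _).hom ≫ L.sum (𝟙 (y ⊗ x))
      rw [sum_comp_map, id_comp]
      exact (L.sum_comm (x := x) (y := y) (β_ x y).hom (𝟙 (y ⊗ x)) (comp_id _)).symm }

end Unit

lemma unit_unique {C : Type*} [Category C] [MonoidalCategory C] {I : C} (e e' : 𝟙_ C ⟶ I)
    (m : I ⊗ I ⟶ I) [IsIso m] (h : (I ◁ e) ≫ m = (ρ_ I).hom) (h' : (I ◁ e') ≫ m = (ρ_ I).hom)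
    (hI : ∀ f g : 𝟙_ C ⟶ I, I ◁ f = I ◁ g → f = g) : e = e' :=
  hI _ _ (by rw [← cancel_mono m, h, h'])

/-- Additive transformations of braided functors are monoidal. -/
lemma isMonoidal_of_tensor {f g : Q ⥤ P} [f.Monoidal] [g.Monoidal] (γ : f ⟶ g)
    (h : ∀ x y, μ f x y ≫ γ.app (x ⊗ y) = (γ.app x ⊗ₘ γ.app y) ≫ μ g x y) :
    NatTrans.IsMonoidal γ where
  unit := by
    -- Both candidates solve the right unit equation of `g` at the unit object, whose solution is
    -- unique by cancellation.
    refine unit_unique _ _ (μ g _ _ ≫ g.map (ρ_ (𝟙_ Q)).hom) ?_ (right_unitality g _).symm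
      (fun _ _ => whiskerLeft_injective' _)
    rw [← cancel_epi (γ.app (𝟙_ Q) ▷ 𝟙_ P), ← whisker_exchange_assoc,
      MonoidalCategory.whiskerLeft_comp, assoc, ← MonoidalCategory.tensorHom_def'_assoc,
      ← reassoc_of% h, ← γ.naturality, rightUnitor_naturality, right_unitality f]
    simp only [assoc]
  tensor := h

end AddFunctor

/-! ### Determinant functors as additive functors -/

/-- A distinguished triangle `x → y → z`. -/
structure TriSum (T : TrCat.{u}) (z x y : Core T) where
  u : x.of ⟶ y.of
  v : y.of ⟶ z.of
  w : z.of ⟶ x.of⟦(1 : ℤ)⟧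
  dist : Triangle.mk u v w ∈ distTriang T

namespace TriSum

variable {T : TrCat.{u}} {z x y z' x' y' : Core T}

/-- A morphism of triangles. -/
structure IsMap (σ : TriSum T z x y) (σ' : TriSum T z' x' y') (p : z ⟶ z') (q : x ⟶ x')
    (r : y ⟶ y') : Prop where
  u : σ.u ≫ r.iso.hom = q.iso.hom ≫ σ'.u
  v : σ.v ≫ p.iso.hom = r.iso.hom ≫ σ'.v
  w : σ.w ≫ q.iso.hom⟦(1 : ℤ)⟧' = p.iso.hom ≫ σ'.w

/-- The triangles of an octahedron. -/
structure IsAssoc {a b c m n t : Core T} (σ₁ : TriSum T a b m) (σ₂ : TriSum T m c t)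
    (σ₃ : TriSum T b c n) (σ₄ : TriSum T a n t) : Prop where
  h₁ : σ₃.u ≫ σ₄.u = σ₂.u
  h₂ : σ₃.v ≫ σ₁.u = σ₄.u ≫ σ₂.v
  h₃ : σ₁.u ≫ σ₂.w = σ₃.w
  h₄ : σ₂.v ≫ σ₁.v = σ₄.v
  h₅ : σ₂.w ≫ σ₃.u⟦(1 : ℤ)⟧' = σ₁.v ≫ σ₄.w
  h₆ : σ₁.w = σ₄.w ≫ σ₃.v⟦(1 : ℤ)⟧'

/-- The two split triangles of a direct sum. -/
structure IsComm (σ : TriSum T z x y) (σ' : TriSum T x z y) : Prop where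
  w : σ.w = 0
  w' : σ'.w = 0
  h₁ : σ'.u ≫ σ.v = 𝟙 _
  h₂ : σ.u ≫ σ'.v = 𝟙 _

lemma isMap_id (σ : TriSum T z x y) : IsMap σ σ (𝟙 z) (𝟙 x) (𝟙 y) where
  u := (comp_id _).trans (id_comp _).symm
  v := (comp_id _).trans (id_comp _).symm
  w := by
    change σ.w ≫ (𝟙 _)⟦(1 : ℤ)⟧' = 𝟙 _ ≫ σ.w
    simp

end TriSum

/-- The sums given by the distinguished triangles of a triangulated category. -/
abbrev SumCat.ofTr (T : TrCat.{u}) : SumCat.{u} where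
  carrier := Core T
  Sum := TriSum T
  IsMap := TriSum.IsMap
  IsAssoc := TriSum.IsAssoc
  IsComm := TriSum.IsComm
  isMap_id := TriSum.isMap_id

namespace DetFunctor

variable {T : TrCat.{u}} {P Q : PicCat.{u}} (D : DetFunctor T P)

lemma additivity_comm {a b s : T} {u : a ⟶ s} {v : s ⟶ b} {u' : b ⟶ s} {v' : s ⟶ a}
    {w : b ⟶ a⟦(1 : ℤ)⟧} {w' : a ⟶ b⟦(1 : ℤ)⟧} (h : Triangle.mk u v w ∈ distTriang T)
    (h' : Triangle.mk u' v' w' ∈ distTriang T) (hw : w = 0) (hw' : w' = 0) (e₁ : u ≫ v' = 𝟙 a)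
    (e₂ : u' ≫ v = 𝟙 b) :
    (β_ (D.functor.obj ⟨a⟩) (D.functor.obj ⟨b⟩)).hom ≫ D.additivity _ h = D.additivity _ h' := by
  subst hw hw'
  have z₁ : u ≫ v = 0 := comp_distTriang_mor_zero₁₂ _ h
  have z₂ : u' ≫ v' = 0 := comp_distTriang_mor_zero₁₂ _ h'
  let B : BinaryBicone a b :=
    { pt := s, fst := v', snd := v, inl := u, inr := u'
      inl_fst := e₁, inl_snd := z₁, inr_fst := z₂, inr_snd := e₂ }
  refine D.commutativity B (isBinaryBilimitOfTotal B ?_) h h'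
  change v' ≫ u + v ≫ u' = 𝟙 _
  -- The difference from the identity is killed by `u`, hence factors through `v` by exactness of
  -- the triangle; precomposing with the section `u'` shows that the factor vanishes.
  have h0 : u ≫ (𝟙 s - (v' ≫ u + v ≫ u')) = 0 := by
    rw [Preadditive.comp_sub, Preadditive.comp_add, ← assoc, ← assoc, z₁, e₁]
    simp
  have ht' : ∃ t : b ⟶ s, 𝟙 s - (v' ≫ u + v ≫ u') = v ≫ t := Triangle.yoneda_exact₂ _ h _ h0
  obtain ⟨t, ht⟩ := ht'
  have h3 : t = 0 := by
    rw [← id_comp t, ← e₂, assoc, ← ht]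
    rw [Preadditive.comp_sub, Preadditive.comp_add, ← assoc, ← assoc, z₂, e₂]
    simp
  rw [h3, comp_zero, sub_eq_zero] at ht
  exact ht.symm

/-- The connecting morphism `l` is a variable subject to an equation, because the triangle on the
cones is usually given with its own connecting morphism rather than with the composite that
`Octahedron.mem` demands. -/
lemma additivity_octahedron {x y z z' x' y' : T} {f : x ⟶ y} {g : y ⟶ z} {k : x ⟶ z}
    {f' : y ⟶ z'} {f'' : z' ⟶ x⟦(1 : ℤ)⟧} (h₁ : Triangle.mk f f' f'' ∈ distTriang T)
    {g' : z ⟶ x'} {g'' : x' ⟶ y⟦(1 : ℤ)⟧} (h₃ : Triangle.mk g g' g'' ∈ distTriang T)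
    {k' : z ⟶ y'} {k'' : y' ⟶ x⟦(1 : ℤ)⟧} (h₂ : Triangle.mk k k' k'' ∈ distTriang T)
    {m : z' ⟶ y'} {n : y' ⟶ x'} {l : x' ⟶ z'⟦(1 : ℤ)⟧} (h₄ : Triangle.mk m n l ∈ distTriang T)
    (e₁ : f ≫ g = k) (e₂ : f' ≫ m = g ≫ k') (e₃ : m ≫ k'' = f'') (e₄ : k' ≫ n = g')
    (e₅ : k'' ≫ f⟦(1 : ℤ)⟧' = n ≫ g'') (e₆ : l = g'' ≫ f'⟦(1 : ℤ)⟧') :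
    (D.additivity _ h₄ ▷ D.functor.obj ⟨x⟩) ≫ D.additivity _ h₂ =
      (α_ (D.functor.obj ⟨x'⟩) (D.functor.obj ⟨z'⟩) (D.functor.obj ⟨x⟩)).hom ≫
        (D.functor.obj ⟨x'⟩ ◁ D.additivity _ h₁) ≫ D.additivity _ h₃ := by
  subst e₆
  exact D.octahedron e₁ h₁ h₃ h₂
    { m₁ := m, m₃ := n, comm₁ := e₂, comm₂ := e₃, comm₃ := e₄, comm₄ := e₅, mem := h₄ }

/-- A determinant functor, as an additive functor. -/
def toAdd : AddFunctor (SumCat.ofTr T) P where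
  functor := D.functor
  sum σ := D.additivity _ σ.dist
  sum_map σ σ' p q r h := D.naturality σ.dist σ'.dist q.iso r.iso p.iso h.u h.v h.w
  sum_assoc σ₁ σ₂ σ₃ σ₄ h := D.additivity_octahedron σ₃.dist σ₄.dist σ₂.dist σ₁.dist h.h₁ h.h₂ h.h₃
    h.h₄ h.h₅ h.h₆
  sum_comm σ σ' h := D.additivity_comm σ'.dist σ.dist h.w' h.w h.h₁ h.h₂

/-- An additive functor on the distinguished triangles, as a determinant functor. -/
def ofAdd (F : AddFunctor (SumCat.ofTr T) P) : DetFunctor T P where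
  functor := F.functor
  additivity Δ hΔ := F.sum (x := ⟨Δ.obj₃⟩) (y := ⟨Δ.obj₁⟩) (s := ⟨Δ.obj₂⟩)
    ⟨Δ.mor₁, Δ.mor₂, Δ.mor₃, hΔ⟩
  naturality hΔ hΔ' p q r h₁ h₂ h₃ := F.sum_map _ _ _ _ _ ⟨h₁, h₂, h₃⟩
  commutativity b hb h₁ h₂ := F.sum_comm _ _ ⟨rfl, rfl, b.inl_fst, b.inr_snd⟩
  octahedron := by
    intro x y z z' x' y' f g k comm f' f'' h₁ g' g'' h₃ k' k'' h₂ o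
    exact F.sum_assoc (x := ⟨x'⟩) (y := ⟨z'⟩) (z := ⟨x⟩) (s := ⟨y'⟩) (t := ⟨y⟩) (w := ⟨z⟩)
      ⟨_, _, _, o.mem⟩ ⟨_, _, _, h₂⟩ ⟨_, _, _, h₁⟩ ⟨_, _, _, h₃⟩
      ⟨comm, o.comm₁, o.comm₂, o.comm₃, o.comm₄, rfl⟩

end DetFunctor

/-- For every `F`, universality supplies an initial pair among the additive functors `G` with a
transformation from their restriction to `F` (`key`). Unit constraints cause no trouble, since
additive functors are braided and additive transformations are monoidal. Essential surjectivity is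
then clear, transformations being invertible, and full faithfulness follows by comparing maps out of
an initial pair. -/
lemma isUniversal_toAdd {T : TrCat.{u}} {Q : PicCat.{u}} {d : DetFunctor T Q} (hd : d.IsUniversal) :
    d.toAdd.IsUniversal := by
  intro P
  have key : ∀ (F : AddFunctor (SumCat.ofTr T) P),
      ∃ (G : AddFunctor (SumCat.ofPic Q) P) (α : (d.toAdd.precomp P).obj G ⟶ F),
        ∀ (G' : AddFunctor (SumCat.ofPic Q) P) (α' : (d.toAdd.precomp P).obj G' ⟶ F),
          ∃! γ : G ⟶ G', (d.toAdd.precomp P).map γ ≫ α' = α := by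
    intro F
    obtain ⟨f, hf, α, hα, huniv⟩ := hd P (DetFunctor.ofAdd F)
    refine ⟨AddFunctor.ofBraided f, { natTrans := α, comm := fun σ => ?_ }, fun G' α' => ?_⟩
    · exact (assoc _ _ _).trans (hα _ σ.dist)
    · letI := G'.braided
      obtain ⟨γ, ⟨h₁, h₂⟩, h₃⟩ := huniv G'.functor G'.braided α'.natTrans (fun Δ hΔ => by
        have := α'.comm (x := ⟨Δ.obj₃⟩) (y := ⟨Δ.obj₁⟩) (s := ⟨Δ.obj₂⟩) ⟨Δ.mor₁, Δ.mor₂, Δ.mor₃, hΔ⟩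
        refine Eq.trans ?_ this
        refine (assoc _ _ _).symm.trans (congrArg (· ≫ _) ?_)
        exact (G'.sum_eq _).symm)
      have hc : ∀ {x y s : Q} (σ : x ⊗ y ⟶ s), (AddFunctor.ofBraided f).sum σ ≫ γ.app s =
          (γ.app x ⊗ₘ γ.app y) ≫ G'.sum σ := fun {x y s} σ => by
        have e : μ f x y ≫ γ.app (x ⊗ y) = (γ.app x ⊗ₘ γ.app y) ≫ G'.sum (𝟙 (x ⊗ y)) :=
          NatTrans.IsMonoidal.tensor (C := Q) (τ := γ) x y
        have n := γ.naturality σ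
        change (μ f x y ≫ f.map σ) ≫ γ.app s = _
        rw [assoc, n, reassoc_of% e, ← G'.sum_eq]
      refine ⟨AddFunctor.Hom.mk γ hc, AddFunctor.Hom.ext h₂, fun γ' hγ' => ?_⟩
      refine AddFunctor.Hom.ext (h₃ γ'.natTrans ⟨?_, congrArg AddFunctor.Hom.natTrans hγ'⟩)
      refine AddFunctor.isMonoidal_of_tensor (f := f) (Q := Q) γ'.natTrans fun x y => ?_
      have := γ'.comm (x := x) (y := y) (𝟙 (x ⊗ y))
      rw [AddFunctor.ofBraided_sum, f.map_id, comp_id] at this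
      exact this
  have full : ∀ {G G' : AddFunctor (SumCat.ofPic Q) P}
      (δ : (d.toAdd.precomp P).obj G ⟶ (d.toAdd.precomp P).obj G'),
      ∃! γ : G ⟶ G', (d.toAdd.precomp P).map γ = δ := by
    intro G G' δ
    -- The initial pair over the restriction of `G` maps to `(G, 𝟙)` by `γ₀` and, as `δ` is
    -- invertible, to `(G', inv δ)` by `γ₁`. The preimage of `δ` has to be `inv γ₀ ≫ γ₁`.
    obtain ⟨U, α, h⟩ := key ((d.toAdd.precomp P).obj G)
    obtain ⟨γ₀, h₀, -⟩ := h G (𝟙 _)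
    obtain ⟨γ₁, h₁, h₁'⟩ := h G' (inv δ)
    simp only [comp_id] at h₀
    refine ⟨inv γ₀ ≫ γ₁, ?_, fun γ hγ => ?_⟩
    · simp only [Functor.map_comp, Functor.map_inv]
      rw [IsIso.inv_comp_eq, h₀, ← h₁, assoc, IsIso.inv_hom_id, comp_id]
    · rw [IsIso.eq_inv_comp]
      refine h₁' _ ?_
      simp only [Functor.map_comp]
      rw [hγ, assoc, IsIso.hom_inv_id, comp_id, h₀]
  exact
    { faithful := ⟨fun {G G' γ γ'} h => (full ((d.toAdd.precomp P).map γ')).unique h rfl⟩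
      full := ⟨fun δ => ⟨_, (full δ).exists.choose_spec⟩⟩
      essSurj := ⟨fun F => by
        obtain ⟨G, α, -⟩ := key F
        exact ⟨G, ⟨asIso α⟩⟩⟩ }

/-! ### Multiexact functors of Picard groupoids as multiadditive functors -/

namespace PicFunctor

variable {ι : Type} {A : ι → PicCat.{u}} {P : PicCat.{u}}

/-- The two notions of a sum in one variable agree. -/
def _root_.DetFun.SumIn.ofElem {i : ι} {x y s : ∀ j, A j}
    (σ : ElemSum (fun i => SumCat.ofPic (A i)) i x y s) : SumIn A i x y s where
  main := σ.main
  fst := σ.fst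
  snd := σ.snd

/-- The two notions of a sum in one variable agree. -/
def _root_.DetFun.SumIn.toElem {i : ι} {x y s : ∀ j, A j}
    (σ : SumIn A i x y s) : ElemSum (fun i => SumCat.ofPic (A i)) i x y s where
  main := σ.main
  fst := σ.fst
  snd := σ.snd

/-- A multiexact functor, as a multiadditive functor. -/
def toMulti (f : PicFunctor A P) (hf : f.IsMultiexact) :
    MultiAdd (fun i => SumCat.ofPic (A i)) P where
  functor := f.functor
  sum i _ _ _ σ := f.sum i (SumIn.ofElem σ)
  sum_map i _ _ _ _ _ _ σ σ' := hf.naturality i (SumIn.ofElem σ) (SumIn.ofElem σ')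
  sum_assoc i _ _ _ _ _ _ σ₁ σ₂ σ₃ σ₄ :=
    hf.associativity i (SumIn.ofElem σ₁) (SumIn.ofElem σ₂) (SumIn.ofElem σ₃) (SumIn.ofElem σ₄)
  sum_comm i _ _ _ σ σ' := hf.commutativity i (SumIn.ofElem σ) (SumIn.ofElem σ')
  interchange i k hik _ _ _ _ _ _ _ _ _ σ₀ σ₁ σ τ₀ τ₁ τ := hf.interchange i k hik
    (SumIn.ofElem σ₀) (SumIn.ofElem σ₁) (SumIn.ofElem σ) (SumIn.ofElem τ₀) (SumIn.ofElem τ₁)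
    (SumIn.ofElem τ)

/-- A multiadditive functor, as a functor of Picard groupoids. -/
def ofMulti (F : MultiAdd (fun i => SumCat.ofPic (A i)) P) : PicFunctor A P where
  functor := F.functor
  sum i _ _ _ σ := F.sum i σ.toElem

lemma ofMulti_isMultiexact (F : MultiAdd (fun i => SumCat.ofPic (A i)) P) :
    (ofMulti F).IsMultiexact where
  naturality i _ _ _ _ _ _ σ σ' := F.sum_map i σ.toElem σ'.toElem
  associativity i _ _ _ _ _ _ σ₁ σ₂ σ₃ σ₄ := F.sum_assoc i σ₁.toElem σ₂.toElem σ₃.toElem σ₄.toElem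
  commutativity i _ _ _ σ σ' := F.sum_comm i σ.toElem σ'.toElem
  interchange i k hik _ _ _ _ _ _ _ _ _ σ₀ σ₁ σ τ₀ τ₁ τ := F.interchange i k hik
    σ₀.toElem σ₁.toElem σ.toElem τ₀.toElem τ₁.toElem τ.toElem

variable (A P) in
/-- Multiexact functors as multiadditive functors. -/
def multi : Pic A P ⥤ MultiAdd (fun i => SumCat.ofPic (A i)) P where
  obj f := f.obj.toMulti f.property
  map γ := { natTrans := γ.hom.natTrans, comm := fun i _ _ _ σ => γ.hom.comm i (SumIn.ofElem σ) }

instance : (multi A P).IsEquivalence where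
  faithful := ⟨fun {f g γ γ'} h => ObjectProperty.hom_ext _
    (PicFunctor.Hom.ext (congrArg MultiAdd.Hom.natTrans h))⟩
  full := ⟨fun {f g} γ => ⟨ObjectProperty.homMk
    { natTrans := γ.natTrans, comm := fun i _ _ _ σ => γ.comm i σ.toElem }, rfl⟩⟩
  essSurj := ⟨fun F => ⟨⟨ofMulti F, ofMulti_isMultiexact F⟩, ⟨Iso.refl _⟩⟩⟩

end PicFunctor

/-! ### Multideterminant functors as multiadditive functors -/

section

variable {ι : Type} {T : ι → TrCat.{u}} {P : PicCat.{u}}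

lemma exists_pi {α : ι → Type*} (i : ι) (a : α i) (b : ∀ j, j ≠ i → α j) :
    ∃ f : ∀ j, α j, f i = a ∧ ∀ j h, f j = b j h := by
  classical
  exact ⟨fun j => if h : j = i then h ▸ a else b j h, by simp, fun j h => by simp [h]⟩

/-- In the sum of a triangle the cone is included, outside the variable of the triangle, by the
inverse of `v`. This lemma converts squares of such inverses into squares of the `v` themselves, and
back. -/
lemma iso_square {C : Type*} [Category C] {a b c d : C} {e : b ≅ a} {e' : d ≅ c} {p : a ⟶ c}
    {q : b ⟶ d} : e.hom ≫ p = q ≫ e'.hom ↔ e.inv ≫ q = p ≫ e'.inv := by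
  rw [Iso.inv_comp_eq, ← assoc, Iso.eq_comp_inv, eq_comm]

/-- A triangle in one variable, as a sum. -/
noncomputable def TriangleIn.toElem {i : ι} {x y z : ∀ j, T j} (Δ : TriangleIn T i x y z) :
    ElemSum (fun i => SumCat.ofTr (T i)) i (fun j => ⟨z j⟩) (fun j => ⟨x j⟩) (fun j => ⟨y j⟩) where
  main := ⟨Δ.u i, Δ.v i, Δ.w.main, Δ.dist⟩
  fst j h := have := Δ.isIso_v j h; ⟨(asIso (Δ.v j)).symm⟩
  snd j h := have := Δ.isIso_u j h; ⟨asIso (Δ.u j)⟩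

/-- The triangle in one variable underlying a sum, given its components. -/
lemma exists_triangleIn {i : ι} {x y z : ∀ j, Core (T j)}
    (σ : ElemSum (fun i => SumCat.ofTr (T i)) i z x y) :
    ∃ Δ : TriangleIn T i (fun j => (x j).of) (fun j => (y j).of) (fun j => (z j).of),
      Δ.u i = σ.main.u ∧ Δ.v i = σ.main.v ∧ Δ.w.main = σ.main.w ∧
      (∀ j h, Δ.u j = (σ.snd j h).iso.hom) ∧ (∀ j h, Δ.v j = (σ.fst j h).iso.inv) := by
  obtain ⟨u, hu, hu'⟩ := exists_pi (α := fun j => (x j).of ⟶ (y j).of) i σ.main.u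
    (fun j h => (σ.snd j h).iso.hom)
  obtain ⟨v, hv, hv'⟩ := exists_pi (α := fun j => (y j).of ⟶ (z j).of) i σ.main.v
    (fun j h => (σ.fst j h).iso.inv)
  exact ⟨{
    u := u
    v := v
    -- Outside `i` there is no freedom: `off_comp` prescribes the inverse of the composite.
    w := { main := σ.main.w, off := fun j h => (σ.fst j h).iso.hom ≫ (σ.snd j h).iso.inv }
    dist := by rw [hu, hv]; exact σ.main.dist
    isIso_u := fun j h => by rw [hu' j h]; infer_instance
    isIso_v := fun j h => by rw [hv' j h]; infer_instance
    off_comp := fun j h => by rw [hu' j h, hv' j h]; simp }, hu, hv, rfl, hu', hv'⟩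

lemma exists_toElem {i : ι} {x y z : ∀ j, Core (T j)}
    (σ : ElemSum (fun i => SumCat.ofTr (T i)) i z x y) :
    ∃ Δ : TriangleIn T i (fun j => (x j).of) (fun j => (y j).of) (fun j => (z j).of),
      Δ.toElem = σ := by
  obtain ⟨Δ, hu, hv, hw, hu', hv'⟩ := exists_triangleIn σ
  refine ⟨Δ, ?_⟩
  obtain ⟨⟨u, v, w, d⟩, f, s⟩ := σ
  dsimp only at hu hv hw hu' hv'
  subst hu hv hw
  have e₁ : Δ.toElem.fst = f := by
    funext j h
    refine CoreHom.ext (Iso.ext_inv ?_)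
    exact hv' j h
  have e₂ : Δ.toElem.snd = s := by
    funext j h
    refine CoreHom.ext (Iso.ext ?_)
    exact hu' j h
  rw [← e₁, ← e₂]
  rfl

/-- The one datum that `toElem` forgets, the part of `w` outside `i`, is determined by `off_comp`,
as `u` and `v` are invertible there. This makes the value of `DetData.elemSum` independent of the
chosen triangle. -/
lemma TriangleIn.ext_of_toElem {i : ι} {x y z : ∀ j, T j} {Δ Δ' : TriangleIn T i x y z}
    (h : Δ.toElem = Δ'.toElem) : Δ = Δ' := by
  have h₁ : Δ.u = Δ'.u := by
    funext j
    by_cases hj : j = i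
    · subst hj
      exact congrArg (fun σ => σ.main.u) h
    · exact congrArg (fun σ => (σ.snd j hj).iso.hom) h
  have h₂ : Δ.v = Δ'.v := by
    funext j
    by_cases hj : j = i
    · subst hj
      exact congrArg (fun σ => σ.main.v) h
    · exact congrArg (fun σ => (σ.fst j hj).iso.inv) h
  have h₃ : Δ.w = Δ'.w := by
    refine DegHom.ext (congrArg (fun σ => σ.main.w) h) ?_
    funext j hj
    have := Δ.isIso_u j hj
    have := Δ.isIso_v j hj
    have e := Δ'.off_comp j hj
    rw [← h₁, ← h₂, ← Δ.off_comp j hj] at e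
    exact ((cancel_epi _).1 ((cancel_epi _).1 e)).symm
  obtain ⟨u, v, w, _, _, _, _⟩ := Δ
  obtain ⟨u', v', w', _, _, _, _⟩ := Δ'
  dsimp only at h₁ h₂ h₃
  subst h₁ h₂ h₃
  rfl

lemma TriangleIn.isMap_of_toElem {i : ι} {x y z x' y' z' : ∀ j, T j} {Δ : TriangleIn T i x y z}
    {Δ' : TriangleIn T i x' y' z'} {p : x ⟶ x'} {q : y ⟶ y'} {r : z ⟶ z'}
    (h₁ : Δ.u i ≫ q i = p i ≫ Δ'.u i) (h₂ : Δ.v i ≫ r i = q i ≫ Δ'.v i)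
    (h₃ : Δ.w.main ≫ (p i)⟦(1 : ℤ)⟧' = r i ≫ Δ'.w.main)
    (h₄ : ∀ j, j ≠ i → Δ.u j ≫ q j = p j ≫ Δ'.u j)
    (h₅ : ∀ j, j ≠ i → Δ.v j ≫ r j = q j ≫ Δ'.v j) : Δ.IsMap Δ' p q r where
  comm₁ := funext fun j => by
    by_cases hj : j = i
    · subst hj; exact h₁
    · exact h₄ j hj
  comm₂ := funext fun j => by
    by_cases hj : j = i
    · subst hj; exact h₂
    · exact h₅ j hj
  comm₃ := h₃

/-- A family of cores is the core of the product. -/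
def coreJoin (T : ι → TrCat.{u}) : (∀ i, Core (T i)) ⥤ Core (∀ i, T i) where
  obj x := ⟨fun i => (x i).of⟩
  map p := ⟨Pi.isoMk fun i => (p i).iso⟩

namespace DetData

/-- The sum attached to a triangle in one variable. -/
noncomputable def elemSum (D : DetData T P) (i : ι) {z x y : ∀ j, Core (T j)}
    (σ : ElemSum (fun i => SumCat.ofTr (T i)) i z x y) :
    D.functor.obj ⟨fun j => (z j).of⟩ ⊗ D.functor.obj ⟨fun j => (x j).of⟩ ⟶
      D.functor.obj ⟨fun j => (y j).of⟩ :=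
  D.additivity i (exists_toElem σ).choose

lemma elemSum_eq (D : DetData T P) (i : ι) {z x y : ∀ j, Core (T j)}
    {σ : ElemSum (fun i => SumCat.ofTr (T i)) i z x y}
    {Δ : TriangleIn T i (fun j => (x j).of) (fun j => (y j).of) (fun j => (z j).of)}
    (h : Δ.toElem = σ) : D.elemSum i σ = D.additivity i Δ :=
  congrArg (D.additivity i) (TriangleIn.ext_of_toElem ((exists_toElem σ).choose_spec.trans h.symm))

end DetData

lemma core_snd_square {i : ι} {x y z x' y' z' : ∀ j, Core (T j)}
    {Δ : TriangleIn T i (fun j => (x j).of) (fun j => (y j).of) (fun j => (z j).of)}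
    {Δ' : TriangleIn T i (fun j => (x' j).of) (fun j => (y' j).of) (fun j => (z' j).of)}
    {p : x ⟶ x'} {q : y ⟶ y'} {j : ι} (h : j ≠ i)
    (e : Δ.toElem.snd j h ≫ q j = p j ≫ Δ'.toElem.snd j h) :
    Δ.u j ≫ (q j).iso.hom = (p j).iso.hom ≫ Δ'.u j :=
  congrArg (fun t => t.iso.hom) e

lemma core_fst_square {i : ι} {x y z x' y' z' : ∀ j, Core (T j)}
    {Δ : TriangleIn T i (fun j => (x j).of) (fun j => (y j).of) (fun j => (z j).of)}
    {Δ' : TriangleIn T i (fun j => (x' j).of) (fun j => (y' j).of) (fun j => (z' j).of)}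
    {r : z ⟶ z'} {q : y ⟶ y'} {j : ι} (h : j ≠ i)
    (e : Δ.toElem.fst j h ≫ q j = r j ≫ Δ'.toElem.fst j h) :
    Δ.v j ≫ (r j).iso.hom = (q j).iso.hom ≫ Δ'.v j :=
  iso_square.1 (congrArg (fun t => t.iso.hom) e :
    (Δ.toElem.fst j h).iso.hom ≫ (q j).iso.hom = (r j).iso.hom ≫ (Δ'.toElem.fst j h).iso.hom)

/-- A sum of x and y comes from a triangle y → s → x, so the grid is filled in reverse order: `x₀₀`
stands at position (2, 2) and `x₁₁` at (0, 0). -/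
lemma triangleGrid_of_toElem {i k : ι} {x₀₀ x₁₀ x₀₁ x₁₁ s₀ s₁ t₀ t₁ w : ∀ j, T j}
    {σ₀ : TriangleIn T i x₁₀ s₀ x₀₀} {σ₁ : TriangleIn T i x₁₁ s₁ x₀₁} {σ : TriangleIn T k s₁ w s₀}
    {τ₀ : TriangleIn T k x₀₁ t₀ x₀₀} {τ₁ : TriangleIn T k x₁₁ t₁ x₁₀} {τ : TriangleIn T i t₁ w t₀}
    (h₁ : σ₁.IsMap τ τ₁.u σ.u τ₀.u) (h₂ : τ.IsMap σ₀ τ₁.v σ.v τ₀.v)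
    (h₃ : τ₁.IsMap σ σ₁.u τ.u σ₀.u) (h₄ : σ.IsMap τ₀ σ₁.v τ.v σ₀.v) {D : DetData T P}
    (hD : D.IsMultiDet) (hik : i ≠ k) :
    (D.additivity i σ₀ ⊗ₘ D.additivity i σ₁) ≫ D.additivity k σ =
      tensorμ (D.functor.obj ⟨x₀₀⟩) (D.functor.obj ⟨x₁₀⟩) (D.functor.obj ⟨x₀₁⟩)
        (D.functor.obj ⟨x₁₁⟩) ≫ (D.additivity k τ₀ ⊗ₘ D.additivity k τ₁) ≫ D.additivity i τ :=
  hD.two_triangles i k hik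
    { X := fun a b => match a, b with
        | 0, 0 => x₁₁ | 1, 0 => s₁ | 2, 0 => x₀₁
        | 0, 1 => t₁ | 1, 1 => w | 2, 1 => t₀
        | 0, 2 => x₁₀ | 1, 2 => s₀ | 2, 2 => x₀₀
      row := fun b => match b with | 0 => σ₁ | 1 => τ | 2 => σ₀
      col := fun b => match b with | 0 => τ₁ | 1 => σ | 2 => τ₀
      row_u := h₁
      row_v := h₂
      col_u := h₃
      col_v := h₄ }

lemma isMap_of_core {i : ι} {x y z x' y' z' : ∀ j, Core (T j)}
    {Δ : TriangleIn T i (fun j => (x j).of) (fun j => (y j).of) (fun j => (z j).of)}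
    {Δ' : TriangleIn T i (fun j => (x' j).of) (fun j => (y' j).of) (fun j => (z' j).of)}
    {p : x ⟶ x'} {q : y ⟶ y'} {r : z ⟶ z'}
    (h : TriSum.IsMap Δ.toElem.main Δ'.toElem.main (r i) (p i) (q i))
    (h₁ : ∀ j h, Δ.toElem.fst j h ≫ q j = r j ≫ Δ'.toElem.fst j h)
    (h₂ : ∀ j h, Δ.toElem.snd j h ≫ q j = p j ≫ Δ'.toElem.snd j h) :
    Δ.IsMap Δ' (fun j => (p j).iso.hom) (fun j => (q j).iso.hom) (fun j => (r j).iso.hom) :=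
  TriangleIn.isMap_of_toElem h.u h.v h.w (fun j hj => core_snd_square hj (h₂ j hj))
    (fun j hj => core_fst_square hj (h₁ j hj))

/-- Half of the compatibilities of a grid; the other half is the same statement with `i` and `k`
exchanged. Each is checked in three places: at `i`, at `k`, and at the remaining indices, where all
morphisms are invertible. -/
lemma grid_isMap {i k : ι} (hik : i ≠ k) {x₀₀ x₁₀ x₀₁ x₁₁ s₀ s₁ t₀ t₁ w : ∀ j, T j}
    {σ₀ : TriangleIn T i x₁₀ s₀ x₀₀} {σ₁ : TriangleIn T i x₁₁ s₁ x₀₁} {σ : TriangleIn T k s₁ w s₀}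
    {τ₀ : TriangleIn T k x₀₁ t₀ x₀₀} {τ₁ : TriangleIn T k x₁₁ t₁ x₁₀} {τ : TriangleIn T i t₁ w t₀}
    (h₁ : TriSum.IsMap σ₀.toElem.main τ.toElem.main (τ₀.toElem.fst i hik) (τ₁.toElem.fst i hik)
      (σ.toElem.fst i hik))
    (h₂ : TriSum.IsMap σ₁.toElem.main τ.toElem.main (τ₀.toElem.snd i hik) (τ₁.toElem.snd i hik)
      (σ.toElem.snd i hik))
    (h₃ : TriSum.IsMap τ₀.toElem.main σ.toElem.main (σ₀.toElem.fst k hik.symm)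
      (σ₁.toElem.fst k hik.symm) (τ.toElem.fst k hik.symm))
    (h₄ : TriSum.IsMap τ₁.toElem.main σ.toElem.main (σ₀.toElem.snd k hik.symm)
      (σ₁.toElem.snd k hik.symm) (τ.toElem.snd k hik.symm))
    (h₅ : ∀ j (hi : j ≠ i) (hk : j ≠ k),
      σ₀.toElem.fst j hi ≫ σ.toElem.fst j hk = τ₀.toElem.fst j hk ≫ τ.toElem.fst j hi ∧
      σ₀.toElem.snd j hi ≫ σ.toElem.fst j hk = τ₁.toElem.fst j hk ≫ τ.toElem.snd j hi ∧
      σ₁.toElem.fst j hi ≫ σ.toElem.snd j hk = τ₀.toElem.snd j hk ≫ τ.toElem.fst j hi ∧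
      σ₁.toElem.snd j hi ≫ σ.toElem.snd j hk = τ₁.toElem.snd j hk ≫ τ.toElem.snd j hi) :
    σ₁.IsMap τ τ₁.u σ.u τ₀.u ∧ τ.IsMap σ₀ τ₁.v σ.v τ₀.v := by
  refine ⟨TriangleIn.isMap_of_toElem h₂.u h₂.v h₂.w ?_ ?_, TriangleIn.isMap_of_toElem
    (iso_square.1 h₁.u.symm).symm (iso_square.1 h₁.v.symm).symm ?_ ?_ ?_⟩
  · intro j hi
    by_cases hk : j = k
    · subst hk; exact h₄.u.symm
    · exact congrArg (fun t => t.iso.hom) (h₅ j hi hk).2.2.2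
  · intro j hi
    by_cases hk : j = k
    · subst hk; exact iso_square.1 h₃.u.symm
    · exact (iso_square.1 (congrArg (fun t => t.iso.hom) (h₅ j hi hk).2.2.1 :) :)
  · exact (iso_square (e := (τ₀.toElem.fst i hik).iso)
      (e' := (shiftFunctor (T i) (1 : ℤ)).mapIso (τ₁.toElem.fst i hik).iso)).1 h₁.w.symm |>.symm
  · intro j hi
    by_cases hk : j = k
    · subst hk; exact h₄.v.symm
    · exact (iso_square.1 (congrArg (fun t => t.iso.hom) (h₅ j hi hk).2.1.symm :)).symm
  · intro j hi
    by_cases hk : j = k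
    · subst hk; exact iso_square.1 h₃.v.symm
    · exact (congrArg (fun t => t.iso.inv) (h₅ j hi hk).1).symm

namespace DetData

/-- A multideterminant functor, as a multiadditive functor. -/
noncomputable def toMulti (D : DetData T P) (hD : D.IsMultiDet) :
    MultiAdd (fun i => SumCat.ofTr (T i)) P where
  functor := coreJoin T ⋙ D.functor
  sum i _ _ _ σ := D.elemSum i σ
  sum_map i z x y z' x' y' σ σ' r p q h h₁ h₂ := by
    obtain ⟨Δ, rfl⟩ := exists_toElem σ
    obtain ⟨Δ', rfl⟩ := exists_toElem σ'
    rw [D.elemSum_eq i rfl, D.elemSum_eq i rfl]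
    exact hD.naturality i Δ Δ' (Pi.isoMk fun j => (p j).iso) (Pi.isoMk fun j => (q j).iso)
      (Pi.isoMk fun j => (r j).iso) (isMap_of_core h h₁ h₂)
  sum_assoc i x y z s t w σ₁ σ₂ σ₃ σ₄ h h₁ h₂ h₃ := by
    obtain ⟨Δ₁, rfl⟩ := exists_toElem σ₁
    obtain ⟨Δ₂, rfl⟩ := exists_toElem σ₂
    obtain ⟨Δ₃, rfl⟩ := exists_toElem σ₃
    obtain ⟨Δ₄, rfl⟩ := exists_toElem σ₄
    rw [D.elemSum_eq i rfl, D.elemSum_eq i rfl, D.elemSum_eq i rfl, D.elemSum_eq i rfl]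
    refine hD.octahedron i Δ₃ Δ₂ Δ₄ Δ₁ ?_ ?_ h.h₃ ?_ h.h₅ h.h₆
    · funext j
      by_cases hj : j = i
      · subst hj; exact h.h₁
      · exact (congrArg (fun t => t.iso.hom) (h₃ j hj)).symm
    · funext j
      by_cases hj : j = i
      · subst hj; exact h.h₂
      · exact (iso_square.1 (congrArg (fun t => t.iso.hom) (h₂ j hj)).symm :)
    · funext j
      by_cases hj : j = i
      · subst hj; exact h.h₄
      · exact congrArg (fun t => t.iso.inv) (h₁ j hj)
  sum_comm i x y s σ σ' h h₁ h₂ := by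
    obtain ⟨Δ, rfl⟩ := exists_toElem σ
    obtain ⟨Δ', rfl⟩ := exists_toElem σ'
    rw [D.elemSum_eq i rfl, D.elemSum_eq i rfl]
    refine hD.commutativity i Δ' Δ h.w' h.w ?_ ?_
    · funext j
      by_cases hj : j = i
      · subst hj; exact h.h₁
      · have := Δ.isIso_v j hj
        exact (congrArg (· ≫ Δ.v j) (congrArg (fun t => t.iso.hom) (h₁ j hj))).symm.trans
          (IsIso.inv_hom_id (Δ.v j))
    · funext j
      by_cases hj : j = i
      · subst hj; exact h.h₂
      · have := Δ'.isIso_v j hj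
        exact (congrArg (· ≫ Δ'.v j) (congrArg (fun t => t.iso.hom) (h₂ j hj))).trans
          (IsIso.inv_hom_id (Δ'.v j))
  interchange i k hik x₀₀ x₁₀ x₀₁ x₁₁ s₀ s₁ t₀ t₁ w σ₀ σ₁ σ τ₀ τ₁ τ h₁ h₂ h₃ h₄ h₅ := by
    obtain ⟨σ₀, rfl⟩ := exists_toElem σ₀
    obtain ⟨σ₁, rfl⟩ := exists_toElem σ₁
    obtain ⟨σ, rfl⟩ := exists_toElem σ
    obtain ⟨τ₀, rfl⟩ := exists_toElem τ₀
    obtain ⟨τ₁, rfl⟩ := exists_toElem τ₁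
    obtain ⟨τ, rfl⟩ := exists_toElem τ
    rw [D.elemSum_eq i rfl, D.elemSum_eq i rfl, D.elemSum_eq i rfl, D.elemSum_eq k rfl,
      D.elemSum_eq k rfl, D.elemSum_eq k rfl]
    obtain ⟨a, b⟩ := grid_isMap hik h₁ h₂ h₃ h₄ h₅
    obtain ⟨c, d⟩ := grid_isMap hik.symm h₃ h₄ h₁ h₂ (fun j hk hi =>
      ⟨(h₅ j hi hk).1.symm, (h₅ j hi hk).2.2.1.symm, (h₅ j hi hk).2.1.symm,
        (h₅ j hi hk).2.2.2.symm⟩)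
    exact triangleGrid_of_toElem a b c d hD hik

variable (T P) in
/-- Multideterminant functors as multiadditive functors. -/
noncomputable def multi : Det T P ⥤ MultiAdd (fun i => SumCat.ofTr (T i)) P where
  obj D := D.obj.toMulti D.property
  map γ :=
    { natTrans := Functor.whiskerLeft (coreJoin T) γ.hom.natTrans
      comm := fun i _ _ _ σ => γ.hom.comm i _ }

instance : (multi T P).Faithful where
  map_injective {D E f g} h := by
    refine ObjectProperty.hom_ext _ (DetData.Hom.ext (NatTrans.ext (funext fun x => ?_)))
    exact congrArg (fun t => t.natTrans.app (fun j => ⟨x.of j⟩)) h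

/-- Essential surjectivity of this embedding is not needed: full faithfulness suffices to transfer
the equivalence for multiadditive functors to `det^*`. -/
instance : (multi T P).Full where
  map_surjective {D E} N := by
    have c : ∀ (i : ι) {x y z : ∀ j, T j} (Δ : TriangleIn T i x y z),
        D.obj.additivity i Δ ≫ N.natTrans.app (fun j => ⟨y j⟩) =
          (N.natTrans.app (fun j => ⟨z j⟩) ⊗ₘ N.natTrans.app (fun j => ⟨x j⟩)) ≫
            E.obj.additivity i Δ := fun i x y z Δ => by
      have := N.comm i Δ.toElem
      have e₁ : ((multi T P).obj D).sum i Δ.toElem = D.obj.additivity i Δ := elemSum_eq _ _ rfl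
      have e₂ : ((multi T P).obj E).sum i Δ.toElem = E.obj.additivity i Δ := elemSum_eq _ _ rfl
      rw [e₁, e₂] at this
      exact this
    refine ⟨ObjectProperty.homMk
      { natTrans :=
          { app := fun x => N.natTrans.app (fun j => ⟨x.of j⟩)
            naturality := fun x y p => ?_ }
        comm := c }, ?_⟩
    · exact N.natTrans.naturality (X := fun j => ⟨x.of j⟩) (Y := fun j => ⟨y.of j⟩)
        (fun j => ⟨Pi.isoApp p.iso j⟩)
    · exact MultiAdd.hom_ext fun x => rfl

end DetData

section

variable {V : TrCat.{u} → PicCat.{u}} (det : ∀ T, DetFunctor T (V T))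

/-- After embedding both sides in `MultiAdd`, `det^*` is substitution of the universal additive
functors `(det (T i)).toAdd`. The composite of `det^*` with the fully faithful `DetData.multi` is
therefore an equivalence, and this forces `det^*` to be one. -/
theorem detStar_isEquivalence [Finite ι] (hdet : ∀ T, (det T).IsUniversal) :
    (detStar P det T).IsEquivalence := by
  have h₁ := MultiAdd.precomp_isEquivalence (fun i => (det (T i)).toAdd) P
    (fun i => isUniversal_toAdd (hdet (T i)))
  have : (detStar P det T ⋙ DetData.multi T P).IsEquivalence := by
    refine Functor.isEquivalence_of_iso (F := PicFunctor.multi (fun i => V (T i)) P ⋙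
      MultiAdd.precomp (fun i => (det (T i)).toAdd) P) (NatIso.ofComponents (fun f =>
        MultiAdd.mkIso (NatIso.ofComponents (fun x => Iso.refl _)
          (fun p => (comp_id _).trans (id_comp _).symm)) ?_) ?_)
    · intro i z x y σ
      refine Eq.trans (comp_id _) (Eq.trans ?_ ((id_comp _).symm.trans
        (congrArg (· ≫ _) (id_tensorHom_id _ _).symm)))
      obtain ⟨Δ, rfl⟩ := exists_toElem σ
      exact (DetData.elemSum_eq (detPullObj det f.obj) i (Δ := Δ) rfl).symm
    · intro f g γ
      exact MultiAdd.hom_ext fun x => (comp_id _).trans (id_comp _).symm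
  have f := Functor.Faithful.of_comp (detStar P det T) (DetData.multi T P)
  have f' := Functor.Full.of_comp_faithful (detStar P det T) (DetData.multi T P)
  exact { essSurj := ⟨fun D => ⟨_, ⟨(DetData.multi T P).preimageIso
    ((detStar P det T ⋙ DetData.multi T P).objObjPreimageIso ((DetData.multi T P).obj D))⟩⟩⟩ }

end

end

/-! ### Verdier structures and additivity -/

section Coherence

variable {C : Type*} [Category C] [MonoidalCategory C] [SymmetricCategory C]

/-- Cancellation of `s` and `c`, given `s ⊗ c ⟶ 𝟙`. -/
def cancelMiddle {s c : C} (ε : s ⊗ c ⟶ 𝟙_ C) (v : C) : s ⊗ (v ⊗ c) ⟶ v :=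
  (α_ s v c).inv ≫ ((β_ s v).hom ▷ c) ≫ (α_ v s c).hom ≫ (v ◁ ε) ≫ (ρ_ v).hom

lemma cancelMiddle_naturality {s c : C} (ε : s ⊗ c ⟶ 𝟙_ C) {v v' : C} (f : v ⟶ v') :
    (s ◁ (f ▷ c)) ≫ cancelMiddle ε v' = cancelMiddle ε v ≫ f := by
  simp only [cancelMiddle, assoc]
  rw [← rightUnitor_naturality, whisker_exchange_assoc, ← associator_naturality_left_assoc,
    ← comp_whiskerRight_assoc, ← BraidedCategory.braiding_naturality_right, comp_whiskerRight_assoc]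
  simp

/-- Contracting `s ⊗ c` on the left of `w` agrees with moving both past `w` and contracting on the
right, by naturality of the braiding and the hexagon. -/
lemma cancel_swap {s c : C} (ε : s ⊗ c ⟶ 𝟙_ C) (w : C) :
    (α_ s c w).inv ≫ (ε ▷ w) ≫ (λ_ w).hom =
      (s ◁ (β_ c w).hom) ≫ (α_ s w c).inv ≫ ((β_ s w).hom ▷ c) ≫ (α_ w s c).hom ≫ (w ◁ ε) ≫
        (ρ_ w).hom := by
  have h := BraidedCategory.braiding_naturality_left ε w
  have h' := BraidedCategory.hexagon_reverse s c w
  rw [← braiding_rightUnitor, reassoc_of% h, ← reassoc_of% h', Iso.inv_hom_id_assoc]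

/-- One may contract next to `v ⊗ w`, or first move `c` past `w` and contract next to `v`. The two
procedures differ by a double braiding of `w` and `c`, which is trivial by symmetry. -/
lemma cancelMiddle_tensor {s c : C} (ε : s ⊗ c ⟶ 𝟙_ C) (v w : C) :
    cancelMiddle ε (v ⊗ w) =
      (s ◁ ((α_ v w c).hom ≫ (v ◁ (β_ w c).hom) ≫ (α_ v c w).inv)) ≫ (α_ s (v ⊗ c) w).inv ≫
        (cancelMiddle ε v ▷ w) := by
  have k : (ε ▷ w) ≫ (λ_ w).hom = (α_ s c w).hom ≫ (s ◁ (β_ c w).hom) ≫ (α_ s w c).inv ≫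
      ((β_ s w).hom ▷ c) ≫ (α_ w s c).hom ≫ (w ◁ ε) ≫ (ρ_ w).hom := by
    rw [← cancel_swap, Iso.hom_inv_id_assoc]
  symm
  calc
    _ = 𝟙 _ ⊗≫ s ◁ v ◁ (β_ w c).hom ⊗≫ ((β_ s v).hom ▷ c ▷ w) ⊗≫ v ◁ ((ε ▷ w) ≫ (λ_ w).hom) := by
      rw [cancelMiddle]
      monoidal
    _ = 𝟙 _ ⊗≫ s ◁ v ◁ (β_ w c).hom ⊗≫ ((β_ s v).hom ▷ (c ⊗ w) ≫ (v ⊗ s) ◁ (β_ c w).hom) ⊗≫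
        v ◁ (β_ s w).hom ▷ c ⊗≫ (v ⊗ w) ◁ ε ⊗≫ 𝟙 _ := by
      rw [k]
      monoidal
    _ = 𝟙 _ ⊗≫ s ◁ v ◁ ((β_ w c).hom ≫ (β_ c w).hom) ⊗≫ (β_ s v).hom ▷ (w ⊗ c) ⊗≫
        v ◁ (β_ s w).hom ▷ c ⊗≫ (v ⊗ w) ◁ ε ⊗≫ 𝟙 _ := by
      rw [← whisker_exchange]
      monoidal
    _ = _ := by
      rw [SymmetricCategory.symmetry, cancelMiddle, BraidedCategory.braiding_tensor_right_hom]
      monoidal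

/-- Here `c`, `s` and `a` stand for the values at z', Σz' and the diagonal cone A, and `h` comes
from the third octahedron, which involves the rotated triangles `rB` and `rC`. After tensoring with
`s` and composing with `rB`, both sides contract `s` against `c` by `hB` and `hC`, and
`cancelMiddle_tensor` accounts for the braiding. -/
lemma verdier_square {c s x'' z'' z y'' a : C} (ε : s ⊗ c ⟶ 𝟙_ C) (sB : y'' ⊗ c ⟶ a)
    (rB : s ⊗ a ⟶ y'') (sC : z'' ⊗ c ⟶ z) (rC : s ⊗ z ⟶ z'') (s₂ : z'' ⊗ x'' ⟶ y'')
    (sE : z ⊗ x'' ⟶ a) [Mono rB] (hB : (s ◁ sB) ≫ rB = cancelMiddle ε y'')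
    (hC : (s ◁ sC) ≫ rC = cancelMiddle ε z'')
    (h : (rC ▷ x'') ≫ s₂ = (α_ s z x'').hom ≫ (s ◁ sE) ≫ rB)
    (hs : ∀ {p q : C} (f g : p ⟶ q), s ◁ f = s ◁ g → f = g) :
    (s₂ ▷ c) ≫ sB = (α_ z'' x'' c).hom ≫ (z'' ◁ (β_ x'' c).hom) ≫ (α_ z'' c x'').inv ≫
      (sC ▷ x'') ≫ sE := by
  refine hs _ _ ?_
  rw [← cancel_mono rB, MonoidalCategory.whiskerLeft_comp, assoc, hB, cancelMiddle_naturality,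
    cancelMiddle_tensor]
  have h' : (s ◁ sE) ≫ rB = (α_ s z x'').inv ≫ (rC ▷ x'') ≫ s₂ := by rw [h]; simp
  have h'' : (s ◁ (sC ▷ x'')) ≫ (α_ s z x'').inv = (α_ s (z'' ⊗ c) x'').inv ≫ ((s ◁ sC) ▷ x'') := by
    simp
  simp only [MonoidalCategory.whiskerLeft_comp, assoc]
  rw [h', reassoc_of% h'', ← comp_whiskerRight_assoc, hC]

/-- The octahedra `h₁` and `h₂` rewrite the two expansions as composites ending in `sA`. What
remains is `h₃`, tensored with x'; its braiding is the one in `tensorμ`. -/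
lemma verdier_interchange {x' y' z' x y z x'' y'' z'' a : C} (s₀ : z' ⊗ x' ⟶ y')
    (s₁ : z ⊗ x ⟶ y) (s₂ : z'' ⊗ x'' ⟶ y'') (t₀ : x'' ⊗ x' ⟶ x) (t₁ : y'' ⊗ y' ⟶ y)
    (t₂ : z'' ⊗ z' ⟶ z) (sA : a ⊗ x' ⟶ y) (sB : y'' ⊗ z' ⟶ a) (sE : z ⊗ x'' ⟶ a)
    (h₁ : (sE ▷ x') ≫ sA = (α_ z x'' x').hom ≫ (z ◁ t₀) ≫ s₁)
    (h₂ : (sB ▷ x') ≫ sA = (α_ y'' z' x').hom ≫ (y'' ◁ s₀) ≫ t₁)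
    (h₃ : (s₂ ▷ z') ≫ sB = (α_ z'' x'' z').hom ≫ (z'' ◁ (β_ x'' z').hom) ≫ (α_ z'' z' x'').inv ≫
      (t₂ ▷ x'') ≫ sE) :
    (s₂ ⊗ₘ s₀) ≫ t₁ = tensorμ z'' x'' z' x' ≫ (t₂ ⊗ₘ t₀) ≫ s₁ := by
  have h₁' : (z ◁ t₀) ≫ s₁ = (α_ z x'' x').inv ≫ (sE ▷ x') ≫ sA := by rw [h₁]; simp
  have h₂' : (y'' ◁ s₀) ≫ t₁ = (α_ y'' z' x').inv ≫ (sB ▷ x') ≫ sA := by rw [h₂]; simp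
  rw [MonoidalCategory.tensorHom_def, MonoidalCategory.tensorHom_def, assoc, assoc, h₁', h₂']
  have e : (s₂ ▷ (z' ⊗ x')) ≫ (α_ y'' z' x').inv = (α_ (z'' ⊗ x'') z' x').inv ≫ ((s₂ ▷ z') ▷ x') := by
    simp
  have e' : (t₂ ▷ (x'' ⊗ x')) ≫ (α_ z x'' x').inv = (α_ (z'' ⊗ z') x'' x').inv ≫ ((t₂ ▷ x'') ▷ x') := by
    simp
  rw [reassoc_of% e, reassoc_of% e', ← comp_whiskerRight_assoc, h₃]
  simp only [comp_whiskerRight, assoc, tensorμ]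
  monoidal

end Coherence

/-! ### Additivity on rotated triangles, and interchange from a Verdier structure. -/

section Rotation

variable {T : TrCat.{u}} {P : PicCat.{u}} (F : AddFunctor (SumCat.ofTr T) P)

lemma dist_of_iso {x y z x' y' z' : T} {f : x ⟶ y} {g : y ⟶ z} {h : z ⟶ x⟦(1 : ℤ)⟧}
    {f' : x' ⟶ y'} {g' : y' ⟶ z'} {h' : z' ⟶ x'⟦(1 : ℤ)⟧} (H : Triangle.mk f g h ∈ distTriang T)
    (a : x' ≅ x) (b : y' ≅ y) (c : z' ≅ z) (e₁ : f' ≫ b.hom = a.hom ≫ f)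
    (e₂ : g' ≫ c.hom = b.hom ≫ g) (e₃ : h' ≫ a.hom⟦(1 : ℤ)⟧' = c.hom ≫ h) :
    Triangle.mk f' g' h' ∈ distTriang T :=
  isomorphic_distinguished _ H _ (Triangle.isoMk _ _ a b c e₁ e₂ e₃)

open scoped ZeroObject in
lemma dist_zero_shift (x : T) :
    Triangle.mk (0 : x ⟶ 0) (0 : 0 ⟶ x⟦(1 : ℤ)⟧) (-𝟙 (x⟦(1 : ℤ)⟧)) ∈ distTriang T :=
  dist_of_iso (rot_of_distTriang _ (contractible_distinguished x)) (Iso.refl _) (Iso.refl _)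
    (Iso.refl _) ((comp_id _).trans (id_comp _).symm) ((comp_id _).trans (id_comp _).symm)
    (show (-𝟙 (x⟦(1 : ℤ)⟧)) ≫ (𝟙 x)⟦(1 : ℤ)⟧' = 𝟙 _ ≫ (-(𝟙 x)⟦(1 : ℤ)⟧') by simp)

lemma dist_zero_biprod (x z : T) : Triangle.mk (0 : x ⟶ z)
    (biprod.inl : z ⟶ z ⊞ x⟦(1 : ℤ)⟧) (biprod.snd : z ⊞ x⟦(1 : ℤ)⟧ ⟶ x⟦(1 : ℤ)⟧) ∈
      distTriang T := by
  rw [rotate_distinguished_triangle]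
  exact dist_of_iso (binaryBiproductTriangle_distinguished z (x⟦(1 : ℤ)⟧)) (Iso.refl _)
    (Iso.refl _) (Iso.refl _) ((comp_id _).trans (id_comp _).symm)
    ((comp_id _).trans (id_comp _).symm)
    (show (-(0 : x ⟶ z)⟦(1 : ℤ)⟧') ≫ (𝟙 z)⟦(1 : ℤ)⟧' = 𝟙 _ ≫ 0 by simp)

/-- The signs here and in `dist_biprod_graph` are chosen so that the two are the split triangles of
one direct sum, each section being inverted by the projection of the other, and so that both occur
as triangles of cones in `exists_rotation`. -/
lemma dist_biprod_swap (a z : T) : Triangle.mk (-biprod.inr : a ⟶ z ⊞ a)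
    (biprod.fst : z ⊞ a ⟶ z) 0 ∈ distTriang T :=
  dist_of_iso (binaryBiproductTriangle_distinguished a z) (Iso.refl _)
    (show z ⊞ a ≅ a ⊞ z from
      { hom := biprod.desc biprod.inr (-biprod.inl)
        inv := biprod.desc (-biprod.inr) biprod.inl
        hom_inv_id := by ext <;> simp
        inv_hom_id := by ext <;> simp })
    (Iso.refl _) (show (-biprod.inr) ≫ biprod.desc biprod.inr (-biprod.inl) = 𝟙 a ≫ biprod.inl by
      simp)
    (show biprod.fst ≫ 𝟙 z = biprod.desc biprod.inr (-biprod.inl) ≫ biprod.snd by ext <;> simp)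
    (show 0 ≫ (𝟙 a)⟦(1 : ℤ)⟧' = 𝟙 z ≫ 0 by simp)

lemma dist_biprod_graph {a z : T} (w : z ⟶ a) : Triangle.mk (biprod.lift (𝟙 z) w)
    (biprod.desc w (-𝟙 a)) 0 ∈ distTriang T :=
  dist_of_iso (binaryBiproductTriangle_distinguished z a) (Iso.refl _)
    (show z ⊞ a ≅ z ⊞ a from
      { hom := biprod.desc (biprod.lift (𝟙 z) w) (-biprod.inr)
        inv := biprod.desc (biprod.lift (𝟙 z) w) (-biprod.inr)
        hom_inv_id := by ext <;> simp
        inv_hom_id := by ext <;> simp })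
    (Iso.refl _)
    (show biprod.lift (𝟙 z) w ≫ biprod.desc (biprod.lift (𝟙 z) w) (-biprod.inr) =
      𝟙 z ≫ biprod.inl by ext <;> simp)
    (show biprod.desc w (-𝟙 a) ≫ 𝟙 a = biprod.desc (biprod.lift (𝟙 z) w) (-biprod.inr) ≫
      biprod.snd by ext <;> simp)
    (show 0 ≫ (𝟙 z)⟦(1 : ℤ)⟧' = 𝟙 a ≫ 0 by simp)

open scoped ZeroObject in
/-- Additivity on a rotated triangle. -/
lemma exists_rotation (x : Core T) :
    ∃ ε : F.functor.obj ⟨x.of⟦(1 : ℤ)⟧⟩ ⊗ F.functor.obj x ⟶ 𝟙_ P, ∀ {y z : Core T}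
      (σ : TriSum T z x y) (ρ : TriSum T ⟨x.of⟦(1 : ℤ)⟧⟩ y z), ρ.u = σ.v → ρ.v = σ.w →
      ρ.w = -σ.u⟦(1 : ℤ)⟧' →
      (F.functor.obj ⟨x.of⟦(1 : ℤ)⟧⟩ ◁ F.sum σ) ≫ F.sum ρ = cancelMiddle ε (F.functor.obj z) := by
  let o : Core T := ⟨0⟩
  let sx : Core T := ⟨x.of⟦(1 : ℤ)⟧⟩
  let δ₁ : TriSum T sx x o := ⟨0, 0, -𝟙 _, dist_zero_shift x.of⟩
  let n (z : Core T) : TriSum T z o z := ⟨0, 𝟙 _, 0, contractible_distinguished₁ z.of⟩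
  -- `e` identifies the unit of `P` with the value at the zero object, found by division as in
  -- `AddFunctor.exists_unit`. By `right_unit_of_assoc` it is then a right unit for every `n z`.
  obtain ⟨e, he⟩ := AddFunctor.whiskerLeft_surjective (F.functor.obj o)
    ((ρ_ (F.functor.obj o)).hom ≫ inv (F.sum (n o)))
  have he' : ∀ z, F.sum (n z) = (F.functor.obj z ◁ inv e) ≫ (ρ_ (F.functor.obj z)).hom := fun z => by
    rw [← right_unit_of_assoc e (F.sum (n z)) (F.sum (n o))
      (F.sum_assoc (n z) (n z) (n o) (n z) ?_) (by rw [he, assoc, IsIso.inv_hom_id, comp_id]),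
      ← MonoidalCategory.whiskerLeft_comp_assoc]
    · simp
    · exact ⟨by simp [n], by simp [n], by simp [n], by simp [n], by simp [n], by simp [n]⟩
  refine ⟨F.sum δ₁ ≫ inv e, fun {y z} σ ρ h₁ h₂ h₃ => ?_⟩
  let b : Core T := ⟨z.of ⊞ x.of⟦(1 : ℤ)⟧⟩
  let δ₂ : TriSum T b x z := ⟨0, biprod.inl, biprod.snd, dist_zero_biprod x.of z.of⟩
  let δ₄ : TriSum T sx z b := ⟨_, _, _, dist_biprod_graph σ.w⟩
  let δ₅ : TriSum T z sx b := ⟨_, _, _, dist_biprod_swap (x.of⟦(1 : ℤ)⟧) z.of⟩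
  have z₁ : σ.u ≫ σ.v = 0 := comp_distTriang_mor_zero₁₂ _ σ.dist
  have z₂ : σ.v ≫ σ.w = 0 := comp_distTriang_mor_zero₂₃ _ σ.dist
  have z₃ : σ.w ≫ σ.u⟦(1 : ℤ)⟧' = 0 := comp_distTriang_mor_zero₃₁ _ σ.dist
  -- The octahedron on x ⟶ y ⟶ z. The composite is zero, so its cone can be taken to be `z ⊞ Σx`.
  have a₁ := F.sum_assoc δ₄ δ₂ σ ρ (by
    refine ⟨?_, ?_, ?_, ?_, ?_, ?_⟩
    · simp [δ₂, h₁, z₁]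
    · dsimp [δ₂, δ₄]
      rw [h₁]
      ext <;> simp [z₂]
    · simp [δ₂, δ₄]
    · simp [δ₂, δ₄, h₂]
    · dsimp [δ₂, δ₄]
      rw [h₃]
      ext <;> simp [z₃]
    · dsimp [δ₄]
      rw [h₃, Preadditive.neg_comp, ← Functor.map_comp, z₁]
      simp)
  -- The octahedron on x ⟶ 0 ⟶ z has the same composite and the same cone, but involves `x` only
  -- through `δ₁`, from which the contraction is built.
  have a₂ := F.sum_assoc δ₅ δ₂ δ₁ (n z) (by
    refine ⟨?_, ?_, ?_, ?_, ?_, ?_⟩ <;> simp [δ₂, δ₅, δ₁, n])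
  -- The two triangles of cones are the split triangles of one direct sum; passing from one to the
  -- other produces the braiding in `cancelMiddle`.
  have a₃ := F.sum_comm δ₄ δ₅ ⟨rfl, rfl, by simp [δ₄, δ₅]; rfl, by simp [δ₄, δ₅]⟩
  have a₁' : (F.functor.obj sx ◁ F.sum σ) ≫ F.sum ρ =
      (α_ (F.functor.obj sx) (F.functor.obj z) (F.functor.obj x)).inv ≫
        (F.sum δ₄ ▷ F.functor.obj x) ≫ F.sum δ₂ := by
    rw [a₁, Iso.inv_hom_id_assoc]
  refine a₁'.trans ?_
  rw [← a₃, comp_whiskerRight, assoc, a₂, he', cancelMiddle]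
  simp only [MonoidalCategory.whiskerLeft_comp, assoc]
  rfl

/-- A triangle, as a sum. -/
def TriSum.mk' {x y z : T} (u : x ⟶ y) (v : y ⟶ z) (w : z ⟶ x⟦(1 : ℤ)⟧)
    (h : Triangle.mk u v w ∈ distTriang T) : TriSum T ⟨z⟩ ⟨x⟩ ⟨y⟩ := ⟨u, v, w, h⟩

/-- The interchange of sums in a diagram with a Verdier structure. -/
theorem NineDiagram.HasVerdierStructure.interchange {N : NineDiagram T}
    (hN : N.HasVerdierStructure)
    (h₀ : Triangle.mk N.f' N.g' N.h' ∈ distTriang T) (h₁ : Triangle.mk N.f N.g N.h ∈ distTriang T)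
    (h₂ : Triangle.mk N.f'' N.g'' N.h'' ∈ distTriang T)
    (k₀ : Triangle.mk N.p' N.p N.p'' ∈ distTriang T) (k₁ : Triangle.mk N.q' N.q N.q'' ∈ distTriang T)
    (k₂ : Triangle.mk N.r' N.r N.r'' ∈ distTriang T) :
    (F.sum (TriSum.mk' _ _ _ h₂) ⊗ₘ F.sum (TriSum.mk' _ _ _ h₀)) ≫ F.sum (TriSum.mk' _ _ _ k₁) =
      tensorμ (F.functor.obj ⟨N.z''⟩) (F.functor.obj ⟨N.x''⟩) (F.functor.obj ⟨N.z'⟩)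
        (F.functor.obj ⟨N.x'⟩) ≫
      (F.sum (TriSum.mk' _ _ _ k₂) ⊗ₘ F.sum (TriSum.mk' _ _ _ k₀)) ≫
        F.sum (TriSum.mk' _ _ _ h₁) := by
  obtain ⟨A, a, v, ε, η, b, c, ⟨c₁, _, _, hA, o₁, rfl, rfl⟩, ⟨c₂, _, _, _, o₂, rfl, rfl⟩,
    ⟨c₃, hE, hB', _, o₃, hr, hr''⟩, hb⟩ := hN
  have dB : Triangle.mk o₂.m₁ o₂.m₃ (N.q'' ≫ N.g'⟦(1 : ℤ)⟧') ∈ distTriang T := o₂.mem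
  -- The third octahedron contains this rotation of the column, not the column itself.
  have dC : Triangle.mk N.r N.r'' (-N.r'⟦(1 : ℤ)⟧') ∈ distTriang T := rot_of_distTriang _ k₂
  let sA := TriSum.mk' _ _ _ hA
  let sB := TriSum.mk' _ _ _ dB
  let rB := TriSum.mk' _ _ _ hB'
  let sE := TriSum.mk' _ _ _ hE
  let rC := TriSum.mk' _ _ _ dC
  -- Both rotated triangles start from z', and the contraction depends on nothing else, so the same
  -- one serves for both.
  obtain ⟨e, he⟩ := exists_rotation F ⟨N.z'⟩
  have e₁ := F.sum_assoc sE sA (TriSum.mk' _ _ _ k₀) (TriSum.mk' _ _ _ h₁)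
    ⟨c₁, o₁.comm₁, o₁.comm₂, o₁.comm₃, o₁.comm₄, rfl⟩
  have e₂ := F.sum_assoc sB sA (TriSum.mk' _ _ _ h₀) (TriSum.mk' _ _ _ k₁)
    ⟨c₂, o₂.comm₁, o₂.comm₂, o₂.comm₃, o₂.comm₄, rfl⟩
  have e₃ := F.sum_assoc rC (TriSum.mk' _ _ _ h₂) sE rB
    ⟨c₃, by have := o₃.comm₁; rw [hr] at this; exact this,
      by have := o₃.comm₂; rw [hr] at this; exact this,
      by have := o₃.comm₃; rw [hr''] at this; exact this,
      by have := o₃.comm₄; rw [hr''] at this; exact this, by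
        -- This is where the condition η b = r' enters: it makes the triangle of cones the rotation
        -- of the column.
        change -N.r'⟦(1 : ℤ)⟧' = (-o₂.m₁⟦(1 : ℤ)⟧') ≫ o₁.m₃⟦(1 : ℤ)⟧'
        rw [← hb, Functor.map_comp, Preadditive.neg_comp]⟩
  have r₁ := he sB rB rfl rfl rfl
  have r₂ := he (TriSum.mk' _ _ _ k₂) rC rfl rfl rfl
  exact verdier_interchange _ _ _ _ _ _ _ _ _ e₁ e₂ (verdier_square e _ _ _ _ _ _ r₁ r₂ e₃
    (fun _ _ => AddFunctor.whiskerLeft_injective' _))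

end Rotation

/-! ### Restriction to one variable -/

section Axis

variable {ι : Type} {X : ι → SumCat.{u}} {P : PicCat.{u}} {k : ι}

/-- The functors that insert a varying object at `k` and `w` elsewhere. As the other indices are not
separated from `k` definitionally, these functors are known through equations only; hence the casts
and `eqToHom` that follow. -/
lemma exists_axis (k : ι) (w : ∀ j, X j) : ∃ H : ∀ j, X k ⥤ X j, H k = 𝟭 _ ∧
    ∀ j, j ≠ k → H j = (Functor.const _).obj (w j) :=
  exists_pi (α := fun j => X k ⥤ X j) k (𝟭 _) (fun j _ => (Functor.const _).obj (w j))

namespace SumCat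

variable {Z : SumCat.{u}} {G : Z ⥤ Z}

lemma obj_eq (hG : G = 𝟭 _) (x : Z) : x = G.obj x := by rw [hG]; rfl

variable (hG : G = 𝟭 _)

/-- The image of a sum under a functor which is the identity. -/
def castSum {x y s : Z} (σ : Z.Sum x y s) : Z.Sum (G.obj x) (G.obj y) (G.obj s) :=
  cast (by rw [hG]; rfl) σ

lemma isMap_castSum {x y s x' y' s' : Z} {σ : Z.Sum x y s} {σ' : Z.Sum x' y' s'} {p : x ⟶ x'}
    {q : y ⟶ y'} {r : s ⟶ s'} (h : Z.IsMap σ σ' p q r) :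
    Z.IsMap (castSum hG σ) (castSum hG σ') (G.map p) (G.map q) (G.map r) := by
  subst hG
  exact h

lemma isAssoc_castSum {x y z s t w : Z} {σ₁ : Z.Sum x y s} {σ₂ : Z.Sum s z w} {σ₃ : Z.Sum y z t}
    {σ₄ : Z.Sum x t w} (h : Z.IsAssoc σ₁ σ₂ σ₃ σ₄) :
    Z.IsAssoc (castSum hG σ₁) (castSum hG σ₂) (castSum hG σ₃) (castSum hG σ₄) := by
  subst hG
  exact h

lemma isComm_castSum {x y s : Z} {σ : Z.Sum x y s} {σ' : Z.Sum y x s} (h : Z.IsComm σ σ') :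
    Z.IsComm (castSum hG σ) (castSum hG σ') := by
  subst hG
  exact h

lemma isMap_castSum_eqToHom {x y s : Z} (σ : Z.Sum x y s) :
    Z.IsMap σ (castSum hG σ) (eqToHom (obj_eq hG x)) (eqToHom (obj_eq hG y))
      (eqToHom (obj_eq hG s)) := by
  subst hG
  exact Z.isMap_id σ

end SumCat

lemma const_obj_eq {C D : Type*} [Category C] [Category D] {G : C ⥤ D} {w : D}
    (h : G = (Functor.const _).obj w) (x y : C) : G.obj x = G.obj y := by
  subst h
  rfl

lemma const_square {C D : Type*} [Category C] [Category D] {G : C ⥤ D} {w : D}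
    (h : G = (Functor.const _).obj w) {x x' s s' : C} (p : x ⟶ x') (r : s ⟶ s') :
    eqToHom (const_obj_eq h x s) ≫ G.map r = G.map p ≫ eqToHom (const_obj_eq h x' s') := by
  subst h
  rfl

lemma const_trans {C D : Type*} [Category C] [Category D] {G : C ⥤ D} {w : D}
    (h : G = (Functor.const _).obj w) (x y z : C) :
    eqToHom (const_obj_eq h x y) ≫ eqToHom (const_obj_eq h y z) = eqToHom (const_obj_eq h x z) :=
  eqToHom_trans _ _

lemma const_eq {C D : Type*} [Category C] [Category D] {G : C ⥤ D} {w : D}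
    (h : G = (Functor.const _).obj w) (x : C) : w = G.obj x := by
  subst h
  rfl

lemma const_fill {C D : Type*} [Category C] [Category D] {G : C ⥤ D} {w : D}
    (h : G = (Functor.const _).obj w) {a b : D} {f : a ⟶ b} {q : b ⟶ w} {q' : a ⟶ w}
    (e : f ≫ q = q') (x y : C) : f ≫ q ≫ eqToHom (const_eq h y) =
      (q' ≫ eqToHom (const_eq h x)) ≫ eqToHom (const_obj_eq h x y) := by
  subst h e
  simp

/-- Six comparison squares carry interchange from one diagram to another; only the comparison of the
total objects has to be cancelled. -/
lemma interchange_transport {C : Type*} [Category C] [MonoidalCategory C] [BraidedCategory C]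
    {a b c d s s' t t' w a' b' c' d' r r' q q' w' : C}
    {ea : a' ⟶ a} {eb : b' ⟶ b} {ec : c' ⟶ c} {ed : d' ⟶ d} {es : r ⟶ s} {es' : r' ⟶ s'}
    {et : q ⟶ t} {et' : q' ⟶ t'} {ew : w' ⟶ w} (hew : IsIso ew)
    {σ₀ : a ⊗ b ⟶ s} {σ₁ : c ⊗ d ⟶ s'} {σ : s ⊗ s' ⟶ w} {τ₀ : a ⊗ c ⟶ t} {τ₁ : b ⊗ d ⟶ t'}
    {τ : t ⊗ t' ⟶ w} {σ₀' : a' ⊗ b' ⟶ r} {σ₁' : c' ⊗ d' ⟶ r'} {σ' : r ⊗ r' ⟶ w'}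
    {τ₀' : a' ⊗ c' ⟶ q} {τ₁' : b' ⊗ d' ⟶ q'} {τ' : q ⊗ q' ⟶ w'}
    (h : (σ₀ ⊗ₘ σ₁) ≫ σ = tensorμ a b c d ≫ (τ₀ ⊗ₘ τ₁) ≫ τ)
    (h₁ : σ₀' ≫ es = (ea ⊗ₘ eb) ≫ σ₀) (h₂ : σ₁' ≫ es' = (ec ⊗ₘ ed) ≫ σ₁)
    (h₃ : σ' ≫ ew = (es ⊗ₘ es') ≫ σ) (h₄ : τ₀' ≫ et = (ea ⊗ₘ ec) ≫ τ₀)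
    (h₅ : τ₁' ≫ et' = (eb ⊗ₘ ed) ≫ τ₁) (h₆ : τ' ≫ ew = (et ⊗ₘ et') ≫ τ) :
    (σ₀' ⊗ₘ σ₁') ≫ σ' = tensorμ a' b' c' d' ≫ (τ₀' ⊗ₘ τ₁') ≫ τ' := by
  rw [← cancel_mono ew, assoc, assoc, assoc, h₃, h₆, tensorHom_comp_tensorHom_assoc,
    tensorHom_comp_tensorHom_assoc, h₁, h₂, h₄, h₅, ← tensorHom_comp_tensorHom_assoc,
    ← tensorHom_comp_tensorHom_assoc, h, tensorμ_natural_assoc]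

namespace MultiAdd

variable (M : MultiAdd X P) {w : ∀ j, X j} {H : ∀ j, X k ⥤ X j} (hk : H k = 𝟭 _)
  (hw : ∀ j, j ≠ k → H j = (Functor.const _).obj (w j))

/-- A sum in one variable, the other variables being constant. -/
def axisSum {x y s : X k} (σ : (X k).Sum x y s) : ElemSum X k ((Functor.pi' H).obj x)
    ((Functor.pi' H).obj y) ((Functor.pi' H).obj s) where
  main := SumCat.castSum hk σ
  fst j h := eqToHom (const_obj_eq (hw j h) x s)
  snd j h := eqToHom (const_obj_eq (hw j h) y s)

/-- The restriction to one variable. -/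
def axis : AddFunctor (X k) P where
  functor := Functor.pi' H ⋙ M.functor
  sum σ := M.sum k (axisSum hk hw σ)
  sum_map σ σ' p q r h := M.sum_map k (axisSum hk hw σ) (axisSum hk hw σ') ((Functor.pi' H).map p)
    ((Functor.pi' H).map q) ((Functor.pi' H).map r) (SumCat.isMap_castSum hk h)
    (fun j h => const_square (hw j h) p r) (fun j h => const_square (hw j h) q r)
  sum_assoc {x y z s t w} σ₁ σ₂ σ₃ σ₄ h := M.sum_assoc k (axisSum hk hw σ₁) (axisSum hk hw σ₂)
    (axisSum hk hw σ₃) (axisSum hk hw σ₄) (SumCat.isAssoc_castSum hk h)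
    (fun j h => const_trans (hw j h) x s w)
    (fun j h => (const_trans (hw j h) y s w).trans (const_trans (hw j h) y t w).symm)
    (fun j h => (const_trans (hw j h) z t w).symm)
  sum_comm σ σ' h := M.sum_comm k (axisSum hk hw σ) (axisSum hk hw σ')
    (SumCat.isComm_castSum hk h) (fun _ _ => rfl) (fun _ _ => rfl)

lemma exists_axisHom {x : ∀ j, X j} (q : ∀ j, j ≠ k → (x j ⟶ w j)) :
    ∃ f : x ⟶ (Functor.pi' H).obj (x k), f k = eqToHom (SumCat.obj_eq hk (x k)) ∧
      ∀ j h, f j = q j h ≫ eqToHom (const_eq (hw j h) _) :=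
  exists_pi (α := fun j => x j ⟶ (H j).obj (x k)) k _ _

/-- A sum in the variable `k` can be moved to the axis through `w`, once compatible morphisms from
its objects to `w` are given outside `k`. -/
lemma sum_axis {x y s : ∀ j, X j} (σ : ElemSum X k x y s)
    {f : x ⟶ (Functor.pi' H).obj (x k)} {g : y ⟶ (Functor.pi' H).obj (y k)}
    {h : s ⟶ (Functor.pi' H).obj (s k)} {qx : ∀ j, j ≠ k → (x j ⟶ w j)}
    {qy : ∀ j, j ≠ k → (y j ⟶ w j)} {qs : ∀ j, j ≠ k → (s j ⟶ w j)}
    (hf : f k = eqToHom (SumCat.obj_eq hk (x k)) ∧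
      ∀ j h, f j = qx j h ≫ eqToHom (const_eq (hw j h) _))
    (hg : g k = eqToHom (SumCat.obj_eq hk (y k)) ∧
      ∀ j h, g j = qy j h ≫ eqToHom (const_eq (hw j h) _))
    (hh : h k = eqToHom (SumCat.obj_eq hk (s k)) ∧
      ∀ j h', h j = qs j h' ≫ eqToHom (const_eq (hw j h') _))
    (e₁ : ∀ j h, σ.fst j h ≫ qs j h = qx j h) (e₂ : ∀ j h, σ.snd j h ≫ qs j h = qy j h) :
    M.sum k σ ≫ M.functor.map h = (M.functor.map f ⊗ₘ M.functor.map g) ≫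
      M.sum k (axisSum hk hw σ.main) := by
  refine M.sum_map k σ (axisSum hk hw σ.main) f g h ?_ ?_ ?_
  · rw [hf.1, hg.1, hh.1]
    exact SumCat.isMap_castSum_eqToHom hk σ.main
  · intro j hj
    rw [hf.2 j hj, hh.2 j hj]
    exact const_fill (hw j hj) (e₁ j hj) _ _
  · intro j hj
    rw [hg.2 j hj, hh.2 j hj]
    exact const_fill (hw j hj) (e₂ j hj) _ _

/-- Interchange in one variable, given that it holds for functors of that variable. -/
lemma interchange_of_axis {x₀₀ x₁₀ x₀₁ x₁₁ s₀ s₁ t₀ t₁ w : ∀ j, X j}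
    (σ₀ : ElemSum X k x₀₀ x₁₀ s₀) (σ₁ : ElemSum X k x₀₁ x₁₁ s₁) (σ : ElemSum X k s₀ s₁ w)
    (τ₀ : ElemSum X k x₀₀ x₀₁ t₀) (τ₁ : ElemSum X k x₁₀ x₁₁ t₁) (τ : ElemSum X k t₀ t₁ w)
    (h : ∀ F : AddFunctor (X k) P, (F.sum σ₀.main ⊗ₘ F.sum σ₁.main) ≫ F.sum σ.main =
      tensorμ (F.functor.obj (x₀₀ k)) (F.functor.obj (x₁₀ k)) (F.functor.obj (x₀₁ k))
        (F.functor.obj (x₁₁ k)) ≫ (F.sum τ₀.main ⊗ₘ F.sum τ₁.main) ≫ F.sum τ.main)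
    (h₅ : ∀ j (hj : j ≠ k), σ₀.fst j hj ≫ σ.fst j hj = τ₀.fst j hj ≫ τ.fst j hj ∧
      σ₀.snd j hj ≫ σ.fst j hj = τ₁.fst j hj ≫ τ.snd j hj ∧
      σ₁.fst j hj ≫ σ.snd j hj = τ₀.snd j hj ≫ τ.fst j hj ∧
      σ₁.snd j hj ≫ σ.snd j hj = τ₁.snd j hj ≫ τ.snd j hj) :
    (M.sum k σ₀ ⊗ₘ M.sum k σ₁) ≫ M.sum k σ =
      tensorμ (M.functor.obj x₀₀) (M.functor.obj x₁₀) (M.functor.obj x₀₁) (M.functor.obj x₁₁) ≫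
        (M.sum k τ₀ ⊗ₘ M.sum k τ₁) ≫ M.sum k τ := by
  -- The axis runs through the total object `w`, to which every other object of the diagram maps
  -- outside `k`. The identities `h₅` say that the two ways of mapping the four corners agree.
  obtain ⟨H, hk, hw⟩ := exists_axis k w
  obtain ⟨a, ha⟩ := exists_axisHom hk hw (fun j hj => σ₀.fst j hj ≫ σ.fst j hj)
  obtain ⟨b, hb⟩ := exists_axisHom hk hw (fun j hj => σ₀.snd j hj ≫ σ.fst j hj)
  obtain ⟨c, hc⟩ := exists_axisHom hk hw (fun j hj => σ₁.fst j hj ≫ σ.snd j hj)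
  obtain ⟨d, hd⟩ := exists_axisHom hk hw (fun j hj => σ₁.snd j hj ≫ σ.snd j hj)
  obtain ⟨m₀, hm₀⟩ := exists_axisHom hk hw σ.fst
  obtain ⟨m₁, hm₁⟩ := exists_axisHom hk hw σ.snd
  obtain ⟨n₀, hn₀⟩ := exists_axisHom hk hw τ.fst
  obtain ⟨n₁, hn₁⟩ := exists_axisHom hk hw τ.snd
  obtain ⟨o, ho⟩ := exists_axisHom hk hw (fun j hj => 𝟙 (w j))
  have r₁ := M.sum_axis hk hw σ₀ ha hb hm₀ (fun _ _ => rfl) (fun _ _ => rfl)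
  have r₂ := M.sum_axis hk hw σ₁ hc hd hm₁ (fun _ _ => rfl) (fun _ _ => rfl)
  have r₃ := M.sum_axis hk hw σ hm₀ hm₁ ho (fun _ _ => comp_id _) (fun _ _ => comp_id _)
  have r₄ := M.sum_axis hk hw τ₀ ha hc hn₀ (fun j hj => (h₅ j hj).1.symm)
    (fun j hj => (h₅ j hj).2.2.1.symm)
  have r₅ := M.sum_axis hk hw τ₁ hb hd hn₁ (fun j hj => (h₅ j hj).2.1.symm)
    (fun j hj => (h₅ j hj).2.2.2.symm)
  have r₆ := M.sum_axis hk hw τ hn₀ hn₁ ho (fun _ _ => comp_id _) (fun _ _ => comp_id _)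
  exact interchange_transport (C := P) (IsGroupoid.all_isIso (C := P) _) (h (M.axis hk hw)) r₁ r₂ r₃ r₄ r₅ r₆

end MultiAdd

end Axis

/-! ### Composition of multideterminant functors with multiexact functors -/

section

variable {ι : Type} {T : ι → TrCat.{u}}

/-- The morphisms of triangles in an octahedron. -/
lemma octahedron_isMap {i : ι} {x y z z' y' x' : ∀ j, T j} {Δ₁ : TriangleIn T i x y z'}
    {Δ₂ : TriangleIn T i x z y'} {Δ₃ : TriangleIn T i y z x'} {Δ₄ : TriangleIn T i z' y' x'}
    (h₁ : Δ₁.u ≫ Δ₃.u = Δ₂.u) (h₂ : Δ₁.v ≫ Δ₄.u = Δ₃.u ≫ Δ₂.v)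
    (h₃ : Δ₄.u i ≫ Δ₂.w.main = Δ₁.w.main) (h₄ : Δ₂.v ≫ Δ₄.v = Δ₃.v)
    (h₅ : Δ₂.w.main ≫ (Δ₁.u i)⟦(1 : ℤ)⟧' = Δ₄.v i ≫ Δ₃.w.main)
    (h₆ : Δ₄.w.main = Δ₃.w.main ≫ (Δ₁.v i)⟦(1 : ℤ)⟧') :
    Δ₁.IsMap Δ₂ (𝟙 x) Δ₃.u Δ₄.u ∧ Δ₂.IsMap Δ₃ Δ₁.u (𝟙 z) Δ₄.v ∧ Δ₃.IsMap Δ₄ Δ₁.v Δ₂.v (𝟙 x') :=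
  ⟨⟨h₁.trans (id_comp _).symm, h₂,
      (congrArg (Δ₁.w.main ≫ ·) ((shiftFunctor (T i) (1 : ℤ)).map_id (x i))).trans
        ((comp_id _).trans h₃.symm)⟩,
    ⟨(comp_id _).trans h₁.symm, h₄.trans (id_comp _).symm, h₅⟩,
    ⟨h₂.symm, (comp_id _).trans h₄.symm, h₆.symm.trans (id_comp _).symm⟩⟩

lemma TrFunctor.conn_isMap {U : TrCat.{u}} {F : TrFunctor T U} (hF : F.IsMultiexact) {i : ι}
    {x y z x' y' z' : ∀ j, T j} {Δ : TriangleIn T i x y z} {Δ' : TriangleIn T i x' y' z'}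
    {p : x ⟶ x'} {q : y ⟶ y'} {r : z ⟶ z'} (h : Δ.IsMap Δ' p q r) :
    F.conn i Δ.w ≫ (F.functor.map p)⟦(1 : ℤ)⟧' = F.functor.map r ≫ F.conn i Δ'.w := by
  rw [← hF.conn_postcomp, ← hF.conn_precomp, TrString.isMap_w h]

lemma TrFunctor.conn_zero {U : TrCat.{u}} {F : TrFunctor T U} (hF : F.IsMultiexact) {i : ι}
    {z x : ∀ j, T j} (d : DegHom T i z x) (h : d.main = 0) : F.conn i d = 0 := by
  rw [conn_eq_lift hF, map_zero_of hF (k := i) _ (by simp [lift, toPut_self, h]), zero_comp]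

lemma TrFunctor.map_eq_id {U : TrCat.{u}} (F : TrFunctor T U) {x y : ∀ j, T j} {p : x ⟶ y}
    {q : y ⟶ x} (h : p ≫ q = 𝟙 x) : F.functor.map p ≫ F.functor.map q = 𝟙 _ := by
  rw [← F.functor.map_comp, h, F.functor.map_id]

lemma TrFunctor.map_comp_of {U : TrCat.{u}} (F : TrFunctor T U) {x y z : ∀ j, T j} {p : x ⟶ y}
    {q : y ⟶ z} {r : x ⟶ z} (h : p ≫ q = r) : F.functor.map p ≫ F.functor.map q = F.functor.map r := by
  rw [← F.functor.map_comp, h]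

lemma TrFunctor.map_comm {U : TrCat.{u}} (F : TrFunctor T U) {x y y' z : ∀ j, T j} {p : x ⟶ y}
    {q : y ⟶ z} {p' : x ⟶ y'} {q' : y' ⟶ z} (h : p ≫ q = p' ≫ q') :
    F.functor.map p ≫ F.functor.map q = F.functor.map p' ≫ F.functor.map q' := by
  rw [← F.functor.map_comp, h, F.functor.map_comp]

/-- The laws in one variable hold because `F` preserves triangles and their morphisms in that
variable; interchange is what the Verdier structure provides. The result is needed to find V(F), by
essential surjectivity of `det^*`. -/
theorem detAfter_isMultiDet {U : TrCat.{u}} {P : PicCat.{u}} (d : DetFunctor U P)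
    {F : TrFunctor T U} (hF : F.IsMultiexact) (hV : F.AdmitsVerdierStructure) :
    (detAfter d F hF).IsMultiDet where
  naturality i x y z x' y' z' Δ Δ' p q r h :=
    d.naturality (hF.dist i Δ) (hF.dist i Δ') (F.functor.mapIso p) (F.functor.mapIso q)
      (F.functor.mapIso r) (F.map_comm h.comm₁) (F.map_comm h.comm₂) (F.conn_isMap hF h)
  commutativity i a b s Δ₁ Δ₂ h₁ h₂ h₃ h₄ :=
    d.additivity_comm (hF.dist i Δ₁) (hF.dist i Δ₂) (F.conn_zero hF _ h₁) (F.conn_zero hF _ h₂)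
      (F.map_eq_id h₃) (F.map_eq_id h₄)
  octahedron i x y z z' y' x' Δ₁ Δ₂ Δ₃ Δ₄ h₁ h₂ h₃ h₄ h₅ h₆ := by
    obtain ⟨m₁, m₂, m₃⟩ := octahedron_isMap h₁ h₂ h₃ h₄ h₅ h₆
    have k₁ := F.conn_isMap hF m₁
    have k₃ := F.conn_isMap hF m₃
    rw [F.functor.map_id, CategoryTheory.Functor.map_id, comp_id] at k₁
    rw [F.functor.map_id, id_comp] at k₃
    exact d.additivity_octahedron (hF.dist i Δ₁) (hF.dist i Δ₃) (hF.dist i Δ₂) (hF.dist i Δ₄)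
      (F.map_comp_of h₁) (F.map_comm h₂) k₁.symm (F.map_comp_of h₄) (F.conn_isMap hF m₂) k₃.symm
  two_triangles i j hij G :=
    (hV i j hij G).interchange d.toAdd (hF.dist i (G.row 0)) (hF.dist i (G.row 1))
      (hF.dist i (G.row 2)) (hF.dist j (G.col 0)) (hF.dist j (G.col 1)) (hF.dist j (G.col 2))

/-- Interchange of sums in the same variable, given that it holds for functors of that variable. -/
lemma DetData.IsMultiDet.interchange_of_axis {P : PicCat.{u}} {D : DetData T P} (hD : D.IsMultiDet)
    {k : ι} (G : TriangleGrid T k k)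
    (h : ∀ F : AddFunctor (SumCat.ofTr (T k)) P,
      (F.sum (G.row 2).toElem.main ⊗ₘ F.sum (G.row 0).toElem.main) ≫ F.sum (G.col 1).toElem.main =
        tensorμ (F.functor.obj ⟨G.X 2 2 k⟩) (F.functor.obj ⟨G.X 0 2 k⟩)
          (F.functor.obj ⟨G.X 2 0 k⟩) (F.functor.obj ⟨G.X 0 0 k⟩) ≫
        (F.sum (G.col 2).toElem.main ⊗ₘ F.sum (G.col 0).toElem.main) ≫
          F.sum (G.row 1).toElem.main) :
    (D.additivity k (G.row 2) ⊗ₘ D.additivity k (G.row 0)) ≫ D.additivity k (G.col 1) =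
      tensorμ (D.functor.obj ⟨G.X 2 2⟩) (D.functor.obj ⟨G.X 0 2⟩) (D.functor.obj ⟨G.X 2 0⟩)
        (D.functor.obj ⟨G.X 0 0⟩) ≫
      (D.additivity k (G.col 2) ⊗ₘ D.additivity k (G.col 0)) ≫ D.additivity k (G.row 1) := by
  have key := (D.toMulti hD).interchange_of_axis (G.row 2).toElem (G.row 0).toElem
    (G.col 1).toElem (G.col 2).toElem (G.col 0).toElem (G.row 1).toElem h (fun j hj => ?_)
  · have e : ∀ {x y z : ∀ j, T j} (Δ : TriangleIn T k x y z),
        (D.toMulti hD).sum k Δ.toElem = D.additivity k Δ := fun Δ => D.elemSum_eq k rfl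
    rw [e, e, e, e, e, e] at key
    exact key
  · refine ⟨CoreHom.ext (Iso.ext_inv ?_), CoreHom.ext (Iso.ext (iso_square.2 ?_).symm),
      CoreHom.ext (Iso.ext (iso_square.2 ?_)), CoreHom.ext (Iso.ext ?_)⟩
    · exact (congrFun G.row_v.comm₂ j).symm
    · exact (congrFun G.row_v.comm₁ j).symm
    · exact congrFun G.row_u.comm₂ j
    · exact congrFun G.row_u.comm₁ j

end

section

variable {I J : Type} {φ : I → J} {S : I → TrCat.{u}} {T : J → TrCat.{u}} {P : PicCat.{u}}

lemma additivity_starTri {F : TrString φ S T} (hF : ∀ j, (F j).IsMultiexact) (D : DetData T P)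
    {i : I} {k : J} (h : φ i = k) {x y z : ∀ i, S i} (Δ : TriangleIn S i x y z) :
    D.additivity (φ i) (F.starTri hF ⟨i, rfl⟩ Δ) = D.additivity k (F.starTri hF ⟨i, h⟩ Δ) := by
  subst h
  rfl

lemma star_map_comp_of (F : TrString φ S T) {x y z : ∀ i, S i} {p : x ⟶ y} {q : y ⟶ z} {r : x ⟶ z}
    (h : p ≫ q = r) : F.star.map p ≫ F.star.map q = F.star.map r := by
  rw [← F.star.map_comp, h]

lemma star_map_eq_id (F : TrString φ S T) {x y : ∀ i, S i} {p : x ⟶ y} {q : y ⟶ x}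
    (h : p ≫ q = 𝟙 x) : F.star.map p ≫ F.star.map q = 𝟙 _ := by
  rw [← F.star.map_comp, h, F.star.map_id]

lemma interchange_congr {P : PicCat.{u}} {a b c a' b' t m : P} {f₂ g₂ : a ⟶ b}
    {f₀ g₀ : a' ⟶ b'} {f₁ g₁ : c ⟶ t} {v : b ⊗ b' ⟶ t} {w : a ⊗ a' ⟶ m} {w' : m ⟶ c}
    (e₂ : f₂ = g₂) (e₀ : f₀ = g₀) (e₁ : f₁ = g₁) (h : (g₂ ⊗ₘ g₀) ≫ v = w ≫ w' ≫ g₁) :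
    (f₂ ⊗ₘ f₀) ≫ v = w ≫ w' ≫ f₁ := by
  rw [e₂, e₀, e₁, h]

/-- Only interchange is not formal. Two variables in different fibres of `φ` give a grid in two
different variables of `D`, covered by its own interchange. Two variables in the same fibre give a
grid in a single variable of `D`; there the Verdier structure of `F (φ j)` gives interchange for
every additive functor of that variable, and restriction to an axis extends this to `D`. -/
theorem pullbackIsMultiDet : PullbackIsMultiDet.{u} := by
  intro I J φ S T P F D hD
  have hF := F.multiexact
  exact
    { naturality := fun i x y z x' y' z' Δ Δ' p q r h =>
        hD.naturality (φ i) (F.string.starTri hF ⟨i, rfl⟩ Δ) (F.string.starTri hF ⟨i, rfl⟩ Δ')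
          (F.string.star.mapIso p) (F.string.star.mapIso q) (F.string.star.mapIso r)
          (F.string.starTri_isMap hF ⟨i, rfl⟩ h)
      commutativity := fun i a b s Δ₁ Δ₂ h₁ h₂ h₃ h₄ =>
        hD.commutativity (φ i) (F.string.starTri hF ⟨i, rfl⟩ Δ₁) (F.string.starTri hF ⟨i, rfl⟩ Δ₂)
          (TrFunctor.conn_zero (hF (φ i)) _ h₁) (TrFunctor.conn_zero (hF (φ i)) _ h₂)
          (star_map_eq_id _ h₃) (star_map_eq_id _ h₄)
      octahedron := fun i x y z z' y' x' Δ₁ Δ₂ Δ₃ Δ₄ h₁ h₂ h₃ h₄ h₅ h₆ => by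
        obtain ⟨m₁, m₂, m₃⟩ := octahedron_isMap h₁ h₂ h₃ h₄ h₅ h₆
        have k₁ := (F.string.starTri_isMap hF (k := φ i) ⟨i, rfl⟩ m₁).comm₃
        have k₂ := (F.string.starTri_isMap hF (k := φ i) ⟨i, rfl⟩ m₂).comm₃
        have k₃ := (F.string.starTri_isMap hF (k := φ i) ⟨i, rfl⟩ m₃).comm₃
        rw [F.string.star.map_id] at k₁ k₃
        refine hD.octahedron (φ i) (F.string.starTri hF ⟨i, rfl⟩ Δ₁)
          (F.string.starTri hF ⟨i, rfl⟩ Δ₂) (F.string.starTri hF ⟨i, rfl⟩ Δ₃)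
          (F.string.starTri hF ⟨i, rfl⟩ Δ₄) (star_map_comp_of _ h₁) ?_ ?_ (star_map_comp_of _ h₄)
          k₂ ?_
        · exact (star_map_comp_of _ h₂).trans (F.string.star.map_comp _ _)
        · exact (k₁.symm.trans ((congrArg (_ ≫ ·)
            ((shiftFunctor (T (φ i)) (1 : ℤ)).map_id _)).trans (comp_id _)))
        · exact ((k₃.trans (id_comp _)).symm)
      two_triangles := fun i j hij G => by
        by_cases h : φ i = φ j
        · let i' : Fib φ (φ j) := ⟨i, h⟩
          let j' : Fib φ (φ j) := ⟨j, rfl⟩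
          have key := hD.interchange_of_axis (F.string.starGrid hF i' j' G) (fun L =>
            ((F (φ j)).property.2 i' j' (fun e => hij (congrArg Subtype.val e))
              (G.pull i' (TrString.fib_inj i') (TrString.fib_inj j'))).interchange L
              ((F (φ j)).property.1.dist i' _) ((F (φ j)).property.1.dist i' _)
              ((F (φ j)).property.1.dist i' _) ((F (φ j)).property.1.dist j' _)
              ((F (φ j)).property.1.dist j' _) ((F (φ j)).property.1.dist j' _))
          exact interchange_congr (additivity_starTri hF D h (G.row 2))
            (additivity_starTri hF D h (G.row 0)) (additivity_starTri hF D h (G.row 1)) key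
        · exact hD.two_triangles (φ i) (φ j) h
            (F.string.starGrid hF (k := φ i) (l := φ j) ⟨i, rfl⟩ ⟨j, rfl⟩ G) }

end

/-! ### Existence of universal determinant functors -/

namespace PicCat

variable (P : PicCat.{u})

lemma exists_dual (x : P) : ∃ y : P, Nonempty (x ⊗ y ≅ 𝟙_ P) :=
  haveI := P.groupLike x
  ⟨(tensorLeft x).objPreimage (𝟙_ P), ⟨(tensorLeft x).objObjPreimageIso (𝟙_ P)⟩⟩

/-- A chosen inverse of an object of a Picard groupoid. -/
noncomputable def dual (x : P) : P := (P.exists_dual x).choose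

/-- The contraction of an object with its inverse. -/
noncomputable def contract (x : P) : x ⊗ P.dual x ≅ 𝟙_ P := (P.exists_dual x).choose_spec.some

end PicCat

/-- By the braiding an inverse on one side is an inverse on both, and tensoring with it is a
quasi-inverse. -/
lemma tensorLeft_isEquivalence {C : Type*} [Category C] [MonoidalCategory C] [BraidedCategory C]
    {x y : C} (e : x ⊗ y ≅ 𝟙_ C) : (tensorLeft x).IsEquivalence :=
  (CategoryTheory.Equivalence.mk (tensorLeft x) (tensorLeft y)
    ((leftUnitorNatIso C).symm ≪≫ (tensoringLeft C).mapIso (e.symm ≪≫ β_ x y) ≪≫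
      tensorLeftTensor y x)
    ((tensorLeftTensor x y).symm ≪≫ (tensoringLeft C).mapIso e ≪≫
      leftUnitorNatIso C)).isEquivalence_functor

/-- Formal sums of objects of `T` and their inverses. -/
inductive VirtualObj (T : TrCat.{u}) : Type u
  | of (x : T)
  | unit
  | tensor (a b : VirtualObj T)
  | neg (a : VirtualObj T)

namespace VirtualObj

variable {T : TrCat.{u}}

/-- Formal composites of the structure morphisms of a Picard groupoid and the values of a
determinant functor. -/
inductive Word : VirtualObj T → VirtualObj T → Type u
  | id (a) : Word a a
  | comp {a b c} (f : Word a b) (g : Word b c) : Word a c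
  | inv {a b} (f : Word a b) : Word b a
  | tensor {a b a' b'} (f : Word a b) (g : Word a' b') : Word (tensor a a') (tensor b b')
  | associator (a b c) : Word (tensor (tensor a b) c) (tensor a (tensor b c))
  | leftUnitor (a) : Word (tensor unit a) a
  | rightUnitor (a) : Word (tensor a unit) a
  | braiding (a b) : Word (tensor a b) (tensor b a)
  | contract (a) : Word (tensor a (neg a)) unit
  | map {x y : T} (f : x ≅ y) : Word (of x) (of y)
  | add (Δ : Triangle T) (hΔ : Δ ∈ distTriang T) :
      Word (tensor (of Δ.obj₃) (of Δ.obj₁)) (of Δ.obj₂)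

variable {P : PicCat.{u}} (D : DetFunctor T P)

/-- The value of a formal sum under a determinant functor. -/
noncomputable def eval : VirtualObj T → P
  | of x => D.functor.obj ⟨x⟩
  | unit => 𝟙_ P
  | tensor a b => eval a ⊗ eval b
  | neg a => P.dual (eval a)

/-- The value of a formal composite under a determinant functor. -/
noncomputable def Word.eval : ∀ {a b : VirtualObj T}, Word a b → (a.eval D ⟶ b.eval D)
  | _, _, .id a => 𝟙 _
  | _, _, .comp f g => f.eval ≫ g.eval
  | _, _, .inv f => CategoryTheory.inv f.eval
  | _, _, .tensor f g => f.eval ⊗ₘ g.eval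
  | _, _, .associator a b c => (α_ (a.eval D) (b.eval D) (c.eval D)).hom
  | _, _, .leftUnitor a => (λ_ (a.eval D)).hom
  | _, _, .rightUnitor a => (ρ_ (a.eval D)).hom
  | _, _, .braiding a b => (β_ (a.eval D) (b.eval D)).hom
  | _, _, .contract a => (P.contract (a.eval D)).hom
  | _, _, .map f => D.functor.map ⟨f⟩
  | _, _, .add Δ hΔ => D.additivity Δ hΔ

/-- Formal composites are identified when all determinant functors identify their values. -/
instance wordSetoid (a b : VirtualObj T) : Setoid (Word a b) where
  r f g := ∀ (P : PicCat.{u}) (D : DetFunctor T P), f.eval D = g.eval D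
  iseqv := ⟨fun _ _ _ => rfl, fun h P D => (h P D).symm, fun h h' P D => (h P D).trans (h' P D)⟩

instance : CategoryStruct (VirtualObj T) where
  Hom a b := Quotient (wordSetoid a b)
  id a := ⟦.id a⟧
  comp := Quotient.map₂ .comp fun _ _ h _ _ h' P D => congrArg₂ (· ≫ ·) (h P D) (h' P D)

/-- The value of a morphism under a determinant functor. -/
noncomputable def evalHom {a b : VirtualObj T} : (a ⟶ b) → (a.eval D ⟶ b.eval D) :=
  Quotient.lift (fun f => f.eval D) fun _ _ h => h P D

/-- By the definition of the setoid, a relation holds as soon as every determinant functor satisfies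
it. All axioms of a symmetric monoidal groupoid and of a determinant functor are checked in this
way. -/
lemma hom_ext {a b : VirtualObj T} {f g : a ⟶ b}
    (h : ∀ (P : PicCat.{u}) (D : DetFunctor T P), evalHom D f = evalHom D g) : f = g := by
  induction f using Quotient.inductionOn
  induction g using Quotient.inductionOn
  exact Quotient.sound h

@[simp]
lemma evalHom_id (a : VirtualObj T) : evalHom D (𝟙 a) = 𝟙 _ := rfl

@[simp]
lemma evalHom_comp {a b c : VirtualObj T} (f : a ⟶ b) (g : b ⟶ c) :
    evalHom D (f ≫ g) = evalHom D f ≫ evalHom D g := by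
  induction f using Quotient.inductionOn
  induction g using Quotient.inductionOn
  rfl

instance : Category (VirtualObj T) where
  id_comp f := hom_ext fun P D => by simp
  comp_id f := hom_ext fun P D => by simp
  assoc f g h := hom_ext fun P D => by simp

/-- The class of a formal composite. -/
def Word.hom {a b : VirtualObj T} (f : Word a b) : a ⟶ b := Quotient.mk _ f

/-- The class of a formal composite, as an isomorphism. -/
def Word.iso {a b : VirtualObj T} (f : Word a b) : a ≅ b where
  hom := f.hom
  inv := f.inv.hom
  hom_inv_id := hom_ext fun P D => IsIso.hom_inv_id (f.eval D)
  inv_hom_id := hom_ext fun P D => IsIso.inv_hom_id (f.eval D)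

@[simp]
lemma evalHom_hom {a b : VirtualObj T} (f : Word a b) : evalHom D f.hom = f.eval D := rfl

instance : IsGroupoid (VirtualObj T) where
  all_isIso f := by
    induction f using Quotient.inductionOn with
    | _ f => exact f.iso.isIso_hom

instance : MonoidalCategoryStruct (VirtualObj T) where
  tensorObj := tensor
  tensorUnit := unit
  tensorHom := Quotient.map₂ .tensor fun _ _ h _ _ h' P D => congrArg₂ (· ⊗ₘ ·) (h P D) (h' P D)
  whiskerLeft a _ _ := Quotient.map (.tensor (.id a)) fun _ _ h P D =>
    congrArg (fun t => 𝟙 _ ⊗ₘ t) (h P D)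
  whiskerRight {b c} f a := Quotient.map (sa := wordSetoid b c) (fun t => .tensor t (.id a))
    (fun _ _ h P D => congrArg (fun t => t ⊗ₘ 𝟙 _) (h P D)) f
  associator a b c := (Word.associator a b c).iso
  leftUnitor a := (Word.leftUnitor a).iso
  rightUnitor a := (Word.rightUnitor a).iso

lemma evalHom_tensorHom {a b a' b' : VirtualObj T} (f : a ⟶ b) (g : a' ⟶ b') :
    evalHom D (f ⊗ₘ g) = evalHom D f ⊗ₘ evalHom D g := by
  induction f using Quotient.inductionOn
  induction g using Quotient.inductionOn
  rfl

lemma evalHom_whiskerLeft (a : VirtualObj T) {b c : VirtualObj T} (f : b ⟶ c) :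
    evalHom D (a ◁ f) = a.eval D ◁ evalHom D f := by
  induction f using Quotient.inductionOn
  exact id_tensorHom _ _

lemma evalHom_whiskerRight {b c : VirtualObj T} (f : b ⟶ c) (a : VirtualObj T) :
    evalHom D (f ▷ a) = evalHom D f ▷ a.eval D := by
  induction f using Quotient.inductionOn
  exact tensorHom_id _ _

instance : MonoidalCategory (VirtualObj T) where
  tensorHom_def f g := hom_ext fun P D => by
    rw [evalHom_comp, evalHom_tensorHom, evalHom_whiskerLeft, evalHom_whiskerRight]
    exact MonoidalCategory.tensorHom_def _ _
  id_tensorHom_id a b := hom_ext fun P D => by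
    rw [evalHom_tensorHom]
    exact id_tensorHom_id _ _
  tensorHom_comp_tensorHom f g h k := hom_ext fun P D => by
    simp only [evalHom_comp, evalHom_tensorHom]
    exact tensorHom_comp_tensorHom _ _ _ _
  whiskerLeft_id a b := hom_ext fun P D => by
    rw [evalHom_whiskerLeft]
    exact MonoidalCategory.whiskerLeft_id _ _
  id_whiskerRight a b := hom_ext fun P D => by
    rw [evalHom_whiskerRight]
    exact id_whiskerRight _ _
  associator_naturality f g h := hom_ext fun P D => by
    simp only [evalHom_comp, evalHom_tensorHom]
    exact associator_naturality _ _ _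
  leftUnitor_naturality f := hom_ext fun P D => by
    rw [evalHom_comp, evalHom_comp, evalHom_whiskerLeft]
    exact leftUnitor_naturality _
  rightUnitor_naturality f := hom_ext fun P D => by
    rw [evalHom_comp, evalHom_comp, evalHom_whiskerRight]
    exact rightUnitor_naturality _
  pentagon a b c d := hom_ext fun P D => by
    simp only [evalHom_comp, evalHom_whiskerLeft, evalHom_whiskerRight]
    exact pentagon _ _ _ _
  triangle a b := hom_ext fun P D => by
    simp only [evalHom_comp, evalHom_whiskerLeft, evalHom_whiskerRight]
    exact triangle _ _

lemma evalHom_associator_inv (a b c : VirtualObj T) :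
    evalHom D (α_ a b c).inv = (α_ (a.eval D) (b.eval D) (c.eval D)).inv :=
  IsIso.Iso.inv_hom _

instance : SymmetricCategory (VirtualObj T) where
  braiding a b := (Word.braiding a b).iso
  braiding_naturality_right a _ _ f := hom_ext fun P D => by
    rw [evalHom_comp, evalHom_comp, evalHom_whiskerLeft, evalHom_whiskerRight]
    exact BraidedCategory.braiding_naturality_right _ _
  braiding_naturality_left f a := hom_ext fun P D => by
    rw [evalHom_comp, evalHom_comp, evalHom_whiskerLeft, evalHom_whiskerRight]
    exact BraidedCategory.braiding_naturality_left _ _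
  hexagon_forward a b c := hom_ext fun P D => by
    simp only [evalHom_comp, evalHom_whiskerLeft, evalHom_whiskerRight]
    exact BraidedCategory.hexagon_forward _ _ _
  hexagon_reverse a b c := hom_ext fun P D => by
    simp only [evalHom_comp, evalHom_whiskerLeft, evalHom_whiskerRight, evalHom_associator_inv]
    exact BraidedCategory.hexagon_reverse _ _ _
  symmetry a b := hom_ext fun P D => by
    rw [evalHom_comp]
    exact SymmetricCategory.symmetry _ _

end VirtualObj

open VirtualObj

/-- The Picard groupoid of formal sums. -/
abbrev PicCat.virtual (T : TrCat.{u}) : PicCat.{u} where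
  carrier := VirtualObj T
  groupLike a := tensorLeft_isEquivalence (Word.contract a).iso

/-- The determinant functor given by formal sums. -/
def DetFunctor.virtual (T : TrCat.{u}) : DetFunctor T (PicCat.virtual T) where
  functor :=
    { obj x := VirtualObj.of x.of
      map p := (Word.map p.iso).hom
      map_id x := VirtualObj.hom_ext fun P D => D.functor.map_id _
      map_comp p q := VirtualObj.hom_ext fun P D => D.functor.map_comp _ _ }
  additivity Δ hΔ := (Word.add Δ hΔ).hom
  naturality hΔ hΔ' p q r h₁ h₂ h₃ := VirtualObj.hom_ext fun P D =>
    D.naturality hΔ hΔ' p q r h₁ h₂ h₃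
  commutativity b hb h₁ h₂ := VirtualObj.hom_ext fun P D => D.commutativity b hb h₁ h₂
  octahedron comm _ _ h₁ _ _ h₃ _ _ h₂ o := VirtualObj.hom_ext fun P D => by
    refine Eq.trans ?_ ((D.octahedron comm h₁ h₃ h₂ o).trans ?_)
    · exact congrArg (· ≫ _) (tensorHom_id _ _)
    · exact congrArg (fun t => _ ≫ t ≫ _) (id_tensorHom _ _).symm

/-! ### Squares for inverses and for the constraints of a lax monoidal functor. -/

section

variable {C D : Type*} [Category C] [Category D]

lemma inv_square' {A B : D} {w : A ⟶ B} [IsIso w] {p q : D} {g : B ⟶ q} {h : A ⟶ p} {s : p ⟶ q}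
    {t : q ⟶ p} (e : w ≫ g = h ≫ s) (e' : s ≫ t = 𝟙 _) : inv w ≫ h = g ≫ t := by
  rw [IsIso.inv_comp_eq, reassoc_of% e, e', comp_id]

lemma invert_additivity [MonoidalCategory D] {z x y z' x' y' : D} {p : z ⟶ z'} {q : x ⟶ x'}
    {r : y ⟶ y'} {p' : z' ⟶ z} {q' : x' ⟶ x} {r' : y' ⟶ y} (hp : p' ≫ p = 𝟙 _) (hq : q' ≫ q = 𝟙 _)
    (hr : r ≫ r' = 𝟙 _) {t : D} {m : z ⊗ x ⟶ t} {n : t ⟶ y} {s : z' ⊗ x' ⟶ y'}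
    (h : m ≫ n ≫ r = (p ⊗ₘ q) ≫ s) : s ≫ r' = (p' ⊗ₘ q') ≫ m ≫ n := by
  have e : (p' ⊗ₘ q') ≫ (p ⊗ₘ q) = 𝟙 _ := by
    rw [tensorHom_comp_tensorHom, hp, hq, id_tensorHom_id]
  have h' := congrArg (fun t => (p' ⊗ₘ q') ≫ t ≫ r') h
  simp only [assoc, hr, comp_id] at h'
  rw [h', reassoc_of% e]

variable [MonoidalCategory C] [MonoidalCategory D] (f : C ⥤ D)

/-- This lemma and the next four are the inductive steps of `extend_naturality` for the structure
morphisms of a Picard groupoid. -/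
lemma associator_lax [f.LaxMonoidal] {a b c : C} {A B E : D} (p : A ⟶ f.obj a) (q : B ⟶ f.obj b)
    (r : E ⟶ f.obj c) :
    (α_ A B E).hom ≫ (p ⊗ₘ ((q ⊗ₘ r) ≫ μ f b c)) ≫ μ f a (b ⊗ c) =
      ((((p ⊗ₘ q) ≫ μ f a b) ⊗ₘ r) ≫ μ f (a ⊗ b) c) ≫ f.map (α_ a b c).hom := by
  have h₁ : (p ⊗ₘ ((q ⊗ₘ r) ≫ μ f b c)) = (p ⊗ₘ (q ⊗ₘ r)) ≫ (f.obj a ◁ μ f b c) := by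
    rw [← id_tensorHom, tensorHom_comp_tensorHom, comp_id]
  have h₂ : (((p ⊗ₘ q) ≫ μ f a b) ⊗ₘ r) = ((p ⊗ₘ q) ⊗ₘ r) ≫ (μ f a b ▷ f.obj c) := by
    rw [← tensorHom_id, tensorHom_comp_tensorHom, comp_id]
  rw [h₁, h₂, assoc, assoc, assoc, associativity, associator_naturality_assoc]

lemma leftUnitor_lax [f.LaxMonoidal] {a : C} {A : D} (p : A ⟶ f.obj a) :
    (λ_ A).hom ≫ p = ((ε f ⊗ₘ p) ≫ μ f (𝟙_ C) a) ≫ f.map (λ_ a).hom := by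
  rw [MonoidalCategory.tensorHom_def', assoc, assoc, ← left_unitality, leftUnitor_naturality]

lemma rightUnitor_lax [f.LaxMonoidal] {a : C} {A : D} (p : A ⟶ f.obj a) :
    (ρ_ A).hom ≫ p = ((p ⊗ₘ ε f) ≫ μ f a (𝟙_ C)) ≫ f.map (ρ_ a).hom := by
  rw [MonoidalCategory.tensorHom_def, assoc, assoc, ← right_unitality, rightUnitor_naturality]

lemma braiding_lax [BraidedCategory C] [BraidedCategory D] [f.LaxBraided] {a b : C} {A B : D}
    (p : A ⟶ f.obj a) (q : B ⟶ f.obj b) :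
    (β_ A B).hom ≫ (q ⊗ₘ p) ≫ μ f b a = ((p ⊗ₘ q) ≫ μ f a b) ≫ f.map (β_ a b).hom := by
  rw [assoc, Functor.LaxBraided.braided, BraidedCategory.braiding_naturality_assoc]

lemma contract_lax [f.LaxMonoidal] [IsIso (ε f)] {a b : C} {A B : D} (p : A ⟶ f.obj a)
    (q : B ⟶ f.obj b) {r : A ⊗ B ⟶ 𝟙_ D} {t : a ⊗ b ⟶ 𝟙_ C}
    (h : (p ⊗ₘ q) ≫ μ f a b ≫ f.map t ≫ inv (ε f) = r) :
    r ≫ ε f = ((p ⊗ₘ q) ≫ μ f a b) ≫ f.map t := by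
  rw [← h]
  simp

end

/-! ### Universality of the formal sums. -/

namespace VirtualObj

variable {T : TrCat.{u}} {P : PicCat.{u}} (D : DetFunctor T P)

/-- The functor on formal sums given by a determinant functor. -/
noncomputable def evalFunctor : PicCat.virtual T ⥤ P where
  obj a := a.eval D
  map f := evalHom D f
  map_comp f g := evalHom_comp D f g

/-- The functor on formal sums given by a determinant functor is symmetric monoidal. -/
noncomputable instance : (evalFunctor D).Braided where
  toMonoidal := Functor.CoreMonoidal.toMonoidal
    { εIso := Iso.refl _
      μIso a b := Iso.refl _
      μIso_hom_natural_left f a :=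
        (comp_id _).trans ((evalHom_whiskerRight D f a).symm.trans (id_comp _).symm)
      μIso_hom_natural_right a f :=
        (comp_id _).trans ((evalHom_whiskerLeft D a f).symm.trans (id_comp _).symm)
      associativity a b c := by
        change (𝟙 (_ ⊗ _) ▷ _) ≫ 𝟙 (_ ⊗ _) ≫ (α_ (a.eval D) (b.eval D) (c.eval D)).hom =
          (α_ _ _ _).hom ≫ (_ ◁ 𝟙 (_ ⊗ _)) ≫ 𝟙 (_ ⊗ _)
        simp
      left_unitality a := by
        change (λ_ (a.eval D)).hom = (𝟙 (𝟙_ P) ▷ a.eval D) ≫ 𝟙 _ ≫ (λ_ (a.eval D)).hom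
        simp
      right_unitality a := by
        change (ρ_ (a.eval D)).hom = (a.eval D ◁ 𝟙 (𝟙_ P)) ≫ 𝟙 _ ≫ (ρ_ (a.eval D)).hom
        simp }
  braided a b := by
    change 𝟙 _ ≫ (β_ (a.eval D) (b.eval D)).hom = (β_ (a.eval D) (b.eval D)).hom ≫ 𝟙 _
    simp

variable {D} (f : PicCat.virtual T ⥤ P) [f.Braided]
  (β : D.functor ⟶ (DetFunctor.virtual T).functor ⋙ f)

/-- The extension of a transformation to inverses. -/
noncomputable def extendNeg {x x' y y' e : P} (p : x ⊗ y ⟶ e) (q : x' ⊗ y' ⟶ e) (g : x ⟶ x') :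
    y ⟶ y' :=
  haveI := P.groupLike x'
  (tensorLeft x').preimage ((inv g ▷ y) ≫ p ≫ inv q)

/-- A morphism between inverses is determined by compatibility with the contractions, because
tensoring with `x'` is fully faithful. So a monoidal transformation has no freedom at `neg a`. -/
lemma extendNeg_iff {x x' y y' e : P} (p : x ⊗ y ⟶ e) (q : x' ⊗ y' ⟶ e) (g : x ⟶ x')
    (h : y ⟶ y') : (g ⊗ₘ h) ≫ q = p ↔ h = extendNeg p q g := by
  haveI := P.groupLike x'
  have e : (x' ◁ extendNeg p q g) = (inv g ▷ y) ≫ p ≫ inv q :=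
    (tensorLeft x').map_preimage _
  constructor
  · intro h'
    refine (tensorLeft x').map_injective ?_
    change x' ◁ h = x' ◁ _
    rw [e, ← h', MonoidalCategory.tensorHom_def]
    simp
  · rintro rfl
    rw [MonoidalCategory.tensorHom_def, e]
    simp

/-- The transformation of functors on formal sums given by its values on objects. -/
noncomputable def extend : ∀ a : VirtualObj T, a.eval D ⟶ f.obj a
  | of x => β.app ⟨x⟩
  | unit => ε f
  | tensor a b => (extend a ⊗ₘ extend b) ≫ μ f a b
  | neg a => extendNeg (P.contract (a.eval D)).hom
      (μ f a (neg a) ≫ f.map (Word.contract a).hom ≫ inv (ε f)) (extend a)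

/-- Induction on words. The generators are covered by the axioms of the braided functor `f`, by the
defining property of `extendNeg` for contractions, by naturality of `β`, and by `hβ`. -/
lemma extend_naturality (hβ : ∀ (Δ : Triangle T) (hΔ : Δ ∈ distTriang T),
      D.additivity Δ hΔ ≫ β.app ⟨Δ.obj₂⟩ = (β.app ⟨Δ.obj₃⟩ ⊗ₘ β.app ⟨Δ.obj₁⟩) ≫
        μ f (.of Δ.obj₃) (.of Δ.obj₁) ≫ f.map (Word.add Δ hΔ).hom) {a b : VirtualObj T}
    (w : Word a b) : w.eval D ≫ extend f β b = extend f β a ≫ f.map w.hom := by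
  induction w with
  | id a => exact (id_comp _).trans ((comp_id _).symm.trans (congrArg (_ ≫ ·) (f.map_id _).symm))
  | comp v w hv hw =>
    refine (assoc _ _ _).trans ((congrArg (_ ≫ ·) hw).trans ?_)
    refine (assoc _ _ _).symm.trans ((congrArg (· ≫ _) hv).trans ?_)
    exact (assoc _ _ _).trans (congrArg (_ ≫ ·) (f.map_comp _ _).symm)
  | inv w hw =>
    have e : f.map w.hom ≫ f.map w.inv.hom = 𝟙 _ :=
      (f.map_comp _ _).symm.trans ((congrArg f.map w.iso.hom_inv_id).trans (f.map_id _))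
    exact inv_square' hw e
  | tensor v w hv hw =>
    refine (assoc _ _ _).symm.trans ((congrArg (· ≫ _) ((tensorHom_comp_tensorHom _ _ _ _).trans
      (congrArg₂ (· ⊗ₘ ·) hv hw))).trans ?_)
    refine (congrArg (· ≫ _) (tensorHom_comp_tensorHom _ _ _ _).symm).trans ?_
    exact (assoc _ _ _).trans ((congrArg (_ ≫ ·) (μ_natural f _ _)).trans (assoc _ _ _).symm)
  | associator a b c => exact associator_lax f _ _ _
  | leftUnitor a => exact leftUnitor_lax f _
  | rightUnitor a => exact rightUnitor_lax f _
  | braiding a b => exact braiding_lax f _ _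
  | contract a => exact contract_lax f _ _ ((extendNeg_iff _ _ _ _).2 rfl)
  | map p => exact β.naturality ⟨p⟩
  | add Δ hΔ => exact (hβ Δ hΔ).trans (assoc _ _ _).symm

/-- Induction on formal sums; at `neg a`, naturality for the contraction leaves only the value
`extendNeg`. -/
lemma eq_extend {γ : ∀ a : VirtualObj T, a.eval D ⟶ f.obj a} (h₁ : ∀ x, γ (of x) = β.app ⟨x⟩)
    (h₂ : γ unit = ε f) (h₃ : ∀ a b, γ (tensor a b) = (γ a ⊗ₘ γ b) ≫ μ f a b)
    (h₄ : ∀ {a b : VirtualObj T} (w : Word a b), w.eval D ≫ γ b = γ a ≫ f.map w.hom)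
    (a : VirtualObj T) : γ a = extend f β a := by
  induction a with
  | of x => exact h₁ x
  | unit => exact h₂
  | tensor a b ha hb => rw [h₃, ha, hb]; rfl
  | neg a ha =>
    refine (extendNeg_iff _ _ _ _).1 ?_
    have h := h₄ (Word.contract a)
    rw [h₂, h₃, ha] at h
    refine (cancel_mono (ε f)).1 (Eq.trans ?_ h.symm)
    refine (assoc _ _ _).trans (Eq.trans (congrArg (_ ≫ ·) ?_) (assoc _ _ _).symm)
    exact (assoc _ _ _).trans (congrArg (_ ≫ ·) ((assoc _ _ _).trans
      ((congrArg (_ ≫ ·) (IsIso.inv_hom_id _)).trans (comp_id _))))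

end VirtualObj

/-- Evaluation is symmetric monoidal with identity constraints and restricts to `D` itself, so the
first transformation has identity components. The comparison with another pair must then extend the
inverse of its transformation. -/
theorem DetFunctor.virtual_isUniversal (T : TrCat.{u}) : (DetFunctor.virtual T).IsUniversal := by
  intro P D
  refine ⟨evalFunctor D, inferInstance, ⟨fun x => 𝟙 (D.functor.obj x), fun x y p => ?_⟩, ?_, ?_⟩
  · exact (comp_id _).trans (id_comp _).symm
  · intro Δ hΔ
    exact (id_comp _).trans ((comp_id _).trans ((id_comp _).symm.trans
      (congrArg (· ≫ _) (id_tensorHom_id _ _).symm)))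
  · intro f hf α hα
    have hi : ∀ x, IsIso (α.app x) := fun x => IsGroupoid.all_isIso (C := P) _
    have hi' : IsIso α := NatIso.isIso_of_isIso_app α
    -- The transformation to be extended starts at `D`, against the direction of `α`, so
    -- compatibility with additivity is inverted.
    have hβ : ∀ (Δ : Triangle T) (hΔ : Δ ∈ distTriang T),
        D.additivity Δ hΔ ≫ (inv α).app ⟨Δ.obj₂⟩ = ((inv α).app ⟨Δ.obj₃⟩ ⊗ₘ (inv α).app ⟨Δ.obj₁⟩) ≫
          μ f (.of Δ.obj₃) (.of Δ.obj₁) ≫ f.map (Word.add Δ hΔ).hom := fun Δ hΔ =>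
      invert_additivity (NatTrans.congr_app (IsIso.inv_hom_id α) ⟨Δ.obj₃⟩)
        (NatTrans.congr_app (IsIso.inv_hom_id α) ⟨Δ.obj₁⟩)
        (NatTrans.congr_app (IsIso.hom_inv_id α) ⟨Δ.obj₂⟩) (hα Δ hΔ)
    refine ⟨⟨fun a => extend f (inv α) a, fun a b w => ?_⟩, ⟨⟨?_, fun a b => ?_⟩, ?_⟩, ?_⟩
    · induction w using Quotient.inductionOn with
      | _ w => exact extend_naturality f (inv α) hβ w
    · exact id_comp _
    · exact id_comp _
    · exact IsIso.inv_hom_id α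
    · rintro γ ⟨h₁, h₂⟩
      ext a
      refine eq_extend f (inv α) (γ := fun a => γ.app a) (fun x => ?_) ?_ (fun a b => ?_)
        (fun w => γ.naturality (Word.hom w)) a
      · have h : Functor.whiskerLeft (DetFunctor.virtual T).functor γ = inv α :=
          (@IsIso.eq_inv_of_inv_hom_id _ _ _ _ α hi' _ h₂)
        exact NatTrans.congr_app h ⟨x⟩
      · exact (id_comp _).symm.trans h₁.unit
      · exact (id_comp _).symm.trans (h₁.tensor a b)

/-! ### Functoriality of the virtual objects -/

section

variable {ι : Type} {A : ι → PicCat.{u}} {P : PicCat.{u}}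

instance {f g : PicFunctor A P} (γ : f ⟶ g) : IsIso γ := by
  have : ∀ x, IsIso (γ.natTrans.app x) := fun x => IsGroupoid.all_isIso (C := P) _
  have : IsIso γ.natTrans := NatIso.isIso_of_isIso_app _
  refine ⟨{ natTrans := inv γ.natTrans, comm := fun i x y s σ => ?_ },
    PicFunctor.Hom.ext (IsIso.hom_inv_id γ.natTrans),
    PicFunctor.Hom.ext (IsIso.inv_hom_id γ.natTrans)⟩
  rw [NatIso.isIso_inv_app, NatIso.isIso_inv_app, NatIso.isIso_inv_app, IsIso.comp_inv_eq, assoc,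
    γ.comm, tensorHom_comp_tensorHom_assoc, IsIso.inv_hom_id, IsIso.inv_hom_id, id_tensorHom_id,
    id_comp]

instance {f g : Pic A P} (γ : f ⟶ g) : IsIso γ :=
  (ObjectProperty.isoMk _ (asIso γ.hom)).isIso_hom

lemma DetData.isIso_hom {T : ι → TrCat.{u}} {D E : DetData T P} (γ : D ⟶ E) : IsIso γ := by
  have : ∀ x, IsIso (γ.natTrans.app x) := fun x => IsGroupoid.all_isIso (C := P) _
  have : IsIso γ.natTrans := NatIso.isIso_of_isIso_app _
  refine ⟨{ natTrans := inv γ.natTrans, comm := fun i x y z Δ => ?_ },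
    DetData.Hom.ext (IsIso.hom_inv_id γ.natTrans),
    DetData.Hom.ext (IsIso.inv_hom_id γ.natTrans)⟩
  rw [NatIso.isIso_inv_app, NatIso.isIso_inv_app, NatIso.isIso_inv_app, IsIso.comp_inv_eq, assoc,
    γ.comm, tensorHom_comp_tensorHom_assoc, IsIso.inv_hom_id, IsIso.inv_hom_id, id_tensorHom_id,
    id_comp]

end

section

variable {I J : Type} {φ : I → J} {A : I → PicCat.{u}} {B : J → PicCat.{u}} {C : PicCat.{u}}

/-- Transformations `f_j ⟶ f'_j` induce a transformation `g ∘ (f_j)_j ⟶ g ∘ (f'_j)_j`. -/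
def PicFunctor.postMap {f f' : PicString φ A B} (γ : ∀ j, f j ⟶ f' j) {g : PicFunctor B C}
    (hg : g.IsMultiexact) : comp f g ⟶ comp f' g where
  natTrans :=
    { app := fun y => g.functor.map (fun j => (γ j).natTrans.app (fun i => y i.1))
      naturality := fun x y p => by
        refine (g.functor.map_comp _ _).symm.trans (Eq.trans ?_ (g.functor.map_comp _ _))
        exact congrArg g.functor.map
          (funext fun j => (γ j).natTrans.naturality (fun i : Fib φ j => p i.1)) }
  comm i x y s σ := hg.naturality (φ i) _ _ _ _ _ ((γ (φ i)).comm ⟨i, rfl⟩ (σ.pull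
      (⟨i, rfl⟩ : Fib φ (φ i)) (TrString.fib_inj _)))
    (fun j h => (γ j).natTrans.naturality (X := fun i => x i.1) (Y := fun i => s i.1) _)
    (fun j h => (γ j).natTrans.naturality (X := fun i => y i.1) (Y := fun i => s i.1) _)

/-- Transformations of functors on a fibre of `φ`, regarded as functors on a fibre of `fibMap`. -/
def PicFunctor.restrictMap {K : Type} {ψ : J → K} {k : K} (j : Fib ψ k)
    {f f' : PicFunctor (onFib A φ j.1) C} (γ : f ⟶ f') : f.restrict j ⟶ f'.restrict j where
  natTrans :=
    { app := fun y => γ.natTrans.app (fun i => y (inFib φ ψ j i))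
      naturality := fun x y p => γ.natTrans.naturality (fun i => p (inFib φ ψ j i)) }
  comm i _ _ _ σ := γ.comm ⟨i.1.1, congrArg Subtype.val i.2⟩
    (σ.pull (r := inFib φ ψ j) ⟨i.1.1, congrArg Subtype.val i.2⟩ (inFib_inj φ ψ j _))

/-- Transformations `f_j ⟶ f'_j` induce a transformation `g ∘ (f_j)_j ⟶ g ∘ (f'_j)_j`. -/
def PicHom.postMap {K : Type} {ψ : J → K} {D : K → PicCat.{u}} {f f' : PicHom φ A B}
    (γ : ∀ j, f j ⟶ f' j) (g : PicHom ψ B D) (k : K) : (f.comp g k).obj ⟶ (f'.comp g k).obj :=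
  PicFunctor.postMap (φ := fibMap φ ψ k)
    (fun j => PicFunctor.restrictMap (φ := φ) (ψ := ψ) (k := k) j (γ j.1).hom) (g k).property

end

section

variable {V : TrCat.{u} → PicCat.{u}} {det : ∀ T, DetFunctor T (V T)}

section

variable {ι : Type} [Finite ι] {T : ι → TrCat.{u}} {P : PicCat.{u}}

/-- Transformations of multiexact functors on virtual objects are determined by their components
at determinants. -/
lemma PicFunctor.app_eq_of_det (hdet : ∀ T, (det T).IsUniversal)
    {f g : PicFunctor (fun i => V (T i)) P} (hf : f.IsMultiexact) (hg : g.IsMultiexact)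
    (γ γ' : f ⟶ g)
    (h : ∀ x : ∀ i, T i, γ.natTrans.app (detObj det x) = γ'.natTrans.app (detObj det x))
    (y : ∀ i, V (T i)) : γ.natTrans.app y = γ'.natTrans.app y := by
  have := detStar_isEquivalence (P := P) (T := T) det hdet
  have e : (ObjectProperty.homMk γ : (⟨f, hf⟩ : Pic _ P) ⟶ ⟨g, hg⟩) = ObjectProperty.homMk γ' := by
    refine (detStar P det T).map_injective (ObjectProperty.hom_ext _ (DetData.Hom.ext ?_))
    ext x
    exact h x.of
  exact congrArg (fun t => t.hom.natTrans.app y) e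

/-- Fullness of `det^*` lifts `δ` followed by the inverse of `ε`. The target `D` need not be a
multideterminant functor, since only the composite between the restrictions is lifted. -/
lemma exists_pic_hom (hdet : ∀ T, (det T).IsUniversal) {f g : Pic (fun i => V (T i)) P}
    {D : DetData T P} (δ : detPullObj det f.obj ⟶ D) (ε : detPullObj det g.obj ⟶ D) :
    ∃ γ : f ⟶ g, ∀ x : ∀ i, T i,
      γ.hom.natTrans.app (detObj det x) ≫ ε.natTrans.app ⟨x⟩ = δ.natTrans.app ⟨x⟩ := by
  have := detStar_isEquivalence (P := P) (T := T) det hdet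
  have := DetData.isIso_hom ε
  obtain ⟨η, hη⟩ : ∃ η : D ⟶ detPullObj det g.obj, η ≫ ε = 𝟙 D := ⟨inv ε, IsIso.inv_hom_id ε⟩
  obtain ⟨γ, hγ⟩ := (detStar P det T).map_surjective (X := f) (Y := g) (ObjectProperty.homMk (δ ≫ η))
  have e : detPullMap det γ.hom ≫ ε = δ :=
    (congrArg (· ≫ ε) (congrArg (fun t => t.hom) hγ)).trans
      ((assoc δ η ε).trans ((congrArg (δ ≫ ·) hη).trans (comp_id δ)))
  exact ⟨γ, fun x => congrArg (fun t => t.natTrans.app ⟨x⟩) e⟩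

end

section

variable {I J : Type} {φ : I → J} {S : I → TrCat.{u}} {T : J → TrCat.{u}} {P : PicCat.{u}}

/-- A 2-cell `F ≅ F'` induces `det ∘ F_j ⟶ det ∘ F'_j`. -/
def detAfterMap {F F' : TrHom φ S T} (σ : F ≅ F') (j : J) (d : DetFunctor (T j) P) :
    detAfter d (F j).obj (F j).property.1 ⟶ detAfter d (F' j).obj (F' j).property.1 where
  natTrans :=
    { app := fun x => d.functor.map ⟨TrHom.appIso σ j x.of⟩
      naturality := fun x y p => by
        refine (d.functor.map_comp _ _).symm.trans (Eq.trans ?_ (d.functor.map_comp _ _))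
        exact congrArg d.functor.map (CoreHom.ext (Iso.ext
          ((σ.hom j).hom.natTrans.naturality p.iso.hom))) }
  comm i x y z Δ := d.naturality ((F j).property.1.dist i Δ) ((F' j).property.1.dist i Δ)
    (TrHom.appIso σ j x) (TrHom.appIso σ j y) (TrHom.appIso σ j z) ((σ.hom j).hom.natTrans.naturality Δ.u)
    ((σ.hom j).hom.natTrans.naturality Δ.v) ((σ.hom j).hom.comm i Δ.w)

lemma map_iso_symm {C D : Type*} [Category C] [Category D] (F : C ⥤ D) {a b : C} (e : a ≅ b)
    (h : IsIso (F.map e.hom)) : F.mapIso e.symm = (@asIso _ _ _ _ (F.map e.hom) h).symm := by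
  ext
  exact IsIso.eq_inv_of_hom_inv_id (by simp)

/-- Transformations `f_j ∘ (det, …, det) ⟶ det ∘ F_j` induce
`g ∘ (f_j)_j ∘ (det, …, det) ⟶ g ∘ (det, …, det) ∘ (F_j)_j`. -/
noncomputable def pushDet {f : PicString φ (fun i => V (S i)) (fun j => V (T j))} {F : TrHom φ S T}
    (α : ∀ j, detPullObj det (T := onFib S φ j) (f j) ⟶
      detAfter (det (T j)) (F j).obj (F j).property.1)
    {g : PicFunctor (fun j => V (T j)) P} (hg : g.IsMultiexact) :
    detPullObj det (PicFunctor.comp f g) ⟶ pullDetObj F (detPullObj det g) where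
  natTrans :=
    { app := fun x => g.functor.map (fun j => (α j).natTrans.app ⟨fun i => x.of i.1⟩)
      naturality := fun x y p => by
        refine (g.functor.map_comp _ _).symm.trans (Eq.trans ?_ (g.functor.map_comp _ _))
        exact congrArg g.functor.map (funext fun j => (α j).natTrans.naturality
          (X := ⟨fun i => x.of i.1⟩) (Y := ⟨fun i => y.of i.1⟩)
          ⟨Pi.isoMk fun i => Pi.isoApp p.iso i.1⟩) }
  comm i x y z Δ := by
    refine hg.naturality (φ i) _ _ _ _ _ ((α (φ i)).comm ⟨i, rfl⟩ (Δ.pull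
      (⟨i, rfl⟩ : Fib φ (φ i)) (TrString.fib_inj _))) (fun j h => ?_) (fun j h => ?_)
    · have hi : ∀ i' : Fib φ j, IsIso (Δ.v i'.1) :=
        fun i' => Δ.isIso_v i'.1 (fun e => h (by rw [← i'.2, e]))
      -- In a fibre that does not contain `i` every entry of `v` is invertible. The inclusion of the
      -- cone is the inverse there, which `map_iso_symm` matches with the family of inverses used by
      -- `detSum`.
      have n := (α j).natTrans.naturality (X := ⟨fun i => z i.1⟩) (Y := ⟨fun i => y i.1⟩)
        ⟨(Pi.isoMk fun i' => asIso (Δ.v i'.1)).symm⟩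
      exact n.trans (congrArg (fun t => _ ≫ (det (T j)).functor.map ⟨t⟩)
        (map_iso_symm _ _ _))
    · have hi : ∀ i' : Fib φ j, IsIso (Δ.u i'.1) :=
        fun i' => Δ.isIso_u i'.1 (fun e => h (by rw [← i'.2, e]))
      have n := (α j).natTrans.naturality (X := ⟨fun i => x i.1⟩) (Y := ⟨fun i => y i.1⟩)
        ⟨Pi.isoMk fun i' => asIso (Δ.u i'.1)⟩
      exact n.trans (congrArg (fun t => _ ≫ (det (T j)).functor.map ⟨t⟩)
        (Iso.ext rfl))

/-- A 1-cell acts on transformations of multideterminant functors. -/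
def pullDetMap (F : TrHom φ S T) {D E : DetData T P} (γ : D ⟶ E) :
    pullDetObj F D ⟶ pullDetObj F E where
  natTrans := Functor.whiskerLeft F.string.star.core γ.natTrans
  comm i _ _ _ Δ := γ.comm (φ i) (F.string.starTri F.multiexact ⟨i, rfl⟩ Δ)

end

/-- `id ∘ (det, …, det) = det ∘ id`. -/
noncomputable def detAfterId {J : Type} (T : J → TrCat.{u}) (j : J) :
    detAfter (det (T j)) (TrHom.id T j).obj (TrHom.id T j).property.1 ⟶
      detPullObj det (T := onFib T id j) (PicHom.id (fun j => V (T j)) j).obj where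
  natTrans :=
    { app := fun x => 𝟙 ((det (T j)).functor.obj ⟨x.of ⟨j, rfl⟩⟩)
      naturality := fun x y p => (comp_id _).trans (id_comp _).symm }
  comm i x y z Δ := by
    obtain ⟨i, rfl⟩ := i
    refine Eq.trans (comp_id _) (Eq.trans ?_ ((id_comp _).symm.trans
      (congrArg (· ≫ _) (id_tensorHom_id _ _).symm)))
    rfl

/-- The restriction of a 1-cell to the fibres over `k`. -/
abbrev TrHom.restrict {I J K : Type} {φ : I → J} {ψ : J → K} {S : I → TrCat.{u}}
    {T : J → TrCat.{u}} (F : TrHom φ S T) (k : K) :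
    TrHom (fibMap φ ψ k) (onFib S (ψ ∘ φ) k) (onFib T ψ k) := fun j =>
  ⟨(F j.1).obj.restrict j, (F j.1).property.1.restrict j, (F j.1).property.2.restrict j⟩

/-- A transformation `f ∘ (det, …, det) ⟶ det ∘ F` of functors on a fibre of `φ`, regarded as
functors on a fibre of `fibMap`. -/
def detRestrict {I J K : Type} {φ : I → J} {ψ : J → K} {S : I → TrCat.{u}} {T : TrCat.{u}} {k : K}
    (j : Fib ψ k) {f : PicFunctor (onFib (fun i => V (S i)) φ j.1) (V T)}
    {F : TrFunctor (onFib S φ j.1) T} {hF : F.IsMultiexact}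
    (α : detPullObj det (T := onFib S φ j.1) f ⟶ detAfter (det T) F hF) :
    detPullObj det (T := onFib (onFib S (ψ ∘ φ) k) (fibMap φ ψ k) j) (f.restrict j) ⟶
      detAfter (det T) (F.restrict j) (hF.restrict j) where
  natTrans :=
    { app := fun x => α.natTrans.app ⟨fun i => x.of (inFib φ ψ j i)⟩
      naturality := fun x y p => α.natTrans.naturality (X := ⟨fun i => x.of (inFib φ ψ j i)⟩)
        (Y := ⟨fun i => y.of (inFib φ ψ j i)⟩)
        ⟨Pi.isoMk fun i => Pi.isoApp p.iso (inFib φ ψ j i)⟩ }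
  comm i x y z Δ := α.comm ⟨i.1.1, congrArg Subtype.val i.2⟩
    (Δ.pull (r := inFib φ ψ j) (k := ⟨i.1.1, congrArg Subtype.val i.2⟩) (inFib_inj φ ψ j _))

end

variable {V : TrCat.{u} → PicCat.{u}} {det : ∀ T, DetFunctor T (V T)}

/-- Each det ∘ F_j is a multideterminant functor, and essential surjectivity of `det^*` provides
V(F)_j together with its isomorphism. -/
theorem nonempty_virtualFunctors (hdet : ∀ T, (det T).IsUniversal) :
    Nonempty (VirtualFunctors det) := by
  have key : ∀ {ι : Type} [Finite ι] {S : ι → TrCat.{u}} {T : TrCat.{u}} (F : TrV S T),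
      ∃ f : Pic (fun i => V (S i)) (V T),
        Nonempty (detPullObj det f.obj ≅ detAfter (det T) F.obj F.property.1) := by
    intro ι _ S T F
    have := detStar_isEquivalence (P := V T) (T := S) det hdet
    let D : Det S (V T) := ⟨detAfter (det T) F.obj F.property.1,
      detAfter_isMultiDet (det T) F.property.1 F.property.2⟩
    exact ⟨(detStar (V T) det S).objPreimage D,
      ⟨(ObjectProperty.ι _).mapIso ((detStar (V T) det S).objObjPreimageIso D)⟩⟩
  exact ⟨{ map := fun F j => (key (F j)).choose
           iso := fun F j => (key (F j)).choose_spec.some }⟩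

/-! ### Lifting and comparing 2-cells; existence of the constraints. -/

section

variable {I J : Type} [Finite I] {φ : I → J} {S : I → TrCat.{u}} {T : J → TrCat.{u}}

lemma exists_picHom_iso (hdet : ∀ T, (det T).IsUniversal)
    {f g : PicHom φ (fun i => V (S i)) (fun j => V (T j))}
    {D : ∀ j, DetData (onFib S φ j) (V (T j))}
    (δ : ∀ j, detPullObj det (T := onFib S φ j) (f j).obj ⟶ D j)
    (ε : ∀ j, detPullObj det (T := onFib S φ j) (g j).obj ⟶ D j) :
    ∃ γ : f ≅ g, ∀ (j : J) (x : ∀ i : Fib φ j, S i.1),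
      VirtualFunctors.app γ j (detObj det (S := onFib S φ j) x) ≫ (ε j).natTrans.app ⟨x⟩ =
        (δ j).natTrans.app ⟨x⟩ := by
  choose γ hγ using fun j => exists_pic_hom hdet (T := onFib S φ j) (f := f j) (g := g j) (δ j) (ε j)
  exact ⟨Pi.isoMk fun j => asIso (γ j), hγ⟩

lemma picHom_iso_ext (hdet : ∀ T, (det T).IsUniversal)
    {f g : PicHom φ (fun i => V (S i)) (fun j => V (T j))} {γ γ' : f ≅ g}
    (h : ∀ (j : J) (x : ∀ i : Fib φ j, S i.1),
      VirtualFunctors.app γ j (detObj det (S := onFib S φ j) x) =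
        VirtualFunctors.app γ' j (detObj det (S := onFib S φ j) x)) : γ = γ' := by
  refine Iso.ext (funext fun j => ObjectProperty.hom_ext _ (PicFunctor.Hom.ext ?_))
  ext y
  exact PicFunctor.app_eq_of_det (T := onFib S φ j) hdet (f j).property (g j).property _ _ (h j) y

end

section

variable {C D : Type*} [Category C] [Category D]

/-- The diagram chase for naturality in 2-cells. The constraints `c`, `c'` are known only through
their values at determinants, `he` and `he'`, so equality is tested after the invertible `G'.map i'
≫ j'`. -/
lemma comp_square {G G' : C ⥤ D} (t : G ⟶ G') {v v' d d' : C} {m : v ⟶ v'} {i : v ⟶ d}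
    {i' : v' ⟶ d'} {s : d ⟶ d'} (hm : m ≫ i' = i ≫ s) {X X' Y Y₁ Y' : D} {c : X ⟶ G.obj v}
    {c' : X' ⟶ G'.obj v'} {m₂ : X ⟶ X'} {e : X ⟶ Y} {e' : X' ⟶ Y'} {j : G.obj d ⟶ Y}
    {j' : G'.obj d' ⟶ Y'} {j₁ : G.obj d' ⟶ Y₁} {q : Y ⟶ Y₁} {q' : Y₁ ⟶ Y'} {p : Y ⟶ Y'}
    (he : c ≫ G.map i ≫ j = e) (he' : c' ≫ G'.map i' ≫ j' = e') (h₂ : m₂ ≫ e' = e ≫ p)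
    (hj : G.map s ≫ j₁ = j ≫ q) (ht : t.app d' ≫ j' = j₁ ≫ q') (hp : q ≫ q' = p) [IsIso i']
    [IsIso j'] : m₂ ≫ c' = c ≫ G.map m ≫ t.app v' := by
  refine (cancel_mono (G'.map i' ≫ j')).1 ?_
  rw [assoc, he', h₂, ← he, ← hp, assoc, assoc, assoc, assoc, ← t.naturality_assoc, ht,
    ← G.map_comp_assoc, hm, G.map_comp_assoc, reassoc_of% hj]

end

namespace VirtualFunctors

variable (L : VirtualFunctors det)

section

variable {I J K : Type} [Finite I] [Finite J] [Finite K] {φ : I → J} {ψ : J → K}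
  {S : I → TrCat.{u}} {T : J → TrCat.{u}} {U : K → TrCat.{u}}

lemma exists_map₂ (hdet : ∀ T, (det T).IsUniversal) {F F' : TrHom φ S T} (σ : F ≅ F') :
    ∃ γ : L.map F ≅ L.map F', ∀ (j : J) (x : ∀ i : Fib φ j, S i.1),
      app γ j (detObj det (S := onFib S φ j) x) ≫ L.isoApp F' j x =
        L.isoApp F j x ≫ (det (T j)).functor.map ⟨TrHom.appIso σ j x⟩ :=
  exists_picHom_iso hdet (fun j => (L.iso F j).hom ≫ detAfterMap σ j (det (T j)))
    (fun j => (L.iso F' j).hom)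

/-- Both functors are compared with det ∘ G ∘ F at determinants: V(G ∘ F) directly, and V(G) ∘ V(F)
by passing `det` first through `F` (`pushDet`) and then through `G`. -/
lemma exists_mapComp (hdet : ∀ T, (det T).IsUniversal) (F : TrHom φ S T) (G : TrHom ψ T U) :
    ∃ γ : L.map (F.comp G) ≅ (L.map F).comp (L.map G),
      ∀ (k : K) (x : ∀ i : Fib (ψ ∘ φ) k, S i.1),
        app γ k (detObj det (S := onFib S (ψ ∘ φ) k) x) ≫
            (L.map G k).obj.functor.map
              (fun j : Fib ψ k => L.isoApp F j.1 (fun i => x (inFib φ ψ j i).1)) ≫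
            L.isoApp G k
              (fun j : Fib ψ k => (F j.1).obj.functor.obj (fun i => x (inFib φ ψ j i).1)) =
          L.isoApp (F.comp G) k x :=
  exists_picHom_iso hdet (g := (L.map F).comp (L.map G)) (fun k => (L.iso (F.comp G) k).hom)
    (fun k => pushDet (F := F.restrict (ψ := ψ) k)
      (fun j => detRestrict (φ := φ) (ψ := ψ) j (L.iso F j.1).hom) (L.map G k).property ≫
        pullDetMap (F.restrict (ψ := ψ) k) (L.iso G k).hom)

lemma exists_mapId (hdet : ∀ T, (det T).IsUniversal) (T : J → TrCat.{u}) :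
    ∃ γ : L.map (TrHom.id T) ≅ PicHom.id (fun j => V (T j)),
      ∀ (j : J) (x : ∀ i : Fib (id : J → J) j, T i.1),
        app γ j (detObj det (S := onFib T id j) x) = L.isoApp (TrHom.id T) j x := by
  obtain ⟨γ, hγ⟩ := exists_picHom_iso hdet (g := PicHom.id (fun j => V (T j)))
    (fun j => (L.iso (TrHom.id T) j).hom ≫ detAfterId T j) (fun j => 𝟙 _)
  exact ⟨γ, fun j x => (comp_id _).symm.trans ((hγ j x).trans (comp_id _))⟩

end

end VirtualFunctors

variable {V : TrCat.{u} → PicCat.{u}} {det : ∀ T, DetFunctor T (V T)}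

section

variable {C D : Type*} [Category C] [Category D]

/-- The diagram chase shared by associativity of the composition constraints and by compatibility of
the naturality squares with composition. -/
lemma assoc_square {B : Type*} [Category B] {H : C ⥤ D} {H' : B ⥤ D} {R : B ⥤ C} (t : H' ⟶ R ⋙ H)
    {w d : B} {i : w ⟶ d} {d' v : C} {b : R.obj d ⟶ d'} {X Y : D} {j : H.obj d' ⟶ Y}
    {j' : H'.obj d ⟶ Y} {c₁ : X ⟶ H.obj v} {c₂ : v ⟶ R.obj w} {c₃ : X ⟶ H'.obj w} {e : X ⟶ Y}
    {e' : v ⟶ d'} (h₁ : c₁ ≫ H.map e' ≫ j = e) (h₂ : c₂ ≫ R.map i ≫ b = e')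
    (h₃ : c₃ ≫ H'.map i ≫ j' = e) (h₄ : t.app d ≫ H.map b ≫ j = j') [IsIso i] [IsIso b] [IsIso j] :
    c₁ ≫ H.map c₂ = c₃ ≫ t.app w := by
  refine (cancel_mono (H.map (R.map i ≫ b) ≫ j)).1 ?_
  have n : t.app w ≫ H.map (R.map i) = H'.map i ≫ t.app d := (t.naturality i).symm
  rw [assoc, ← H.map_comp_assoc, h₂, h₁, assoc, H.map_comp, assoc, reassoc_of% n, h₄, h₃]

lemma right_unit_square {H E : C ⥤ D} (t : H ⟶ E) {v d : C} {i : v ⟶ d} {X : D} {c : X ⟶ H.obj v}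
    {m : X ⟶ E.obj v} {e : X ⟶ E.obj d} (h : c ≫ H.map i ≫ t.app d = e) (h' : m ≫ E.map i = e)
    [IsIso i] : c ≫ t.app v = m := by
  rw [← cancel_mono (E.map i), assoc, ← t.naturality, h, h']

lemma unit_square {G : C ⥤ D} {v d : C} {m i : v ⟶ d} (hm : m = i) {X Y : D} {c : X ⟶ G.obj v}
    {j : G.obj d ⟶ Y} {e : X ⟶ Y} (h : c ≫ G.map i ≫ j = e) {p : X ⟶ G.obj d} (hp : p ≫ j = e)
    [IsIso j] : c ≫ G.map m = p := by
  rw [hm, ← cancel_mono j, assoc, h, hp]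

end

lemma TrHom.appIso_eqToIso {I J : Type} {φ : I → J} {S : I → TrCat.{u}} {T : J → TrCat.{u}}
    {F F' : TrHom φ S T} (h : F = F') (j : J) (x : ∀ i : Fib φ j, S i.1) :
    TrHom.appIso (eqToIso h) j x = eqToIso (congrArg (fun F => (F j).obj.functor.obj x) h) := by
  subst h
  rfl

/-! ### Uniqueness and coherence of the constraints. -/

namespace VirtualFunctors

variable (L : VirtualFunctors det)

section

variable {I J K M : Type} [Finite I] [Finite J] [Finite K] [Finite M] {φ : I → J} {ψ : J → K}
  {χ : K → M} {S : I → TrCat.{u}} {T : J → TrCat.{u}} {U : K → TrCat.{u}} {W : M → TrCat.{u}}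

/-- `γ` is the transformation induced by the 2-cell `σ`. -/
def IsMap₂ {F F' : TrHom φ S T} (σ : F ≅ F') (γ : L.map F ≅ L.map F') : Prop :=
  ∀ (j : J) (x : ∀ i : Fib φ j, S i.1),
    app γ j (detObj det (S := onFib S φ j) x) ≫ L.isoApp F' j x =
      L.isoApp F j x ≫ (det (T j)).functor.map ⟨TrHom.appIso σ j x⟩

/-- `γ` is the transformation induced by the composition of `F` and `G`. -/
def IsMapComp (F : TrHom φ S T) (G : TrHom ψ T U)
    (γ : L.map (F.comp G) ≅ (L.map F).comp (L.map G)) : Prop :=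
  ∀ (k : K) (x : ∀ i : Fib (ψ ∘ φ) k, S i.1),
    app γ k (detObj det (S := onFib S (ψ ∘ φ) k) x) ≫
        (L.map G k).obj.functor.map
          (fun j : Fib ψ k => L.isoApp F j.1 (fun i => x (inFib φ ψ j i).1)) ≫
        L.isoApp G k
          (fun j : Fib ψ k => (F j.1).obj.functor.obj (fun i => x (inFib φ ψ j i).1)) =
      L.isoApp (F.comp G) k x

/-- `γ` is the transformation induced by the identity of `T`. -/
def IsMapId (T : J → TrCat.{u}) (γ : L.map (TrHom.id T) ≅ PicHom.id (fun j => V (T j))) : Prop :=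
  ∀ (j : J) (x : ∀ i : Fib (id : J → J) j, T i.1),
    app γ j (detObj det (S := onFib T id j) x) = L.isoApp (TrHom.id T) j x

variable {L}

lemma isIso_isoApp (F : TrHom φ S T) (j : J) (x : ∀ i : Fib φ j, S i.1) :
    IsIso (L.isoApp F j x) := IsGroupoid.all_isIso (C := V (T j)) _

lemma isIso_isoApp_pi (F : TrHom φ S T) {K : Type} (r : K → J)
    (x : ∀ k, ∀ i : Fib φ (r k), S i.1) :
    IsIso (C := ∀ k, V (T (r k))) (fun k => L.isoApp F (r k) (x k)) :=
  (isIso_pi_iff (C := fun k => V (T (r k))) _).2 fun k => isIso_isoApp F (r k) (x k)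

/-- The effect of `V(G)_k ∘ (det, …, det) ≅ det ∘ G_k` on a family of isomorphisms. -/
lemma isoApp_naturality (G : TrHom ψ T U) (k : K) {x y : ∀ j : Fib ψ k, T j.1}
    (e : ∀ j, x j ≅ y j) :
    (L.map G k).obj.functor.map (fun j => (det (T j.1)).functor.map ⟨e j⟩) ≫ L.isoApp G k y =
      L.isoApp G k x ≫ (det (U k)).functor.map ⟨(G k).obj.functor.mapIso (Pi.isoMk e)⟩ :=
  (L.iso G k).hom.natTrans.naturality (X := ⟨x⟩) (Y := ⟨y⟩) ⟨Pi.isoMk e⟩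

lemma IsMap₂.refl {F : TrHom φ S T} : L.IsMap₂ (Iso.refl F) (Iso.refl (L.map F)) := fun j x =>
  (id_comp _).trans ((comp_id _).symm.trans
    (congrArg (L.isoApp F j x ≫ ·) ((det (T j)).functor.map_id ⟨_⟩).symm))

lemma IsMap₂.trans {F F' F'' : TrHom φ S T} {σ : F ≅ F'} {σ' : F' ≅ F''} {γ : L.map F ≅ L.map F'}
    {γ' : L.map F' ≅ L.map F''} (h : L.IsMap₂ σ γ) (h' : L.IsMap₂ σ' γ') :
    L.IsMap₂ (σ ≪≫ σ') (γ ≪≫ γ') := fun j x => by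
  refine (assoc _ _ _).trans ((congrArg (_ ≫ ·) (h' j x)).trans ((assoc _ _ _).symm.trans
    ((congrArg (· ≫ _) (h j x)).trans ((assoc _ _ _).trans (congrArg (_ ≫ ·) ?_)))))
  exact ((det (T j)).functor.map_comp (X := ⟨_⟩) (Y := ⟨_⟩) (Z := ⟨_⟩) _ _).symm

/-- Cancelling the invertible components of the given isomorphisms, the two agree at determinants,
hence everywhere. Functoriality of the action on 2-cells is a consequence of this uniqueness. -/
lemma IsMap₂.eq (hdet : ∀ T, (det T).IsUniversal) {F F' : TrHom φ S T} {σ : F ≅ F'}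
    {γ γ' : L.map F ≅ L.map F'} (h : L.IsMap₂ σ γ) (h' : L.IsMap₂ σ γ') : γ = γ' :=
  picHom_iso_ext hdet fun j x =>
    have := isIso_isoApp (L := L) F' j x
    (cancel_mono (L.isoApp F' j x)).1 ((h j x).trans (h' j x).symm)

lemma IsMapComp.eq (hdet : ∀ T, (det T).IsUniversal) {F : TrHom φ S T} {G : TrHom ψ T U}
    {γ γ' : L.map (F.comp G) ≅ (L.map F).comp (L.map G)} (h : L.IsMapComp F G γ)
    (h' : L.IsMapComp F G γ') : γ = γ' :=
  picHom_iso_ext hdet fun k x =>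
    have := IsGroupoid.all_isIso (C := V (U k)) ((L.map G k).obj.functor.map
          (fun j : Fib ψ k => L.isoApp F j.1 (fun i => x (inFib φ ψ j i).1)) ≫
        L.isoApp G k
          (fun j : Fib ψ k => (F j.1).obj.functor.obj (fun i => x (inFib φ ψ j i).1)))
    (cancel_mono _).1 ((h k x).trans (h' k x).symm)

lemma IsMapId.eq (hdet : ∀ T, (det T).IsUniversal) {T : J → TrCat.{u}}
    {γ γ' : L.map (TrHom.id T) ≅ PicHom.id (fun j => V (T j))} (h : L.IsMapId T γ)
    (h' : L.IsMapId T γ') : γ = γ' :=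
  picHom_iso_ext hdet fun j x => (h j x).trans (h' j x).symm

/-- Both sides are transformations of multiexact functors on virtual objects, so it suffices to
compare them at determinants, where all constraints are known. The coherence laws below are proved
in the same way. -/
lemma IsMapComp.naturality (hdet : ∀ T, (det T).IsUniversal) {F F' : TrHom φ S T}
    {G G' : TrHom ψ T U} {σ : F ≅ F'} {τ : G ≅ G'} {γ : L.map (F.comp G) ≅ L.map (F'.comp G')}
    (hγ : L.IsMap₂ (TrHom.hcomp σ τ) γ) {c : L.map (F.comp G) ≅ (L.map F).comp (L.map G)}
    (hc : L.IsMapComp F G c) {c' : L.map (F'.comp G') ≅ (L.map F').comp (L.map G')}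
    (hc' : L.IsMapComp F' G' c') {s : L.map F ≅ L.map F'} (hs : L.IsMap₂ σ s)
    {t : L.map G ≅ L.map G'} (ht : L.IsMap₂ τ t) (k : K) (y : ∀ i : Fib (ψ ∘ φ) k, V (S i.1)) :
    app γ k y ≫ app c' k y =
      app c k y ≫
        (L.map G k).obj.functor.map
          (fun j : Fib ψ k => app s j.1 (fun i => y (inFib φ ψ j i).1)) ≫
        app t k
          (fun j : Fib ψ k => (L.map F' j.1).obj.functor.obj (fun i => y (inFib φ ψ j i).1)) := by
  refine PicFunctor.app_eq_of_det (T := onFib S (ψ ∘ φ) k) hdet (L.map (F.comp G) k).property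
    ((L.map F').comp (L.map G') k).property
    ((γ.hom k).hom ≫ (c'.hom k).hom)
    ((c.hom k).hom ≫ PicHom.postMap s.hom (L.map G) k ≫
      PicFunctor.whisker (φ := fibMap φ ψ k) (fun j => (L.map F' j.1).obj.restrict j)
        (t.hom k).hom) (fun x => ?_) y
  have i₁ := isIso_isoApp_pi (L := L) F' (fun j : Fib ψ k => j.1)
    (fun j i => x (inFib φ ψ j i))
  have i₂ := isIso_isoApp (L := L) G' k
    (fun j : Fib ψ k => (F' j.1).obj.functor.obj (fun i => x (inFib φ ψ j i)))
  exact @comp_square _ _ _ _ _ _ (t.hom k).hom.natTrans _ _ _ _ _ _ _ _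
    (funext fun j : Fib ψ k => hs j.1 (fun i => x (inFib φ ψ j i))) _ _ _ _ _ _ _ _ _ _ _ _ _ _ _
    _ (hc k x) (hc' k x) (hγ k x)
    (isoApp_naturality G k (fun j => TrHom.appIso σ j.1 (fun i => x (inFib φ ψ j i))))
    (ht k _) ((det (U k)).map_triangle rfl) i₁ i₂

lemma IsMapComp.associativity (hdet : ∀ T, (det T).IsUniversal) {F : TrHom φ S T} {G : TrHom ψ T U}
    {H : TrHom χ U W} {c₁ : L.map ((F.comp G).comp H) ≅ (L.map (F.comp G)).comp (L.map H)}
    (h₁ : L.IsMapComp (F.comp G) H c₁) {c₂ : L.map (F.comp G) ≅ (L.map F).comp (L.map G)}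
    (h₂ : L.IsMapComp F G c₂) {c₃ : L.map (F.comp (G.comp H)) ≅ (L.map F).comp (L.map (G.comp H))}
    (h₃ : L.IsMapComp F (G.comp H) c₃) {c₄ : L.map (G.comp H) ≅ (L.map G).comp (L.map H)}
    (h₄ : L.IsMapComp G H c₄) (m : M) (y : ∀ i : Fib (χ ∘ ψ ∘ φ) m, V (S i.1)) :
    app c₁ m y ≫
        (L.map H m).obj.functor.map
          (fun k : Fib χ m => app c₂ k.1 (fun i => y (inFib (ψ ∘ φ) χ k i).1)) =
      app c₃ m y ≫
        app c₄ m (fun j : Fib (χ ∘ ψ) m =>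
          (L.map F j.1).obj.functor.obj (fun i => y (inFib φ (χ ∘ ψ) j i).1)) := by
  refine PicFunctor.app_eq_of_det (T := onFib S (χ ∘ ψ ∘ φ) m) hdet
    (L.map ((F.comp G).comp H) m).property (((L.map F).comp (L.map G)).comp (L.map H) m).property
    ((c₁.hom m).hom ≫ PicHom.postMap c₂.hom (L.map H) m)
    ((c₃.hom m).hom ≫ PicFunctor.whisker (φ := fibMap φ (χ ∘ ψ) m)
      (fun j => (L.map F j.1).obj.restrict j) (c₄.hom m).hom) (fun x => ?_) y
  have i₁ := isIso_isoApp_pi (L := L) F (fun j : Fib (χ ∘ ψ) m => j.1)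
    (fun j i => x (inFib φ (χ ∘ ψ) j i).1)
  have i₂ := isIso_isoApp_pi (L := L) G (fun k : Fib χ m => k.1)
    (fun k j => (F j.1).obj.functor.obj (fun i => x ⟨i.1, (congrArg (χ ∘ ψ) i.2).trans
      ((congrArg χ j.2).trans k.2)⟩))
  have i₃ := isIso_isoApp (L := L) H m
    (fun k : Fib χ m => (F.comp G k.1).obj.functor.obj (fun i => x (inFib (ψ ∘ φ) χ k i).1))
  exact @assoc_square _ _ _ _ _ _ _ _
    (PicString.star (φ := fibMap ψ χ m) (fun k => (L.map G k.1).obj.restrict k))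
    (c₄.hom m).hom.natTrans _ _ _ _ _ _ _ _ _ _ _ _ _ _ _ (h₁ m x)
    (funext fun k => h₂ k.1 _) (h₃ m x) (h₄ m _) i₁ i₂ i₃

lemma IsMapComp.left_unit (hdet : ∀ T, (det T).IsUniversal) {F : TrHom φ S T}
    {c : L.map ((TrHom.id S).comp F) ≅ (L.map (TrHom.id S)).comp (L.map F)}
    (hc : L.IsMapComp (TrHom.id S) F c)
    {e : L.map (TrHom.id S) ≅ PicHom.id (fun i => V (S i))} (he : L.IsMapId S e) (j : J)
    (y : ∀ i : Fib φ j, V (S i.1)) :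
    app c j y ≫
        (L.map F j).obj.functor.map
          (fun i : Fib φ j => app e i.1 (fun i' => y (inFib id φ i i').1)) =
      𝟙 ((L.map F j).obj.functor.obj y) := by
  refine PicFunctor.app_eq_of_det (T := onFib S φ j) hdet (L.map F j).property (L.map F j).property
    ((c.hom j).hom ≫ PicHom.postMap e.hom (L.map F) j) (𝟙 (L.map F j).obj) (fun x => ?_) y
  have i₁ := isIso_isoApp (L := L) F j x
  exact @unit_square _ _ _ _ (L.map F j).obj.functor _ _ _ _ (funext fun i : Fib φ j => he i.1 _)
    _ _ _ _ _ (hc j x) _ (id_comp _) i₁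

/-- `id ∘ f = f`. -/
def compIdHom {A : I → PicCat.{u}} {B : J → PicCat.{u}} (f : PicHom φ A B) (j : J) :
    (f.comp (PicHom.id B) j).obj ⟶ (f j).obj where
  natTrans := { app := fun y => 𝟙 ((f j).obj.functor.obj y)
                naturality := fun x y p => (comp_id _).trans (id_comp _).symm }
  comm i x y s σ := by
    obtain ⟨i, rfl⟩ := i
    refine Eq.trans (comp_id _) (Eq.trans ?_ ((id_comp _).symm.trans
      (congrArg (· ≫ _) (id_tensorHom_id _ _).symm)))
    rfl

lemma IsMapComp.right_unit (hdet : ∀ T, (det T).IsUniversal) {F : TrHom φ S T}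
    {c : L.map (F.comp (TrHom.id T)) ≅ (L.map F).comp (L.map (TrHom.id T))}
    (hc : L.IsMapComp F (TrHom.id T) c)
    {e : L.map (TrHom.id T) ≅ PicHom.id (fun j => V (T j))} (he : L.IsMapId T e)
    {γ : L.map (F.comp (TrHom.id T)) ≅ L.map F} (hγ : L.IsMap₂ (eqToIso F.comp_id) γ) (j : J)
    (y : ∀ i : Fib φ j, V (S i.1)) :
    app c j y ≫
        app e j (fun j' : Fib (id : J → J) j =>
          (L.map F j'.1).obj.functor.obj (fun i => y (inFib φ id j' i).1)) =
      app γ j y := by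
  -- The sums of `f.comp id` agree with those of `f` only after a case split on the index, so the
  -- identity transformation `compIdHom` is inserted to reach `L.map F`.
  refine (congrArg (app c j y ≫ ·) (comp_id _).symm).trans
    (PicFunctor.app_eq_of_det (T := onFib S φ j) hdet (L.map (F.comp (TrHom.id T)) j).property
    (L.map F j).property
    ((c.hom j).hom ≫ PicFunctor.whisker (φ := fibMap φ id j)
      (fun j' => (L.map F j'.1).obj.restrict j') (e.hom j).hom ≫ compIdHom (L.map F) j)
    (γ.hom j).hom (fun x => ?_) y)
  refine (congrArg (app c j (detObj det (S := onFib S φ j) x) ≫ ·) (comp_id _)).trans ?_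
  have i₁ := isIso_isoApp_pi (L := L) F (fun j' : Fib (id : J → J) j => j'.1)
    (fun j' i => x (inFib φ id j' i).1)
  refine @right_unit_square _ _ _ _ _ _ (e.hom j).hom.natTrans _ _ _ _ _ _ _
    ((congrArg (fun t => _ ≫ _ ≫ t) (he j _)).trans (hc j x)) ((hγ j x).trans ?_) i₁
  rw [TrHom.appIso_eqToIso]
  exact (congrArg (_ ≫ ·) ((det (T j)).functor.map_id ⟨_⟩)).trans (comp_id _)

end

/-- The pseudofunctor structure on the virtual objects. -/
noncomputable def coherence (L : VirtualFunctors det) (hdet : ∀ T, (det T).IsUniversal) :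
    L.Coherence where
  map₂ σ := (L.exists_map₂ hdet σ).choose
  mapComp F G := (L.exists_mapComp hdet F G).choose
  mapId T := (L.exists_mapId hdet T).choose
  map₂_iso σ := (L.exists_map₂ hdet σ).choose_spec
  mapComp_iso F G := (L.exists_mapComp hdet F G).choose_spec
  mapId_iso T := (L.exists_mapId hdet T).choose_spec
  map₂_id F := IsMap₂.eq hdet (L.exists_map₂ hdet (Iso.refl F)).choose_spec IsMap₂.refl
  map₂_comp σ σ' := IsMap₂.eq hdet (L.exists_map₂ hdet (σ ≪≫ σ')).choose_spec
    (IsMap₂.trans (L.exists_map₂ hdet σ).choose_spec (L.exists_map₂ hdet σ').choose_spec)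
  mapComp_naturality σ τ := IsMapComp.naturality hdet
    (L.exists_map₂ hdet (TrHom.hcomp σ τ)).choose_spec (L.exists_mapComp hdet _ _).choose_spec
    (L.exists_mapComp hdet _ _).choose_spec (L.exists_map₂ hdet σ).choose_spec
    (L.exists_map₂ hdet τ).choose_spec
  associativity F G H := IsMapComp.associativity hdet
    (L.exists_mapComp hdet (F.comp G) H).choose_spec (L.exists_mapComp hdet F G).choose_spec
    (L.exists_mapComp hdet F (G.comp H)).choose_spec (L.exists_mapComp hdet G H).choose_spec
  left_unit F := IsMapComp.left_unit hdet (L.exists_mapComp hdet (TrHom.id _) F).choose_spec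
    (L.exists_mapId hdet _).choose_spec
  right_unit F := IsMapComp.right_unit hdet (L.exists_mapComp hdet F (TrHom.id _)).choose_spec
    (L.exists_mapId hdet _).choose_spec (L.exists_map₂ hdet (eqToIso F.comp_id)).choose_spec

/-- The data `map₂`, `mapComp` and `mapId` are pinned down by their compatibility with the chosen
isomorphisms; all other fields are propositions. -/
lemma Coherence.eq (hdet : ∀ T, (det T).IsUniversal) {L : VirtualFunctors det}
    (c c' : L.Coherence) : c = c' := by
  have h₁ : @c.map₂ = @c'.map₂ := by
    funext I J _ _ φ S T F F' σ
    exact IsMap₂.eq hdet (c.map₂_iso σ) (c'.map₂_iso σ)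
  have h₂ : @c.mapComp = @c'.mapComp := by
    funext I J K _ _ _ φ ψ S T U F G
    exact IsMapComp.eq hdet (c.mapComp_iso F G) (c'.mapComp_iso F G)
  have h₃ : @c.mapId = @c'.mapId := by
    funext J _ T
    exact IsMapId.eq hdet (c.mapId_iso T) (c'.mapId_iso T)
  obtain ⟨m, mc, mi⟩ := c
  obtain ⟨m', mc', mi'⟩ := c'
  obtain rfl : @m = @m' := h₁
  obtain rfl : @mc = @mc' := h₂
  obtain rfl : @mi = @mi' := h₃
  rfl

end VirtualFunctors

variable {V : TrCat.{u} → PicCat.{u}} {det : ∀ T, DetFunctor T (V T)}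

section

variable {C D : Type*} [Category C] [Category D]

lemma trans_square {G G' : C ⥤ D} (t : G ⟶ G') {v d : C} {i : v ⟶ d} {X X' Y Y' : D}
    {c : X ⟶ G.obj v} {c' : X' ⟶ G'.obj v} {m : X ⟶ X'} {e : X ⟶ Y} {e' : X' ⟶ Y'}
    {j : G.obj d ⟶ Y} {j' : G'.obj d ⟶ Y'} {q : Y ⟶ Y'} (he : c ≫ G.map i ≫ j = e)
    (he' : c' ≫ G'.map i ≫ j' = e') (hm : m ≫ e' = e ≫ q) (ht : t.app d ≫ j' = j ≫ q) [IsIso i]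
    [IsIso j'] : m ≫ c' = c ≫ t.app v := by
  simpa using comp_square t (m := 𝟙 v) (i := i) (i' := i) (s := 𝟙 d) (by simp) he he' hm
    (j₁ := j) (q := 𝟙 _) (by simp) ht (id_comp _)

lemma arrow_square {G : C ⥤ D} {v v' d d' : C} {m : v ⟶ v'} {i : v ⟶ d} {i' : v' ⟶ d'} {s : d ⟶ d'}
    (hm : m ≫ i' = i ≫ s) {X X' Y Y' : D} {c : X ⟶ G.obj v} {c' : X' ⟶ G.obj v'} {m₂ : X ⟶ X'}
    {e : X ⟶ Y} {e' : X' ⟶ Y'} {j : G.obj d ⟶ Y} {j' : G.obj d' ⟶ Y'} {p : Y ⟶ Y'}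
    (he : c ≫ G.map i ≫ j = e) (he' : c' ≫ G.map i' ≫ j' = e') (h₂ : m₂ ≫ e' = e ≫ p)
    (hj : G.map s ≫ j' = j ≫ p) [IsIso i'] [IsIso j'] : m₂ ≫ c' = c ≫ G.map m := by
  simpa using comp_square (𝟙 G) hm he he' h₂ hj (q' := 𝟙 _) (by simp) (comp_id _)

end

/-! ### Pseudonaturality of the equivalences. -/

namespace VirtualFunctors

variable (L : VirtualFunctors det) (h : PullbackIsMultiDet.{u})

section

variable {P : PicCat.{u}} {I J K : Type} [Finite I] [Finite J] [Finite K] {φ : I → J} {ψ : J → K}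
  {S : I → TrCat.{u}} {T : J → TrCat.{u}} {U : K → TrCat.{u}}
  {R : Det S P ⥤ Pic (fun i => V (S i)) P} (ρ : R ⋙ detStar P det S ≅ 𝟭 (Det S P))
  {R' : Det T P ⥤ Pic (fun j => V (T j)) P} (τ : R' ⋙ detStar P det T ≅ 𝟭 (Det T P))
  {R'' : Det U P ⥤ Pic (fun k => V (U k)) P} (ω : R'' ⋙ detStar P det U ≅ 𝟭 (Det U P))

/-- The components of `τ_D : D' ∘ (det, …, det) ≅ D`. -/
abbrev repApp (D : Det T P) (x : ∀ j, T j) :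
    (R'.obj D).obj.functor.obj (detObj det x) ⟶ D.obj.functor.obj ⟨x⟩ :=
  (τ.hom.app D).hom.natTrans.app ⟨x⟩

/-- `γ : (D ∘ F)' ⟶ D' ∘ V(F)` fills the naturality square of `F`. -/
def IsSquare (F : TrHom φ S T) (D : Det T P)
    (γ : R.obj ((pullDet P h F).obj D) ⟶ (pullPic P (L.map F)).obj (R'.obj D)) : Prop :=
  ∀ x : ∀ i, S i, γ.hom.natTrans.app (detObj det x) ≫
      (R'.obj D).obj.functor.map (fun j => L.isoApp F j (fun i => x i.1)) ≫
        repApp τ D (F.string.star.obj x) =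
    repApp ρ ((pullDet P h F).obj D) x

/-- At determinants the square is prescribed: it compares the representation of D ∘ F with the
representation of `D` preceded by the image of V(F)_j ∘ det ≅ det ∘ F_j. -/
lemma exists_square (hdet : ∀ T, (det T).IsUniversal) (F : TrHom φ S T) (D : Det T P) :
    ∃ γ, L.IsSquare h ρ τ F D γ :=
  exists_pic_hom hdet (f := R.obj ((pullDet P h F).obj D))
    (g := (pullPic P (L.map F)).obj (R'.obj D)) (ρ.hom.app ((pullDet P h F).obj D)).hom
    (pushDet (fun j => (L.iso F j).hom) (R'.obj D).property ≫
      pullDetMap F (τ.hom.app D).hom)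

variable {L h ρ τ ω}

lemma repApp_map {D E : Det T P} (γ : D ⟶ E) (x : ∀ j, T j) :
    (R'.map γ).hom.natTrans.app (detObj det x) ≫ repApp τ E x =
      repApp τ D x ≫ γ.hom.natTrans.app ⟨x⟩ :=
  congrArg (fun t => t.hom.natTrans.app ⟨x⟩) (τ.hom.naturality γ)

lemma IsSquare.eq (hdet : ∀ T, (det T).IsUniversal) {F : TrHom φ S T} {D : Det T P}
    {γ γ' : R.obj ((pullDet P h F).obj D) ⟶ (pullPic P (L.map F)).obj (R'.obj D)}
    (hγ : L.IsSquare h ρ τ F D γ) (hγ' : L.IsSquare h ρ τ F D γ') : γ = γ' := by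
  refine ObjectProperty.hom_ext _ (PicFunctor.Hom.ext ?_)
  ext y
  refine PicFunctor.app_eq_of_det hdet (R.obj ((pullDet P h F).obj D)).property
    ((pullPic P (L.map F)).obj (R'.obj D)).property γ.hom γ'.hom (fun x => ?_) y
  have := IsGroupoid.all_isIso (C := P)
    ((R'.obj D).obj.functor.map (fun j => L.isoApp F j (fun i => x i.1)) ≫
        repApp τ D (F.string.star.obj x))
  exact (cancel_mono _).1 ((hγ x).trans (hγ' x).symm)

lemma IsSquare.naturality (hdet : ∀ T, (det T).IsUniversal) {F : TrHom φ S T} {D E : Det T P}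
    (u : D ⟶ E) {γ : R.obj ((pullDet P h F).obj D) ⟶ (pullPic P (L.map F)).obj (R'.obj D)}
    {γ' : R.obj ((pullDet P h F).obj E) ⟶ (pullPic P (L.map F)).obj (R'.obj E)}
    (hγ : L.IsSquare h ρ τ F D γ) (hγ' : L.IsSquare h ρ τ F E γ') :
    R.map ((pullDet P h F).map u) ≫ γ' = γ ≫ (pullPic P (L.map F)).map (R'.map u) := by
  refine ObjectProperty.hom_ext _ (PicFunctor.Hom.ext ?_)
  ext y
  refine PicFunctor.app_eq_of_det hdet (R.obj ((pullDet P h F).obj D)).property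
    ((pullPic P (L.map F)).obj (R'.obj E)).property
    ((R.map ((pullDet P h F).map u)).hom ≫ γ'.hom)
    (γ.hom ≫ ((pullPic P (L.map F)).map (R'.map u)).hom) (fun x => ?_) y
  have i₁ := isIso_isoApp_pi (L := L) F (fun j : J => j) (fun j i => x i.1)
  have i₂ : IsIso (repApp τ E (F.string.star.obj x)) := IsGroupoid.all_isIso (C := P) _
  exact @trans_square _ _ _ _ _ _ (R'.map u).hom.natTrans _ _ _ _ _ _ _ _ _ _ _ _ _ _ _ (hγ x) (hγ' x)
    (repApp_map ((pullDet P h F).map u) x) (repApp_map u _) i₁ i₂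

lemma IsSquare.map₂ (hdet : ∀ T, (det T).IsUniversal) {F F' : TrHom φ S T} {σ : F ≅ F'}
    {s : L.map F ≅ L.map F'} (hs : L.IsMap₂ σ s) {D : Det T P}
    {γ : R.obj ((pullDet P h F).obj D) ⟶ (pullPic P (L.map F)).obj (R'.obj D)}
    {γ' : R.obj ((pullDet P h F').obj D) ⟶ (pullPic P (L.map F')).obj (R'.obj D)}
    (hγ : L.IsSquare h ρ τ F D γ) (hγ' : L.IsSquare h ρ τ F' D γ') (y : ∀ i, V (S i)) :
    (R.map ((pullDet₂ P h σ).app D)).hom.natTrans.app y ≫ γ'.hom.natTrans.app y =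
      γ.hom.natTrans.app y ≫
        (R'.obj D).obj.functor.map (fun j => app s j (fun i => y i.1)) := by
  refine PicFunctor.app_eq_of_det hdet (R.obj ((pullDet P h F).obj D)).property
    ((pullPic P (L.map F')).obj (R'.obj D)).property
    ((R.map ((pullDet₂ P h σ).app D)).hom ≫ γ'.hom)
    (γ.hom ≫ PicFunctor.postMap (fun j => (s.hom j).hom) (R'.obj D).property) (fun x => ?_) y
  have i₁ := isIso_isoApp_pi (L := L) F' (fun j : J => j) (fun j i => x i.1)
  have i₂ : IsIso (repApp τ D (F'.string.star.obj x)) := IsGroupoid.all_isIso (C := P) _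
  exact @arrow_square _ _ _ _ (R'.obj D).obj.functor _ _ _ _ _ _ _ _
    (funext fun j => hs j (fun i => x i.1)) _ _ _ _ _ _ _ _ _ _ _ _ (hγ x) (hγ' x)
    (repApp_map ((pullDet₂ P h σ).app D) x)
    ((τ.hom.app D).hom.natTrans.naturality ⟨TrHom.starIso σ x⟩) i₁ i₂

lemma IsSquare.comp (hdet : ∀ T, (det T).IsUniversal) {F : TrHom φ S T} {G : TrHom ψ T U}
    {c : L.map (F.comp G) ≅ (L.map F).comp (L.map G)} (hc : L.IsMapComp F G c) {D : Det U P}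
    {γ : R.obj ((pullDet P h (F.comp G)).obj D) ⟶ (pullPic P (L.map (F.comp G))).obj (R''.obj D)}
    (hγ : L.IsSquare h ρ ω (F.comp G) D γ)
    {γ₁ : R.obj ((pullDet P h F).obj ((pullDet P h G).obj D)) ⟶
      (pullPic P (L.map F)).obj (R'.obj ((pullDet P h G).obj D))}
    (h₁ : L.IsSquare h ρ τ F ((pullDet P h G).obj D) γ₁)
    {γ₂ : R'.obj ((pullDet P h G).obj D) ⟶ (pullPic P (L.map G)).obj (R''.obj D)}
    (h₂ : L.IsSquare h τ ω G D γ₂) (y : ∀ i, V (S i)) :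
    γ.hom.natTrans.app y ≫
        (R''.obj D).obj.functor.map (fun k => app c k (fun i => y i.1)) =
      γ₁.hom.natTrans.app y ≫ γ₂.hom.natTrans.app ((L.map F).string.star.obj y) := by
  refine PicFunctor.app_eq_of_det hdet (R.obj ((pullDet P h (F.comp G)).obj D)).property
    ((pullPic P ((L.map F).comp (L.map G))).obj (R''.obj D)).property
    (γ.hom ≫ PicFunctor.postMap (fun k => (c.hom k).hom) (R''.obj D).property)
    (γ₁.hom ≫ PicFunctor.whisker (L.map F).string γ₂.hom) (fun x => ?_) y
  have i₁ := isIso_isoApp_pi (L := L) F (fun j : J => j) (fun j i => x i.1)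
  have i₂ := isIso_isoApp_pi (L := L) G (fun k : K => k)
    (fun k j => (F j.1).obj.functor.obj (fun i => x i.1))
  have i₃ : IsIso (repApp ω D ((F.comp G).string.star.obj x)) := IsGroupoid.all_isIso (C := P) _
  exact @assoc_square _ _ _ _ _ _ _ _ (L.map G).string.star γ₂.hom.natTrans _ _ _ _ _ _ _ _ _ _ _ _
    _ _ _ (hγ x) (funext fun k => hc k (fun i => x i.1)) (h₁ x) (h₂ _) i₁ i₂ i₃

lemma IsSquare.id (hdet : ∀ T, (det T).IsUniversal)
    {e : L.map (TrHom.id T) ≅ PicHom.id (fun j => V (T j))} (he : L.IsMapId T e) {D : Det T P}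
    {γ : R'.obj ((pullDet P h (TrHom.id T)).obj D) ⟶
      (pullPic P (L.map (TrHom.id T))).obj (R'.obj D)}
    (hγ : L.IsSquare h τ τ (TrHom.id T) D γ) (y : ∀ j, V (T j)) :
    γ.hom.natTrans.app y ≫
        (R'.obj D).obj.functor.map (fun j => app e j (fun i => y i.1)) =
      𝟙 ((R'.obj D).obj.functor.obj y) := by
  refine PicFunctor.app_eq_of_det hdet (R'.obj D).property (R'.obj D).property
    (γ.hom ≫ PicFunctor.postMap (fun j => (e.hom j).hom) (R'.obj D).property)
    (𝟙 (R'.obj D).obj) (fun x => ?_) y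
  have i₁ : IsIso (repApp τ D x) := IsGroupoid.all_isIso (C := P) _
  exact @unit_square _ _ _ _ (R'.obj D).obj.functor _ _ _ _ (funext fun j => he j _)
    _ _ _ _ _ (hγ x) _ (id_comp _) i₁

end

/-- The condition `square_iso` alone determines every square. Existence is pointwise in `D`;
naturality in `D` and the three compatibilities then hold automatically, as they may be checked at
determinants. -/
theorem nonempty_unique_naturality (hdet : ∀ T, (det T).IsUniversal) (c : L.Coherence)
    (P : PicCat.{u})
    (bar : ∀ {ι : Type} [Finite ι] (T : ι → TrCat.{u}), Det T P ⥤ Pic (fun i => V (T i)) P)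
    (τ : ∀ {ι : Type} [Finite ι] (T : ι → TrCat.{u}), bar T ⋙ detStar P det T ≅ 𝟭 (Det T P)) :
    Nonempty (Unique (Naturality c h P bar τ)) := by
  have key : ∀ {I J : Type} [Finite I] [Finite J] {φ : I → J} {S : I → TrCat.{u}}
      {T : J → TrCat.{u}} (F : TrHom φ S T),
      ∃ t : pullDet P h F ⋙ bar S ≅ bar T ⋙ pullPic P (L.map F),
        ∀ D, L.IsSquare h (τ S) (τ T) F D (t.hom.app D) := by
    intro I J _ _ φ S T F
    choose γ hγ using L.exists_square h (τ S) (τ T) hdet F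
    exact ⟨NatIso.ofComponents (fun D => asIso (γ D))
      (fun u => IsSquare.naturality hdet u (hγ _) (hγ _)), hγ⟩
  choose t ht using @key
  let N : Naturality c h P bar τ :=
    { square := fun F => t F
      square_iso := fun F D => ht F D
      square_map₂ := fun {I J _ _ φ S T F F'} σ D =>
        IsSquare.map₂ hdet (c.map₂_iso σ) (ht F D) (ht F' D)
      square_comp := fun F G D =>
        IsSquare.comp hdet (c.mapComp_iso F G) (ht (F.comp G) D) (ht F _) (ht G D)
      square_id := fun T D => IsSquare.id hdet (c.mapId_iso T) (ht (TrHom.id T) D) }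
  refine ⟨⟨⟨N⟩, fun M => ?_⟩⟩
  have e : @M.square = @N.square := by
    funext I J _ _ φ S T F
    refine Iso.ext (NatTrans.ext (funext fun D => ?_))
    exact IsSquare.eq hdet (M.square_iso F D) (N.square_iso F D)
  generalize N = N' at e
  obtain ⟨m⟩ := M
  obtain ⟨n⟩ := N'
  obtain rfl : @m = @n := e
  rfl

end VirtualFunctors

end DetFun

/-- `PullbackIsMultiDet` is a proposition; the existential quantifier over `h` merely names its
proof, which is needed to state naturality. -/
theorem mainTheorem7 :
    (∀ T : TrCat.{u}, ∃ (Q : PicCat.{u}) (d : DetFunctor T Q), d.IsUniversal) ∧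
    ∃ h : PullbackIsMultiDet.{u},
      ∀ (V : TrCat.{u} → PicCat.{u}) (det : ∀ T : TrCat.{u}, DetFunctor T (V T)),
        (∀ T : TrCat.{u}, (det T).IsUniversal) →
        (∀ (P : PicCat.{u}) {ι : Type} [Finite ι] (T : ι → TrCat.{u}),
          (detStar P det T).IsEquivalence) ∧
        Nonempty (VirtualFunctors det) ∧
        ∀ L : VirtualFunctors det, ∃ c : L.Coherence, (∀ c' : L.Coherence, c' = c) ∧
          ∀ (P : PicCat.{u})
            (bar : ∀ {ι : Type} [Finite ι] (T : ι → TrCat.{u}),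
              Det T P ⥤ Pic (fun i => V (T i)) P)
            (τ : ∀ {ι : Type} [Finite ι] (T : ι → TrCat.{u}),
              bar T ⋙ detStar P det T ≅ 𝟭 (Det T P)),
            Nonempty (Unique (VirtualFunctors.Naturality c h P bar τ)) := by
  refine ⟨fun T => ⟨_, DetFunctor.virtual T, DetFunctor.virtual_isUniversal T⟩,
    pullbackIsMultiDet, fun V det hdet => ⟨fun P ι _ T => detStar_isEquivalence det hdet,
      nonempty_virtualFunctors hdet, fun L => ⟨L.coherence hdet, fun c => VirtualFunctors.Coherence.eq hdet c _,
        fun P bar τ => L.nonempty_unique_naturality _ hdet _ P bar τ⟩⟩⟩
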